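/- All vertex algebras are purely even and over $\mathbb C$; a vertex algebra $V$ has a vacuum $|0\rangle$, bilinear operations $a_{(n)}b$ ($n\in\mathbb Z$) with $a_{(n)}b=0$ for $n\gg0$, the vacuum axioms and the Borcherds identity, and $\partial a=a_{(-2)}|0\rangle$. It is *restricted* if it is graded by a diagonalizable Hamiltonian $H$, $[H,a_{(n)}]=(Ha)_{(n)}-(n+1)a_{(n)}$, and has no negative integer conformal weights; morphisms preserve $|0\rangle$, all operations and $H$. A *one-truncated vertex algebra* is a space $W=W_0\oplus W_1$ with a vacuum in $W_0$ and operations ${}_{(n)}:W_i\times W_j\to W_{i+j-n-1}$ for $i,j,i+j-n-1\in\{0,1\}$ (the impossible operations being set to zero) satisfying the vacuum axioms and the Borcherds identities in the range in which no product of weight $>1$ occurs. For $V$ restricted, $V_{\le1}=V_0\oplus V_1$ is one. For such $W$ put $A=W_0$ (a commutative algebra under ${}_{(-1)}$), $\Omega=\operatorname{span}\{a_{(-1)}\partial b: a,b\in A\}\subset W_1$, $\mathcal T=W_1/\Omega$ (a Lie algebroid over $A$). A *splitting* is a linear section $s$ of $W_1\to\mathcal T$. A *prevertex algebra* consists of a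 commutative algebra $A$; an $A$-module $\Omega$ with a derivation $d:A\to\Omega$ such that the $a\,db$ span $\Omega$; an $A$-Lie algebroid $\mathcal T$ such that $\tau(a\,db)=\tau(a)\,db+a\,d(\tau(b))$ and $\langle\tau,a\,db\rangle=a\tau(b)$ are well defined on $\Omega$, the latter $A$-bilinear; and $\mathbb C$-bilinear maps $\gamma:A\times\mathcal T\to\Omega$, $\langle\,,\rangle:\mathcal T\times\mathcal T\to A$ symmetric, $c^2:\mathcal T\times\mathcal T\to\Omega$ alternating, with 1. $\gamma(ab,\tau)=\gamma(a,b\tau)+a\gamma(b,\tau)+\tau(a)\,db+\tau(b)\,da$; 2. $\langle a\tau_1,\tau_2\rangle=a\langle\tau_1,\tau_2\rangle+\langle\tau_2,\gamma(a,\tau_1)\rangle-\tau_1\tau_2(a)$; 3. $\langle[\tau_1,\tau_2],\tau_3\rangle+\langle\tau_2,[\tau_1,\tau_3]\rangle=\tau_1\langle\tau_2,\tau_3\rangle-\tfrac12\tau_2\langle\tau_1,\tau_3\rangle-\tfrac12\tau_3\langle\tau_1,\tau_2\rangle+\langle\tau_2,c^2(\tau_1,\tau_3)\rangle+\langle\tau_3,c^2(\tau_1,\tau_2)\rangle$;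 4. $c^2(a\tau_1,\tau_2)=a\,c^2(\tau_1,\tau_2)+\gamma(a,[\tau_1,\tau_2])-\gamma(\tau_2(a),\tau_1)+\tau_2\gamma(a,\tau_1)-\tfrac12\langle\tau_1,\tau_2\rangle da+\tfrac12d(\tau_1\tau_2(a))-\tfrac12d\langle\tau_2,\gamma(a,\tau_1)\rangle$; 5. $d_{Lie}c^2=dc^3$ and $d_{Lie}c^3=0$, where $c^3=-\tfrac12K+\tfrac13I$, $K(\tau_1,\tau_2,\tau_3)=\langle\tau_1,[\tau_2,\tau_3]\rangle+\text{cycle}$, $I(\tau_1,\tau_2,\tau_3)=\langle\tau_1,[\tau_2,\tau_3]\rangle-\langle\tau_1,c^2(\tau_2,\tau_3)\rangle+\text{cycle}$, and $d_{Lie}c(\tau_1,\dots,\tau_{i+1})=\sum_{p<q}(-1)^{p+q-1}c([\tau_p,\tau_q],\dots,\hat\tau_p,\dots,\hat\tau_q,\dots)+\sum_p(-1)^p\tau_pc(\dots,\hat\tau_p,\dots)$. Morphisms are triples of linear maps preserving all the data. A prevertex algebra $P$ determines a one-truncated vertex algebra $W(P)=A\oplus(\mathcal T\oplus\Omega)$,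 functorially in $P$: the vacuum is $1$, $\partial a=da$, $a_{(-1)}b=ab$, $a_{(-2)}b=b\,da$, $a_{(-1)}\omega=\omega_{(-1)}a=a\omega$, $a_{(-1)}\tau=a\tau-\gamma(a,\tau)$, $\tau_{(-1)}a=a\tau-\gamma(a,\tau)+d(\tau(a))$, $\tau_{(0)}a=-a_{(0)}\tau=\tau(a)$, $\omega_{(0)}a=a_{(0)}\omega=0$, $\tau_{(0)}\omega=\tau(\omega)$, $\omega_{(0)}\tau=-\tau(\omega)+d\langle\tau,\omega\rangle$, $\omega_{(0)}\omega'=0$, $\tau_{1(0)}\tau_2=[\tau_1,\tau_2]-c^2(\tau_1,\tau_2)+\tfrac12d\langle\tau_1,\tau_2\rangle$, $\tau_{1(1)}\tau_2=\langle\tau_1,\tau_2\rangle$, $\tau_{(1)}\omega=\omega_{(1)}\tau=\langle\tau,\omega\rangle$, $\omega_{(1)}\omega'=0$. A *split* restricted vertex algebra is a restricted vertex algebra $V$ with a splitting $s$ of $V_1\to\mathcal T$; morphisms commute with the splittings. The functor $\mathcal P$ sends $(V,s)$ to $(A,\Omega,\mathcal T,\dots)$ formed from $V_{\le1}$ with $\gamma(a,\tau)=s(a\tau)-a_{(-1)}s(\tau)$,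 $\langle\tau_1,\tau_2\rangle=s(\tau_1)_{(1)}s(\tau_2)$, $c^2(\tau_1,\tau_2)=s([\tau_1,\tau_2])-\tfrac12\bigl(s(\tau_1)_{(0)}s(\tau_2)-s(\tau_2)_{(0)}s(\tau_1)\bigr)$. **Theorem.** (a) The functor $V\mapsto V_{\le1}$ from restricted vertex algebras to one-truncated vertex algebras has a left adjoint $U_1$, and the unit $W\to(U_1W)_{\le1}$ is an isomorphism for every $W$. (b) (Size of $U_1W$.) For a one-truncated vertex algebra $W$ let $S(W)$ be the commutative algebra generated by symbols $\partial^{(n)}a$, $\partial^{(n)}\omega$, $\partial^{(n)}\tau$ ($n\ge0$, $a\in A$, $\omega\in\Omega$, $\tau\in\mathcal T$), linear in $a,\omega,\tau$, with relations $\partial^{(0)}1=1$, $\partial^{(n)}(ax)=\sum_{p+q=n}\partial^{(p)}a\,\partial^{(q)}x$ for $a\in A$ and $x\in A,\Omega,\mathcal T$, and $\partial^{(n)}(da)=(n+1)\partial^{(n+1)}a$ (so $S(W)$ is generated by the $\partial^{(n)}a$ and $\partial^{(n)}\tau$). Give $\partial^{(n)}a$ weight $n$, give $\partial^{(n)}\omega$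 and $\partial^{(n)}\tau$ weight $n+1$, and for a finite sequence $l=(x_1,\dots,x_k)$ of symbols let $\deg l$ be the number of symbols of the form $\partial^{(n)}\tau$ in it. Choose a splitting $s$ of $W$, and let $\pi(l)=x_1(x_2(\cdots(x_k|0\rangle)))\in U_1W$, where $\partial^{(n)}a,\partial^{(n)}\omega,\partial^{(n)}\tau$ act as $a_{(-1-n)},\omega_{(-1-n)},s(\tau)_{(-1-n)}$. Then there is a surjective linear map $\Phi:S(W)\to U_1W$, which is bijective if the $A$-module $\mathcal T$ is projective, such that for every $l$ the vector $\Phi(x_1\cdots x_k)$ has conformal weight the sum of the weights of the $x_i$, and $\Phi(x_1\cdots x_k)-\pi(l)$ lies in the span of the $\pi(l')$ with $\deg l'<\deg l$. (c) The functor $\mathcal P$ from split restricted vertex algebras to prevertex algebras has a left adjoint $\mathcal V$ (the vertex envelope), and the composition of $\mathcal V$ with the functor forgetting the splitting is isomorphic to $P\mapsto U_1(W(P))$. -/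

import Mathlib

universe u

open CategoryTheory

/-- A (purely even) vertex algebra over `ℂ`: a vacuum vector and bilinear operations
`op n a b = a_(n) b`, `n ∈ ℤ`, subject to the field property, the vacuum axioms and the
Borcherds identity. -/
structure VertexAlgebra where
  carrier : Type u
  [addCommGroup : AddCommGroup carrier]
  [module : Module ℂ carrier]
  vac : carrier
  op : ℤ → carrier →ₗ[ℂ] carrier →ₗ[ℂ] carrier
  field : ∀ a b, ∃ N : ℤ, ∀ n, N ≤ n → op n a b = 0
  vac_op : ∀ n a, op n vac a = if n = -1 then a else 0
  op_vac : ∀ n a, 0 ≤ n → op n a vac = 0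
  op_neg_one_vac : ∀ a, op (-1) a vac = a
  /-- All three sums have finite support by `field`. -/
  borcherds : ∀ (m n k : ℤ) (a b c : carrier),
    ∑ᶠ j : ℕ, (Ring.choose m j : ℂ) • op (m + k - j) (op (n + j) a b) c =
      ∑ᶠ j : ℕ, ((-1 : ℂ) ^ j * (Ring.choose n j : ℂ)) • op (n + m - j) a (op (k + j) b c) -
      ∑ᶠ j : ℕ, ((-1 : ℂ) ^ ((j : ℤ) + n) * (Ring.choose n j : ℂ)) •
        op (n + k - j) b (op (m + j) a c)

attribute [instance] VertexAlgebra.addCommGroup VertexAlgebra.module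

/-- The translation operator `∂ a = a_(-2) |0⟩`. -/
def VertexAlgebra.der (V : VertexAlgebra.{u}) : V.carrier →ₗ[ℂ] V.carrier :=
  (V.op (-2)).flip V.vac

/-- A restricted vertex algebra: a vertex algebra graded by a diagonalizable Hamiltonian `H`
with `[H, a(z)] = z ∂_z a(z) + (H a)(z)`, having no negative integer conformal weights. -/
structure RestrictedVertexAlgebra extends VertexAlgebra.{u} where
  H : carrier →ₗ[ℂ] carrier
  diagonalizable : ⨆ μ : ℂ, Module.End.eigenspace H μ = ⊤
  H_op : ∀ (n : ℤ) (a b : carrier),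
    H (op n a b) - op n a (H b) = (-(n : ℂ) - 1) • op n a b + op n (H a) b
  no_negative_weight : ∀ n : ℕ, Module.End.eigenspace H (-((n : ℂ) + 1)) = ⊥

namespace RestrictedVertexAlgebra

/-- The component of conformal weight `μ`. -/
abbrev wt (V : RestrictedVertexAlgebra.{u}) (μ : ℂ) : Submodule ℂ V.carrier :=
  Module.End.eigenspace V.H μ

@[ext]
structure Hom (V V' : RestrictedVertexAlgebra.{u}) where
  toLin : V.carrier →ₗ[ℂ] V'.carrier
  map_vac : toLin V.vac = V'.vac
  map_op : ∀ n a b, toLin (V.op n a b) = V'.op n (toLin a) (toLin b)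
  map_H : ∀ a, toLin (V.H a) = V'.H (toLin a)

instance : Category RestrictedVertexAlgebra.{u} where
  Hom := Hom
  id V := ⟨LinearMap.id, rfl, fun _ _ _ => rfl, fun _ => rfl⟩
  comp f g := ⟨g.toLin ∘ₗ f.toLin, by simp [f.map_vac, g.map_vac],
    fun n a b => by simp [f.map_op, g.map_op], fun a => by simp [f.map_H, g.map_H]⟩

variable (V : RestrictedVertexAlgebra.{u})

lemma bijective_wt : Function.Bijective (DirectSum.coeLinearMap V.wt) :=
  DirectSum.isInternal_submodule_of_iSupIndep_of_iSup_eq_top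
    (Module.End.eigenspaces_iSupIndep V.H) V.diagonalizable

/-- The projection of a vector to its component of conformal weight `μ`. -/
noncomputable def proj (μ : ℂ) : V.carrier →ₗ[ℂ] V.wt μ :=
  DirectSum.component ℂ ℂ (fun μ => V.wt μ) μ ∘ₗ
    (LinearEquiv.ofBijective (DirectSum.coeLinearMap V.wt) V.bijective_wt).symm.toLinearMap

lemma proj_of_mem {μ : ℂ} {x : V.carrier} (hx : x ∈ V.wt μ) : V.proj μ x = ⟨x, hx⟩ := by
  have : (LinearEquiv.ofBijective (DirectSum.coeLinearMap V.wt) V.bijective_wt).symm x =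
      DirectSum.lof ℂ ℂ (fun μ => V.wt μ) μ ⟨x, hx⟩ := by
    rw [LinearEquiv.symm_apply_eq, LinearEquiv.ofBijective_apply, DirectSum.coeLinearMap_lof]
  simp [proj, this, DirectSum.component.lof_self]

lemma proj_of_mem_ne {μ ν : ℂ} (h : ν ≠ μ) {x : V.carrier} (hx : x ∈ V.wt ν) :
    V.proj μ x = 0 := by
  have : (LinearEquiv.ofBijective (DirectSum.coeLinearMap V.wt) V.bijective_wt).symm x =
      DirectSum.lof ℂ ℂ (fun μ => V.wt μ) ν ⟨x, hx⟩ := by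
    rw [LinearEquiv.symm_apply_eq, LinearEquiv.ofBijective_apply, DirectSum.coeLinearMap_lof]
  simp only [proj, LinearMap.comp_apply, LinearEquiv.coe_coe, this]
  rw [DirectSum.component.of, dif_neg h]

lemma op_mem {i j : ℂ} {a b : V.carrier} (ha : a ∈ V.wt i) (hb : b ∈ V.wt j) (n : ℤ) :
    V.op n a b ∈ V.wt (i + j - n - 1) := by
  rw [Module.End.mem_eigenspace_iff] at *
  have h := V.H_op n a b
  rw [ha, hb] at h
  simp only [map_smul, LinearMap.smul_apply] at h
  rw [sub_eq_iff_eq_add] at h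
  rw [h]
  module

lemma eq_zero_of_neg {i : ℤ} (hi : i < 0) {a : V.carrier} (ha : a ∈ V.wt (i : ℂ)) : a = 0 := by
  obtain ⟨n, rfl⟩ := Int.eq_negSucc_of_lt_zero hi
  have h := V.no_negative_weight n
  have h2 : ((Int.negSucc n : ℤ) : ℂ) = -((n : ℂ) + 1) := by
    rw [Int.negSucc_eq]; push_cast; ring
  rw [wt, h2, h] at ha
  simpa using ha

end RestrictedVertexAlgebra

/-- In `V₀ ⊕ V₁`, the component of weight `i` : it is `V₀`, `V₁` or zero. -/
def truncWt (V₀ V₁ : Type u) [AddCommGroup V₀] [Module ℂ V₀] [AddCommGroup V₁] [Module ℂ V₁]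
    (i : ℤ) : Submodule ℂ (V₀ × V₁) where
  carrier := {x | (i ≠ 0 → x.1 = 0) ∧ (i ≠ 1 → x.2 = 0)}
  add_mem' := fun ha hb =>
    ⟨fun h => by simp [ha.1 h, hb.1 h], fun h => by simp [ha.2 h, hb.2 h]⟩
  zero_mem' := by simp
  smul_mem' := fun c x hx => ⟨fun h => by simp [hx.1 h], fun h => by simp [hx.2 h]⟩

/-- A one-truncated vertex algebra `V₀ ⊕ V₁`. The operations `mode n x y = x_(n) y` are those
`V_i × V_j → V_(i+j-n-1)` with `i, j, i+j-n-1 ∈ {0, 1}`; by `mode_mem` all the other components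
of `mode n` vanish. The Borcherds identity is imposed whenever no product of conformal weight
greater than one enters it. In that range the inner products of the sums have weights `≤ 1 - j`,
so that only the terms `j = 0, 1` of each sum involve possible operations. -/
structure OneTruncatedVertexAlgebra where
  V₀ : Type u
  V₁ : Type u
  [addCommGroup₀ : AddCommGroup V₀]
  [module₀ : Module ℂ V₀]
  [addCommGroup₁ : AddCommGroup V₁]
  [module₁ : Module ℂ V₁]
  vac : V₀
  mode : ℤ → (V₀ × V₁) →ₗ[ℂ] (V₀ × V₁) →ₗ[ℂ] (V₀ × V₁)
  mode_mem : ∀ (n i j : ℤ) (x y : V₀ × V₁), x ∈ truncWt V₀ V₁ i → y ∈ truncWt V₀ V₁ j →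
    mode n x y ∈ truncWt V₀ V₁ (i + j - n - 1)
  vac_mode : ∀ n x, mode n (vac, 0) x = if n = -1 then x else 0
  mode_vac : ∀ n x, 0 ≤ n → mode n x (vac, 0) = 0
  mode_neg_one_vac : ∀ x, mode (-1) x (vac, 0) = x
  borcherds : ∀ (m n k p q r : ℤ) (a b c : V₀ × V₁),
    a ∈ truncWt V₀ V₁ p → b ∈ truncWt V₀ V₁ q → c ∈ truncWt V₀ V₁ r →
    p + q - n - 1 ≤ 1 → q + r - k - 1 ≤ 1 → p + r - m - 1 ≤ 1 →
    ∑ j ∈ Finset.range 2, (Ring.choose m j : ℂ) • mode (m + k - j) (mode (n + j) a b) c =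
      ∑ j ∈ Finset.range 2,
        ((-1 : ℂ) ^ j * (Ring.choose n j : ℂ)) • mode (n + m - j) a (mode (k + j) b c) -
      ∑ j ∈ Finset.range 2, ((-1 : ℂ) ^ ((j : ℤ) + n) * (Ring.choose n j : ℂ)) •
        mode (n + k - j) b (mode (m + j) a c)

attribute [instance] OneTruncatedVertexAlgebra.addCommGroup₀ OneTruncatedVertexAlgebra.module₀
  OneTruncatedVertexAlgebra.addCommGroup₁ OneTruncatedVertexAlgebra.module₁

namespace OneTruncatedVertexAlgebra

@[ext]
structure Hom (W W' : OneTruncatedVertexAlgebra.{u}) where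
  f₀ : W.V₀ →ₗ[ℂ] W'.V₀
  f₁ : W.V₁ →ₗ[ℂ] W'.V₁
  map_vac : f₀ W.vac = W'.vac
  map_mode : ∀ n x y, f₀.prodMap f₁ (W.mode n x y) =
    W'.mode n (f₀.prodMap f₁ x) (f₀.prodMap f₁ y)

instance : Category OneTruncatedVertexAlgebra.{u} where
  Hom := Hom
  id W := ⟨LinearMap.id, LinearMap.id, rfl, fun _ _ _ => by simp⟩
  comp f g := ⟨g.f₀ ∘ₗ f.f₀, g.f₁ ∘ₗ f.f₁, by simp [f.map_vac, g.map_vac], fun n x y => by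
    have h1 := f.map_mode n x y
    have h2 := g.map_mode n (f.f₀.prodMap f.f₁ x) (f.f₀.prodMap f.f₁ y)
    rw [← h1] at h2
    simpa using h2⟩

end OneTruncatedVertexAlgebra

namespace RestrictedVertexAlgebra

variable (V : RestrictedVertexAlgebra.{u})

/-- The inclusion `V₀ ⊕ V₁ → V`. -/
def incl : (V.wt 0 × V.wt 1) →ₗ[ℂ] V.carrier :=
  (V.wt 0).subtype.coprod (V.wt 1).subtype

/-- The projection `V → V₀ ⊕ V₁`. -/
noncomputable def pr : V.carrier →ₗ[ℂ] (V.wt 0 × V.wt 1) :=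
  (V.proj 0).prod (V.proj 1)

lemma incl_mem {i : ℤ} {x : V.wt 0 × V.wt 1} (hx : x ∈ truncWt (V.wt 0) (V.wt 1) i) :
    V.incl x ∈ V.wt (i : ℂ) := by
  obtain ⟨x, y⟩ := x
  obtain ⟨h0, h1⟩ := hx
  by_cases hi0 : i = 0
  · subst hi0
    have : y = 0 := h1 (by simp)
    subst this
    simpa [incl] using x.2
  by_cases hi1 : i = 1
  · subst hi1
    have : x = 0 := h0 (by simp)
    subst this
    simp [incl]
  have hx : x = 0 := h0 hi0
  have hy : y = 0 := h1 hi1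
  subst hx hy
  simp [incl]

lemma pr_mem {i : ℤ} {x : V.carrier} (hx : x ∈ V.wt (i : ℂ)) :
    V.pr x ∈ truncWt (V.wt 0) (V.wt 1) i :=
  ⟨fun h => V.proj_of_mem_ne (by exact_mod_cast h) hx,
    fun h => V.proj_of_mem_ne (by exact_mod_cast h) hx⟩

lemma incl_pr {i : ℤ} (hi : i ≤ 1) {x : V.carrier} (hx : x ∈ V.wt (i : ℂ)) :
    V.incl (V.pr x) = x := by
  by_cases h0 : i = 0
  · subst h0
    have h1 : V.proj 1 x = 0 := V.proj_of_mem_ne (by norm_num) hx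
    rw [Int.cast_zero] at hx
    have h2 := V.proj_of_mem hx
    simp [incl, pr, h1, h2]
  by_cases h1 : i = 1
  · subst h1
    have h1 : V.proj 0 x = 0 := V.proj_of_mem_ne (by norm_num) hx
    rw [Int.cast_one] at hx
    have h2 := V.proj_of_mem hx
    simp [incl, pr, h1, h2]
  have : x = 0 := V.eq_zero_of_neg (by omega) hx
  subst this
  simp

lemma pr_incl (x : V.wt 0 × V.wt 1) : V.pr (V.incl x) = x := by
  obtain ⟨x, y⟩ := x
  have h1 := V.proj_of_mem x.2
  have h2 := V.proj_of_mem y.2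
  have h3 : V.proj 1 x = 0 := V.proj_of_mem_ne (by norm_num) x.2
  have h4 : V.proj 0 y = 0 := V.proj_of_mem_ne (by norm_num) y.2
  have h : V.incl (x, y) = x + y := by simp [incl]
  rw [h]
  refine Prod.ext ?_ ?_
  · change V.proj 0 (x + y) = x
    rw [map_add, h1, h4, add_zero]
  · change V.proj 1 (x + y) = y
    rw [map_add, h3, h2, zero_add]

lemma vac_mem : V.vac ∈ V.wt 0 := by
  have h := V.H_op (-1) V.vac V.vac
  simp only [V.vac_op, V.op_neg_one_vac, if_true] at h
  rw [Module.End.mem_eigenspace_iff, zero_smul]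
  simpa using h.symm

/-- The operations of the truncation: those of `V`, followed by the projection. -/
noncomputable def truncMode (n : ℤ) :
    (V.wt 0 × V.wt 1) →ₗ[ℂ] (V.wt 0 × V.wt 1) →ₗ[ℂ] (V.wt 0 × V.wt 1) :=
  ((V.op n).compl₁₂ V.incl V.incl).compr₂ V.pr

lemma truncMode_apply (n : ℤ) (x y : V.wt 0 × V.wt 1) :
    V.truncMode n x y = V.pr (V.op n (V.incl x) (V.incl y)) := rfl

lemma op_mem' {i j : ℤ} {a b : V.carrier} (ha : a ∈ V.wt (i : ℂ)) (hb : b ∈ V.wt (j : ℂ))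
    (n l : ℤ) (hl : l = i + j - n - 1) : V.op n a b ∈ V.wt (l : ℂ) := by
  subst hl
  have := V.op_mem ha hb n
  push_cast
  exact this

lemma incl_truncMode {i j : ℤ} {x y : V.wt 0 × V.wt 1}
    (hx : x ∈ truncWt (V.wt 0) (V.wt 1) i) (hy : y ∈ truncWt (V.wt 0) (V.wt 1) j)
    (n : ℤ) (h : i + j - n - 1 ≤ 1) :
    V.incl (V.truncMode n x y) = V.op n (V.incl x) (V.incl y) :=
  V.incl_pr h (V.op_mem' (V.incl_mem hx) (V.incl_mem hy) n _ rfl)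

lemma incl_vac : V.incl (⟨V.vac, V.vac_mem⟩, 0) = V.vac := by simp [incl]

lemma finsum_eq_range {E : Type*} [AddCommMonoid E] (f : ℕ → E) (h : ∀ j, 2 ≤ j → f j = 0) :
    ∑ᶠ j, f j = ∑ j ∈ Finset.range 2, f j := by
  apply finsum_eq_sum_of_support_subset
  intro j hj
  by_contra hj2
  simp only [Finset.coe_range, Set.mem_Iio, not_lt] at hj2
  exact hj (h j hj2)

/-- The truncation `V_{≤1} = V₀ ⊕ V₁`. -/
noncomputable def truncObj : OneTruncatedVertexAlgebra.{u} where
  V₀ := V.wt 0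
  V₁ := V.wt 1
  vac := ⟨V.vac, V.vac_mem⟩
  mode := V.truncMode
  mode_mem n i j x y hx hy :=
    V.pr_mem (V.op_mem' (V.incl_mem hx) (V.incl_mem hy) n _ rfl)
  vac_mode n x := by
    rw [truncMode_apply, incl_vac, V.vac_op]
    split_ifs
    · exact V.pr_incl x
    · simp
  mode_vac n x hn := by
    rw [truncMode_apply, incl_vac, V.op_vac n _ hn, map_zero]
  mode_neg_one_vac x := by
    rw [truncMode_apply, incl_vac, V.op_neg_one_vac, pr_incl]
  borcherds m n k p q r a b c ha hb hc hn hk hm := by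
    have h := congrArg V.pr (V.borcherds m n k (V.incl a) (V.incl b) (V.incl c))
    have h0 : ∀ {i j : ℤ} {x y : V.wt 0 × V.wt 1}, x ∈ truncWt (V.wt 0) (V.wt 1) i →
        y ∈ truncWt (V.wt 0) (V.wt 1) j → ∀ (n : ℤ) (s : ℕ), i + j - n - 1 ≤ 1 → 2 ≤ s →
        V.op (n + s) (V.incl x) (V.incl y) = 0 := by
      intro i j x y hx hy n s h1 h2
      exact V.eq_zero_of_neg (i := i + j - (n + s) - 1) (by omega)
        (V.op_mem' (V.incl_mem hx) (V.incl_mem hy) _ _ rfl)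
    rw [finsum_eq_range (E := V.carrier) _ ?_, finsum_eq_range (E := V.carrier) _ ?_,
      finsum_eq_range (E := V.carrier) _ ?_, map_sub, map_sum,
      map_sum, map_sum] at h
    · refine Eq.trans (Finset.sum_congr rfl fun j _ => ?_) (h.trans (congrArg₂ (· - ·)
        (Finset.sum_congr rfl fun j _ => ?_) (Finset.sum_congr rfl fun j _ => ?_)))
      · rw [map_smul, truncMode_apply, V.incl_truncMode ha hb _ (by omega)]
      · rw [map_smul, truncMode_apply, V.incl_truncMode hb hc _ (by omega)]
      · rw [map_smul, truncMode_apply, V.incl_truncMode ha hc _ (by omega)]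
    · intro j hj
      rw [h0 ha hc m j hm hj]
      simp
    · intro j hj
      rw [h0 hb hc k j hk hj]
      simp
    · intro j hj
      rw [h0 ha hb n j hn hj]
      simp

variable {V} {V' V'' : RestrictedVertexAlgebra.{u}}

lemma Hom.map_wt (f : Hom V V') {μ : ℂ} {x : V.carrier} (hx : x ∈ V.wt μ) :
    f.toLin x ∈ V'.wt μ := by
  rw [Module.End.mem_eigenspace_iff] at *
  rw [← f.map_H, hx, map_smul]

/-- The restriction of a morphism to the components of conformal weight `μ`. -/
def Hom.onWt (f : Hom V V') (μ : ℂ) : V.wt μ →ₗ[ℂ] V'.wt μ :=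
  f.toLin.restrict fun _ hx => f.map_wt hx

lemma Hom.proj_map (f : Hom V V') (μ : ℂ) (x : V.carrier) :
    V'.proj μ (f.toLin x) = f.onWt μ (V.proj μ x) := by
  have hx : x ∈ ⨆ ν : ℂ, V.wt ν := by rw [V.diagonalizable]; trivial
  induction hx using Submodule.iSup_induction' with
  | mem ν x hx =>
    by_cases h : ν = μ
    · subst h
      rw [V'.proj_of_mem (f.map_wt hx), V.proj_of_mem hx]
      rfl
    · rw [V'.proj_of_mem_ne h (f.map_wt hx), V.proj_of_mem_ne h hx, map_zero]
  | zero => simp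
  | add x y _ _ hx hy => simp [hx, hy]

lemma Hom.map_truncMode (f : Hom V V') (n : ℤ) (x y : V.wt 0 × V.wt 1) :
    (f.onWt 0).prodMap (f.onWt 1) (V.truncMode n x y) =
      V'.truncMode n ((f.onWt 0).prodMap (f.onWt 1) x) ((f.onWt 0).prodMap (f.onWt 1) y) := by
  have hi : ∀ z, V'.incl ((f.onWt 0).prodMap (f.onWt 1) z) = f.toLin (V.incl z) := by
    intro z
    simp [incl, Hom.onWt]
  have hp : ∀ z, V'.pr (f.toLin z) = (f.onWt 0).prodMap (f.onWt 1) (V.pr z) := by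
    intro z
    simp [pr, f.proj_map]
  rw [truncMode_apply, truncMode_apply, hi, hi, ← f.map_op, hp]

/-- The truncation of a morphism. -/
noncomputable def truncMap (f : Hom V V') :
    OneTruncatedVertexAlgebra.Hom V.truncObj V'.truncObj where
  f₀ := f.onWt 0
  f₁ := f.onWt 1
  map_vac := Subtype.ext f.map_vac
  map_mode n x y := f.map_truncMode n x y

end RestrictedVertexAlgebra

/-- The truncation functor `V ↦ V_{≤1}`. -/
noncomputable def truncation :
    RestrictedVertexAlgebra.{u} ⥤ OneTruncatedVertexAlgebra.{u} where
  obj V := V.truncObj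
  map f := RestrictedVertexAlgebra.truncMap f

set_option linter.unusedSimpArgs false

namespace OneTruncatedVertexAlgebra

variable (W : OneTruncatedVertexAlgebra.{u})

/-- `a_(-1) b ∈ V₀` for `a, b ∈ V₀`. -/
def mul : W.V₀ →ₗ[ℂ] W.V₀ →ₗ[ℂ] W.V₀ :=
  ((W.mode (-1)).compl₁₂ (.inl ℂ W.V₀ W.V₁) (.inl ℂ W.V₀ W.V₁)).compr₂ (.fst ℂ W.V₀ W.V₁)

/-- `a_(-2) b ∈ V₁` for `a, b ∈ V₀`. -/
def mulTwo : W.V₀ →ₗ[ℂ] W.V₀ →ₗ[ℂ] W.V₁ :=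
  ((W.mode (-2)).compl₁₂ (.inl ℂ W.V₀ W.V₁) (.inl ℂ W.V₀ W.V₁)).compr₂ (.snd ℂ W.V₀ W.V₁)

/-- `a_(-1) x ∈ V₁` for `a ∈ V₀`, `x ∈ V₁`. -/
def act : W.V₀ →ₗ[ℂ] W.V₁ →ₗ[ℂ] W.V₁ :=
  ((W.mode (-1)).compl₁₂ (.inl ℂ W.V₀ W.V₁) (.inr ℂ W.V₀ W.V₁)).compr₂ (.snd ℂ W.V₀ W.V₁)

/-- `a_(0) x ∈ V₀` for `a ∈ V₀`, `x ∈ V₁`. -/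
def coanchor : W.V₀ →ₗ[ℂ] W.V₁ →ₗ[ℂ] W.V₀ :=
  ((W.mode 0).compl₁₂ (.inl ℂ W.V₀ W.V₁) (.inr ℂ W.V₀ W.V₁)).compr₂ (.fst ℂ W.V₀ W.V₁)

/-- `x_(-1) a ∈ V₁` for `x ∈ V₁`, `a ∈ V₀`. -/
def ract : W.V₁ →ₗ[ℂ] W.V₀ →ₗ[ℂ] W.V₁ :=
  ((W.mode (-1)).compl₁₂ (.inr ℂ W.V₀ W.V₁) (.inl ℂ W.V₀ W.V₁)).compr₂ (.snd ℂ W.V₀ W.V₁)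

/-- `x_(0) a ∈ V₀` for `x ∈ V₁`, `a ∈ V₀`. -/
def anchor : W.V₁ →ₗ[ℂ] W.V₀ →ₗ[ℂ] W.V₀ :=
  ((W.mode 0).compl₁₂ (.inr ℂ W.V₀ W.V₁) (.inl ℂ W.V₀ W.V₁)).compr₂ (.fst ℂ W.V₀ W.V₁)

/-- `x_(0) y ∈ V₁` for `x, y ∈ V₁`. -/
def br : W.V₁ →ₗ[ℂ] W.V₁ →ₗ[ℂ] W.V₁ :=
  ((W.mode 0).compl₁₂ (.inr ℂ W.V₀ W.V₁) (.inr ℂ W.V₀ W.V₁)).compr₂ (.snd ℂ W.V₀ W.V₁)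

/-- `⟨x, y⟩ = x_(1) y ∈ V₀` for `x, y ∈ V₁`. -/
def pair : W.V₁ →ₗ[ℂ] W.V₁ →ₗ[ℂ] W.V₀ :=
  ((W.mode 1).compl₁₂ (.inr ℂ W.V₀ W.V₁) (.inr ℂ W.V₀ W.V₁)).compr₂ (.fst ℂ W.V₀ W.V₁)

/-- `∂ a = a_(-2) |0⟩ ∈ V₁` for `a ∈ V₀`. -/
def d : W.V₀ →ₗ[ℂ] W.V₁ := W.mulTwo.flip W.vac

lemma mem₀ (a : W.V₀) : (a, (0 : W.V₁)) ∈ truncWt W.V₀ W.V₁ 0 :=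
  ⟨fun h => absurd rfl h, fun _ => rfl⟩

lemma mem₁ (x : W.V₁) : ((0 : W.V₀), x) ∈ truncWt W.V₀ W.V₁ 1 :=
  ⟨fun _ => rfl, fun h => absurd rfl h⟩

lemma mode₀₀ (n : ℤ) (a b : W.V₀) : W.mode n (a, 0) (b, 0) =
    (if n = -1 then W.mul a b else 0, if n = -2 then W.mulTwo a b else 0) := by
  obtain ⟨h0, h1⟩ := W.mode_mem n 0 0 _ _ (W.mem₀ a) (W.mem₀ b)
  refine Prod.ext ?_ ?_
  · dsimp only
    split_ifs with h
    · subst h; rfl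
    · exact h0 (by omega)
  · dsimp only
    split_ifs with h
    · subst h; rfl
    · exact h1 (by omega)

lemma mode₀₁ (n : ℤ) (a : W.V₀) (b : W.V₁) : W.mode n (a, 0) (0, b) =
    (if n = 0 then W.coanchor a b else 0, if n = -1 then W.act a b else 0) := by
  obtain ⟨h0, h1⟩ := W.mode_mem n 0 1 _ _ (W.mem₀ a) (W.mem₁ b)
  refine Prod.ext ?_ ?_
  · dsimp only
    split_ifs with h
    · subst h; rfl
    · exact h0 (by omega)
  · dsimp only
    split_ifs with h
    · subst h; rfl
    · exact h1 (by omega)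

lemma mode₁₀ (n : ℤ) (a : W.V₁) (b : W.V₀) : W.mode n (0, a) (b, 0) =
    (if n = 0 then W.anchor a b else 0, if n = -1 then W.ract a b else 0) := by
  obtain ⟨h0, h1⟩ := W.mode_mem n 1 0 _ _ (W.mem₁ a) (W.mem₀ b)
  refine Prod.ext ?_ ?_
  · dsimp only
    split_ifs with h
    · subst h; rfl
    · exact h0 (by omega)
  · dsimp only
    split_ifs with h
    · subst h; rfl
    · exact h1 (by omega)

lemma mode₁₁ (n : ℤ) (a b : W.V₁) : W.mode n (0, a) (0, b) =
    (if n = 1 then W.pair a b else 0, if n = 0 then W.br a b else 0) := by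
  obtain ⟨h0, h1⟩ := W.mode_mem n 1 1 _ _ (W.mem₁ a) (W.mem₁ b)
  refine Prod.ext ?_ ?_
  · dsimp only
    split_ifs with h
    · subst h; rfl
    · exact h0 (by omega)
  · dsimp only
    split_ifs with h
    · subst h; rfl
    · exact h1 (by omega)

lemma bor (m n k p q r : ℤ) {a b c : W.V₀ × W.V₁} (ha : a ∈ truncWt W.V₀ W.V₁ p)
    (hb : b ∈ truncWt W.V₀ W.V₁ q) (hc : c ∈ truncWt W.V₀ W.V₁ r)
    (h1 : p + q - n - 1 ≤ 1) (h2 : q + r - k - 1 ≤ 1) (h3 : p + r - m - 1 ≤ 1) :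
    W.mode (m + k) (W.mode n a b) c + (m : ℂ) • W.mode (m + k - 1) (W.mode (n + 1) a b) c =
      W.mode (n + m) a (W.mode k b c) - (n : ℂ) • W.mode (n + m - 1) a (W.mode (k + 1) b c) -
      ((-1 : ℂ) ^ n • W.mode (n + k) b (W.mode m a c) -
        ((-1 : ℂ) ^ n * n) • W.mode (n + k - 1) b (W.mode (m + 1) a c)) := by
  have h := W.borcherds m n k p q r a b c ha hb hc h1 h2 h3
  have h4 : (-1 : ℂ) ^ (1 + n) = - (-1 : ℂ) ^ n := by
    rw [zpow_add₀ (by norm_num)]; simp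
  simp only [Finset.sum_range_succ, Finset.sum_range_zero, zero_add, Ring.choose_zero_right,
    Ring.choose_one_right, Nat.cast_zero, Nat.cast_one, add_zero, sub_zero, pow_zero, pow_one,
    one_smul, mul_one, h4, one_mul, neg_mul, neg_smul] at h
  rw [h]
  abel

variable (a b c : W.V₀) (x y z : W.V₁)

lemma mulTwo_vac : W.mulTwo a W.vac = W.d a := rfl

lemma vac_mul : W.mul W.vac a = a := by
  have h := W.vac_mode (-1) (a, 0)
  simpa [mode₀₀] using h

lemma mul_vac : W.mul a W.vac = a := by
  have h := W.mode_neg_one_vac (a, 0)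
  simpa [mode₀₀] using h

lemma vac_act : W.act W.vac x = x := by
  have h := W.vac_mode (-1) (0, x)
  simpa [mode₀₁] using h

lemma ract_vac : W.ract x W.vac = x := by
  have h := W.mode_neg_one_vac (0, x)
  simpa [mode₁₀] using h

lemma anchor_vac : W.anchor x W.vac = 0 := by
  have h := W.mode_vac 0 (0, x) le_rfl
  simpa [mode₁₀] using h

lemma d_vac : W.d W.vac = 0 := by
  have h := W.vac_mode (-2) (W.vac, 0)
  simpa [mode₀₀, mulTwo_vac] using h

lemma mul_comm' : W.mul a b = W.mul b a := by
  have h := W.bor (-1) 0 (-1) 0 0 0 (W.mem₀ a) (W.mem₀ b) (W.mem₀ W.vac) (by norm_num)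
    (by norm_num) (by norm_num)
  simp [mode₀₀, mul_vac] at h
  exact sub_eq_zero.mp h.symm

lemma mul_assoc' : W.mul (W.mul a b) c = W.mul a (W.mul b c) := by
  have h := W.bor 0 (-1) (-1) 0 0 0 (W.mem₀ a) (W.mem₀ b) (W.mem₀ c) (by norm_num)
    (by norm_num) (by norm_num)
  simpa [mode₀₀] using h

lemma mulTwo_eq : W.mulTwo a b = W.act b (W.d a) := by
  have h := W.bor (-2) 0 (-1) 0 0 0 (W.mem₀ a) (W.mem₀ b) (W.mem₀ W.vac) (by norm_num)
    (by norm_num) (by norm_num)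
  simp [mode₀₀, mode₀₁, mul_vac] at h
  exact sub_eq_zero.mp h.symm

lemma d_mul : W.d (W.mul a b) = W.act a (W.d b) + W.act b (W.d a) := by
  have h := W.bor 0 (-1) (-2) 0 0 0 (W.mem₀ a) (W.mem₀ b) (W.mem₀ W.vac) (by norm_num)
    (by norm_num) (by norm_num)
  simp [mode₀₀, mode₀₁, mul_vac, mulTwo_eq W a b] at h
  exact h

lemma coanchor_eq : W.coanchor a x = - W.anchor x a := by
  have h := W.bor (-1) 0 0 0 1 0 (W.mem₀ a) (W.mem₁ x) (W.mem₀ W.vac) (by norm_num)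
    (by norm_num) (by norm_num)
  simp [mode₀₀, mode₀₁, mode₁₀, mul_vac, anchor_vac] at h
  exact h

lemma ract_eq : W.ract x a = W.act a x + W.d (W.anchor x a) := by
  have h := W.bor (-1) 0 (-1) 0 1 0 (W.mem₀ a) (W.mem₁ x) (W.mem₀ W.vac) (by norm_num)
    (by norm_num) (by norm_num)
  simp [mode₀₀, mode₀₁, mode₁₀, mul_vac, anchor_vac, ract_vac, coanchor_eq, mulTwo_vac] at h
  rw [← sub_eq_zero, ← neg_eq_zero, neg_sub, add_sub_right_comm, ← h]
  abel

lemma act_act : W.act (W.mul a b) x = W.act a (W.act b x) -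
    W.act (W.anchor x b) (W.d a) - W.act (W.anchor x a) (W.d b) := by
  have h := W.bor 0 (-1) (-1) 0 0 1 (W.mem₀ a) (W.mem₀ b) (W.mem₁ x) (by norm_num)
    (by norm_num) (by norm_num)
  simp [mode₀₀, mode₀₁, mode₁₀, coanchor_eq, mulTwo_eq] at h
  rw [h]

lemma anchor_mul : W.anchor x (W.mul a b) =
    W.mul (W.anchor x a) b + W.mul a (W.anchor x b) := by
  have h := W.bor 0 0 (-1) 1 0 0 (W.mem₁ x) (W.mem₀ a) (W.mem₀ b) (by norm_num)
    (by norm_num) (by norm_num)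
  simp [mode₀₀, mode₀₁, mode₁₀] at h
  rw [h]
  abel

lemma anchor_act : W.anchor (W.act a x) b = W.mul a (W.anchor x b) := by
  have h := W.bor 0 (-1) 0 0 1 0 (W.mem₀ a) (W.mem₁ x) (W.mem₀ b) (by norm_num)
    (by norm_num) (by norm_num)
  simpa [mode₀₀, mode₀₁, mode₁₀] using h

lemma anchor_d : W.anchor (W.d a) b = 0 := by
  have h := W.bor 0 (-2) 0 0 0 0 (W.mem₀ a) (W.mem₀ W.vac) (W.mem₀ b) (by norm_num)
    (by norm_num) (by norm_num)
  simpa [mode₀₀, mode₀₁, mode₁₀, mulTwo_vac] using h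

lemma pair_comm : W.pair x y = W.pair y x := by
  have h := W.bor (-1) 0 1 1 1 0 (W.mem₁ x) (W.mem₁ y) (W.mem₀ W.vac) (by norm_num)
    (by norm_num) (by norm_num)
  simp [mode₀₀, mode₁₀, mode₁₁, mul_vac, anchor_vac, ract_vac] at h
  exact h

lemma pair_d : W.pair (W.d a) x = W.anchor x a := by
  have h := W.bor 0 (-2) 1 0 0 1 (W.mem₀ a) (W.mem₀ W.vac) (W.mem₁ x) (by norm_num)
    (by norm_num) (by norm_num)
  simp [mode₀₀, mode₀₁, mode₁₀, mode₁₁, mulTwo_vac, coanchor_eq, vac_mul] at h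
  exact h

lemma pair_act : W.pair (W.act a x) y =
    W.mul a (W.pair x y) - W.anchor x (W.anchor y a) := by
  have h := W.bor 0 (-1) 1 0 1 1 (W.mem₀ a) (W.mem₁ x) (W.mem₁ y) (by norm_num)
    (by norm_num) (by norm_num)
  simp [mode₀₀, mode₀₁, mode₁₀, mode₁₁, coanchor_eq] at h
  rw [h]

lemma br_comm : W.br x y = - W.br y x + W.d (W.pair x y) := by
  have h := W.bor (-1) 0 0 1 1 0 (W.mem₁ x) (W.mem₁ y) (W.mem₀ W.vac) (by norm_num)
    (by norm_num) (by norm_num)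
  simp [mode₀₀, mode₁₀, mode₁₁, mul_vac, anchor_vac, ract_vac, mulTwo_vac] at h
  rw [← h]
  abel

lemma br_d : W.br x (W.d a) = W.d (W.anchor x a) := by
  have h := W.bor 0 0 (-2) 1 0 0 (W.mem₁ x) (W.mem₀ a) (W.mem₀ W.vac) (by norm_num)
    (by norm_num) (by norm_num)
  simp [mode₀₀, mode₁₀, mode₁₁, anchor_vac, mulTwo_vac] at h
  exact h.symm

lemma d_br : W.br (W.d a) x = 0 := by
  have h := W.bor 0 (-2) 0 0 0 1 (W.mem₀ a) (W.mem₀ W.vac) (W.mem₁ x) (by norm_num)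
    (by norm_num) (by norm_num)
  simp [mode₀₀, mode₀₁, mode₁₁, mulTwo_vac, coanchor_eq] at h
  simp [h, mulTwo_eq, d_vac, anchor_vac]

lemma br_act : W.br x (W.act a y) = W.act (W.anchor x a) y + W.act a (W.br x y) := by
  have h := W.bor 0 0 (-1) 1 0 1 (W.mem₁ x) (W.mem₀ a) (W.mem₁ y) (by norm_num)
    (by norm_num) (by norm_num)
  simp [mode₀₀, mode₀₁, mode₁₀, mode₁₁] at h
  rw [h]
  abel

lemma anchor_br : W.anchor (W.br x y) a =
    W.anchor x (W.anchor y a) - W.anchor y (W.anchor x a) := by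
  have h := W.bor 0 0 0 1 1 0 (W.mem₁ x) (W.mem₁ y) (W.mem₀ a) (by norm_num)
    (by norm_num) (by norm_num)
  simpa [mode₀₀, mode₀₁, mode₁₀, mode₁₁] using h

lemma anchor_pair : W.anchor x (W.pair y z) =
    W.pair (W.br x y) z + W.pair y (W.br x z) := by
  have h := W.bor 0 0 1 1 1 1 (W.mem₁ x) (W.mem₁ y) (W.mem₁ z) (by norm_num)
    (by norm_num) (by norm_num)
  simp [mode₀₀, mode₀₁, mode₁₀, mode₁₁] at h
  rw [h]
  abel

lemma br_br : W.br x (W.br y z) = W.br (W.br x y) z + W.br y (W.br x z) := by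
  have h := W.bor 0 0 0 1 1 1 (W.mem₁ x) (W.mem₁ y) (W.mem₁ z) (by norm_num)
    (by norm_num) (by norm_num)
  simp [mode₀₀, mode₀₁, mode₁₀, mode₁₁] at h
  rw [h]
  abel

lemma act_br : W.br (W.act a x) y = W.act a (W.br x y) - W.act (W.anchor y a) x +
    W.act (W.pair x y) (W.d a) - W.d (W.anchor x (W.anchor y a)) := by
  have h := W.bor 0 (-1) 0 0 1 1 (W.mem₀ a) (W.mem₁ x) (W.mem₁ y) (by norm_num)
    (by norm_num) (by norm_num)
  simp [mode₀₀, mode₀₁, mode₁₀, mode₁₁, coanchor_eq, ract_eq, mulTwo_eq] at h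
  rw [h]
  abel

end OneTruncatedVertexAlgebra

namespace OneTruncatedVertexAlgebra

variable (W : OneTruncatedVertexAlgebra.{u})

/-- `V₀` is a commutative ring under `a_(-1) b`, with unit the vacuum. -/
instance commRing : CommRing W.V₀ where
  __ := W.addCommGroup₀
  mul a b := W.mul a b
  one := W.vac
  mul_assoc := W.mul_assoc'
  mul_comm := W.mul_comm'
  one_mul := W.vac_mul
  mul_one := W.mul_vac
  left_distrib a b c := (W.mul a).map_add b c
  right_distrib a b c := by
    change W.mul (a + b) c = W.mul a c + W.mul b c
    simp
  zero_mul a := by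
    change W.mul 0 a = 0
    simp
  mul_zero a := (W.mul a).map_zero

instance algebra : Algebra ℂ W.V₀ :=
  Algebra.ofModule (fun r a b => by
      change W.mul (r • a) b = r • W.mul a b
      simp)
    (fun r a b => (W.mul a).map_smul r b)

lemma mul_eq (a b : W.V₀) : W.mul a b = a * b := rfl

lemma one_eq : W.vac = 1 := rfl

/-- The subspace `Ω ⊆ V₁` spanned by the elements `a ∂b`. -/
def Om : Submodule ℂ W.V₁ :=
  Submodule.span ℂ {x | ∃ a b : W.V₀, x = W.act a (W.d b)}

/-- `𝒯 = V₁ / Ω`. -/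
abbrev T : Type u := W.V₁ ⧸ W.Om

variable {W}

lemma act_d_mem (a b : W.V₀) : W.act a (W.d b) ∈ W.Om := Submodule.subset_span ⟨a, b, rfl⟩

@[elab_as_elim]
lemma Om_induction {p : ∀ x, x ∈ W.Om → Prop} (h : ∀ a b, p (W.act a (W.d b)) (act_d_mem a b))
    (h0 : p 0 (zero_mem _)) (hadd : ∀ x y hx hy, p x hx → p y hy → p (x + y) (add_mem hx hy))
    (hsmul : ∀ (c : ℂ) x hx, p x hx → p (c • x) (Submodule.smul_mem _ c hx))
    {x : W.V₁} (hx : x ∈ W.Om) : p x hx := by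
  induction hx using Submodule.span_induction with
  | mem x hx => obtain ⟨a, b, rfl⟩ := hx; exact h a b
  | zero => exact h0
  | add x y hx' hy' hx hy => exact hadd x y hx' hy' hx hy
  | smul c x hx' hx => exact hsmul c x hx' hx

lemma d_mem (a : W.V₀) : W.d a ∈ W.Om := by
  simpa [W.vac_act] using act_d_mem (W.vac) a

lemma anchor_Om {x : W.V₁} (hx : x ∈ W.Om) (a : W.V₀) : W.anchor x a = 0 := by
  induction hx using Om_induction with
  | h a b => simp [anchor_act, anchor_d]
  | h0 => simp
  | hadd x y _ _ hx hy => simp [hx, hy]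
  | hsmul c x _ hx => simp [hx]

lemma act_act_Om {x : W.V₁} (hx : x ∈ W.Om) (a b : W.V₀) :
    W.act (a * b) x = W.act a (W.act b x) := by
  rw [← mul_eq, act_act, anchor_Om hx, anchor_Om hx]
  simp

lemma act_mem (a : W.V₀) {x : W.V₁} (hx : x ∈ W.Om) : W.act a x ∈ W.Om := by
  induction hx using Om_induction with
  | h b c => rw [← act_act_Om (d_mem c)]; exact act_d_mem _ _
  | h0 => simp
  | hadd x y _ _ hx hy => rw [map_add]; exact add_mem hx hy
  | hsmul c x _ hx => rw [map_smul]; exact Submodule.smul_mem _ _ hx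

lemma br_mem (x : W.V₁) {y : W.V₁} (hy : y ∈ W.Om) : W.br x y ∈ W.Om := by
  induction hy using Om_induction with
  | h b c =>
    rw [br_act, br_d]
    exact add_mem (act_d_mem _ _) (act_d_mem _ _)
  | h0 => simp
  | hadd x y _ _ hx hy => rw [map_add]; exact add_mem hx hy
  | hsmul c x _ hx => rw [map_smul]; exact Submodule.smul_mem _ _ hx

lemma br_mem' {x : W.V₁} (hx : x ∈ W.Om) (y : W.V₁) : W.br x y ∈ W.Om := by
  rw [br_comm]
  exact add_mem (neg_mem (br_mem y hx)) (d_mem _)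

lemma br_Om_Om {x y : W.V₁} (hx : x ∈ W.Om) (hy : y ∈ W.Om) : W.br x y = 0 := by
  induction hy using Om_induction with
  | h b c => simp [br_act, br_d, anchor_Om hx]
  | h0 => simp
  | hadd x y _ _ hx hy => simp [hx, hy]
  | hsmul c x _ hx => simp [hx]

lemma pair_Om_Om {x y : W.V₁} (hx : x ∈ W.Om) (hy : y ∈ W.Om) : W.pair x y = 0 := by
  induction hx using Om_induction with
  | h b c => simp [pair_act, pair_d, anchor_Om hy]
  | h0 => simp
  | hadd x y _ _ hx hy => simp [hx, hy]
  | hsmul c x _ hx => simp [hx]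

/-- The `A`-module structure of `Ω`. -/
instance moduleOm : Module W.V₀ W.Om where
  smul a x := ⟨W.act a x, act_mem a x.2⟩
  one_smul x := Subtype.ext (W.vac_act x)
  mul_smul a b x := Subtype.ext (act_act_Om x.2 a b)
  smul_zero a := Subtype.ext (W.act a).map_zero
  smul_add a x y := Subtype.ext ((W.act a).map_add x y)
  add_smul a b x := Subtype.ext (by
    change W.act (a + b) x = W.act a x + W.act b x
    simp)
  zero_smul x := Subtype.ext (by
    change W.act 0 x = 0
    simp)

lemma coe_smul (a : W.V₀) (x : W.Om) : ((a • x : W.Om) : W.V₁) = W.act a x := rfl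

instance towerOm : IsScalarTower ℂ W.V₀ W.Om :=
  ⟨fun c a x => Subtype.ext (by simp [coe_smul])⟩

/-- The derivation `d : A → Ω`. -/
def dOm : Derivation ℂ W.V₀ W.Om :=
  Derivation.mk' (W.d.codRestrict W.Om d_mem) fun a b => Subtype.ext (by
    simp [coe_smul, ← mul_eq, d_mul])

lemma coe_dOm (a : W.V₀) : (dOm a : W.V₁) = W.d a := rfl

lemma span_dOm : Submodule.span ℂ {x : W.Om | ∃ a b : W.V₀, x = a • dOm b} = ⊤ := by
  apply Submodule.map_injective_of_injective W.Om.injective_subtype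
  rw [Submodule.map_span, Submodule.map_top, Submodule.range_subtype]
  change _ = Submodule.span ℂ _
  congr 1
  ext x
  constructor
  · rintro ⟨_, ⟨a, b, rfl⟩, rfl⟩
    exact ⟨a, b, rfl⟩
  · rintro ⟨a, b, rfl⟩
    exact ⟨a • dOm b, ⟨a, b, rfl⟩, rfl⟩

variable (W) in
/-- Multiplication by `A` on `𝒯`. -/
def smulT : W.V₀ →ₗ[ℂ] W.T →ₗ[ℂ] W.T where
  toFun a := W.Om.mapQ W.Om (W.act a) fun _ hx => act_mem a hx
  map_add' a b := by ext x; simp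
  map_smul' c a := by ext x; simp

/-- The `A`-module structure of `𝒯`. -/
instance moduleT : Module W.V₀ W.T where
  smul a t := W.smulT a t
  one_smul t := by
    obtain ⟨x, rfl⟩ := Submodule.Quotient.mk_surjective _ t
    exact congrArg _ (W.vac_act x)
  mul_smul a b t := by
    obtain ⟨x, rfl⟩ := Submodule.Quotient.mk_surjective _ t
    refine (Submodule.Quotient.eq _).mpr ?_
    rw [← mul_eq, act_act]
    have := add_mem (act_d_mem (W.anchor x b) a) (act_d_mem (W.anchor x a) b)
    convert neg_mem this using 1
    abel
  smul_zero a := (W.smulT a).map_zero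
  smul_add a := (W.smulT a).map_add
  add_smul a b t := by
    change W.smulT (a + b) t = W.smulT a t + W.smulT b t
    simp
  zero_smul t := by
    change W.smulT 0 t = 0
    simp

lemma smul_mk (a : W.V₀) (x : W.V₁) : a • (W.Om.mkQ x) = W.Om.mkQ (W.act a x) := rfl

instance towerT : IsScalarTower ℂ W.V₀ W.T :=
  ⟨fun c a t => by
    change W.smulT (c • a) t = c • W.smulT a t
    simp⟩

variable (W) in
/-- The bracket of `𝒯`, induced by `x_(0) y`. -/
def bracketT : W.T →ₗ[ℂ] W.T →ₗ[ℂ] W.T :=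
  W.Om.liftQ (LinearMap.flip (W.Om.liftQ (LinearMap.flip (W.br.compr₂ W.Om.mkQ))
    (by
      intro y hy
      ext x
      simpa using br_mem x hy)))
    (by
      intro x hx
      ext y
      exact (Submodule.Quotient.mk_eq_zero _).mpr (br_mem' hx y))

lemma bracketT_mk (x y : W.V₁) :
    W.bracketT (W.Om.mkQ x) (W.Om.mkQ y) = W.Om.mkQ (W.br x y) := rfl

instance lieRingT : LieRing W.T where
  bracket s t := W.bracketT s t
  add_lie s t r := by
    change W.bracketT (s + t) r = W.bracketT s r + W.bracketT t r
    simp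
  lie_add s t r := (W.bracketT s).map_add t r
  lie_self s := by
    obtain ⟨x, rfl⟩ := Submodule.mkQ_surjective _ s
    change W.Om.mkQ (W.br x x) = 0
    have h := W.br_comm x x
    have h2 : W.br x x = (1 / 2 : ℂ) • W.d (W.pair x x) := by
      have : W.br x x + W.br x x = W.d (W.pair x x) := by
        nth_rewrite 1 [h]
        abel
      rw [← this]
      module
    rw [h2]
    exact (Submodule.Quotient.mk_eq_zero _).mpr (Submodule.smul_mem _ _ (d_mem _))
  leibniz_lie s t r := by
    obtain ⟨x, rfl⟩ := Submodule.mkQ_surjective _ s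
    obtain ⟨y, rfl⟩ := Submodule.mkQ_surjective _ t
    obtain ⟨z, rfl⟩ := Submodule.mkQ_surjective _ r
    exact congrArg W.Om.mkQ (W.br_br x y z)

lemma lie_mk (x y : W.V₁) : ⁅W.Om.mkQ x, W.Om.mkQ y⁆ = W.Om.mkQ (W.br x y) := rfl

instance lieAlgebraT : LieAlgebra ℂ W.T where
  lie_smul c s t := (W.bracketT s).map_smul c t

variable (W) in
/-- The action of `𝒯` on `A`, induced by `x_(0) a`. -/
def anchorT : W.T →ₗ[ℂ] W.V₀ →ₗ[ℂ] W.V₀ :=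
  W.Om.liftQ W.anchor fun x hx => by
    ext a
    simpa using anchor_Om hx a

instance lieRingModuleT : LieRingModule W.T W.V₀ where
  bracket t a := W.anchorT t a
  add_lie s t a := by
    change W.anchorT (s + t) a = W.anchorT s a + W.anchorT t a
    simp
  lie_add s := (W.anchorT s).map_add
  leibniz_lie s t a := by
    obtain ⟨x, rfl⟩ := Submodule.mkQ_surjective _ s
    obtain ⟨y, rfl⟩ := Submodule.mkQ_surjective _ t
    change W.anchor x (W.anchor y a) = W.anchor (W.br x y) a + W.anchor y (W.anchor x a)
    rw [anchor_br]
    abel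

lemma lie_mk_fun (x : W.V₁) (a : W.V₀) : ⁅W.Om.mkQ x, a⁆ = W.anchor x a := rfl

instance lieRinehartRingT : LieRinehartRing W.V₀ W.T where
  lie_smul_eq_mul' a b t := by
    obtain ⟨x, rfl⟩ := Submodule.mkQ_surjective _ t
    exact W.anchor_act a b x
  leibniz_mul_right' t a b := by
    obtain ⟨x, rfl⟩ := Submodule.mkQ_surjective _ t
    refine (W.anchor_mul a b x).trans ?_
    rw [add_comm]
    rfl
  leibniz_smul_right' s t a := by
    obtain ⟨x, rfl⟩ := Submodule.mkQ_surjective _ s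
    obtain ⟨y, rfl⟩ := Submodule.mkQ_surjective _ t
    rw [smul_mk, lie_mk, br_act, map_add, add_comm]
    rfl

instance lieRinehartAlgebraT : LieRinehartAlgebra ℂ W.V₀ W.T where
  smul_lie c t a := by
    change W.anchorT (c • t) a = c • W.anchorT t a
    simp
  lie_smul c t a := (W.anchorT t).map_smul c a

end OneTruncatedVertexAlgebra

/-- The data of a prevertex algebra: a commutative algebra `A`, an `A`-module `Ω` with a derivation
`d : A → Ω` such that the elements `a db` span `Ω`, a Lie algebroid `T` over `A`, and
(`lieΩ`, `pairing`) the action `τ(a db) = τ(a) db + a d(τ(b))` and the `A`-bilinear pairing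
`⟨τ, a db⟩ = a τ(b)`, which are determined by these formulas and assumed to be well defined,
together with maps `γ`, `form`, `c2`. -/
structure PrevertexData where
  A : Type u
  Ω : Type u
  T : Type u
  [commRing : CommRing A]
  [algebra : Algebra ℂ A]
  [addCommGroupΩ : AddCommGroup Ω]
  [moduleΩ : Module ℂ Ω]
  [moduleAΩ : Module A Ω]
  [towerΩ : IsScalarTower ℂ A Ω]
  [lieRing : LieRing T]
  [lieAlgebra : LieAlgebra ℂ T]
  [moduleT : Module A T]
  [lieRingModule : LieRingModule T A]
  [lieRinehartRing : LieRinehartRing A T]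
  [lieRinehartAlgebra : LieRinehartAlgebra ℂ A T]
  d : Derivation ℂ A Ω
  span_d : Submodule.span ℂ {x : Ω | ∃ a b : A, x = a • d b} = ⊤
  lieΩ : T →ₗ[ℂ] Ω →ₗ[ℂ] Ω
  lieΩ_smul_d : ∀ (t : T) (a b : A), lieΩ t (a • d b) = ⁅t, a⁆ • d b + a • d ⁅t, b⁆
  pairing : T →ₗ[A] Ω →ₗ[A] A
  pairing_smul_d : ∀ (t : T) (a b : A), pairing t (a • d b) = a * ⁅t, b⁆
  γ : A →ₗ[ℂ] T →ₗ[ℂ] Ω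
  form : T →ₗ[ℂ] T →ₗ[ℂ] A
  c2 : T →ₗ[ℂ] T →ₗ[ℂ] Ω

attribute [instance] PrevertexData.commRing PrevertexData.algebra PrevertexData.addCommGroupΩ
  PrevertexData.moduleΩ PrevertexData.moduleAΩ PrevertexData.towerΩ PrevertexData.lieRing
  PrevertexData.lieAlgebra PrevertexData.moduleT PrevertexData.lieRingModule
  PrevertexData.lieRinehartRing PrevertexData.lieRinehartAlgebra

namespace PrevertexData

variable (P : PrevertexData.{u})

/-- `K(τ₁, τ₂, τ₃) = ⟨τ₁, [τ₂, τ₃]⟩ + cycle`. -/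
def K (t₁ t₂ t₃ : P.T) : P.A :=
  P.form t₁ ⁅t₂, t₃⁆ + P.form t₂ ⁅t₃, t₁⁆ + P.form t₃ ⁅t₁, t₂⁆

/-- `⟨τ₁, [τ₂, τ₃]'⟩`, where `[τ₂, τ₃]' = [τ₂, τ₃] - c²(τ₂, τ₃) ∈ T ⊕ Ω`. -/
def formBr (t₁ t₂ t₃ : P.T) : P.A :=
  P.form t₁ ⁅t₂, t₃⁆ - P.pairing t₁ (P.c2 t₂ t₃)

/-- `I(τ₁, τ₂, τ₃) = ⟨τ₁, [τ₂, τ₃]'⟩ + cycle`. -/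
def I (t₁ t₂ t₃ : P.T) : P.A :=
  P.formBr t₁ t₂ t₃ + P.formBr t₂ t₃ t₁ + P.formBr t₃ t₁ t₂

/-- The `3`-cochain `c³ = -K/2 + I/3`. -/
noncomputable def c3 (t₁ t₂ t₃ : P.T) : P.A :=
  -((1 / 2 : ℂ) • P.K t₁ t₂ t₃) + (1 / 3 : ℂ) • P.I t₁ t₂ t₃

/-- The Lie differential of the `2`-cochain `c²`, where
`(d_Lie c)(τ₁, …, τᵢ₊₁) = ∑_{p<q} (-1)^(p+q-1) c([τ_p, τ_q], τ₁, …, τ̂_p, …, τ̂_q, …)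
  + ∑_p (-1)^p τ_p c(τ₁, …, τ̂_p, …)`. -/
def dLieC2 (t₁ t₂ t₃ : P.T) : P.Ω :=
  P.c2 ⁅t₁, t₂⁆ t₃ - P.c2 ⁅t₁, t₃⁆ t₂ + P.c2 ⁅t₂, t₃⁆ t₁
    - P.lieΩ t₁ (P.c2 t₂ t₃) + P.lieΩ t₂ (P.c2 t₁ t₃) - P.lieΩ t₃ (P.c2 t₁ t₂)

/-- The Lie differential of the `3`-cochain `c³`. -/
noncomputable def dLieC3 (t₁ t₂ t₃ t₄ : P.T) : P.A :=
  P.c3 ⁅t₁, t₂⁆ t₃ t₄ - P.c3 ⁅t₁, t₃⁆ t₂ t₄ + P.c3 ⁅t₁, t₄⁆ t₂ t₃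
    + P.c3 ⁅t₂, t₃⁆ t₁ t₄ - P.c3 ⁅t₂, t₄⁆ t₁ t₃ + P.c3 ⁅t₃, t₄⁆ t₁ t₂
    - ⁅t₁, P.c3 t₂ t₃ t₄⁆ + ⁅t₂, P.c3 t₁ t₃ t₄⁆ - ⁅t₃, P.c3 t₁ t₂ t₄⁆ + ⁅t₄, P.c3 t₁ t₂ t₃⁆

end PrevertexData

/-- A prevertex algebra. -/
structure PrevertexAlgebra extends PrevertexData.{u} where
  γ_mul : ∀ (a b : A) (t : T),
    γ (a * b) t = γ a (b • t) + a • γ b t + ⁅t, a⁆ • d b + ⁅t, b⁆ • d a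
  form_symm : ∀ t₁ t₂ : T, form t₁ t₂ = form t₂ t₁
  form_smul : ∀ (a : A) (t₁ t₂ : T),
    form (a • t₁) t₂ = a * form t₁ t₂ + pairing t₂ (γ a t₁) - ⁅t₁, ⁅t₂, a⁆⁆
  c2_self : ∀ t : T, c2 t t = 0
  form_lie : ∀ t₁ t₂ t₃ : T,
    form ⁅t₁, t₂⁆ t₃ + form t₂ ⁅t₁, t₃⁆ =
      ⁅t₁, form t₂ t₃⁆ - (1 / 2 : ℂ) • ⁅t₂, form t₁ t₃⁆ - (1 / 2 : ℂ) • ⁅t₃, form t₁ t₂⁆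
        + pairing t₂ (c2 t₁ t₃) + pairing t₃ (c2 t₁ t₂)
  c2_smul : ∀ (a : A) (t₁ t₂ : T),
    c2 (a • t₁) t₂ = a • c2 t₁ t₂ + γ a ⁅t₁, t₂⁆ - γ ⁅t₂, a⁆ t₁ + lieΩ t₂ (γ a t₁)
      - (1 / 2 : ℂ) • (form t₁ t₂ • d a) + (1 / 2 : ℂ) • d ⁅t₁, ⁅t₂, a⁆⁆
      - (1 / 2 : ℂ) • d (pairing t₂ (γ a t₁))
  dLie_c2 : ∀ t₁ t₂ t₃ : T, toPrevertexData.dLieC2 t₁ t₂ t₃ = d (toPrevertexData.c3 t₁ t₂ t₃)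
  dLie_c3 : ∀ t₁ t₂ t₃ t₄ : T, toPrevertexData.dLieC3 t₁ t₂ t₃ t₄ = 0

namespace PrevertexAlgebra

@[ext]
structure Hom (P P' : PrevertexAlgebra.{u}) where
  fA : P.A →ₐ[ℂ] P'.A
  fΩ : P.Ω →ₗ[ℂ] P'.Ω
  fT : P.T →ₗ[ℂ] P'.T
  map_smulΩ : ∀ (a : P.A) (w : P.Ω), fΩ (a • w) = fA a • fΩ w
  map_d : ∀ a, fΩ (P.d a) = P'.d (fA a)
  map_smulT : ∀ (a : P.A) (t : P.T), fT (a • t) = fA a • fT t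
  map_lie : ∀ s t : P.T, fT ⁅s, t⁆ = ⁅fT s, fT t⁆
  map_lieA : ∀ (t : P.T) (a : P.A), fA ⁅t, a⁆ = ⁅fT t, fA a⁆
  map_γ : ∀ a t, fΩ (P.γ a t) = P'.γ (fA a) (fT t)
  map_form : ∀ s t, fA (P.form s t) = P'.form (fT s) (fT t)
  map_c2 : ∀ s t, fΩ (P.c2 s t) = P'.c2 (fT s) (fT t)

instance : Category PrevertexAlgebra.{u} where
  Hom := Hom
  id P := ⟨AlgHom.id ℂ P.A, LinearMap.id, LinearMap.id, fun _ _ => rfl, fun _ => rfl,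
    fun _ _ => rfl, fun _ _ => rfl, fun _ _ => rfl, fun _ _ => rfl, fun _ _ => rfl,
    fun _ _ => rfl⟩
  comp f g := ⟨g.fA.comp f.fA, g.fΩ ∘ₗ f.fΩ, g.fT ∘ₗ f.fT,
    fun _ _ => by simp [f.map_smulΩ, g.map_smulΩ], fun _ => by simp [f.map_d, g.map_d],
    fun _ _ => by simp [f.map_smulT, g.map_smulT], fun _ _ => by simp [f.map_lie, g.map_lie],
    fun _ _ => by simp [f.map_lieA, g.map_lieA], fun _ _ => by simp [f.map_γ, g.map_γ],
    fun _ _ => by simp [f.map_form, g.map_form], fun _ _ => by simp [f.map_c2, g.map_c2]⟩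

end PrevertexAlgebra

namespace OneTruncatedVertexAlgebra

variable {W : OneTruncatedVertexAlgebra.{u}}

variable (W) in
/-- `[x, y] = (x_(0) y - y_(0) x) / 2`. -/
noncomputable def sbr : W.V₁ →ₗ[ℂ] W.V₁ →ₗ[ℂ] W.V₁ := (1 / 2 : ℂ) • (W.br - W.br.flip)

lemma sbr_eq (x y : W.V₁) : W.sbr x y = W.br x y - (1 / 2 : ℂ) • W.d (W.pair x y) := by
  simp only [sbr, LinearMap.smul_apply, LinearMap.sub_apply, LinearMap.flip_apply]
  rw [br_comm W y x, pair_comm W y x]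
  module

lemma mkQ_Om {x : W.V₁} (hx : x ∈ W.Om) : W.Om.mkQ x = 0 :=
  (Submodule.Quotient.mk_eq_zero _).mpr hx

lemma mkQ_sbr (x y : W.V₁) : W.Om.mkQ (W.sbr x y) = ⁅W.Om.mkQ x, W.Om.mkQ y⁆ := by
  rw [sbr_eq, map_sub, lie_mk, map_smul, mkQ_Om (d_mem _)]
  simp

lemma sbr_comm (x y : W.V₁) : W.sbr x y = - W.sbr y x := by
  simp [sbr, ← smul_neg]

lemma pair_d' (x : W.V₁) (a : W.V₀) : W.pair x (W.d a) = W.anchor x a := by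
  rw [pair_comm, pair_d]

lemma anchor_sbr (x y : W.V₁) (a : W.V₀) : W.anchor (W.sbr x y) a =
    W.anchor x (W.anchor y a) - W.anchor y (W.anchor x a) := by
  simp [sbr_eq, anchor_br, anchor_d]

lemma pair_sbr (x y z : W.V₁) : W.pair (W.sbr x y) z + W.pair y (W.sbr x z) =
    W.anchor x (W.pair y z) - (1 / 2 : ℂ) • W.anchor y (W.pair x z)
      - (1 / 2 : ℂ) • W.anchor z (W.pair x y) := by
  rw [anchor_pair]
  simp [sbr_eq, pair_d, pair_d']
  module

lemma sbr_jacobi (x y z : W.V₁) :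
    W.sbr (W.sbr x y) z + W.sbr (W.sbr y z) x + W.sbr (W.sbr z x) y =
      (1 / 6 : ℂ) • W.d (W.pair x (W.sbr y z) + W.pair y (W.sbr z x) + W.pair z (W.sbr x y)) := by
  have h1 := W.br_br x y z
  have h2 := W.br_comm (W.br x z) y
  have h4 := W.br_comm (W.br y z) x
  have h5 := congrArg W.d (W.anchor_pair x y z)
  have h6 := congrArg W.d (W.anchor_pair y x z)
  rw [W.br_comm y x] at h6
  rw [sbr_comm z x]
  simp only [sbr_eq, map_sub, map_add, map_smul, map_neg, LinearMap.sub_apply,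
    LinearMap.neg_apply, LinearMap.add_apply, LinearMap.smul_apply, pair_d', pair_d, br_d, d_br,
    W.pair_comm] at h1 h2 h4 h5 h6 ⊢
  linear_combination (norm := module) h4 - h2 - h1 + (1 / 3 : ℂ) • h5 - (1 / 3 : ℂ) • h6

set_option maxHeartbeats 4000000 in
lemma closed_aux (x₁ x₂ x₃ x₄ s₁₂ s₁₃ s₁₄ s₂₃ s₂₄ s₃₄ : W.V₁)
    (h₁₂ : s₁₂ - W.sbr x₁ x₂ ∈ W.Om) (h₁₃ : s₁₃ - W.sbr x₁ x₃ ∈ W.Om)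
    (h₁₄ : s₁₄ - W.sbr x₁ x₄ ∈ W.Om) (h₂₃ : s₂₃ - W.sbr x₂ x₃ ∈ W.Om)
    (h₂₄ : s₂₄ - W.sbr x₂ x₄ ∈ W.Om) (h₃₄ : s₃₄ - W.sbr x₃ x₄ ∈ W.Om)
    (C : W.V₁ → W.V₁ → W.V₁ → W.V₁ → W.V₁ → W.V₁ → W.V₀)
    (hC : ∀ x y z p q r : W.V₁, C x y z p q r =
      (-(1 / 2 : ℂ) • (W.pair x p + W.pair y q + W.pair z r)) +
      (1 / 3 : ℂ) • (W.pair x (W.sbr y z) + W.pair y (W.sbr z x) + W.pair z (W.sbr x y))) :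
    C s₁₂ x₃ x₄ s₃₄ 0 0 - C s₁₃ x₂ x₄ s₂₄ 0 0 + C s₁₄ x₂ x₃ s₂₃ 0 0
     + C s₂₃ x₁ x₄ s₁₄ 0 0 - C s₂₄ x₁ x₃ s₁₃ 0 0 + C s₃₄ x₁ x₂ s₁₂ 0 0
     - W.anchor x₁ (C x₂ x₃ x₄ s₃₄ (-s₂₄) s₂₃) + W.anchor x₂ (C x₁ x₃ x₄ s₃₄ (-s₁₄) s₁₃)
     - W.anchor x₃ (C x₁ x₂ x₄ s₂₄ (-s₁₄) s₁₂) + W.anchor x₄ (C x₁ x₂ x₃ s₂₃ (-s₁₃) s₁₂) = 0 := by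
  have o1 := pair_Om_Om h₁₂ h₃₄
  have o2 := pair_Om_Om h₁₃ h₂₄
  have o3 := pair_Om_Om h₁₄ h₂₃
  have an : ∀ {s x y : W.V₁}, s - W.sbr x y ∈ W.Om → ∀ a, W.anchor s a =
      W.anchor x (W.anchor y a) - W.anchor y (W.anchor x a) := by
    intro s x y h a
    have := anchor_Om h a
    rw [map_sub, LinearMap.sub_apply, sub_eq_zero] at this
    rw [this, anchor_sbr]
  have t1 := congrArg (W.anchor x₁) (pair_sbr x₂ x₃ x₄)
  have t2 := congrArg (W.anchor x₁) (pair_sbr x₃ x₂ x₄)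
  have t3 := congrArg (W.anchor x₂) (pair_sbr x₁ x₃ x₄)
  have t4 := congrArg (W.anchor x₂) (pair_sbr x₃ x₁ x₄)
  have t5 := congrArg (W.anchor x₃) (pair_sbr x₁ x₂ x₄)
  have t6 := congrArg (W.anchor x₃) (pair_sbr x₂ x₁ x₄)
  have j := congrArg (W.pair x₄) (sbr_jacobi x₁ x₂ x₃)
  have r1 := pair_sbr s₁₂ x₃ x₄
  have r2 := pair_sbr x₃ x₄ s₁₂
  have r3 := pair_sbr x₃ x₄ (W.sbr x₁ x₂)
  have r4 := pair_sbr s₁₃ x₂ x₄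
  have r5 := pair_sbr x₂ x₄ s₁₃
  have r6 := pair_sbr x₂ x₄ (W.sbr x₁ x₃)
  have r7 := pair_sbr s₁₄ x₂ x₃
  have r8 := pair_sbr x₂ x₃ s₁₄
  have r9 := pair_sbr s₂₃ x₁ x₄
  have r10 := pair_sbr x₁ x₄ s₂₃
  have r11 := pair_sbr x₁ x₄ (W.sbr x₂ x₃)
  have r12 := pair_sbr s₂₄ x₁ x₃
  have r13 := pair_sbr x₁ x₃ s₂₄
  have r14 := pair_sbr s₃₄ x₁ x₂
  have r15 := pair_sbr x₁ x₂ s₃₄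
  simp only [hC, map_sub, map_add, map_smul, map_neg, map_zero, LinearMap.sub_apply,
    LinearMap.neg_apply, LinearMap.add_apply, LinearMap.smul_apply,
    pair_d', an h₁₂, an h₁₃, an h₁₄, an h₂₃, an h₂₄, an h₃₄, anchor_sbr,
    sbr_comm x₂ x₁, sbr_comm x₃ x₁, sbr_comm x₄ x₁, sbr_comm x₃ x₂, sbr_comm x₄ x₂,
    sbr_comm x₄ x₃, sbr_comm s₁₂, sbr_comm s₁₃, sbr_comm s₁₄, sbr_comm s₂₃, sbr_comm s₂₄,
    sbr_comm s₃₄, sbr_comm (W.sbr _ _) x₁, sbr_comm (W.sbr _ _) x₂, sbr_comm (W.sbr _ _) x₃,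
    sbr_comm (W.sbr _ _) x₄, W.pair_comm] at o1 o2 o3 t1 t2 t3 t4 t5 t6 j r1 r2 r3 r4 r5 r6 r7 r8 r9 r10 r11 r12 r13 r14 r15 ⊢
  linear_combination (norm := module) (1 / 3 : ℂ) • t1 - (1 / 3 : ℂ) • t2 - (1 / 3 : ℂ) • t3
    + (1 / 3 : ℂ) • t4 + (1 / 3 : ℂ) • t5 - (1 / 3 : ℂ) • t6 + j
    - (1 / 3 : ℂ) • r1 - (2 / 3 : ℂ) • r2 + r3 - o1
    + (1 / 3 : ℂ) • r4 + (2 / 3 : ℂ) • r5 - r6 + o2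
    - (1 / 3 : ℂ) • r7 - (2 / 3 : ℂ) • r8 - o3
    - (1 / 3 : ℂ) • r9 - (2 / 3 : ℂ) • r10 + r11
    + (1 / 3 : ℂ) • r12 + (2 / 3 : ℂ) • r13 - (1 / 3 : ℂ) • r14 - (2 / 3 : ℂ) • r15

end OneTruncatedVertexAlgebra

namespace OneTruncatedVertexAlgebra

/-- A splitting of the projection `V₁ → 𝒯 = V₁ / Ω`. -/
structure Splitting (W : OneTruncatedVertexAlgebra.{u}) where
  s : W.T →ₗ[ℂ] W.V₁
  mkQ_s : ∀ t, W.Om.mkQ (s t) = t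

namespace Splitting

variable {W : OneTruncatedVertexAlgebra.{u}} (S : W.Splitting)

lemma anchor_s (t : W.T) (a : W.V₀) : W.anchor (S.s t) a = ⁅t, a⁆ := by
  conv_rhs => rw [← S.mkQ_s t]
  rfl

lemma sub_mem {x y : W.V₁} (h : W.Om.mkQ x = W.Om.mkQ y) : x - y ∈ W.Om :=
  (Submodule.Quotient.eq _).mp h

lemma γ_mem (a : W.V₀) (t : W.T) : S.s (a • t) - W.act a (S.s t) ∈ W.Om :=
  sub_mem (by rw [S.mkQ_s, ← smul_mk, S.mkQ_s])

/-- `γ(a, τ) = s(aτ) - a s(τ)`. -/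
def γ : W.V₀ →ₗ[ℂ] W.T →ₗ[ℂ] W.Om :=
  LinearMap.mk₂ ℂ (fun a t => ⟨S.s (a • t) - W.act a (S.s t), S.γ_mem a t⟩)
    (fun a b t => Subtype.ext (by
      simp [add_smul]
      abel))
    (fun c a t => Subtype.ext (by simp [smul_sub]))
    (fun a s t => Subtype.ext (by
      simp [smul_add]
      abel))
    (fun c a t => Subtype.ext (by simp [smul_sub, smul_comm a c t]))

lemma coe_γ (a : W.V₀) (t : W.T) : (S.γ a t : W.V₁) = S.s (a • t) - W.act a (S.s t) := rfl

/-- `⟨τ₁, τ₂⟩ = ⟨s(τ₁), s(τ₂)⟩`. -/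
def form : W.T →ₗ[ℂ] W.T →ₗ[ℂ] W.V₀ := W.pair.compl₁₂ S.s S.s

lemma form_eq (t r : W.T) : S.form t r = W.pair (S.s t) (S.s r) := rfl

lemma c2_mem (t r : W.T) : S.s ⁅t, r⁆ - W.sbr (S.s t) (S.s r) ∈ W.Om :=
  sub_mem (by rw [S.mkQ_s, mkQ_sbr, S.mkQ_s, S.mkQ_s])

/-- `c²(τ₁, τ₂) = s([τ₁, τ₂]) - [s(τ₁), s(τ₂)]`. -/
noncomputable def c2 : W.T →ₗ[ℂ] W.T →ₗ[ℂ] W.Om :=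
  LinearMap.mk₂ ℂ (fun t r => ⟨S.s ⁅t, r⁆ - W.sbr (S.s t) (S.s r), S.c2_mem t r⟩)
    (fun a b t => Subtype.ext (by
      simp [add_lie]
      abel))
    (fun c a t => Subtype.ext (by simp [smul_sub]))
    (fun a s t => Subtype.ext (by
      simp [lie_add]
      abel))
    (fun c a t => Subtype.ext (by simp [smul_sub]))

lemma coe_c2 (t r : W.T) : (S.c2 t r : W.V₁) = S.s ⁅t, r⁆ - W.sbr (S.s t) (S.s r) := rfl

/-- The action of `𝒯` on `Ω`, `τ(ω) = s(τ)_(0) ω`. -/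
def lieOm : W.T →ₗ[ℂ] W.Om →ₗ[ℂ] W.Om :=
  LinearMap.mk₂ ℂ (fun t w => ⟨W.br (S.s t) w, br_mem _ w.2⟩)
    (fun a b t => Subtype.ext (by simp)) (fun c a t => Subtype.ext (by simp))
    (fun a s t => Subtype.ext (by simp)) (fun c a t => Subtype.ext (by simp))

lemma coe_lieOm (t : W.T) (w : W.Om) : (S.lieOm t w : W.V₁) = W.br (S.s t) w := rfl

lemma pair_congr {x y : W.V₁} (h : x - y ∈ W.Om) {w : W.V₁} (hw : w ∈ W.Om) :
    W.pair x w = W.pair y w := by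
  rw [← sub_eq_zero, ← LinearMap.sub_apply, ← map_sub]
  exact pair_Om_Om h hw

lemma pair_act_Om (a : W.V₀) (x : W.V₁) {w : W.V₁} (hw : w ∈ W.Om) :
    W.pair x (W.act a w) = a * W.pair x w := by
  rw [pair_comm, pair_act, anchor_Om hw, sub_zero, pair_comm, mul_eq]

lemma pair_act_Om' (a : W.V₀) (x : W.V₁) {w : W.V₁} (hw : w ∈ W.Om) :
    W.pair (W.act a x) w = a * W.pair x w := by
  rw [pair_act, anchor_Om hw, map_zero, sub_zero, mul_eq]

/-- The pairing `⟨τ, ω⟩ = ⟨s(τ), ω⟩`. -/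
def pairing : W.T →ₗ[W.V₀] W.Om →ₗ[W.V₀] W.V₀ :=
  LinearMap.mk₂ W.V₀ (fun t w => W.pair (S.s t) w)
    (fun a b t => by simp)
    (fun c t w => by
      rw [smul_eq_mul, ← pair_act_Om' _ _ w.2]
      exact pair_congr (S.γ_mem c t) w.2)
    (fun a s t => by simp)
    (fun c t w => pair_act_Om c _ w.2)

lemma pairing_eq (t : W.T) (w : W.Om) : S.pairing t w = W.pair (S.s t) w := rfl

/-- The data of the prevertex algebra of a split one-truncated vertex algebra. -/
noncomputable def prevertexData : PrevertexData.{u} where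
  A := W.V₀
  Ω := W.Om
  T := W.T
  d := dOm
  span_d := span_dOm
  lieΩ := S.lieOm
  lieΩ_smul_d t a b := Subtype.ext (by
    simp [coe_lieOm, coe_smul, coe_dOm, br_act, br_d, anchor_s])
  pairing := S.pairing
  pairing_smul_d t a b := by
    rw [pairing_eq, coe_smul, pair_act_Om _ _ (dOm b).2, coe_dOm, pair_d', anchor_s]
  γ := S.γ
  form := S.form
  c2 := S.c2

lemma γ_mul (a b : W.V₀) (t : W.T) :
    S.γ (a * b) t = S.γ a (b • t) + a • S.γ b t + ⁅t, a⁆ • dOm b + ⁅t, b⁆ • dOm a := by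
  apply Subtype.ext
  simp only [coe_γ, coe_smul, coe_dOm, Submodule.coe_add, ← anchor_s S, mul_smul]
  rw [← mul_eq, act_act, map_sub]
  abel

lemma form_smul (a : W.V₀) (t r : W.T) :
    S.form (a • t) r = a * S.form t r + S.pairing r (S.γ a t) - ⁅t, ⁅r, a⁆⁆ := by
  simp only [form_eq, pairing_eq, ← anchor_s S, coe_γ, map_sub]
  rw [pair_comm W (S.s r) (W.act _ _), pair_act, pair_comm W (S.s r), mul_eq]
  abel

lemma c2_self (t : W.T) : S.c2 t t = 0 := by
  apply Subtype.ext
  simp [coe_c2, sbr]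

lemma form_lie (t₁ t₂ t₃ : W.T) :
    S.form ⁅t₁, t₂⁆ t₃ + S.form t₂ ⁅t₁, t₃⁆ =
      ⁅t₁, S.form t₂ t₃⁆ - (1 / 2 : ℂ) • ⁅t₂, S.form t₁ t₃⁆ - (1 / 2 : ℂ) • ⁅t₃, S.form t₁ t₂⁆
        + S.pairing t₂ (S.c2 t₁ t₃) + S.pairing t₃ (S.c2 t₁ t₂) := by
  simp only [form_eq, pairing_eq, ← anchor_s S, coe_c2, map_sub]
  rw [← pair_sbr, pair_comm W (S.s t₃), pair_comm W (S.s t₃)]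
  abel

lemma br_congr {x y : W.V₁} (h : x - y ∈ W.Om) {w : W.V₁} (hw : w ∈ W.Om) :
    W.br x w = W.br y w := by
  rw [← sub_eq_zero, ← LinearMap.sub_apply, ← map_sub]
  exact br_Om_Om h hw

lemma c2_smul (a : W.V₀) (t r : W.T) :
    S.c2 (a • t) r = a • S.c2 t r + S.γ a ⁅t, r⁆ - S.γ ⁅r, a⁆ t + S.lieOm r (S.γ a t)
      - (1 / 2 : ℂ) • (S.form t r • dOm a) + (1 / 2 : ℂ) • dOm ⁅t, ⁅r, a⁆⁆
      - (1 / 2 : ℂ) • dOm (S.pairing r (S.γ a t)) := by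
  have hl : ⁅a • t, r⁆ = a • ⁅t, r⁆ - ⁅r, a⁆ • t := by
    rw [← lie_skew, LieRinehartRing.leibniz_smul_right, ← lie_skew r t, smul_neg]
    abel
  apply Subtype.ext
  simp only [coe_c2, coe_γ, coe_smul, coe_dOm, coe_lieOm, Submodule.coe_add, Submodule.coe_sub,
    SetLike.val_smul, hl, form_eq, pairing_eq, ← anchor_s S, map_sub]
  have h1 := W.act_br a (S.s t) (S.s r)
  have h2 := W.br_comm (S.s (a • t)) (S.s r)
  have h3 := W.br_comm (W.act a (S.s t)) (S.s r)
  have h4 := congrArg W.d (W.pair_act a (S.s t) (S.s r))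
  have h5 := W.d_mul a (W.pair (S.s t) (S.s r))
  rw [W.pair_comm (S.s r) (S.s (a • t)), W.pair_comm (S.s r) (W.act a (S.s t))]
  simp only [sbr_eq, map_sub, LinearMap.sub_apply, map_smul] at *
  linear_combination (norm := module) h3 - h2 - h1 + (1 / 2 : ℂ) • h4 + (1 / 2 : ℂ) • h5

lemma c3_eq (t₁ t₂ t₃ : W.T) : S.prevertexData.c3 t₁ t₂ t₃ =
    (-(1 / 2 : ℂ) • (W.pair (S.s t₁) (S.s ⁅t₂, t₃⁆) + W.pair (S.s t₂) (S.s ⁅t₃, t₁⁆) +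
        W.pair (S.s t₃) (S.s ⁅t₁, t₂⁆))) +
      (1 / 3 : ℂ) • (W.pair (S.s t₁) (W.sbr (S.s t₂) (S.s t₃)) +
        W.pair (S.s t₂) (W.sbr (S.s t₃) (S.s t₁)) + W.pair (S.s t₃) (W.sbr (S.s t₁) (S.s t₂))) := by
  have h : ∀ r₁ r₂ r₃ : W.T, S.prevertexData.formBr r₁ r₂ r₃ =
      W.pair (S.s r₁) (W.sbr (S.s r₂) (S.s r₃)) := by
    intro r₁ r₂ r₃
    change W.pair (S.s r₁) (S.s ⁅r₂, r₃⁆) -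
      W.pair (S.s r₁) (S.s ⁅r₂, r₃⁆ - W.sbr (S.s r₂) (S.s r₃)) = _
    rw [map_sub]
    abel
  simp only [PrevertexData.c3, PrevertexData.I, h]
  rw [neg_smul]
  rfl

lemma s_swap (t r : W.T) : S.s ⁅t, r⁆ = -S.s ⁅r, t⁆ := by
  rw [← lie_skew, map_neg]

lemma s_lie_lie (t₁ t₂ t₃ : W.T) :
    S.s ⁅⁅t₁, t₂⁆, t₃⁆ - S.s ⁅⁅t₁, t₃⁆, t₂⁆ + S.s ⁅⁅t₂, t₃⁆, t₁⁆ = 0 := by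
  have h := lie_jacobi t₁ t₂ t₃
  rw [← lie_skew t₃ t₁, lie_neg] at h
  rw [← map_sub, ← map_add, ← lie_skew ⁅t₁, t₂⁆ t₃, ← lie_skew ⁅t₁, t₃⁆ t₂,
    ← lie_skew ⁅t₂, t₃⁆ t₁, ← map_zero S.s,
    ← neg_zero (G := W.T), ← h]
  congr 1
  abel

lemma dLie_c2 (t₁ t₂ t₃ : W.T) :
    S.prevertexData.dLieC2 t₁ t₂ t₃ = dOm (S.prevertexData.c3 t₁ t₂ t₃) := by
  rw [c3_eq]
  apply Subtype.ext
  change ((S.c2 ⁅t₁, t₂⁆ t₃ - S.c2 ⁅t₁, t₃⁆ t₂ + S.c2 ⁅t₂, t₃⁆ t₁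
    - S.lieOm t₁ (S.c2 t₂ t₃) + S.lieOm t₂ (S.c2 t₁ t₃) - S.lieOm t₃ (S.c2 t₁ t₂) : W.Om) : W.V₁)
    = W.d _
  simp only [Submodule.coe_add, Submodule.coe_sub, coe_c2, coe_lieOm]
  have h0 := S.s_lie_lie t₁ t₂ t₃
  have h1 := W.br_comm (S.s ⁅t₁, t₂⁆) (S.s t₃)
  have h2 := W.br_comm (S.s ⁅t₁, t₃⁆) (S.s t₂)
  have h3 := W.br_comm (S.s ⁅t₂, t₃⁆) (S.s t₁)
  have e1 := W.sbr_eq (S.s ⁅t₁, t₂⁆) (S.s t₃)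
  have e2 := W.sbr_eq (S.s ⁅t₁, t₃⁆) (S.s t₂)
  have e3 := W.sbr_eq (S.s ⁅t₂, t₃⁆) (S.s t₁)
  have f1 := W.sbr_eq (S.s t₁) (W.sbr (S.s t₂) (S.s t₃))
  have f2 := W.sbr_eq (S.s t₂) (W.sbr (S.s t₁) (S.s t₃))
  have f3 := W.sbr_eq (S.s t₃) (W.sbr (S.s t₁) (S.s t₂))
  have j := W.sbr_jacobi (S.s t₁) (S.s t₂) (S.s t₃)
  simp only [sbr_comm (W.sbr _ _) (S.s _), sbr_comm (S.s t₃) (S.s t₁), S.s_swap t₃ t₁, map_sub,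
    map_add, map_neg, map_smul, LinearMap.neg_apply, W.pair_comm (S.s t₁) (S.s _), W.pair_comm (S.s t₂) (S.s ⁅_, _⁆),
    W.pair_comm (S.s t₃) (S.s ⁅_, _⁆)] at *
  linear_combination (norm := module) h0 - h1 + h2 - h3 - e1 + e2 - e3 - f1 + f2 - f3 - j

lemma dLie_c3 (t₁ t₂ t₃ t₄ : W.T) : S.prevertexData.dLieC3 t₁ t₂ t₃ t₄ = 0 := by
  have h := closed_aux (S.s t₁) (S.s t₂) (S.s t₃) (S.s t₄) _ _ _ _ _ _ (S.c2_mem t₁ t₂)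
    (S.c2_mem t₁ t₃) (S.c2_mem t₁ t₄) (S.c2_mem t₂ t₃) (S.c2_mem t₂ t₄) (S.c2_mem t₃ t₄)
    (fun x y z p q r => (-(1 / 2 : ℂ) • (W.pair x p + W.pair y q + W.pair z r)) +
      (1 / 3 : ℂ) • (W.pair x (W.sbr y z) + W.pair y (W.sbr z x) + W.pair z (W.sbr x y)))
    (fun _ _ _ _ _ _ => rfl)
  have j1 := congrArg (W.pair (S.s t₁)) (S.s_lie_lie t₂ t₃ t₄)
  have j2 := congrArg (W.pair (S.s t₂)) (S.s_lie_lie t₁ t₃ t₄)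
  have j3 := congrArg (W.pair (S.s t₃)) (S.s_lie_lie t₁ t₂ t₄)
  have j4 := congrArg (W.pair (S.s t₄)) (S.s_lie_lie t₁ t₂ t₃)
  obtain ⟨c, hc⟩ : ∃ c : W.T → W.T → W.T → W.V₀, c = S.prevertexData.c3 := ⟨_, rfl⟩
  have hd : S.prevertexData.dLieC3 t₁ t₂ t₃ t₄ =
      c ⁅t₁, t₂⁆ t₃ t₄ - c ⁅t₁, t₃⁆ t₂ t₄ + c ⁅t₁, t₄⁆ t₂ t₃
        + c ⁅t₂, t₃⁆ t₁ t₄ - c ⁅t₂, t₄⁆ t₁ t₃ + c ⁅t₃, t₄⁆ t₁ t₂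
        - W.anchor (S.s t₁) (c t₂ t₃ t₄) + W.anchor (S.s t₂) (c t₁ t₃ t₄)
        - W.anchor (S.s t₃) (c t₁ t₂ t₄) + W.anchor (S.s t₄) (c t₁ t₂ t₃) := by
    simp only [anchor_s]
    rw [hc]
    rfl
  have hc' : ∀ t₁ t₂ t₃, c t₁ t₂ t₃ = _ := fun t₁ t₂ t₃ => by
    rw [hc]
    exact S.c3_eq t₁ t₂ t₃
  refine hd.trans (?_ : @Eq W.V₀ _ 0)
  simp only [hc', S.s_swap t₃ t₁, S.s_swap t₄ t₁, S.s_swap t₄ t₂, map_zero,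
    S.s_swap t₁ ⁅_, _⁆, S.s_swap t₂ ⁅_, _⁆, S.s_swap t₃ ⁅_, _⁆, S.s_swap t₄ ⁅_, _⁆,
    map_add, map_sub, map_neg, map_smul] at *
  linear_combination (norm := module) h + (1 / 2 : ℂ) • j1 - (1 / 2 : ℂ) • j2 + (1 / 2 : ℂ) • j3
    - (1 / 2 : ℂ) • j4

/-- The prevertex algebra of a split one-truncated vertex algebra. -/
noncomputable def prevertex : PrevertexAlgebra.{u} where
  toPrevertexData := S.prevertexData
  γ_mul := S.γ_mul
  form_symm _ _ := W.pair_comm _ _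
  form_smul := S.form_smul
  c2_self := S.c2_self
  form_lie := S.form_lie
  c2_smul := S.c2_smul
  dLie_c2 := S.dLie_c2
  dLie_c3 := S.dLie_c3

end Splitting

end OneTruncatedVertexAlgebra

/-- The operations of a one-truncated vertex algebra in terms of the independent ones among them:
the product of `V₀ = A`, and, for `a, b ∈ V₀`, `x, y ∈ V₁ = M`, `act a x = a_(-1) x`,
`anchor x a = x_(0) a`, `d a = a_(-2) |0⟩`, `br x y = x_(0) y`, `pair x y = x_(1) y`. -/
structure TruncOps (A M : Type u) [CommRing A] [Algebra ℂ A] [AddCommGroup M] [Module ℂ M] where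
  act : A →ₗ[ℂ] M →ₗ[ℂ] M
  anchor : M →ₗ[ℂ] A →ₗ[ℂ] A
  d : A →ₗ[ℂ] M
  br : M →ₗ[ℂ] M →ₗ[ℂ] M
  pair : M →ₗ[ℂ] M →ₗ[ℂ] A
  one_act : ∀ x, act 1 x = x
  act_act : ∀ a b x,
    act a (act b x) = act (a * b) x + act (anchor x b) (d a) + act (anchor x a) (d b)
  d_mul : ∀ a b, d (a * b) = act a (d b) + act b (d a)
  anchor_mul : ∀ x a b, anchor x (a * b) = anchor x a * b + a * anchor x b
  anchor_act : ∀ a x b, anchor (act a x) b = a * anchor x b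
  anchor_d : ∀ a b, anchor (d a) b = 0
  pair_comm : ∀ x y, pair x y = pair y x
  pair_d : ∀ x a, pair x (d a) = anchor x a
  pair_act : ∀ a x y, pair (act a x) y = a * pair x y - anchor x (anchor y a)
  br_comm : ∀ x y, br x y = - br y x + d (pair x y)
  br_d : ∀ x a, br x (d a) = d (anchor x a)
  br_act : ∀ x a y, br x (act a y) = act (anchor x a) y + act a (br x y)
  anchor_br : ∀ x y a, anchor (br x y) a = anchor x (anchor y a) - anchor y (anchor x a)
  anchor_pair : ∀ x y z, anchor x (pair y z) = pair (br x y) z + pair y (br x z)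
  br_br : ∀ x y z, br x (br y z) = br (br x y) z + br y (br x z)

namespace TruncOps

variable {A M : Type u} [CommRing A] [Algebra ℂ A] [AddCommGroup M] [Module ℂ M]
  (D : TruncOps A M)

lemma d_br (a : A) (x : M) : D.br (D.d a) x = 0 := by
  rw [D.br_comm, D.br_d, D.pair_comm, D.pair_d]
  simp

lemma pair_act' (a : A) (x y : M) :
    D.pair x (D.act a y) = a * D.pair x y - D.anchor y (D.anchor x a) := by
  rw [D.pair_comm, D.pair_act, D.pair_comm]

lemma act_br (a : A) (x y : M) : D.br (D.act a x) y = D.act a (D.br x y) - D.act (D.anchor y a) x +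
    D.act (D.pair x y) (D.d a) - D.d (D.anchor x (D.anchor y a)) := by
  rw [D.br_comm, D.br_act, D.pair_act, D.br_comm y x, D.pair_comm y x]
  simp [D.d_mul]
  abel

lemma d_one : D.d 1 = 0 := by
  have := D.d_mul 1 1
  simpa [D.one_act] using this

lemma anchor_one (x : M) : D.anchor x 1 = 0 := by
  have := D.anchor_mul x 1 1
  simpa using this

/-- `x_(n) y` for `x, y ∈ V₀ ⊕ V₁`. The dependent operations are `a_(0) x = - x_(0) a`,
`a_(-2) b = b ∂a` and `x_(-1) a = a x + ∂(x_(0) a)`. -/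
def mode (n : ℤ) : (A × M) →ₗ[ℂ] (A × M) →ₗ[ℂ] (A × M) :=
  LinearMap.mk₂ ℂ (fun x y =>
    ((if n = -1 then x.1 * y.1 else 0) +
      (if n = 0 then D.anchor x.2 y.1 - D.anchor y.2 x.1 else 0) +
      (if n = 1 then D.pair x.2 y.2 else 0),
     (if n = -2 then D.act y.1 (D.d x.1) else 0) +
      (if n = -1 then D.act x.1 y.2 + (D.act y.1 x.2 + D.d (D.anchor x.2 y.1)) else 0) +
      (if n = 0 then D.br x.2 y.2 else 0)))
    (fun x x' y => by
      simp only [Prod.fst_add, Prod.snd_add, add_mul, LinearMap.map_add, LinearMap.add_apply,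
        Prod.mk_add_mk]
      refine Prod.ext ?_ ?_ <;> dsimp only <;> split_ifs <;> abel)
    (fun c x y => by
      simp only [Prod.smul_fst, Prod.smul_snd, smul_mul_assoc, LinearMap.map_smul,
        LinearMap.smul_apply, Prod.smul_mk, smul_add, smul_sub, smul_ite, smul_zero])
    (fun x y y' => by
      simp only [Prod.fst_add, Prod.snd_add, mul_add, LinearMap.map_add, LinearMap.add_apply,
        Prod.mk_add_mk]
      refine Prod.ext ?_ ?_ <;> dsimp only <;> split_ifs <;> abel)
    (fun c x y => by
      simp only [Prod.smul_fst, Prod.smul_snd, mul_smul_comm, LinearMap.map_smul,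
        LinearMap.smul_apply, Prod.smul_mk, smul_add, smul_sub, smul_ite, smul_zero])

lemma mode_mk (n : ℤ) (u w : A) (v z : M) : D.mode n (u, v) (w, z) =
    ((if n = -1 then u * w else 0) + (if n = 0 then D.anchor v w - D.anchor z u else 0) +
      (if n = 1 then D.pair v z else 0),
     (if n = -2 then D.act w (D.d u) else 0) +
      (if n = -1 then D.act u z + (D.act w v + D.d (D.anchor v w)) else 0) +
      (if n = 0 then D.br v z else 0)) := rfl

lemma mode₀₀ (n : ℤ) (a b : A) : D.mode n (a, 0) (b, 0) =
    (if n = -1 then a * b else 0, if n = -2 then D.act b (D.d a) else 0) := by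
  simp [mode_mk]

lemma mode₀₁ (n : ℤ) (a : A) (y : M) : D.mode n (a, 0) (0, y) =
    (if n = 0 then - D.anchor y a else 0, if n = -1 then D.act a y else 0) := by
  simp [mode_mk]

lemma mode₁₀ (n : ℤ) (x : M) (b : A) : D.mode n (0, x) (b, 0) =
    (if n = 0 then D.anchor x b else 0,
      if n = -1 then D.act b x + D.d (D.anchor x b) else 0) := by
  simp [mode_mk]

lemma mode₁₁ (n : ℤ) (x y : M) : D.mode n (0, x) (0, y) =
    (if n = 1 then D.pair x y else 0, if n = 0 then D.br x y else 0) := by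
  simp [mode_mk]

lemma cases_mem {i : ℤ} {x : A × M} (hx : x ∈ truncWt A M i) :
    x = 0 ∨ (i = 0 ∧ ∃ a, x = (a, 0)) ∨ (i = 1 ∧ ∃ a, x = (0, a)) := by
  obtain ⟨a, y⟩ := x
  obtain ⟨h0, h1⟩ := hx
  by_cases hi0 : i = 0
  · exact Or.inr (Or.inl ⟨hi0, a, by rw [show y = 0 from h1 (by omega)]⟩)
  by_cases hi1 : i = 1
  · exact Or.inr (Or.inr ⟨hi1, y, by rw [show a = 0 from h0 (by omega)]⟩)
  exact Or.inl (by rw [show a = 0 from h0 hi0, show y = 0 from h1 hi1]; rfl)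

lemma mode_mem (n i j : ℤ) (x y : A × M) (hx : x ∈ truncWt A M i) (hy : y ∈ truncWt A M j) :
    D.mode n x y ∈ truncWt A M (i + j - n - 1) := by
  rcases cases_mem hx with rfl | ⟨rfl, a, rfl⟩ | ⟨rfl, a, rfl⟩
  · simp
  all_goals
    rcases cases_mem hy with rfl | ⟨rfl, b, rfl⟩ | ⟨rfl, b, rfl⟩
    · simp
  all_goals
    refine ⟨fun h => ?_, fun h => ?_⟩ <;>
      simp only [mode₀₀, mode₀₁, mode₁₀, mode₁₁] <;> rw [if_neg (by omega)]

end TruncOps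

namespace TruncOps
variable {A M : Type u} [CommRing A] [Algebra ℂ A] [AddCommGroup M] [Module ℂ M]
  (D : TruncOps A M)

/-- The Borcherds identity with its sums written out. -/
def Bor (m n k : ℤ) (a b c : A × M) : Prop :=
  D.mode (m + k) (D.mode n a b) c + (m : ℂ) • D.mode (m + k - 1) (D.mode (n + 1) a b) c =
      D.mode (n + m) a (D.mode k b c) - (n : ℂ) • D.mode (n + m - 1) a (D.mode (k + 1) b c) -
      ((-1 : ℂ) ^ n • D.mode (n + k) b (D.mode m a c) -
        ((-1 : ℂ) ^ n * n) • D.mode (n + k - 1) b (D.mode (m + 1) a c))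


lemma pair_d' (a : A) (x : M) : D.pair (D.d a) x = D.anchor x a := by
  rw [D.pair_comm, D.pair_d]

lemma mode_eq_zero (n i j : ℤ) {x y : A × M} (hx : x ∈ truncWt A M i) (hy : y ∈ truncWt A M j)
    (h0 : i + j - n - 1 ≠ 0) (h1 : i + j - n - 1 ≠ 1) : D.mode n x y = 0 := by
  obtain ⟨h2, h3⟩ := D.mode_mem n i j x y hx hy
  exact Prod.ext (h2 h0) (h3 h1)

set_option maxHeartbeats 4000000 in
lemma bor_aux (m k : ℤ) (a b c : A) (x y z : M) :
    (-2 ≤ k → -2 ≤ m → -1 ≤ m + k → m + k ≤ 0 → D.Bor m (-2) k (a, 0) (b, 0) (c, 0)) ∧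
    (-2 ≤ k → -1 ≤ m → -1 ≤ m + k → m + k ≤ 0 → D.Bor m (-1) k (0, x) (b, 0) (c, 0)) ∧
    (-1 ≤ k → -2 ≤ m → -1 ≤ m + k → m + k ≤ 0 → D.Bor m (-1) k (a, 0) (0, y) (c, 0)) ∧
    (-1 ≤ k → -1 ≤ m → 0 ≤ m + k → m + k ≤ 1 → D.Bor m (-2) k (a, 0) (b, 0) (0, z)) ∧
    (-1 ≤ k → -1 ≤ m → -1 ≤ m + k → m + k ≤ 0 → D.Bor m 0 k (0, x) (0, y) (c, 0)) ∧
    (-1 ≤ k → 0 ≤ m → 0 ≤ m + k → m + k ≤ 1 → D.Bor m (-1) k (0, x) (b, 0) (0, z)) ∧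
    (0 ≤ k → -1 ≤ m → 0 ≤ m + k → m + k ≤ 1 → D.Bor m (-1) k (a, 0) (0, y) (0, z)) := by
  have hz1 : (-1 : ℂ) ^ (-1 : ℤ) = -1 := by norm_num
  have hz2 : (-1 : ℂ) ^ (-2 : ℤ) = 1 := by norm_num
  refine ⟨?_, ?_, ?_, ?_, ?_, ?_, ?_⟩ <;> intro h2 h3 h4 h5 <;>
    have hk : k ≤ 2 := (by omega) <;> have hm : m ≤ 2 := (by omega) <;> interval_cases k
  all_goals interval_cases m <;> (first | (exfalso; omega) | skip)
  all_goals
    simp only [Bor, mode₀₀, mode₀₁, mode₁₀, mode₁₁, Int.reduceAdd, Int.reduceSub, Int.reduceNeg,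
      Int.reduceEq, if_true, if_false]
    try simp only [mode_mk, Int.reduceAdd, Int.reduceSub, Int.reduceNeg,
      Int.reduceEq, if_true, if_false, add_zero, zero_add, LinearMap.map_zero,
      LinearMap.zero_apply, mul_zero, zero_mul]
  all_goals
    refine Prod.ext ?_ ?_ <;>
    simp only [Prod.fst_add, Prod.snd_add, Prod.fst_sub, Prod.snd_sub, Prod.smul_fst,
      Prod.smul_snd, Prod.fst_zero, Prod.snd_zero, LinearMap.map_add, LinearMap.map_sub, LinearMap.map_neg,
      LinearMap.add_apply, LinearMap.sub_apply, LinearMap.neg_apply, LinearMap.map_zero,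
      LinearMap.zero_apply, mul_add, mul_sub, mul_neg, add_mul, sub_mul, neg_mul, mul_zero, zero_mul, D.d_mul, D.anchor_mul, D.anchor_act, D.anchor_d, D.pair_d, D.act_act,
      D.pair_d', D.pair_act, D.pair_act', D.br_act, D.act_br, D.br_d, D.d_br, D.anchor_br, D.br_comm y x, D.br_comm z y,
      D.br_comm z x, D.pair_comm y x, D.pair_comm z y, D.pair_comm z x,
      mul_comm, mul_left_comm, mul_assoc, Int.cast_neg, Int.cast_ofNat, Int.cast_one, Int.cast_zero, hz2, hz1, zpow_zero]
  all_goals module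


lemma bor_step {m n k p q r : ℤ} {a b c : A × M} (ha : a ∈ truncWt A M p)
    (hb : b ∈ truncWt A M q) (hc : c ∈ truncWt A M r) (h1 : p + q - n - 1 ≤ 1)
    (h2 : q + r - k - 1 ≤ 1) (h3 : p + r - m - 1 ≤ 1) (e1 : D.Bor (m + 1) n k a b c)
    (e2 : D.Bor m n (k + 1) a b c) : D.Bor m (n + 1) k a b c := by
  have z1 : D.mode (n + 1 + 1) a b = 0 := D.mode_eq_zero _ _ _ ha hb (by omega) (by omega)
  have z2 : D.mode (k + 1 + 1) b c = 0 := D.mode_eq_zero _ _ _ hb hc (by omega) (by omega)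
  have z3 : D.mode (m + 1 + 1) a c = 0 := D.mode_eq_zero _ _ _ ha hc (by omega) (by omega)
  have h4 : (-1 : ℂ) ^ (n + 1) = - (-1 : ℂ) ^ n := by
    rw [zpow_add₀ (by norm_num)]
    simp
  rw [Bor] at e1 e2 ⊢
  rw [z1, h4, show n + 1 + m = n + m + 1 by ring, show n + 1 + k = n + k + 1 by ring,
    show n + m + 1 - 1 = n + m by ring, show n + k + 1 - 1 = n + k by ring]
  rw [z3, show m + 1 + k = m + k + 1 by ring, show m + k + 1 - 1 = m + k by ring,
    show n + (m + 1) = n + m + 1 by ring, show n + m + 1 - 1 = n + m by ring] at e1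
  rw [z2, show m + (k + 1) = m + k + 1 by ring, show m + k + 1 - 1 = m + k by ring,
    show n + (k + 1) = n + k + 1 by ring, show n + k + 1 - 1 = n + k by ring] at e2
  push_cast at e1 e2 ⊢
  simp only [map_zero, LinearMap.zero_apply, smul_zero, sub_zero, add_zero] at e1 e2 ⊢
  linear_combination (norm := module) e1 - e2

lemma bor_of_base {p q r : ℤ} {a b c : A × M} (ha : a ∈ truncWt A M p)
    (hb : b ∈ truncWt A M q) (hc : c ∈ truncWt A M r)
    (h : ∀ m k, q + r - 2 ≤ k → p + r - 2 ≤ m → p + q + r - 3 ≤ m + (p + q - 2) + k →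
      m + (p + q - 2) + k ≤ p + q + r - 2 → D.Bor m (p + q - 2) k a b c) (j : ℕ) :
    ∀ m k, q + r - 2 ≤ k → p + r - 2 ≤ m → p + q + r - 3 ≤ m + (p + q - 2 + j) + k →
      m + (p + q - 2 + j) + k ≤ p + q + r - 2 → D.Bor m (p + q - 2 + j) k a b c := by
  induction j with
  | zero => simpa using h
  | succ j ih =>
    intro m k h1 h2 h3 h4
    push_cast at h3 h4 ⊢
    rw [← add_assoc]
    exact D.bor_step ha hb hc (by omega) (by omega) (by omega)
      (ih _ _ (by omega) (by omega) (by omega) (by omega))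
      (ih _ _ (by omega) (by omega) (by omega) (by omega))

lemma bor_aux' (m n k : ℤ) (x y z : M) (h1 : 0 ≤ n) (h2 : 0 ≤ k) (h3 : 0 ≤ m)
    (h5 : m + n + k ≤ 1) : D.Bor m n k (0, x) (0, y) (0, z) := by
  have e1 := D.anchor_pair x y z
  have e2 := D.anchor_pair y x z
  rw [D.br_comm y x, D.pair_comm y x, map_add, LinearMap.add_apply, pair_d', map_neg, LinearMap.neg_apply] at e2
  have e3 := D.br_br x y z
  have hn : n ≤ 1 := (by omega)
  have hk : k ≤ 1 := (by omega)
  have hm : m ≤ 1 := (by omega)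
  interval_cases n <;> interval_cases k <;> interval_cases m <;> (first | (exfalso; omega) | skip)
  all_goals simp [Bor, mode]
  · rw [e3, add_sub_cancel_right]
  · rw [e2]
    abel
  · rw [e1, add_sub_cancel_right]
  · rw [e1, e2]
    abel

lemma bor_of_weight (m n k p q r : ℤ) {a b c : A × M} (ha : a ∈ truncWt A M p)
    (hb : b ∈ truncWt A M q) (hc : c ∈ truncWt A M r)
    (h : m + n + k < p + q + r - 3 ∨ p + q + r - 2 < m + n + k) : D.Bor m n k a b c := by
  rw [Bor, D.mode_eq_zero _ _ _ (D.mode_mem n _ _ _ _ ha hb) hc (by omega) (by omega),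
    D.mode_eq_zero _ _ _ (D.mode_mem (n + 1) _ _ _ _ ha hb) hc (by omega) (by omega),
    D.mode_eq_zero _ _ _ ha (D.mode_mem k _ _ _ _ hb hc) (by omega) (by omega),
    D.mode_eq_zero _ _ _ ha (D.mode_mem (k + 1) _ _ _ _ hb hc) (by omega) (by omega),
    D.mode_eq_zero _ _ _ hb (D.mode_mem m _ _ _ _ ha hc) (by omega) (by omega),
    D.mode_eq_zero _ _ _ hb (D.mode_mem (m + 1) _ _ _ _ ha hc) (by omega) (by omega)]
  simp

lemma bor (m n k p q r : ℤ) {a b c : A × M} (ha : a ∈ truncWt A M p)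
    (hb : b ∈ truncWt A M q) (hc : c ∈ truncWt A M r) (h1 : p + q - n - 1 ≤ 1)
    (h2 : q + r - k - 1 ≤ 1) (h3 : p + r - m - 1 ≤ 1) : D.Bor m n k a b c := by
  by_cases h : m + n + k < p + q + r - 3 ∨ p + q + r - 2 < m + n + k
  · exact D.bor_of_weight m n k p q r ha hb hc h
  obtain ⟨j, hj⟩ := Int.eq_ofNat_of_zero_le (show 0 ≤ n - (p + q - 2) by omega)
  obtain rfl : n = p + q - 2 + j := by omega
  refine D.bor_of_base ha hb hc ?_ j m k (by omega) (by omega) (by omega) (by omega)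
  clear h h1 h2 h3 hj j m k
  intro m k h1 h2 h3 h4
  rcases cases_mem ha with rfl | ⟨rfl, a, rfl⟩ | ⟨rfl, x, rfl⟩
  · simp [Bor]
  all_goals rcases cases_mem hb with rfl | ⟨rfl, b, rfl⟩ | ⟨rfl, y, rfl⟩
  any_goals
    simp [Bor]
    done
  all_goals rcases cases_mem hc with rfl | ⟨rfl, c, rfl⟩ | ⟨rfl, z, rfl⟩
  any_goals
    simp [Bor]
    done
  · exact (D.bor_aux m k a b c 0 0 0).1 (by omega) (by omega) (by omega) (by omega)
  · exact (D.bor_aux m k a b 0 0 0 z).2.2.2.1 (by omega) (by omega) (by omega) (by omega)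
  · exact (D.bor_aux m k a 0 c 0 y 0).2.2.1 (by omega) (by omega) (by omega) (by omega)
  · exact (D.bor_aux m k a 0 0 0 y z).2.2.2.2.2.2 (by omega) (by omega) (by omega) (by omega)
  · exact (D.bor_aux m k 0 b c x 0 0).2.1 (by omega) (by omega) (by omega) (by omega)
  · exact (D.bor_aux m k 0 b 0 x 0 z).2.2.2.2.2.1 (by omega) (by omega) (by omega) (by omega)
  · exact (D.bor_aux m k 0 0 c x y 0).2.2.2.2.1 (by omega) (by omega) (by omega) (by omega)
  · exact D.bor_aux' m _ k x y z (by omega) (by omega) (by omega) (by omega)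

/-- The one-truncated vertex algebra with the given operations. -/
def toOneTruncated : OneTruncatedVertexAlgebra.{u} where
  V₀ := A
  V₁ := M
  vac := 1
  mode := D.mode
  mode_mem := D.mode_mem
  vac_mode n x := by
    ext <;> simp [mode, D.one_act, D.anchor_one, D.d_one] <;> split_ifs <;> simp
  mode_vac n x hn := by
    have h1 : n ≠ -1 := by omega
    have h2 : n ≠ -2 := by omega
    ext <;> simp [mode, D.anchor_one, D.d_one, h1, h2]
  mode_neg_one_vac x := by
    ext <;> simp [mode, D.one_act, D.anchor_one]
  borcherds m n k p q r a b c ha hb hc h1 h2 h3 := by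
    have h := D.bor m n k p q r ha hb hc h1 h2 h3
    have h4 : (-1 : ℂ) ^ (1 + n) = - (-1 : ℂ) ^ n := by
      rw [zpow_add₀ (by norm_num)]
      simp
    simp only [Finset.sum_range_succ, Finset.sum_range_zero, zero_add, Ring.choose_zero_right,
      Ring.choose_one_right, Nat.cast_zero, Nat.cast_one, add_zero, sub_zero, pow_zero, pow_one,
      one_smul, mul_one, h4, one_mul, neg_mul, neg_smul]
    rw [h]
    abel

end TruncOps

namespace PrevertexData

variable (P : PrevertexData.{u})

@[elab_as_elim]
lemma Ω_induction {p : P.Ω → Prop} (h : ∀ a b : P.A, p (a • P.d b)) (h0 : p 0)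
    (hadd : ∀ x y, p x → p y → p (x + y)) (hsmul : ∀ (c : ℂ) x, p x → p (c • x)) (w : P.Ω) :
    p w := by
  have hw : w ∈ Submodule.span ℂ {x : P.Ω | ∃ a b : P.A, x = a • P.d b} := by
    rw [P.span_d]
    trivial
  induction hw using Submodule.span_induction with
  | mem x hx => obtain ⟨a, b, rfl⟩ := hx; exact h a b
  | zero => exact h0
  | add x y _ _ hx hy => exact hadd x y hx hy
  | smul c x _ hx => exact hsmul c x hx

lemma lie_mul (t : P.T) (a b : P.A) : ⁅t, a * b⁆ = ⁅t, a⁆ * b + a * ⁅t, b⁆ := by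
  have h := LieRinehartRing.leibniz_mul_right t a b
  rw [h]
  ring

lemma lie_one (t : P.T) : ⁅t, (1 : P.A)⁆ = 0 := by
  have := P.lie_mul t 1 1
  simpa using this

lemma smul_lie' (a : P.A) (t : P.T) (b : P.A) : ⁅a • t, b⁆ = a * ⁅t, b⁆ :=
  LieRinehartRing.lie_smul_eq_mul a b t

lemma lie_smul' (t : P.T) (a : P.A) (s : P.T) : ⁅t, a • s⁆ = a • ⁅t, s⁆ + ⁅t, a⁆ • s :=
  LieRinehartRing.leibniz_smul_right t s a

lemma lieΩ_d (t : P.T) (a : P.A) : P.lieΩ t (P.d a) = P.d ⁅t, a⁆ := by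
  have := P.lieΩ_smul_d t 1 a
  simpa [lie_one] using this

lemma pairing_d (t : P.T) (a : P.A) : P.pairing t (P.d a) = ⁅t, a⁆ := by
  have := P.pairing_smul_d t 1 a
  simpa using this

lemma lieΩ_smul (t : P.T) (a : P.A) (w : P.Ω) :
    P.lieΩ t (a • w) = ⁅t, a⁆ • w + a • P.lieΩ t w := by
  induction w using P.Ω_induction with
  | h b c =>
    rw [← mul_smul, lieΩ_smul_d, lieΩ_smul_d, lie_mul]
    module
  | h0 => simp
  | hadd x y hx hy =>
    simp only [smul_add, map_add, hx, hy]
    abel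
  | hsmul c x hx => simp only [smul_comm a c, map_smul, hx, smul_add, smul_comm _ c]

lemma lieΩ_lie (s t : P.T) (w : P.Ω) :
    P.lieΩ ⁅s, t⁆ w = P.lieΩ s (P.lieΩ t w) - P.lieΩ t (P.lieΩ s w) := by
  induction w using P.Ω_induction with
  | h b c =>
    simp only [lieΩ_smul_d, map_add, lie_lie, map_sub, sub_smul, smul_sub]
    abel
  | h0 => simp
  | hadd x y hx hy =>
    simp only [map_add, hx, hy]
    abel
  | hsmul c x hx => simp only [map_smul, hx, smul_sub]

lemma smul_lieΩ (a : P.A) (t : P.T) (w : P.Ω) :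
    P.lieΩ (a • t) w = a • P.lieΩ t w + P.pairing t w • P.d a := by
  induction w using P.Ω_induction with
  | h b c =>
    simp only [lieΩ_smul_d, pairing_smul_d, smul_lie', Derivation.leibniz, mul_smul, smul_add]
    rw [smul_comm b a]
    abel
  | h0 => simp
  | hadd x y hx hy =>
    simp only [map_add, hx, hy, smul_add, add_smul]
    abel
  | hsmul c x hx =>
    have : P.pairing t (c • x) = c • P.pairing t x := (P.pairing t).map_smul_of_tower c x
    simp only [map_smul, hx, smul_add, this, smul_comm a c, smul_assoc]

lemma lie_pairing (t s : P.T) (w : P.Ω) :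
    ⁅t, P.pairing s w⁆ = P.pairing ⁅t, s⁆ w + P.pairing s (P.lieΩ t w) := by
  induction w using P.Ω_induction with
  | h b c =>
    simp only [lieΩ_smul_d, pairing_smul_d, map_add, lie_mul, lie_lie]
    ring
  | h0 => simp
  | hadd x y hx hy =>
    simp only [map_add, hx, hy, lie_add]
    abel
  | hsmul c x hx =>
    have h : ∀ (r : P.T) (y : P.Ω), P.pairing r (c • y) = c • P.pairing r y :=
      fun r y => (P.pairing r).map_smul_of_tower c y
    simp only [h, map_smul, lie_smul, hx, smul_add]

end PrevertexData

namespace PrevertexAlgebra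

variable (P : PrevertexAlgebra.{u})

lemma γ_one (t : P.T) : P.γ 1 t = 0 := by
  have := P.γ_mul 1 1 t
  simpa [P.lie_one] using this

lemma c2_comm (s t : P.T) : P.c2 s t = - P.c2 t s := by
  have h := P.c2_self (s + t)
  simp only [map_add, LinearMap.add_apply, P.c2_self, zero_add, add_zero] at h
  exact eq_neg_of_add_eq_zero_right h

lemma pairing_smul_left (c : ℂ) (t : P.T) (w : P.Ω) :
    P.pairing (c • t) w = c • P.pairing t w := by
  rw [← algebraMap_smul P.A c t, map_smul, LinearMap.smul_apply, algebraMap_smul]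

lemma pairing_smul_right (c : ℂ) (t : P.T) (w : P.Ω) :
    P.pairing t (c • w) = c • P.pairing t w :=
  (P.pairing t).map_smul_of_tower c w

/-- `a (τ, ω) = (a τ, a ω - γ(a, τ))`. -/
def act : P.A →ₗ[ℂ] (P.T × P.Ω) →ₗ[ℂ] (P.T × P.Ω) :=
  LinearMap.mk₂ ℂ (fun a x => (a • x.1, a • x.2 - P.γ a x.1))
    (fun a b x => by ext <;> simp [add_smul]; abel)
    (fun c a x => by ext <;> simp [smul_sub])
    (fun a x y => by ext <;> simp; abel)
    (fun c a x => by ext <;> simp [smul_sub, smul_comm a c])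

/-- `(τ, ω) a = τ(a)`. -/
def anchor : (P.T × P.Ω) →ₗ[ℂ] P.A →ₗ[ℂ] P.A :=
  LinearMap.mk₂ ℂ (fun x a => ⁅x.1, a⁆)
    (fun x y a => by simp) (fun c x a => by simp) (fun x a b => by simp) (fun c x a => by simp)

/-- The bracket `(τ, ω)_(0) (τ', ω')`. -/
noncomputable def br : (P.T × P.Ω) →ₗ[ℂ] (P.T × P.Ω) →ₗ[ℂ] (P.T × P.Ω) :=
  LinearMap.mk₂ ℂ (fun x y => (⁅x.1, y.1⁆,
      - P.c2 x.1 y.1 + (1 / 2 : ℂ) • P.d (P.form x.1 y.1) + P.lieΩ x.1 y.2 - P.lieΩ y.1 x.2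
        + P.d (P.pairing y.1 x.2)))
    (fun x y z => by ext <;> simp; module)
    (fun c x y => by ext <;> simp [pairing_smul_right]; module)
    (fun x y z => by ext <;> simp; module)
    (fun c x y => by ext <;> simp [pairing_smul_left]; module)

/-- `⟨(τ, ω), (τ', ω')⟩ = ⟨τ, τ'⟩ + ⟨τ, ω'⟩ + ⟨τ', ω⟩`. -/
def pair : (P.T × P.Ω) →ₗ[ℂ] (P.T × P.Ω) →ₗ[ℂ] P.A :=
  LinearMap.mk₂ ℂ (fun x y => P.form x.1 y.1 + P.pairing x.1 y.2 + P.pairing y.1 x.2)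
    (fun x y z => by simp; abel)
    (fun c x y => by simp [pairing_smul_left, pairing_smul_right])
    (fun x y z => by simp; abel)
    (fun c x y => by simp [pairing_smul_left, pairing_smul_right])

lemma act_mk (a : P.A) (t : P.T) (w : P.Ω) : P.act a (t, w) = (a • t, a • w - P.γ a t) := rfl

lemma anchor_mk (t : P.T) (w : P.Ω) (a : P.A) : P.anchor (t, w) a = ⁅t, a⁆ := rfl

lemma br_mk (s t : P.T) (v w : P.Ω) : P.br (s, v) (t, w) = (⁅s, t⁆,
    - P.c2 s t + (1 / 2 : ℂ) • P.d (P.form s t) + P.lieΩ s w - P.lieΩ t v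
      + P.d (P.pairing t v)) := rfl

lemma pair_mk (s t : P.T) (v w : P.Ω) :
    P.pair (s, v) (t, w) = P.form s t + P.pairing s w + P.pairing t v := rfl

lemma form_lie' (t₁ t₂ t₃ : P.T) :
    P.form ⁅t₁, t₂⁆ t₃ + P.form t₂ ⁅t₁, t₃⁆ =
      ⁅t₁, P.form t₂ t₃⁆ - (1 / 2 : ℂ) • ⁅t₂, P.form t₁ t₃⁆ - (1 / 2 : ℂ) • ⁅t₃, P.form t₁ t₂⁆
        + P.pairing t₂ (P.c2 t₁ t₃) + P.pairing t₃ (P.c2 t₁ t₂) := P.form_lie t₁ t₂ t₃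

/-- The independent operations of the one-truncated vertex algebra `A ⊕ (𝒯 ⊕ Ω)`. -/
noncomputable def truncOps : TruncOps P.A (P.T × P.Ω) where
  act := P.act
  anchor := P.anchor
  d := .inr ℂ P.T P.Ω ∘ₗ P.d.toLinearMap
  br := P.br
  pair := P.pair
  one_act := by
    rintro ⟨t, w⟩
    simp [act_mk, γ_one]
  act_act := by
    rintro a b ⟨t, w⟩
    simp [act_mk, anchor_mk, P.γ_mul, mul_smul, smul_sub]
    abel
  d_mul a b := by
    simp [act_mk]
  anchor_mul := by
    rintro ⟨t, w⟩ a b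
    exact P.lie_mul t a b
  anchor_act := by
    rintro a ⟨t, w⟩ b
    exact P.smul_lie' a t b
  anchor_d a b := by
    simp [anchor_mk]
  pair_comm := by
    rintro ⟨s, v⟩ ⟨t, w⟩
    rw [pair_mk, pair_mk, P.form_symm]
    abel
  pair_d := by
    rintro ⟨t, w⟩ a
    simp [pair_mk, anchor_mk, P.pairing_d]
  pair_act := by
    rintro a ⟨s, v⟩ ⟨t, w⟩
    simp [pair_mk, act_mk, anchor_mk, P.form_smul]
    ring
  br_comm := by
    rintro ⟨s, v⟩ ⟨t, w⟩
    simp only [br_mk, pair_mk, P.form_symm t s, P.c2_comm t s, ← lie_skew s t]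
    ext
    · simp
    · simp
      module
  br_d := by
    rintro ⟨t, w⟩ a
    simp [br_mk, anchor_mk, P.lieΩ_d]
  br_act := by
    rintro ⟨s, v⟩ a ⟨t, w⟩
    rw [act_mk, br_mk, br_mk, act_mk, anchor_mk, act_mk, P.lie_smul', P.form_symm s (a • t),
      P.form_smul, P.c2_comm s (a • t), P.c2_smul]
    ext
    · simp [add_comm]
    · simp [-lie_skew, P.smul_lieΩ, P.lieΩ_smul, P.form_symm t s, P.c2_comm t s, ← lie_skew s t]
      module
  anchor_br := by
    rintro ⟨s, v⟩ ⟨t, w⟩ a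
    simp [anchor_mk, br_mk]
  anchor_pair := by
    rintro ⟨t₁, w₁⟩ ⟨t₂, w₂⟩ ⟨t₃, w₃⟩
    have h := P.form_lie' t₁ t₂ t₃
    simp only [anchor_mk, br_mk, pair_mk, lie_add, P.lie_pairing, map_add, map_sub, map_neg,
      P.pairing_d, P.pairing_smul_right, ← lie_skew t₃ t₂, LinearMap.neg_apply]
    linear_combination (norm := module) - h
  br_br := by
    rintro ⟨t₁, w₁⟩ ⟨t₂, w₂⟩ ⟨t₃, w₃⟩
    have h := P.dLie_c2 t₁ t₂ t₃
    have h1 := congrArg P.d (P.form_lie' t₁ t₂ t₃)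
    have h2 := congrArg P.d (P.form_lie' t₂ t₁ t₃)
    ext
    · simp [br_mk]
    · simp only [br_mk, Prod.snd_add]
      simp only [PrevertexData.dLieC2, PrevertexData.c3, PrevertexData.K, PrevertexData.I,
        PrevertexData.formBr, map_add, map_sub, map_neg, map_smul, Derivation.map_smul, lie_smul, lie_add,
        P.lieΩ_d, P.lieΩ_lie,
        P.pairing_d, P.lie_pairing, P.pairing_smul_right, ← lie_skew t₂ t₁, ← lie_skew t₃ t₁,
        P.c2_comm t₃ t₁, P.form_symm t₂ t₁, P.form_symm t₃, LinearMap.neg_apply, P.c2_comm t₂ ⁅_, _⁆, P.c2_comm t₁ ⁅_, _⁆, P.c2_comm t₂ t₁,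
        P.form_symm _ ⁅_, _⁆] at h h1 h2 ⊢
      linear_combination (norm := module) h - (1 / 3 : ℂ) • h1 + (1 / 3 : ℂ) • h2

end PrevertexAlgebra

namespace OneTruncatedVertexAlgebra

namespace Hom

variable {W W' W'' : OneTruncatedVertexAlgebra.{u}} (f : Hom W W')

lemma map_mul (a b : W.V₀) : f.f₀ (W.mul a b) = W'.mul (f.f₀ a) (f.f₀ b) := by
  simpa [mode₀₀] using congrArg Prod.fst (f.map_mode (-1) (a, 0) (b, 0))

lemma map_act (a : W.V₀) (x : W.V₁) : f.f₁ (W.act a x) = W'.act (f.f₀ a) (f.f₁ x) := by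
  simpa [mode₀₁] using congrArg Prod.snd (f.map_mode (-1) (a, 0) (0, x))

lemma map_anchor (x : W.V₁) (a : W.V₀) : f.f₀ (W.anchor x a) = W'.anchor (f.f₁ x) (f.f₀ a) := by
  simpa [mode₁₀] using congrArg Prod.fst (f.map_mode 0 (0, x) (a, 0))

lemma map_br (x y : W.V₁) : f.f₁ (W.br x y) = W'.br (f.f₁ x) (f.f₁ y) := by
  simpa [mode₁₁] using congrArg Prod.snd (f.map_mode 0 (0, x) (0, y))

lemma map_pair (x y : W.V₁) : f.f₀ (W.pair x y) = W'.pair (f.f₁ x) (f.f₁ y) := by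
  simpa [mode₁₁] using congrArg Prod.fst (f.map_mode 1 (0, x) (0, y))

lemma map_d (a : W.V₀) : f.f₁ (W.d a) = W'.d (f.f₀ a) := by
  have := congrArg Prod.snd (f.map_mode (-2) (a, 0) (W.vac, 0))
  simpa [mode₀₀, f.map_vac, mulTwo_vac] using this

lemma map_sbr (x y : W.V₁) : f.f₁ (W.sbr x y) = W'.sbr (f.f₁ x) (f.f₁ y) := by
  simp [sbr, f.map_br]

lemma map_mem_Om {x : W.V₁} (hx : x ∈ W.Om) : f.f₁ x ∈ W'.Om := by
  induction hx using Om_induction with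
  | h a b =>
    rw [f.map_act, f.map_d]
    exact act_d_mem _ _
  | h0 => simp
  | hadd x y _ _ hx hy =>
    rw [map_add]
    exact add_mem hx hy
  | hsmul c x _ hx =>
    rw [map_smul]
    exact Submodule.smul_mem _ _ hx

/-- The algebra map `A → A'` induced by a morphism. -/
def onA : W.V₀ →ₐ[ℂ] W'.V₀ :=
  AlgHom.ofLinearMap f.f₀ f.map_vac f.map_mul

/-- The map `Ω → Ω'` induced by a morphism. -/
def onOm : W.Om →ₗ[ℂ] W'.Om := f.f₁.restrict fun _ hx => f.map_mem_Om hx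

/-- The map `𝒯 → 𝒯'` induced by a morphism. -/
def onT : W.T →ₗ[ℂ] W'.T := W.Om.mapQ W'.Om f.f₁ fun _ hx => f.map_mem_Om hx

lemma onT_smul (a : W.V₀) (t : W.T) : f.onT (a • t) = f.onA a • f.onT t := by
  obtain ⟨x, rfl⟩ := Submodule.mkQ_surjective _ t
  exact congrArg W'.Om.mkQ (f.map_act a x)

lemma onT_lie (s t : W.T) : f.onT ⁅s, t⁆ = ⁅f.onT s, f.onT t⁆ := by
  obtain ⟨x, rfl⟩ := Submodule.mkQ_surjective _ s
  obtain ⟨y, rfl⟩ := Submodule.mkQ_surjective _ t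
  exact congrArg W'.Om.mkQ (f.map_br x y)

lemma onA_lie (t : W.T) (a : W.V₀) : f.onA ⁅t, a⁆ = ⁅f.onT t, f.onA a⁆ := by
  obtain ⟨x, rfl⟩ := Submodule.mkQ_surjective _ t
  exact f.map_anchor x a

lemma onOm_γ {S : W.Splitting} {S' : W'.Splitting} (h : ∀ t, f.f₁ (S.s t) = S'.s (f.onT t))
    (a : W.V₀) (t : W.T) : f.onOm (S.γ a t) = S'.γ (f.onA a) (f.onT t) := Subtype.ext (by
  change f.f₁ (S.s (a • t) - W.act a (S.s t)) =
    S'.s (f.onA a • f.onT t) - W'.act (f.onA a) (S'.s (f.onT t))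
  rw [map_sub, h, f.map_act, h, f.onT_smul]
  rfl)

lemma onA_form {S : W.Splitting} {S' : W'.Splitting} (h : ∀ t, f.f₁ (S.s t) = S'.s (f.onT t))
    (s t : W.T) : f.onA (S.form s t) = S'.form (f.onT s) (f.onT t) := by
  change f.f₀ (W.pair (S.s s) (S.s t)) = W'.pair (S'.s (f.onT s)) (S'.s (f.onT t))
  rw [f.map_pair, h, h]

lemma onOm_c2 {S : W.Splitting} {S' : W'.Splitting} (h : ∀ t, f.f₁ (S.s t) = S'.s (f.onT t))
    (s t : W.T) : f.onOm (S.c2 s t) = S'.c2 (f.onT s) (f.onT t) := Subtype.ext (by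
  change f.f₁ (S.s ⁅s, t⁆ - W.sbr (S.s s) (S.s t)) =
    S'.s ⁅f.onT s, f.onT t⁆ - W'.sbr (S'.s (f.onT s)) (S'.s (f.onT t))
  rw [map_sub, h, f.map_sbr, h, h, f.onT_lie])

/-- The morphism of prevertex algebras induced by a morphism that preserves splittings. -/
noncomputable def onPrevertex (S : W.Splitting) (S' : W'.Splitting)
    (h : ∀ t, f.f₁ (S.s t) = S'.s (f.onT t)) : PrevertexAlgebra.Hom S.prevertex S'.prevertex where
  fA := f.onA
  fΩ := f.onOm
  fT := f.onT
  map_smulΩ a w := Subtype.ext (f.map_act a w.1)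
  map_d a := Subtype.ext (f.map_d a)
  map_smulT := f.onT_smul
  map_lie := f.onT_lie
  map_lieA := f.onA_lie
  map_γ := f.onOm_γ h
  map_form := f.onA_form h
  map_c2 := f.onOm_c2 h

end Hom

end OneTruncatedVertexAlgebra

/-- A split restricted vertex algebra: a restricted vertex algebra together with a splitting of
`V₁ → V₁ / Ω`. -/
structure SplitRestrictedVertexAlgebra extends RestrictedVertexAlgebra.{u} where
  splitting : toRestrictedVertexAlgebra.truncObj.Splitting

namespace SplitRestrictedVertexAlgebra

/-- Morphisms of split restricted vertex algebras are the morphisms of restricted vertex algebras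
that commute with the splittings. -/
@[ext]
structure Hom (V V' : SplitRestrictedVertexAlgebra.{u}) where
  toHom : RestrictedVertexAlgebra.Hom V.toRestrictedVertexAlgebra V'.toRestrictedVertexAlgebra
  map_s : ∀ t, toHom.onWt 1 (V.splitting.s t) =
    V'.splitting.s ((RestrictedVertexAlgebra.truncMap toHom).onT t)

instance : Category SplitRestrictedVertexAlgebra.{u} where
  Hom := Hom
  id V := ⟨𝟙 V.toRestrictedVertexAlgebra, fun t => by
    obtain ⟨x, rfl⟩ := Submodule.mkQ_surjective _ t
    rfl⟩
  comp {V V' V''} f g := ⟨(f.toHom ≫ g.toHom :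
      V.toRestrictedVertexAlgebra ⟶ V''.toRestrictedVertexAlgebra), fun t => by
    refine (congrArg (g.toHom.onWt 1) (f.map_s t)).trans ((g.map_s _).trans ?_)
    congr 1
    obtain ⟨x, rfl⟩ := Submodule.mkQ_surjective _ t
    rfl⟩

end SplitRestrictedVertexAlgebra

/-- The functor which forgets the splitting. -/
def forgetSplitting : SplitRestrictedVertexAlgebra.{u} ⥤ RestrictedVertexAlgebra.{u} where
  obj V := V.toRestrictedVertexAlgebra
  map f := f.toHom

/-- The functor `𝒫` from split restricted vertex algebras to prevertex algebras. -/
noncomputable def prevertexFunctor : SplitRestrictedVertexAlgebra.{u} ⥤ PrevertexAlgebra.{u} where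
  obj V := V.splitting.prevertex
  map {V V'} f := (RestrictedVertexAlgebra.truncMap f.toHom).onPrevertex V.splitting V'.splitting
    f.map_s
  map_id V := PrevertexAlgebra.Hom.ext rfl rfl (by
    ext t
    obtain ⟨x, rfl⟩ := Submodule.mkQ_surjective _ t
    rfl)
  map_comp f g := PrevertexAlgebra.Hom.ext rfl rfl (by
    ext t
    obtain ⟨x, rfl⟩ := Submodule.mkQ_surjective _ t
    rfl)

namespace PrevertexAlgebra

namespace Hom

variable {P P' : PrevertexAlgebra.{u}} (f : Hom P P')

lemma map_pairing (t : P.T) (w : P.Ω) :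
    f.fA (P.pairing t w) = P'.pairing (f.fT t) (f.fΩ w) := by
  induction w using P.Ω_induction with
  | h a b => rw [P.pairing_smul_d, f.map_smulΩ, f.map_d, P'.pairing_smul_d, map_mul, f.map_lieA]
  | h0 => simp
  | hadd x y hx hy => simp only [map_add, hx, hy]
  | hsmul c x hx => simp only [pairing_smul_right, map_smul, hx]

lemma map_lieΩ (t : P.T) (w : P.Ω) :
    f.fΩ (P.lieΩ t w) = P'.lieΩ (f.fT t) (f.fΩ w) := by
  induction w using P.Ω_induction with
  | h a b => rw [P.lieΩ_smul_d, f.map_smulΩ, f.map_d, P'.lieΩ_smul_d, map_add, f.map_smulΩ,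
      f.map_smulΩ, f.map_d, f.map_d, f.map_lieA, f.map_lieA]
  | h0 => simp
  | hadd x y hx hy => simp only [map_add, hx, hy]
  | hsmul c x hx => simp only [map_smul, hx]

/-- The morphism of one-truncated vertex algebras induced by a morphism of prevertex algebras. -/
noncomputable def onTrunc : OneTruncatedVertexAlgebra.Hom P.truncOps.toOneTruncated
    P'.truncOps.toOneTruncated where
  f₀ := f.fA.toLinearMap
  f₁ := f.fT.prodMap f.fΩ
  map_vac := map_one f.fA
  map_mode := by
    have h_act : ∀ a x, f.fT.prodMap f.fΩ (P.truncOps.act a x) =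
        P'.truncOps.act (f.fA a) (f.fT.prodMap f.fΩ x) := by
      rintro a ⟨t, w⟩
      exact Prod.ext (f.map_smulT a t) (by
        change f.fΩ (a • w - P.γ a t) = f.fA a • f.fΩ w - P'.γ (f.fA a) (f.fT t)
        rw [map_sub, f.map_smulΩ, f.map_γ])
    have h_anchor : ∀ x a, f.fA (P.truncOps.anchor x a) =
        P'.truncOps.anchor (f.fT.prodMap f.fΩ x) (f.fA a) := by
      rintro ⟨t, w⟩ a
      exact f.map_lieA t a
    have h_d : ∀ a, f.fT.prodMap f.fΩ (P.truncOps.d a) = P'.truncOps.d (f.fA a) := fun a =>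
      Prod.ext (map_zero f.fT) (f.map_d a)
    have h_pair : ∀ x y, f.fA (P.truncOps.pair x y) =
        P'.truncOps.pair (f.fT.prodMap f.fΩ x) (f.fT.prodMap f.fΩ y) := by
      rintro ⟨s, v⟩ ⟨t, w⟩
      change f.fA (P.form s t + P.pairing s w + P.pairing t v) = P'.form (f.fT s) (f.fT t) +
        P'.pairing (f.fT s) (f.fΩ w) + P'.pairing (f.fT t) (f.fΩ v)
      rw [map_add, map_add, f.map_form, f.map_pairing, f.map_pairing]
    have h_br : ∀ x y, f.fT.prodMap f.fΩ (P.truncOps.br x y) =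
        P'.truncOps.br (f.fT.prodMap f.fΩ x) (f.fT.prodMap f.fΩ y) := by
      rintro ⟨s, v⟩ ⟨t, w⟩
      refine Prod.ext (f.map_lie s t) ?_
      change f.fΩ (- P.c2 s t + (1 / 2 : ℂ) • P.d (P.form s t) + P.lieΩ s w - P.lieΩ t v
        + P.d (P.pairing t v)) = - P'.c2 (f.fT s) (f.fT t)
        + (1 / 2 : ℂ) • P'.d (P'.form (f.fT s) (f.fT t)) + P'.lieΩ (f.fT s) (f.fΩ w)
        - P'.lieΩ (f.fT t) (f.fΩ v) + P'.d (P'.pairing (f.fT t) (f.fΩ v))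
      rw [map_add, map_sub, map_add, map_add, map_neg, map_smul, f.map_c2, f.map_d, f.map_d,
        f.map_form, f.map_pairing, f.map_lieΩ, f.map_lieΩ]
    have key : ∀ (n : ℤ) (a b : P.A) (x y : P.T × P.Ω),
        f.fA.toLinearMap.prodMap (f.fT.prodMap f.fΩ) (P.truncOps.mode n (a, x) (b, y)) =
          P'.truncOps.mode n (f.fA a, f.fT.prodMap f.fΩ x) (f.fA b, f.fT.prodMap f.fΩ y) := by
      intro n a b x y
      rw [TruncOps.mode_mk, TruncOps.mode_mk, LinearMap.prodMap_apply]
      simp only [map_add, AlgHom.toLinearMap_apply, apply_ite f.fA,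
        apply_ite (f.fT.prodMap f.fΩ), h_act, h_anchor, h_d, h_pair, h_br, map_mul, map_sub,
        map_zero]
    exact fun n x y => key n x.1 y.1 x.2 y.2

end Hom

end PrevertexAlgebra

/-- The functor sending a prevertex algebra to the corresponding one-truncated vertex algebra
`A ⊕ (𝒯 ⊕ Ω)`. -/
noncomputable def prevertexToOneTruncated :
    PrevertexAlgebra.{u} ⥤ OneTruncatedVertexAlgebra.{u} where
  obj P := P.truncOps.toOneTruncated
  map f := f.onTrunc

namespace OneTruncatedVertexAlgebra

variable (W : OneTruncatedVertexAlgebra.{u})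

/-- The symbols `∂^(n) a`, `∂^(n) ω`, `∂^(n) τ` with `n ≥ 0`, `a ∈ A`, `ω ∈ Ω`, `τ ∈ 𝒯`. -/
inductive Symbol : Type u
  | ofA (n : ℕ) (a : W.V₀)
  | ofΩ (n : ℕ) (w : W.Om)
  | ofT (n : ℕ) (t : W.T)

namespace Symbol

variable {W}

/-- The conformal weight of a symbol. -/
def weight : W.Symbol → ℕ
  | ofA n _ => n
  | ofΩ n _ => n + 1
  | ofT n _ => n + 1

/-- The symbols `∂^(n) τ` have degree one, the other ones have degree zero. -/
def degree : W.Symbol → ℕ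
  | ofA _ _ => 0
  | ofΩ _ _ => 0
  | ofT _ _ => 1

end Symbol

open MvPolynomial OneTruncatedVertexAlgebra.Symbol in
/-- The relations between the symbols: linearity, `∂^(0) 1 = 1`, the Leibniz rule
`∂^(n)(a x) = ∑_{p+q=n} ∂^(p) a · ∂^(q) x` for `x ∈ A, Ω, 𝒯`, and
`∂^(n)(da) = (n + 1) ∂^(n+1) a`. -/
inductive Relator : MvPolynomial W.Symbol ℂ → Prop
  | add_A (n : ℕ) (a b : W.V₀) : Relator (X (ofA n (a + b)) - (X (ofA n a) + X (ofA n b)))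
  | add_Ω (n : ℕ) (v w : W.Om) : Relator (X (ofΩ n (v + w)) - (X (ofΩ n v) + X (ofΩ n w)))
  | add_T (n : ℕ) (s t : W.T) : Relator (X (ofT n (s + t)) - (X (ofT n s) + X (ofT n t)))
  | smul_A (n : ℕ) (c : ℂ) (a : W.V₀) : Relator (X (ofA n (c • a)) - c • X (ofA n a))
  | smul_Ω (n : ℕ) (c : ℂ) (w : W.Om) : Relator (X (ofΩ n (c • w)) - c • X (ofΩ n w))
  | smul_T (n : ℕ) (c : ℂ) (t : W.T) : Relator (X (ofT n (c • t)) - c • X (ofT n t))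
  | one : Relator (X (ofA 0 1) - 1)
  | leibniz_A (n : ℕ) (a b : W.V₀) : Relator (X (ofA n (a * b)) -
      ∑ p ∈ Finset.HasAntidiagonal.antidiagonal n, X (ofA p.1 a) * X (ofA p.2 b))
  | leibniz_Ω (n : ℕ) (a : W.V₀) (w : W.Om) : Relator (X (ofΩ n (a • w)) -
      ∑ p ∈ Finset.HasAntidiagonal.antidiagonal n, X (ofA p.1 a) * X (ofΩ p.2 w))
  | leibniz_T (n : ℕ) (a : W.V₀) (t : W.T) : Relator (X (ofT n (a • t)) -
      ∑ p ∈ Finset.HasAntidiagonal.antidiagonal n, X (ofA p.1 a) * X (ofT p.2 t))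
  | d (n : ℕ) (a : W.V₀) : Relator (X (ofΩ n (dOm a)) - ((n : ℂ) + 1) • X (ofA (n + 1) a))

/-- The symmetric algebra on `⨁ ∂^(n) A ⊕ ⨁ ∂^(n) 𝒯`: the commutative algebra generated by the
symbols subject to the above relations. As `Ω` is spanned by the elements `a db`, the symbols
`∂^(n) ω` are polynomials in the symbols `∂^(p) a`. -/
abbrev SymbolAlgebra : Type u := MvPolynomial W.Symbol ℂ ⧸ Ideal.span {p | W.Relator p}

/-- The monomial `x₁ ⋯ xₖ` in the symbol algebra. -/
noncomputable def symbolProd (l : List W.Symbol) : W.SymbolAlgebra :=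
  Ideal.Quotient.mk _ (l.map MvPolynomial.X).prod

/-- The operator of multiplication by a symbol in a vertex algebra `V` with a morphism
`W → V_{≤1}`: multiplication by `∂^(n) x` is `x_(-1-n)`. -/
noncomputable def symbolOp (S : W.Splitting) {V : RestrictedVertexAlgebra.{u}}
    (i : W ⟶ truncation.obj V) : W.Symbol → V.carrier →ₗ[ℂ] V.carrier
  | .ofA n a => V.op (-1 - n) (show V.wt 0 from i.f₀ a).1
  | .ofΩ n w => V.op (-1 - n) (show V.wt 1 from i.f₁ w).1
  | .ofT n t => V.op (-1 - n) (show V.wt 1 from i.f₁ (S.s t)).1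

/-- The product `x₁ (x₂ ( ⋯ (xₖ |0⟩)))` of symbols in `V`. -/
noncomputable def vertexProd (S : W.Splitting) {V : RestrictedVertexAlgebra.{u}}
    (i : W ⟶ truncation.obj V) (l : List W.Symbol) : V.carrier :=
  l.foldr (fun x v => W.symbolOp S i x v) V.vac

/-- The total conformal weight of a list of symbols. -/
def totalWeight (l : List W.Symbol) : ℕ := (l.map Symbol.weight).sum

/-- The number of symbols `∂^(n) τ` in a list. -/
def totalDegree (l : List W.Symbol) : ℕ := (l.map Symbol.degree).sum

end OneTruncatedVertexAlgebra

/-!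
For a one-truncated vertex algebra `W` write `V₀ ⊕ V₁` for its space and `u_(n)` for the modes of
its elements. The commutator formula `[u_(m), v_(n)] = (u_(0) v)_(m+n) + m (u_(1) v)_(m+n-1)` and
`(∂a)_(n) = -n a_(n-1)` define a Lie algebra of modes, as all products in the formula remain in
`V₀ ⊕ V₁`; its Jacobi identity is the part of the Borcherds identity that `W` satisfies.

*The adjoint.* The vertex algebra `U₁ W` is constructed as the envelope: the universal space with a
vacuum vector `|0⟩` and operators `u_(-1-n)`, `n ≥ 0`, subject to the relations of the modes, to
`1_(-1-n)|0⟩ = δ_{n,0}|0⟩` and to `(a_(-1) u)_(-1-n)|0⟩ = ∑_{p+q=n} a_(-1-p) u_(-1-q)|0⟩` for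
`a ∈ V₀`. Only the annihilation operators are missing. They are
obtained from the universal property: the linear maps from the space of modes to the envelope are
again such a module (`CreationModule.modeHom`) and `l ↦ l|0⟩` is a vacuum vector of it
(`isVacuum_onVac`), which yields an operator on the envelope for each mode; these operators satisfy
the commutation relations (`modeAction_lie`), hence form mutually local, translation covariant
fields. Dong's lemma (`Fields.Local.nprod`) and the Borcherds identity for local fields
(`Fields.bsum_nprod`) make a space generated from the vacuum by such fields a vertex algebra
(`IsGenerating.vertexAlgebra`). The universal property of the envelope becomes the adjunction
(`envelopeAdjunction`). The unit is surjective because the envelope is spanned by `V₀ ⊕ V₁` and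
vectors of weight at least two (`range_state_sup`), and injective because `V₀ ⊕ V₁`, with all
products of higher weight set to zero, is itself a module over the creation operators
(`truncatedModule`), which gives a retraction.

*The map `Φ`.* Filter the envelope by the number of factors `s(τ)_(-1-n)` in a word. Two factors
commute up to words of lower degree (`op_comm_mem`), so the class of a word modulo lower degree
depends only on the monomial of its symbols. Choosing complements of the steps of the filtration
and projecting to weight spaces defines a linear map on polynomials in the symbols, and it kills
the ideal of relations (`polyMap_mul_relator`); `Φ` is the induced map, and it is surjective by
induction on the degree.

*Injectivity of `Φ`.* If `𝒯` is free with basis `τ_i`, let `J` be the quotient of the symbol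
algebra by the symbols of `𝒯`, the algebra of arcs. The Lie algebra of modes acts on the polynomial
ring over `J` in variables `x_{i,n}`, where `s(τ_i)_(-1-n)` acts as multiplication by `x_{i,n}` up
to lower degree. In the manner of the Poincaré–Birkhoff–Witt theorem, the action is determined by
the images of the elements of `J`, and the commutation relations hold if they hold on `J`
(`Pbw.rel_of_base`). On `J`, the mode of a function is multiplication by a coefficient of its arc,
`s(τ_i)_(n)` with `n ≥ 0` is a derivation, and the remaining modes are those of normally ordered
products `s(τ_i)_(-1) f`. The commutation relations follow from the fact that the field of
`u_(-1) f` is the normally ordered product of the fields of `u` and `f` on `J` (`nop_eq`). The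
images of words in the polynomial ring have leading terms that recover the symbols
(`toPoly_word_sub_mem`, `leadRep_lift_injective`), so `Φ` is injective (`symbolMap_injective`).
A projective `𝒯` is made free by adding a free module on which it acts through the anchor
(`stabOps`, `free_prod_of_projective`); `W` is a retract of the resulting one-truncated vertex
algebra, and injectivity descends (`symbolMap_injective_of_retract`).

*The vertex envelope.* Morphisms from a prevertex algebra `P` to the prevertex algebra of a split
one-truncated vertex algebra are the same as morphisms from `A ⊕ (𝒯 ⊕ Ω)` that respect the
splittings (`splitEquiv`). Composed with the adjunction above this gives the adjunction between the vertex
envelope and `𝒫` (`vertexEnvelopeEquiv`).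
-/

noncomputable section

open Finset.HasAntidiagonal (antidiagonal)

/-! ### The Lie algebra of modes of a one-truncated vertex algebra -/

namespace OneTruncatedVertexAlgebra

variable (W : OneTruncatedVertexAlgebra.{u})

/-- The underlying space `V₀ ⊕ V₁`, whose elements generate the vertex envelope. -/
abbrev Gen : Type u := W.V₀ × W.V₁

/-- Translation `∂` from `V₀` to `V₁`, as an endomorphism of `V₀ ⊕ V₁`. -/
def tr : W.Gen →ₗ[ℂ] W.Gen := (LinearMap.inr ℂ W.V₀ W.V₁) ∘ₗ W.d ∘ₗ (LinearMap.fst ℂ W.V₀ W.V₁)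

lemma tr_apply (u : W.Gen) : W.tr u = (0, W.d u.1) := rfl

lemma gen_decomp (u : W.Gen) : u = (u.1, 0) + (0, u.2) := by simp

lemma mode_zero (u v : W.Gen) :
    W.mode 0 u v = (W.anchor u.2 v.1 - W.anchor v.2 u.1, W.br u.2 v.2) := by
  obtain ⟨a, x⟩ := u
  obtain ⟨b, y⟩ := v
  rw [W.gen_decomp (a, x), W.gen_decomp (b, y)]
  simp only [map_add, LinearMap.add_apply, mode₀₀, mode₀₁, mode₁₀, mode₁₁, coanchor_eq]
  simp [sub_eq_add_neg, add_comm]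

lemma mode_one (u v : W.Gen) : W.mode 1 u v = (W.pair u.2 v.2, 0) := by
  obtain ⟨a, x⟩ := u
  obtain ⟨b, y⟩ := v
  rw [W.gen_decomp (a, x), W.gen_decomp (b, y)]
  simp only [map_add, LinearMap.add_apply, mode₀₀, mode₀₁, mode₁₀, mode₁₁]
  simp

lemma mode_neg_one (a : W.V₀) (v : W.Gen) :
    W.mode (-1) (a, 0) v = (W.mul a v.1, W.act a v.2) := by
  obtain ⟨b, y⟩ := v
  rw [W.gen_decomp (b, y)]
  simp only [map_add, mode₀₀, mode₀₁]
  simp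

variable (u v w : W.Gen)

lemma mode_zero_swap : W.mode 0 v u = - W.mode 0 u v + W.tr (W.mode 1 u v) := by
  simp [mode_zero, mode_one, tr_apply, W.br_comm v.2 u.2, W.pair_comm v.2 u.2]

lemma mode_one_swap : W.mode 1 v u = W.mode 1 u v := by
  simp [mode_one, W.pair_comm]

lemma mode_zero_zero : W.mode 0 u (W.mode 0 v w) =
    W.mode 0 (W.mode 0 u v) w + W.mode 0 v (W.mode 0 u w) := by
  simp only [mode_zero, map_sub, Prod.mk_add_mk, anchor_br, Prod.mk.injEq]
  exact ⟨by abel, W.br_br _ _ _⟩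

lemma mode_zero_one : W.mode 0 u (W.mode 1 v w) =
    W.mode 1 (W.mode 0 u v) w + W.mode 1 v (W.mode 0 u w) := by
  simp [mode_zero, mode_one, anchor_pair]

lemma mode_one_zero : W.mode 1 u (W.mode 0 v w) =
    W.mode 0 v (W.mode 1 u w) + W.mode 1 (W.mode 0 u v) w + W.mode 0 (W.mode 1 u v) w := by
  simp only [mode_zero, mode_one, map_zero, LinearMap.zero_apply, Prod.mk_add_mk, Prod.mk.injEq,
    anchor_pair, add_zero, sub_zero, zero_sub, and_true]
  rw [W.br_comm u.2 v.2]
  simp [pair_d, anchor_pair]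
  abel

lemma mode_one_one : W.mode 1 u (W.mode 1 v w) = 0 := by
  simp [mode_one]

lemma mode_one_one' : W.mode 1 (W.mode 1 v w) u = 0 := by
  simp [mode_one]

lemma mode_zero_mode_one : W.mode 0 (W.mode 1 v w) u = - W.mode 0 u (W.mode 1 v w) := by
  simp [mode_one, mode_zero]

lemma mode_zero_tr_left : W.mode 0 (W.tr u) v = 0 := by
  simp [mode_zero, tr_apply, anchor_d, d_br]

lemma mode_one_tr_left : W.mode 1 (W.tr u) v = - W.mode 0 (u.1, 0) v := by
  simp [mode_zero, mode_one, tr_apply, pair_d]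

lemma mode_zero_tr : W.mode 0 u (W.tr v) = W.tr (W.mode 0 u (v.1, 0)) := by
  simp [mode_zero, tr_apply, br_d, anchor_d]

lemma mode_one_tr : W.mode 1 u (W.tr v) = W.mode 0 u (v.1, 0) := by
  simp [mode_zero, mode_one, tr_apply, pair_d']

lemma mode_zero_neg_one (a : W.V₀) : W.mode 0 u (W.mode (-1) (a, 0) w) =
    W.mode (-1) (W.anchor u.2 a, 0) w + W.mode (-1) (a, 0) (W.mode 0 u w) := by
  simp only [mode_zero, mode_neg_one, anchor_mul, br_act, map_sub, anchor_act, Prod.mk_add_mk,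
    Prod.mk.injEq, and_true]
  abel

lemma mode_one_neg_one (a : W.V₀) : W.mode 1 u (W.mode (-1) (a, 0) w) =
    W.mode 0 (W.mode 0 u (a, 0)) w + W.mode (-1) (a, 0) (W.mode 1 u w) := by
  simp only [mode_zero, mode_neg_one, mode_one, map_zero, sub_zero, LinearMap.zero_apply, zero_sub,
    W.pair_comm u.2, pair_act, Prod.mk_add_mk, Prod.mk.injEq, add_zero, and_true]
  abel

/-- The relations between modes: `(∂ a)_(n) = -n a_(n-1)`. -/
def modeRel : Submodule ℂ (ℤ →₀ W.Gen) :=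
  Submodule.span ℂ {x | ∃ (n : ℤ) (a : W.V₀), x =
    Finsupp.single n ((0, W.d a) : W.Gen) + (n : ℂ) • Finsupp.single (n - 1) ((a, 0) : W.Gen)}

/-- The space of modes: it is spanned by symbols `u_(n)`, with `u ∈ V₀ ⊕ V₁` and `n ∈ ℤ`, linear
in `u`, subject to `(∂ a)_(n) = -n a_(n-1)`. -/
def Mode : Type u := (ℤ →₀ W.Gen) ⧸ W.modeRel

instance : AddCommGroup W.Mode := inferInstanceAs (AddCommGroup ((ℤ →₀ W.Gen) ⧸ W.modeRel))
instance : Module ℂ W.Mode := inferInstanceAs (Module ℂ ((ℤ →₀ W.Gen) ⧸ W.modeRel))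

/-- The mode `u_(n)`. -/
def md (n : ℤ) : W.Gen →ₗ[ℂ] W.Mode := W.modeRel.mkQ ∘ₗ Finsupp.lsingle n

lemma md_d (n : ℤ) (a : W.V₀) : W.md n (0, W.d a) = -(n : ℂ) • W.md (n - 1) (a, 0) := by
  rw [neg_smul, eq_neg_iff_add_eq_zero]
  exact (Submodule.Quotient.mk_eq_zero _).mpr (Submodule.subset_span ⟨n, a, rfl⟩)

lemma md_tr (n : ℤ) (u : W.Gen) : W.md n (W.tr u) = -(n : ℂ) • W.md (n - 1) (u.1, 0) :=
  W.md_d n u.1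

variable {W} in
lemma mode_hom_ext {M : Type*} [AddCommGroup M] [Module ℂ M] {f g : W.Mode →ₗ[ℂ] M}
    (h : ∀ n u, f (W.md n u) = g (W.md n u)) : f = g := by
  apply Submodule.linearMap_qext
  apply Finsupp.lhom_ext
  intro n u
  exact h n u

variable {W} in
@[elab_as_elim]
lemma mode_induction {p : W.Mode → Prop} (h : ∀ n u, p (W.md n u)) (h0 : p 0)
    (hadd : ∀ x y, p x → p y → p (x + y)) (x : W.Mode) : p x := by
  obtain ⟨x, rfl⟩ := Submodule.mkQ_surjective _ x
  induction x using Finsupp.induction_linear with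
  | zero => exact (map_zero (W.modeRel.mkQ)).symm ▸ h0
  | add x y hx hy => exact (map_add (W.modeRel.mkQ) x y).symm ▸ hadd _ _ hx hy
  | single n u => exact h n u

variable {W} in
/-- Linear maps out of the space of modes. -/
def modeLift {M : Type*} [AddCommGroup M] [Module ℂ M] (f : ℤ → W.Gen →ₗ[ℂ] M)
    (h : ∀ n a, f n (0, W.d a) = -(n : ℂ) • f (n - 1) (a, 0)) : W.Mode →ₗ[ℂ] M :=
  W.modeRel.liftQ (Finsupp.lsum ℂ f) (by
    rw [modeRel, Submodule.span_le]
    rintro _ ⟨n, a, rfl⟩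
    change Finsupp.lsum ℂ f _ = 0
    rw [map_add, map_smul, Finsupp.lsum_single, Finsupp.lsum_single, h]
    module)

variable {W} in
@[simp]
lemma modeLift_md {M : Type*} [AddCommGroup M] [Module ℂ M] (f : ℤ → W.Gen →ₗ[ℂ] M)
    (h : ∀ n a, f n (0, W.d a) = -(n : ℂ) • f (n - 1) (a, 0)) (n : ℤ) (u : W.Gen) :
    modeLift f h (W.md n u) = f n u := by
  change Finsupp.lsum ℂ f (Finsupp.single n u) = _
  simp

/-- The commutator `[u_(m), v_(n)] = (u_(0) v)_(m+n) + m (u_(1) v)_(m+n-1)`, for fixed `m, u`. -/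
def mdBracketAux (m : ℤ) (u : W.Gen) : W.Mode →ₗ[ℂ] W.Mode :=
  modeLift (fun n => W.md (m + n) ∘ₗ W.mode 0 u + (m : ℂ) • W.md (m + n - 1) ∘ₗ W.mode 1 u) (by
    intro n a
    have h1 := W.mode_zero_tr u (a, 0)
    have h2 := W.mode_one_tr u (a, 0)
    rw [tr_apply] at h1 h2
    simp only [LinearMap.add_apply, LinearMap.comp_apply, LinearMap.smul_apply, h1, h2, md_tr]
    have h3 : W.mode 1 u (a, 0) = 0 := by simp [mode_one]
    have h4 : ((W.mode 0 u (a, 0)).1, (0 : W.V₁)) = W.mode 0 u (a, 0) := by simp [mode_zero]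
    rw [h3, h4, map_zero, smul_zero, add_zero, show m + n - 1 = m + (n - 1) by ring]
    rw [← add_smul]
    push_cast
    congr 1
    ring)

/-- The commutator on the space of modes. -/
def mdBracket : W.Mode →ₗ[ℂ] W.Mode →ₗ[ℂ] W.Mode :=
  modeLift (fun m =>
    { toFun := W.mdBracketAux m
      map_add' := fun u v => mode_hom_ext fun n w => by
        simp only [mdBracketAux, modeLift_md, map_add, LinearMap.add_apply, LinearMap.comp_apply,
          LinearMap.smul_apply, smul_add]
        abel
      map_smul' := fun c u => mode_hom_ext fun n w => by
        simp only [mdBracketAux, modeLift_md, map_smul, LinearMap.add_apply, LinearMap.comp_apply,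
          LinearMap.smul_apply, smul_add, RingHom.id_apply, smul_comm c] }) (by
    intro m a
    refine mode_hom_ext fun n w => ?_
    rw [LinearMap.smul_apply]
    have h1 := W.mode_zero_tr_left (a, 0) w
    have h2 := W.mode_one_tr_left (a, 0) w
    rw [tr_apply] at h1 h2
    have h3 : W.mode 1 (a, 0) w = 0 := by simp [mode_one]
    simp only [LinearMap.coe_mk, AddHom.coe_mk, mdBracketAux, modeLift_md, LinearMap.add_apply,
      LinearMap.comp_apply, LinearMap.smul_apply, h1, h2, h3, map_zero, zero_add, smul_zero,
      add_zero, map_neg, smul_neg, neg_smul]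
    rw [show m + n - 1 = m - 1 + n by ring])

lemma mdBracket_md (m n : ℤ) (u v : W.Gen) : W.mdBracket (W.md m u) (W.md n v) =
    W.md (m + n) (W.mode 0 u v) + (m : ℂ) • W.md (m + n - 1) (W.mode 1 u v) := by
  simp [mdBracket, mdBracketAux]

lemma mdBracket_swap (x y : W.Mode) : W.mdBracket x y = - W.mdBracket y x := by
  have h : W.mdBracket = - W.mdBracket.flip := by
    refine mode_hom_ext fun m u => mode_hom_ext fun n v => ?_
    simp only [LinearMap.neg_apply, LinearMap.flip_apply, mdBracket_md]
    rw [W.mode_zero_swap u v, W.mode_one_swap u v, map_add, md_tr, add_comm n m]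
    have h4 : ((W.mode 1 u v).1, (0 : W.V₁)) = W.mode 1 u v := by simp [mode_one]
    rw [h4]
    push_cast
    simp only [map_neg]
    module
  exact congr($h x y)

/-- The Jacobi identity for the modes is the commutator formula for `V₀ ⊕ V₁`, applied to
three generators. -/
lemma mdBracket_jacobi (x y z : W.Mode) : W.mdBracket x (W.mdBracket y z) =
    W.mdBracket (W.mdBracket x y) z + W.mdBracket y (W.mdBracket x z) := by
  induction x using mode_induction with
  | h0 => simp
  | hadd x x' hx hx' => simp only [map_add, LinearMap.add_apply, hx, hx']; abel
  | h m u =>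
  induction y using mode_induction with
  | h0 => simp
  | hadd x x' hx hx' => simp only [map_add, LinearMap.add_apply, hx, hx']; abel
  | h n v =>
  induction z using mode_induction with
  | h0 => simp
  | hadd x x' hx hx' => simp only [map_add, hx, hx']; abel
  | h k w =>
  simp only [mdBracket_md, map_add, LinearMap.add_apply, map_smul, LinearMap.smul_apply,
    mode_one_one, mode_one_one', mode_zero_zero W u v w, mode_one_zero W u v w,
    mode_zero_one W u v w, map_zero, smul_zero, add_zero, mode_zero_mode_one W w u v]
  have e1 : m + n + k = m + (n + k) := by ring
  have e2 : n + (m + k) = m + (n + k) := by ring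
  have e3 : m + (n + k) - 1 = m + (n + k - 1) := by ring
  have e4 : m + n - 1 + k = m + (n + k - 1) := by ring
  have e5 : n + (m + k - 1) = m + (n + k - 1) := by ring
  have e6 : n + (m + k) - 1 = m + (n + k - 1) := by ring
  simp only [e1, e2, e3, e4, e5]
  push_cast
  module

instance : LieRing W.Mode where
  bracket x y := W.mdBracket x y
  add_lie x y z := by
    change W.mdBracket (x + y) z = _
    rw [map_add]; rfl
  lie_add x y z := by
    exact map_add (W.mdBracket x) y z
  lie_self x := by
    change W.mdBracket x x = 0
    have h := W.mdBracket_swap x x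
    rwa [eq_neg_iff_add_eq_zero, ← two_smul ℂ, smul_eq_zero_iff_right two_ne_zero] at h
  leibniz_lie := W.mdBracket_jacobi

instance : LieAlgebra ℂ W.Mode where
  lie_smul c x y := by
    change W.mdBracket x (c • y) = _
    exact map_smul _ _ _

lemma lie_md (m n : ℤ) (u v : W.Gen) : ⁅W.md m u, W.md n v⁆ =
    W.md (m + n) (W.mode 0 u v) + (m : ℂ) • W.md (m + n - 1) (W.mode 1 u v) :=
  W.mdBracket_md m n u v

end OneTruncatedVertexAlgebra

/-! ### The envelope as a module over the creation operators -/

namespace OneTruncatedVertexAlgebra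

variable (W : OneTruncatedVertexAlgebra.{u})

/-- A module over the creation operators of `W`: operators `ν n u = u_(-1-n)`, for `n ≥ 0` and
`u ∈ V₀ ⊕ V₁`, which satisfy `(∂ a)_(n) = -n a_(n-1)` and the commutator formula. -/
structure CreationModule (M : Type*) [AddCommGroup M] [Module ℂ M] where
  ν : ℕ → W.Gen →ₗ[ℂ] Module.End ℂ M
  der : ∀ n a x, ν n (0, W.d a) x = ((n : ℂ) + 1) • ν (n + 1) (a, 0) x
  comm : ∀ n m u v x, ν n u (ν m v x) - ν m v (ν n u x) =
    ν (n + m + 1) (W.mode 0 u v) x - ((n : ℂ) + 1) • ν (n + m + 2) (W.mode 1 u v) x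

namespace CreationModule

variable {W}
variable {M : Type*} [AddCommGroup M] [Module ℂ M] (N : W.CreationModule M)

/-- A vector on which the creation operators of the vacuum and of the products `a_(-1) u`,
`a ∈ V₀`, act as on the vacuum vector. -/
structure IsVacuum (e : M) : Prop where
  vac : ∀ n, N.ν n (W.vac, 0) e = if n = 0 then e else 0
  mul : ∀ n a u, N.ν n (W.mode (-1) (a, 0) u) e =
    ∑ p ∈ antidiagonal n, N.ν p.1 (a, 0) (N.ν p.2 u e)

/-- The Leibniz rule for `∂` on a Cauchy product. -/
lemma sum_antidiagonal_translation {F : Type*} [AddCommGroup F] [Module ℂ F] (f : ℕ → ℕ → F)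
    (n : ℕ) : ∑ p ∈ antidiagonal n, (((p.1 : ℂ) + 1) • f (p.1 + 1) p.2 +
      ((p.2 : ℂ) + 1) • f p.1 (p.2 + 1)) =
    ((n : ℂ) + 1) • ∑ p ∈ antidiagonal (n + 1), f p.1 p.2 := by
  have h1 : ∑ p ∈ antidiagonal n, ((p.1 : ℂ) + 1) • f (p.1 + 1) p.2 =
      ∑ p ∈ antidiagonal (n + 1), (p.1 : ℂ) • f p.1 p.2 := by
    rw [Finset.Nat.sum_antidiagonal_succ]; simp
  have h2 : ∑ p ∈ antidiagonal n, ((p.2 : ℂ) + 1) • f p.1 (p.2 + 1) =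
      ∑ p ∈ antidiagonal (n + 1), (p.2 : ℂ) • f p.1 p.2 := by
    rw [Finset.Nat.sum_antidiagonal_succ']; simp
  rw [Finset.sum_add_distrib, h1, h2, ← Finset.sum_add_distrib, Finset.smul_sum]
  refine Finset.sum_congr rfl fun p hp => ?_
  rw [← add_smul, ← Nat.cast_add, Finset.HasAntidiagonal.mem_antidiagonal.1 hp]
  push_cast; rfl

/-- In the presence of a translation operator, it is enough to check the products `a_(-1) u` in
the lowest degree. -/
lemma isVacuum_of_translation (D : Module.End ℂ M)
    (hD : ∀ n u x, D (N.ν n u x) = ((n : ℂ) + 1) • N.ν (n + 1) u x + N.ν n u (D x)) {e : M}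
    (he : D e = 0) (h0 : ∀ n, N.ν n (W.vac, 0) e = if n = 0 then e else 0)
    (h1 : ∀ a u, N.ν 0 (W.mode (-1) (a, 0) u) e = N.ν 0 (a, 0) (N.ν 0 u e)) : N.IsVacuum e where
  vac := h0
  mul n a u := by
    induction n with
    | zero => simpa using h1 a u
    | succ n ih =>
      have h2 := congrArg D ih
      simp only [map_sum, hD, he, map_zero, add_zero, map_smul] at h2
      have h3 := sum_antidiagonal_translation (fun p q => N.ν p (a, 0) (N.ν q u e)) n
      rw [h3] at h2
      exact smul_right_injective _ (Nat.cast_add_one_ne_zero (R := ℂ) n) h2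

/-- The extension of a module by itself defined by an infinitesimal deformation of the creation
operators. -/
def extension (δ : ℕ → W.Gen →ₗ[ℂ] Module.End ℂ M)
    (hder : ∀ n a x, δ n (0, W.d a) x = ((n : ℂ) + 1) • δ (n + 1) (a, 0) x)
    (hcomm : ∀ n m u v x, δ n u (N.ν m v x) - N.ν m v (δ n u x) +
      (N.ν n u (δ m v x) - δ m v (N.ν n u x)) =
      δ (n + m + 1) (W.mode 0 u v) x - ((n : ℂ) + 1) • δ (n + m + 2) (W.mode 1 u v) x) :
    W.CreationModule (M × M) where
  ν n :=
    { toFun := fun u =>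
        { toFun := fun x => (N.ν n u x.1, δ n u x.1 + N.ν n u x.2)
          map_add' := fun x y => by
            refine Prod.ext (by simp) ?_
            simp only [Prod.fst_add, Prod.snd_add, map_add]
            abel
          map_smul' := fun c x => by simp }
      map_add' := fun u v => LinearMap.ext fun x => by
        refine Prod.ext (by simp) ?_
        simp only [LinearMap.coe_mk, AddHom.coe_mk, map_add, LinearMap.add_apply, Prod.snd_add]
        abel
      map_smul' := fun c u => LinearMap.ext fun x => by simp }
  der n a x := by
    refine Prod.ext ?_ ?_
    · simp [N.der]
    · simp [N.der, hder]
  comm n m u v x := by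
    refine Prod.ext ?_ ?_
    · simpa using N.comm n m u v x.1
    · have h1 := N.comm n m u v x.2
      have h2 := hcomm n m u v x.1
      simp only [LinearMap.coe_mk, AddHom.coe_mk, Prod.snd_sub, Prod.smul_snd, map_add]
      linear_combination (norm := module) h1 + h2

/-- Linear maps from the space of modes to a creation module, with creation operators acting on
`φ = (l ↦ l(w))` as on the vector `w`. -/
def modeHom : W.CreationModule (W.Mode →ₗ[ℂ] M) where
  ν n :=
    { toFun := fun u =>
        { toFun := fun φ => N.ν n u ∘ₗ φ + φ ∘ₗ (W.mdBracket.flip (W.md (-1 - n) u))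
          map_add' := fun φ ψ => LinearMap.ext fun l => by
            simp only [LinearMap.add_apply, LinearMap.comp_apply, map_add]; abel
          map_smul' := fun c φ => LinearMap.ext fun l => by simp }
      map_add' := fun u v => LinearMap.ext fun φ => LinearMap.ext fun l => by
        simp only [LinearMap.coe_mk, AddHom.coe_mk, LinearMap.add_apply, LinearMap.comp_apply,
          map_add, LinearMap.flip_apply]
        abel
      map_smul' := fun c u => LinearMap.ext fun φ => LinearMap.ext fun l => by simp }
  der n a φ := LinearMap.ext fun l => by
    have h : W.md (-1 - n) (0, W.d a) = ((n : ℂ) + 1) • W.md (-1 - (n + 1 : ℕ)) (a, 0) := by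
      rw [md_d]
      push_cast
      rw [show (-1 - (n : ℤ) - 1) = -1 - (n + 1) by ring]
      congr 1
      ring
    simp only [LinearMap.coe_mk, AddHom.coe_mk, LinearMap.add_apply, LinearMap.comp_apply,
      LinearMap.flip_apply, N.der, h, map_smul, LinearMap.smul_apply, smul_add]
  comm n m u v φ := LinearMap.ext fun l => by
    have h := W.mdBracket_jacobi l (W.md (-1 - n) u) (W.md (-1 - m) v)
    rw [mdBracket_md] at h
    have e1 : -1 - (n : ℤ) + (-1 - m) = -1 - (n + m + 1 : ℕ) := by push_cast; ring
    have e2 : -1 - ((n + m + 1 : ℕ) : ℤ) - 1 = -1 - (n + m + 2 : ℕ) := by push_cast; ring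
    rw [e1, e2, ← sub_eq_iff_eq_add, map_add, map_smul] at h
    have h2 := congrArg φ h
    have h1 := N.comm n m u v (φ l)
    simp only [LinearMap.coe_mk, AddHom.coe_mk, LinearMap.add_apply, LinearMap.comp_apply,
      LinearMap.flip_apply, LinearMap.sub_apply, LinearMap.smul_apply, map_add]
    have h3 : ((-1 - (n : ℤ) : ℤ) : ℂ) = -((n : ℂ) + 1) := by push_cast; ring
    simp only [map_sub, map_add, map_smul, map_neg, h3, neg_smul] at h2
    rw [sub_eq_iff_eq_add] at h1
    rw [← h2, h1, W.mdBracket_swap (W.md (-1 - n) u), map_neg]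
    simp only [smul_add]
    abel

lemma modeHom_apply (n : ℕ) (u : W.Gen) (φ : W.Mode →ₗ[ℂ] M) (l : W.Mode) :
    N.modeHom.ν n u φ l = N.ν n u (φ l) + φ ⁅l, W.md (-1 - n) u⁆ := rfl

lemma modeHom_creation {φ : W.Mode →ₗ[ℂ] M} {x : M}
    (h : ∀ k v, φ (W.md (-1 - (k : ℕ)) v) = N.ν k v x) (n k : ℕ) (u v : W.Gen) :
    N.modeHom.ν n u φ (W.md (-1 - (k : ℕ)) v) = N.ν k v (N.ν n u x) := by
  have e1 : -1 - (k : ℤ) + (-1 - n) = -1 - (k + n + 1 : ℕ) := by push_cast; ring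
  have e2 : -1 - ((k + n + 1 : ℕ) : ℤ) - 1 = -1 - (k + n + 2 : ℕ) := by push_cast; ring
  rw [modeHom_apply, lie_md, e1, e2, map_add, map_smul, h, h, h]
  have h1 := N.comm k n v u x
  rw [sub_eq_iff_eq_add] at h1
  rw [h1]
  push_cast
  module

end CreationModule

/-- The symbol of the creation operator `u_(-1-n)` in the tensor algebra. -/
def creationSymbol (n : ℕ) : W.Gen →ₗ[ℂ] TensorAlgebra ℂ (ℕ →₀ W.Gen) :=
  TensorAlgebra.ι ℂ ∘ₗ Finsupp.lsingle n

/-- The relations between creation operators. -/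
inductive CreationRel : TensorAlgebra ℂ (ℕ →₀ W.Gen) → TensorAlgebra ℂ (ℕ →₀ W.Gen) → Prop
  | der (n : ℕ) (a : W.V₀) : CreationRel (W.creationSymbol n (0, W.d a))
      (((n : ℂ) + 1) • W.creationSymbol (n + 1) (a, 0))
  | comm (n m : ℕ) (u v : W.Gen) : CreationRel
      (W.creationSymbol n u * W.creationSymbol m v - W.creationSymbol m v * W.creationSymbol n u)
      (W.creationSymbol (n + m + 1) (W.mode 0 u v) -
        ((n : ℂ) + 1) • W.creationSymbol (n + m + 2) (W.mode 1 u v))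

/-- The associative algebra generated by the creation operators. -/
abbrev CreationAlgebra : Type u := RingQuot W.CreationRel

/-- The creation operator `u_(-1-n)` as an element of the algebra they generate. -/
def creation (n : ℕ) : W.Gen →ₗ[ℂ] W.CreationAlgebra :=
  (RingQuot.mkAlgHom ℂ W.CreationRel).toLinearMap ∘ₗ W.creationSymbol n

/-- The left ideal of relations satisfied by the vacuum vector. -/
def vacuumIdeal : Submodule W.CreationAlgebra W.CreationAlgebra :=
  Submodule.span _ ({x | ∃ n, x = W.creation n (W.vac, 0) - if n = 0 then 1 else 0} ∪
    {x | ∃ n a u, x = W.creation n (W.mode (-1) (a, 0) u) -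
      ∑ p ∈ antidiagonal n, W.creation p.1 (a, 0) * W.creation p.2 u})

/-- The space of the vertex algebra freely generated by `W`: the universal creation module with
a vacuum vector. -/
def Envelope : Type u := W.CreationAlgebra ⧸ W.vacuumIdeal

namespace Envelope

instance : AddCommGroup W.Envelope := inferInstanceAs (AddCommGroup (_ ⧸ W.vacuumIdeal))
instance : Module W.CreationAlgebra W.Envelope :=
  inferInstanceAs (Module W.CreationAlgebra (_ ⧸ W.vacuumIdeal))
instance : Module ℂ W.Envelope := inferInstanceAs (Module ℂ (_ ⧸ W.vacuumIdeal))
instance : IsScalarTower ℂ W.CreationAlgebra W.Envelope :=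
  inferInstanceAs (IsScalarTower ℂ W.CreationAlgebra (_ ⧸ W.vacuumIdeal))

/-- The vacuum vector. -/
def vac : W.Envelope := W.vacuumIdeal.mkQ 1

lemma smul_vac (x : W.CreationAlgebra) : x • vac W = W.vacuumIdeal.mkQ x := by
  change W.vacuumIdeal.mkQ (x * 1) = _
  rw [mul_one]

lemma creation_comm (n m : ℕ) (u v : W.Gen) :
    W.creation n u * W.creation m v - W.creation m v * W.creation n u =
      W.creation (n + m + 1) (W.mode 0 u v) -
        ((n : ℂ) + 1) • W.creation (n + m + 2) (W.mode 1 u v) := by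
  have h := RingQuot.mkAlgHom_rel ℂ (CreationRel.comm (W := W) n m u v)
  rw [map_sub, map_sub, map_mul, map_mul, map_smul] at h
  exact h

lemma creation_der (n : ℕ) (a : W.V₀) :
    W.creation n (0, W.d a) = ((n : ℂ) + 1) • W.creation (n + 1) (a, 0) := by
  have h := RingQuot.mkAlgHom_rel ℂ (CreationRel.der (W := W) n a)
  rw [map_smul] at h
  exact h

/-- The action of the creation operators on the envelope. -/
def creationModule : W.CreationModule W.Envelope where
  ν n := (Algebra.lsmul ℂ ℂ W.Envelope).toLinearMap ∘ₗ W.creation n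
  der n a x := by
    simp [creation_der]
  comm n m u v x := by
    have h := congrArg (fun t => t • x) (creation_comm W n m u v)
    simpa [sub_smul, mul_smul, smul_assoc] using h

/-- The creation operator `u_(-1-n)` on the envelope. -/
abbrev ν (n : ℕ) : W.Gen →ₗ[ℂ] Module.End ℂ W.Envelope := (creationModule W).ν n

lemma smul_vac_eq {x y : W.CreationAlgebra} (h : x - y ∈ W.vacuumIdeal) :
    x • vac W = y • vac W := by
  rw [smul_vac, smul_vac]
  exact (Submodule.Quotient.eq _).mpr h

lemma isVacuum : (creationModule W).IsVacuum (vac W) where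
  vac n := by
    refine (smul_vac_eq W (Submodule.subset_span (.inl ⟨n, rfl⟩))).trans ?_
    split_ifs <;> simp
  mul n a u := by
    refine (smul_vac_eq W (Submodule.subset_span (.inr ⟨n, a, u, rfl⟩))).trans ?_
    rw [Finset.sum_smul]
    exact Finset.sum_congr rfl fun p _ => mul_smul _ _ _

variable {W}

lemma eq_top_of_creation {S : Submodule ℂ W.Envelope} (h0 : vac W ∈ S)
    (h1 : ∀ n u x, x ∈ S → ν W n u x ∈ S) : S = ⊤ := by
  have key : ∀ (t : TensorAlgebra ℂ (ℕ →₀ W.Gen)) (x : W.Envelope), x ∈ S →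
      RingQuot.mkAlgHom ℂ W.CreationRel t • x ∈ S := by
    intro t
    induction t using TensorAlgebra.induction with
    | algebraMap r =>
      intro x hx
      rw [AlgHom.commutes, algebraMap_smul]
      exact S.smul_mem _ hx
    | ι f =>
      intro x hx
      induction f using Finsupp.induction_linear with
      | zero => simp
      | add f g hf hg => simpa [add_smul] using S.add_mem hf hg
      | single n u => exact h1 n u x hx
    | mul s t hs ht =>
      intro x hx
      rw [map_mul, mul_smul]
      exact hs _ (ht _ hx)
    | add s t hs ht =>
      intro x hx
      rw [map_add, add_smul]
      exact S.add_mem (hs _ hx) (ht _ hx)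
  rw [eq_top_iff]
  intro x _
  obtain ⟨y, rfl⟩ := Submodule.mkQ_surjective _ x
  obtain ⟨t, rfl⟩ := RingQuot.mkAlgHom_surjective ℂ W.CreationRel y
  rw [← smul_vac]
  exact key t _ h0

@[elab_as_elim]
lemma induction {p : W.Envelope → Prop} (vac : p (vac W)) (zero : p 0)
    (add : ∀ x y, p x → p y → p (x + y)) (smul : ∀ (c : ℂ) x, p x → p (c • x))
    (creation : ∀ n u x, p x → p (ν W n u x)) (x : W.Envelope) : p x := by
  let S : Submodule ℂ W.Envelope :=
    { carrier := {x | p x}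
      add_mem' := fun hx hy => add _ _ hx hy
      zero_mem' := zero
      smul_mem' := fun c x hx => smul c x hx }
  have : S = ⊤ := eq_top_of_creation vac creation
  have h : x ∈ S := this ▸ Submodule.mem_top
  exact h

lemma hom_ext {M : Type*} [AddCommGroup M] [Module ℂ M] {f g : W.Envelope →ₗ[ℂ] M}
    (h0 : f (vac W) = g (vac W))
    (h1 : ∀ n u x, f x = g x → f (ν W n u x) = g (ν W n u x)) : f = g := by
  ext x
  induction x using induction with
  | vac => exact h0
  | zero => simp
  | add x y hx hy => rw [map_add, map_add, hx, hy]
  | smul c x hx => rw [map_smul, map_smul, hx]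
  | creation n u x hx => exact h1 n u x hx

section lift

variable {M : Type u} [AddCommGroup M] [Module ℂ M] (N : W.CreationModule M)

/-- The action of the algebra of creation operators on a creation module. -/
def actionHom : W.CreationAlgebra →ₐ[ℂ] Module.End ℂ M :=
  RingQuot.liftAlgHom ℂ ⟨TensorAlgebra.lift ℂ (Finsupp.lsum ℂ N.ν), by
    intro x y h
    cases h with
    | der n a => ext x; simpa [creationSymbol] using N.der n a x
    | comm n m u v => ext x; simpa [creationSymbol] using N.comm n m u v x⟩

lemma actionHom_creation (n : ℕ) (u : W.Gen) : actionHom N (W.creation n u) = N.ν n u := by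
  simp [actionHom, creation, creationSymbol]

/-- The universal property of the envelope. -/
def lift {e : M} (he : N.IsVacuum e) : W.Envelope →ₗ[ℂ] M :=
  (W.vacuumIdeal.restrictScalars ℂ).liftQ
    ((LinearMap.applyₗ e).comp (actionHom N).toLinearMap) (by
      intro x hx
      replace hx : x ∈ W.vacuumIdeal := hx
      induction hx using Submodule.span_induction with
      | mem x hx =>
        rcases hx with ⟨n, rfl⟩ | ⟨n, a, u, rfl⟩
        · have := he.vac n
          split_ifs at this ⊢ with h
          · subst h; simp [actionHom_creation, this]
          · simp [actionHom_creation, this]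
        · simp [actionHom_creation, he.mul n a u]
      | zero => simp
      | add x y _ _ hx hy => exact Submodule.add_mem _ hx hy
      | smul c x _ hx =>
        rw [LinearMap.mem_ker] at hx ⊢
        simp only [LinearMap.comp_apply, AlgHom.toLinearMap_apply, LinearMap.applyₗ_apply_apply,
          smul_eq_mul, map_mul, Module.End.mul_apply] at hx ⊢
        rw [hx, map_zero])

variable {N}

@[simp]
lemma lift_vac {e : M} (he : N.IsVacuum e) : lift N he (vac W) = e := by
  change actionHom N 1 e = e
  simp

@[simp]
lemma lift_ν {e : M} (he : N.IsVacuum e) (n : ℕ) (u : W.Gen) (x : W.Envelope) :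
    lift N he (ν W n u x) = N.ν n u (lift N he x) := by
  obtain ⟨y, rfl⟩ := Submodule.mkQ_surjective _ x
  rw [← actionHom_creation N]
  change actionHom N (W.creation n u * y) e =
    actionHom N (W.creation n u) (actionHom N y e)
  rw [map_mul]
  rfl

end lift

/-- A derivation of the creation operators integrates to the envelope. -/
lemma exists_derivation (δ : ℕ → W.Gen →ₗ[ℂ] Module.End ℂ W.Envelope)
    (hder : ∀ n a x, δ n (0, W.d a) x = ((n : ℂ) + 1) • δ (n + 1) (a, 0) x)
    (hcomm : ∀ n m u v x, δ n u (ν W m v x) - ν W m v (δ n u x) +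
      (ν W n u (δ m v x) - δ m v (ν W n u x)) =
      δ (n + m + 1) (W.mode 0 u v) x - ((n : ℂ) + 1) • δ (n + m + 2) (W.mode 1 u v) x)
    (hvac : ∀ n, δ n (W.vac, 0) (vac W) = 0)
    (hmul : ∀ n a u, δ n (W.mode (-1) (a, 0) u) (vac W) = ∑ p ∈ antidiagonal n,
      (δ p.1 (a, 0) (ν W p.2 u (vac W)) + ν W p.1 (a, 0) (δ p.2 u (vac W)))) :
    ∃ D : Module.End ℂ W.Envelope, D (vac W) = 0 ∧
      ∀ n u x, D (ν W n u x) = δ n u x + ν W n u (D x) := by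
  let N := (creationModule W).extension δ hder hcomm
  have hν : ∀ n u x, N.ν n u x = (ν W n u x.1, δ n u x.1 + ν W n u x.2) := fun _ _ _ => rfl
  have he : N.IsVacuum (vac W, 0) :=
    { vac := fun n => by
        rw [hν, hvac, (isVacuum W).vac]
        split_ifs <;> simp
      mul := fun n a u => by
        simp only [hν, hmul, (isVacuum W).mul, map_zero, add_zero]
        refine Prod.ext ?_ ?_
        · rw [Prod.fst_sum]
        · rw [Prod.snd_sum] }
  have h1 : LinearMap.fst ℂ _ _ ∘ₗ lift N he = LinearMap.id :=
    hom_ext (by simp) (fun n u x h => by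
      have h : (lift N he x).1 = x := h
      simp [hν, h])
  refine ⟨LinearMap.snd ℂ _ _ ∘ₗ lift N he, by simp, fun n u x => ?_⟩
  have h2 : (lift N he x).1 = x := congr($h1 x)
  simp [hν, h2]

/-- The translation operator is the derivation of the creation operators with
`[∂, u_(-1-n)] = (n + 1) u_(-2-n)`. -/
lemma exists_translation : ∃ D : Module.End ℂ W.Envelope, D (vac W) = 0 ∧
    ∀ n u x, D (ν W n u x) = ((n : ℂ) + 1) • ν W (n + 1) u x + ν W n u (D x) := by
  refine exists_derivation (fun n => ((n : ℂ) + 1) • ν W (n + 1)) ?_ ?_ ?_ ?_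
  · intro n a x
    simp [(creationModule W).der, smul_smul]
  · intro n m u v x
    have h1 := (creationModule W).comm (n + 1) m u v x
    have h2 := (creationModule W).comm n (m + 1) u v x
    simp only [LinearMap.smul_apply, map_smul, ← smul_sub, h1, h2]
    rw [show n + 1 + m = n + m + 1 by ring, show n + (m + 1) = n + m + 1 by ring]
    push_cast
    module
  · intro n
    simp [(isVacuum W).vac]
  · intro n a u
    simp only [LinearMap.smul_apply, map_smul]
    rw [CreationModule.sum_antidiagonal_translation
      (fun p q => ν W p (a, 0) (ν W q u (vac W))), (isVacuum W).mul]

/-- The operator by which the Hamiltonian acts on generators, so that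
`[H, u_(-1-n)] = (h n u)_(-1-n)`. -/
def genEnergy (n : ℕ) : W.Gen →ₗ[ℂ] W.Gen :=
  ((n : ℂ) • LinearMap.id).prodMap (((n : ℂ) + 1) • LinearMap.id)

lemma genEnergy_mk (n : ℕ) (a : W.V₀) (x : W.V₁) :
    genEnergy n (a, x) = ((n : ℂ) • a, ((n : ℂ) + 1) • x) := rfl

/-- The Hamiltonian is the derivation of the creation operators that multiplies `a_(-1-n)` by `n`
and `x_(-1-n)` by `n + 1`, for `a` of weight zero and `x` of weight one. -/
lemma exists_hamiltonian : ∃ D : Module.End ℂ W.Envelope, D (vac W) = 0 ∧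
    ∀ n u x, D (ν W n u x) = ν W n (genEnergy n u) x + ν W n u (D x) := by
  refine exists_derivation (fun n => ν W n ∘ₗ genEnergy n) ?_ ?_ ?_ ?_
  · intro n a x
    have h := (creationModule W).der n a x
    have e1 : genEnergy (W := W) n (0, W.d a) = ((n : ℂ) + 1) • (0, W.d a) := by
      simp [genEnergy_mk]
    have e2 : genEnergy (W := W) (n + 1) (a, 0) = ((n : ℂ) + 1) • (a, 0) := by
      simp [genEnergy_mk]
    simp only [LinearMap.comp_apply, e1, e2, map_smul, LinearMap.smul_apply, h]
  · intro n m u v x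
    have h1 := (creationModule W).comm n m (genEnergy n u) v x
    have h2 := (creationModule W).comm n m u (genEnergy m v) x
    simp only [LinearMap.comp_apply]
    rw [h1, h2]
    have e0 : W.mode 0 (genEnergy n u) v + W.mode 0 u (genEnergy m v) =
        genEnergy (n + m + 1) (W.mode 0 u v) := by
      obtain ⟨a, y⟩ := u
      obtain ⟨b, z⟩ := v
      simp only [genEnergy_mk, mode_zero, map_smul, LinearMap.smul_apply, Prod.mk_add_mk]
      refine Prod.ext ?_ ?_ <;> push_cast <;> module
    have e1 : W.mode 1 (genEnergy n u) v + W.mode 1 u (genEnergy m v) =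
        genEnergy (n + m + 2) (W.mode 1 u v) := by
      obtain ⟨a, y⟩ := u
      obtain ⟨b, z⟩ := v
      simp only [genEnergy_mk, mode_one, map_smul, LinearMap.smul_apply, Prod.mk_add_mk]
      refine Prod.ext ?_ ?_ <;> push_cast <;> module
    rw [← e0, ← e1]
    simp only [map_add, LinearMap.add_apply]
    module
  · intro n
    have e1 : genEnergy (W := W) n (W.vac, 0) = (n : ℂ) • (W.vac, 0) := by
      simp [genEnergy_mk]
    rw [LinearMap.comp_apply, e1, map_smul, LinearMap.smul_apply, (isVacuum W).vac]
    split_ifs with h <;> simp [h]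
  · intro n a u
    simp only [LinearMap.comp_apply]
    have e1 : genEnergy n (W.mode (-1) (a, 0) u) = W.mode (-1) (a, 0) (genEnergy n u) := by
      obtain ⟨b, y⟩ := u
      simp only [genEnergy_mk, mode_neg_one, map_smul]
    rw [e1, (isVacuum W).mul]
    refine Finset.sum_congr rfl fun p hp => ?_
    obtain rfl := Finset.HasAntidiagonal.mem_antidiagonal.1 hp
    obtain ⟨b, y⟩ := u
    have e2 : genEnergy (W := W) p.1 (a, 0) = (p.1 : ℂ) • (a, 0) := by
      simp [genEnergy_mk]
    have e3 : genEnergy (W := W) (p.1 + p.2) (b, y) =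
        (p.1 : ℂ) • (b, y) + genEnergy p.2 (b, y) := by
      simp only [genEnergy_mk, Prod.smul_mk, Prod.mk_add_mk, ← add_smul]
      push_cast
      ring_nf
    rw [e2, e3]
    simp only [map_smul, map_add, LinearMap.smul_apply, LinearMap.add_apply]

variable (W)

/-- The translation operator on the envelope. -/
def trans : Module.End ℂ W.Envelope := exists_translation.choose

@[simp]
lemma trans_vac : trans W (vac W) = 0 := exists_translation.choose_spec.1

lemma trans_ν (n : ℕ) (u : W.Gen) (x : W.Envelope) : trans W (ν W n u x) =
    ((n : ℂ) + 1) • ν W (n + 1) u x + ν W n u (trans W x) :=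
  exists_translation.choose_spec.2 n u x

/-- The Hamiltonian of the envelope. -/
def ham : Module.End ℂ W.Envelope := exists_hamiltonian.choose

@[simp]
lemma ham_vac : ham W (vac W) = 0 := exists_hamiltonian.choose_spec.1

lemma ham_ν (n : ℕ) (u : W.Gen) (x : W.Envelope) : ham W (ν W n u x) =
    ν W n (genEnergy n u) x + ν W n u (ham W x) :=
  exists_hamiltonian.choose_spec.2 n u x

end Envelope

end OneTruncatedVertexAlgebra

/-! ### The modes of generators acting on the envelope -/

namespace OneTruncatedVertexAlgebra

variable (W : OneTruncatedVertexAlgebra.{u})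

/-- Translation on the space of modes: `u_(n) ↦ -n u_(n-1)`. -/
def modeTrans : W.Mode →ₗ[ℂ] W.Mode :=
  modeLift (fun n => -(n : ℂ) • W.md (n - 1)) (by
    intro n a
    simp only [LinearMap.smul_apply, md_d])

lemma modeTrans_md (n : ℤ) (u : W.Gen) : W.modeTrans (W.md n u) = -(n : ℂ) • W.md (n - 1) u := by
  simp [modeTrans]

lemma modeTrans_lie (x y : W.Mode) :
    W.modeTrans ⁅x, y⁆ = ⁅W.modeTrans x, y⁆ + ⁅x, W.modeTrans y⁆ := by
  induction x using mode_induction with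
  | h0 => simp
  | hadd x x' hx hx' => simp only [map_add, add_lie, hx, hx']; abel
  | h m u =>
  induction y using mode_induction with
  | h0 => simp
  | hadd x x' hx hx' => simp only [map_add, lie_add, hx, hx']; abel
  | h n v =>
  simp only [lie_md, map_add, map_smul, modeTrans_md, smul_lie, lie_smul]
  rw [show m - 1 + n = m + n - 1 by ring, show m + (n - 1) = m + n - 1 by ring]
  push_cast
  module

lemma lie_md_vac (l : W.Mode) (n : ℤ) : ⁅l, W.md n (W.vac, 0)⁆ = 0 := by
  induction l using mode_induction with
  | h0 => simp
  | hadd x x' hx hx' => simp only [add_lie, hx, hx', add_zero]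
  | h m u =>
    have h0 : W.mode 0 u (W.vac, 0) = 0 := by simp [mode_zero, anchor_vac]
    have h1 : W.mode 1 u (W.vac, 0) = 0 := by simp [mode_one]
    simp [lie_md, h0, h1]

/-- An induction principle which separates annihilation and creation operators. -/
lemma mode_induction_creation {p : W.Mode → Prop} (pos : ∀ n u, 0 ≤ n → p (W.md n u))
    (neg : ∀ (k : ℕ) u, p (W.md (-1 - k) u)) (h0 : p 0)
    (hadd : ∀ x y, p x → p y → p (x + y)) (x : W.Mode) : p x := by
  refine mode_induction (fun n u => ?_) h0 hadd x
  rcases le_or_gt 0 n with h | h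
  · exact pos n u h
  · obtain ⟨k, rfl⟩ : ∃ k : ℕ, n = -1 - k := ⟨(-1 - n).toNat, by omega⟩
    exact neg k u

namespace Envelope

lemma ν_vac (n : ℕ) (x : W.Envelope) : ν W n (W.vac, 0) x = if n = 0 then x else 0 := by
  have h : ν W n (W.vac, 0) = if n = 0 then LinearMap.id else 0 := by
    refine hom_ext ?_ fun m u x hx => ?_
    · rw [(isVacuum W).vac]; split_ifs <;> simp
    · have h1 := (creationModule W).comm m n u (W.vac, 0) x
      simp only [mode_zero, mode_one, anchor_vac, map_zero, LinearMap.zero_apply, sub_zero,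
        Prod.mk_zero_zero, smul_zero, sub_eq_zero] at h1
      rw [← h1, hx]
      split_ifs <;> simp
  rw [h]
  split_ifs <;> simp

/-- The map sending a mode `l` to `l |0⟩`. -/
def onVac : W.Mode →ₗ[ℂ] W.Envelope :=
  modeLift (fun n => if n < 0 then (ν W (-1 - n).toNat).flip (vac W) else 0) (by
    intro n a
    rcases lt_or_ge n 0 with h | h
    · obtain ⟨k, rfl⟩ : ∃ k : ℕ, n = -1 - k := ⟨(-1 - n).toNat, by omega⟩
      rw [if_pos h, if_pos (by omega), show (-1 - (-1 - (k : ℤ))).toNat = k by omega,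
        show (-1 - (-1 - (k : ℤ) - 1)).toNat = k + 1 by omega]
      have h1 := (creationModule W).der k a (vac W)
      rw [LinearMap.flip_apply, LinearMap.flip_apply]
      refine h1.trans ?_
      push_cast
      congr 1
      ring
    · rw [if_neg (by omega)]
      rcases h.eq_or_lt with rfl | h
      · simp
      · rw [if_neg (by omega)]; simp)

lemma onVac_creation (k : ℕ) (u : W.Gen) : onVac W (W.md (-1 - k) u) = ν W k u (vac W) := by
  rw [onVac, modeLift_md, if_pos (by omega), show (-1 - (-1 - (k : ℤ))).toNat = k by omega]
  rfl

lemma onVac_of_nonneg {n : ℤ} (h : 0 ≤ n) (u : W.Gen) : onVac W (W.md n u) = 0 := by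
  rw [onVac, modeLift_md, if_neg (by omega)]
  rfl

lemma onVac_modeTrans (l : W.Mode) : onVac W (W.modeTrans l) = trans W (onVac W l) := by
  induction l using mode_induction_creation with
  | h0 => simp
  | hadd x y hx hy => simp only [map_add, hx, hy]
  | pos n u hn =>
    rw [modeTrans_md, map_smul, onVac_of_nonneg W hn]
    rcases hn.eq_or_lt with rfl | hn
    · simp
    · rw [onVac_of_nonneg W (by omega)]; simp
  | neg k u =>
    rw [modeTrans_md, map_smul, onVac_creation, trans_ν, trans_vac, map_zero, add_zero,
      show -1 - (k : ℤ) - 1 = -1 - (k + 1 : ℕ) by push_cast; ring, onVac_creation]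
    push_cast
    congr 1
    ring

lemma ν_zero_mul (b : W.V₀) (u : W.Gen) : ν W 0 (W.mode (-1) (b, 0) u) (vac W) =
    ν W 0 (b, 0) (ν W 0 u (vac W)) := by
  simpa using (isVacuum W).mul 0 b u

/-- The map `l ↦ l|0⟩` is a vacuum vector of the space of linear maps from the modes to the
envelope. Because of translation covariance, the only relation to verify is the one for
`a_(-1) u`. It is tested on a mode `v_(m)`; if `m ≥ 0`, it says that `v_(m)`, moved to the right
until it annihilates the vacuum, acts in the same way on `(a_(-1) u)_(-1)|0⟩` and on
`a_(-1) u_(-1)|0⟩`. -/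
lemma isVacuum_onVac : (creationModule W).modeHom.IsVacuum (onVac W) := by
  have hcr : ∀ n k u v, (creationModule W).modeHom.ν n u (onVac W) (W.md (-1 - (k : ℕ)) v) =
      ν W k v (ν W n u (vac W)) :=
    (creationModule W).modeHom_creation (onVac_creation W)
  refine CreationModule.isVacuum_of_translation _
    (LinearMap.compRight ℂ (trans W) - LinearMap.lcomp ℂ _ W.modeTrans) ?_ ?_ ?_ ?_
  · intro n u φ
    ext l
    have h := trans_ν W n u (φ l)
    have h2 := congrArg φ (W.modeTrans_lie l (W.md (-1 - n) u))
    rw [modeTrans_md, lie_smul, map_add, map_smul,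
      show -1 - (n : ℤ) - 1 = -1 - (n + 1 : ℕ) by push_cast; ring] at h2
    simp only [LinearMap.sub_apply, LinearMap.add_apply, LinearMap.smul_apply,
      LinearMap.compRight_apply, LinearMap.comp_apply, LinearMap.lcomp_apply,
      CreationModule.modeHom_apply, map_add, map_sub, h, h2]
    push_cast
    module
  · ext l
    simp [onVac_modeTrans]
  · intro n
    ext l
    rw [CreationModule.modeHom_apply, lie_md_vac, map_zero, add_zero]
    refine (ν_vac W n _).trans ?_
    split_ifs <;> simp
  · intro a u
    refine mode_hom_ext fun m v => ?_
    rcases lt_or_ge m 0 with h | h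
    · obtain ⟨k, rfl⟩ : ∃ k : ℕ, m = -1 - k := ⟨(-1 - m).toNat, by omega⟩
      rw [hcr, (creationModule W).modeHom_creation
        (x := ν W 0 u (vac W)) (fun k v => hcr 0 k u v), ν_zero_mul]
    · have e1 : W.mode 0 v (a, 0) = ((W.mode 0 v (a, 0)).1, 0) := by simp [mode_zero]
      have e2 : ∀ w, W.mode 1 (W.mode 0 v (a, 0)) w = 0 := by simp [mode_zero, mode_one]
      have e3 : W.mode 1 v (a, 0) = 0 := by simp [mode_one]
      simp only [CreationModule.modeHom_apply, lie_md, map_add, map_smul, onVac_of_nonneg W h,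
        map_zero, zero_add, e2, e3, smul_zero, add_zero]
      have e4 : (W.anchor v.2 a, (0 : W.V₁)) = W.mode 0 v (a, 0) := by simp [mode_zero]
      -- the case `m = 0`: the zeroth product with `v` is a derivation
      rcases h.eq_or_lt with rfl | h
      · have k1 : ∀ w, onVac W (W.md (0 + (-1 - ((0 : ℕ) : ℤ))) w) = ν W 0 w (vac W) := fun w =>
          onVac_creation W 0 w
        have k2 : ∀ w, onVac W (W.md (0 + (-1 - ((0 : ℕ) : ℤ)) + (-1 - ((0 : ℕ) : ℤ))) w) =
          ν W 1 w (vac W) := fun w => onVac_creation W 1 w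
        rw [k1, k1, k1, k2, Int.cast_zero]
        simp only [zero_smul, add_zero]
        rw [mode_zero_neg_one, map_add, LinearMap.add_apply, ν_zero_mul, ν_zero_mul, e4]
        have h2 := (creationModule W).comm 0 0 (W.mode 0 v (a, 0)) u (vac W)
        rw [e2] at h2
        simp only [map_zero, LinearMap.zero_apply, smul_zero, sub_zero] at h2
        rw [sub_eq_iff_eq_add] at h2
        rw [h2]
        abel
      · rw [onVac_of_nonneg W (show 0 ≤ m + (-1 - ((0 : ℕ) : ℤ)) by simp; omega),
          onVac_of_nonneg W (show 0 ≤ m + (-1 - ((0 : ℕ) : ℤ)) by simp; omega),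
          onVac_of_nonneg W (show 0 ≤ m + (-1 - ((0 : ℕ) : ℤ)) by simp; omega)]
        -- for `m = 1` the first products remain, for `m ≥ 2` all terms vanish
        rcases (show 1 ≤ m by omega).eq_or_lt with rfl | h
        · have k1 : ∀ w, onVac W (W.md (1 + (-1 - ((0 : ℕ) : ℤ)) - 1) w) = ν W 0 w (vac W) :=
            fun w => onVac_creation W 0 w
          have k2 : ∀ w, onVac W (W.md (1 + (-1 - ((0 : ℕ) : ℤ)) + (-1 - ((0 : ℕ) : ℤ))) w) =
            ν W 0 w (vac W) := fun w => onVac_creation W 0 w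
          rw [k1, k1, k2, Int.cast_one, mode_one_neg_one, map_add, LinearMap.add_apply, ν_zero_mul]
          simp only [one_smul, map_zero, zero_add]
          abel
        · rw [onVac_of_nonneg W (show 0 ≤ m + (-1 - ((0 : ℕ) : ℤ)) - 1 by simp; omega),
            onVac_of_nonneg W (show 0 ≤ m + (-1 - ((0 : ℕ) : ℤ)) - 1 by simp; omega),
            onVac_of_nonneg W (show 0 ≤ m + (-1 - ((0 : ℕ) : ℤ)) + (-1 - ((0 : ℕ) : ℤ)) by
              simp; omega)]
          simp

/-- The action of the modes of generators on the envelope, as a linear map. -/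
def modeAction : W.Mode →ₗ[ℂ] Module.End ℂ W.Envelope :=
  (lift _ (isVacuum_onVac W)).flip

lemma modeAction_vac (l : W.Mode) : modeAction W l (vac W) = onVac W l := by
  simp [modeAction]

lemma modeAction_ν (l : W.Mode) (n : ℕ) (u : W.Gen) (x : W.Envelope) :
    modeAction W l (ν W n u x) =
      ν W n u (modeAction W l x) + modeAction W ⁅l, W.md (-1 - n) u⁆ x := by
  simp [modeAction, CreationModule.modeHom_apply]

lemma modeAction_creation (k : ℕ) (v : W.Gen) :
    modeAction W (W.md (-1 - k) v) = ν W k v := by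
  refine LinearMap.ext fun x => ?_
  induction x using induction generalizing k v with
  | vac => rw [modeAction_vac, onVac_creation]
  | zero => simp
  | add x y hx hy => rw [map_add, map_add, hx, hy]
  | smul c x hx => rw [map_smul, map_smul, hx]
  | creation n u x hx =>
    rw [modeAction_ν, lie_md, map_add, map_smul, LinearMap.add_apply, LinearMap.smul_apply,
      show -1 - (k : ℤ) + (-1 - n) = -1 - (k + n + 1 : ℕ) by push_cast; ring,
      show -1 - ((k + n + 1 : ℕ) : ℤ) - 1 = -1 - (k + n + 2 : ℕ) by push_cast; ring, hx, hx, hx]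
    have h1 := (creationModule W).comm k n v u x
    rw [sub_eq_iff_eq_add] at h1
    rw [h1]
    push_cast
    module

/-- The operators of the modes form a representation of their Lie algebra. If one of the modes is
a creation operator, this is the definition of the action; the Jacobi identity extends the
relation from a vector `x` to `u_(-1-n) x`, and on the vacuum two annihilation operators
both give zero. -/
lemma modeAction_lie (l l' : W.Mode) (x : W.Envelope) : modeAction W ⁅l, l'⁆ x =
    modeAction W l (modeAction W l' x) - modeAction W l' (modeAction W l x) := by
  have hν : ∀ (l : W.Mode) (k : ℕ) (v : W.Gen) (x : W.Envelope),
      modeAction W ⁅l, W.md (-1 - k) v⁆ x =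
        modeAction W l (modeAction W (W.md (-1 - k) v) x) -
          modeAction W (W.md (-1 - k) v) (modeAction W l x) := by
    intro l k v x
    rw [modeAction_creation, modeAction_ν]
    abel
  induction x using induction generalizing l l' with
  | zero => simp
  | add x y hx hy => simp only [map_add, hx, hy]; abel
  | smul c x hx => simp only [map_smul, hx, smul_sub]
  | creation n u x hx =>
    have h3 := congrArg (fun t => modeAction W t x) (lie_lie l l' (W.md (-1 - n) u))
    simp only [map_sub, LinearMap.sub_apply] at h3
    rw [hx l ⁅l', _⁆, hx l' ⁅l, _⁆] at h3
    rw [modeAction_ν, modeAction_ν, modeAction_ν, map_add, map_add, modeAction_ν, modeAction_ν,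
      hx l l', h3, map_sub]
    abel
  | vac =>
    induction l' using mode_induction_creation with
    | h0 => simp
    | hadd x y hx hy => simp only [lie_add, map_add, LinearMap.add_apply, hx, hy]; abel
    | neg k u => exact hν _ _ _ _
    | pos n v hn =>
    induction l using mode_induction_creation with
    | h0 => simp
    | hadd x y hx hy => simp only [add_lie, map_add, LinearMap.add_apply, hx, hy]; abel
    | neg k u =>
      rw [← lie_skew, map_neg, LinearMap.neg_apply, hν]
      abel
    | pos m u hm =>
      rw [modeAction_vac, modeAction_vac, modeAction_vac, onVac_of_nonneg W hn,
        onVac_of_nonneg W hm, lie_md, map_add, map_smul, onVac_of_nonneg W (add_nonneg hm hn)]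
      rcases hm.eq_or_lt with rfl | hm
      · simp
      · rw [onVac_of_nonneg W (by omega)]; simp

/-- The mode `u_(n)` of a generator `u`, acting on the envelope. -/
def μ (n : ℤ) : W.Gen →ₗ[ℂ] Module.End ℂ W.Envelope := modeAction W ∘ₗ W.md n

lemma μ_creation (k : ℕ) : μ W (-1 - k) = ν W k :=
  LinearMap.ext fun v => modeAction_creation W k v

lemma μ_vac_of_nonneg {n : ℤ} (h : 0 ≤ n) (u : W.Gen) : μ W n u (vac W) = 0 := by
  rw [μ, LinearMap.comp_apply, modeAction_vac, onVac_of_nonneg W h]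

lemma μ_comm (m n : ℤ) (u v : W.Gen) (x : W.Envelope) :
    μ W m u (μ W n v x) - μ W n v (μ W m u x) =
      μ W (m + n) (W.mode 0 u v) x + (m : ℂ) • μ W (m + n - 1) (W.mode 1 u v) x := by
  have h := modeAction_lie W (W.md m u) (W.md n v) x
  rw [lie_md, map_add, map_smul] at h
  exact h.symm

lemma trans_μ (n : ℤ) (u : W.Gen) (x : W.Envelope) : trans W (μ W n u x) =
    -(n : ℂ) • μ W (n - 1) u x + μ W n u (trans W x) := by
  have hν : ∀ (k : ℕ) u x, trans W (μ W (-1 - k) u x) =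
      -((-1 - (k : ℤ) : ℤ) : ℂ) • μ W (-1 - k - 1) u x + μ W (-1 - k) u (trans W x) := by
    intro k u x
    rw [show -1 - (k : ℤ) - 1 = -1 - (k + 1 : ℕ) by push_cast; ring, μ_creation, μ_creation,
      trans_ν]
    congr 2
    push_cast
    ring
  induction x using induction generalizing n u with
  | zero => simp
  | add x y hx hy => simp only [map_add, smul_add, hx, hy]; abel
  | smul c x hx => simp only [map_smul, hx, smul_add, smul_comm c]
  | vac =>
    rcases le_or_gt 0 n with h | h
    · rw [μ_vac_of_nonneg W h, trans_vac, map_zero, map_zero, add_zero]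
      rcases h.eq_or_lt with rfl | h
      · simp
      · rw [μ_vac_of_nonneg W (by omega), smul_zero]
    · obtain ⟨k, rfl⟩ : ∃ k : ℕ, n = -1 - k := ⟨(-1 - n).toNat, by omega⟩
      exact hν _ _ _
  | creation k v x hx =>
    rw [← μ_creation]
    set j : ℤ := -1 - k with hj
    have e1 := fun x => sub_eq_iff_eq_add.1 (μ_comm W n j u v x)
    have e2 := sub_eq_iff_eq_add.1 (μ_comm W (n - 1) j u v x)
    have e3 := sub_eq_iff_eq_add.1 (μ_comm W n (j - 1) u v x)
    have hj2 := hν k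
    rw [← hj] at hj2
    rw [e1, e2]
    simp only [map_add, map_smul, hx, hj2, smul_add, e1, e3]
    rw [show n + (j - 1) = n + j - 1 by ring, show n - 1 + j = n + j - 1 by ring]
    push_cast
    module

/-- The Hamiltonian and the modes of generators. -/
lemma ham_μ (n : ℤ) (u : W.Gen) (x : W.Envelope) : ham W (μ W n u x) =
    μ W n ((-(n : ℂ) - 1) • u + (0, u.2)) x + μ W n u (ham W x) := by
  have hν : ∀ (k : ℕ) u x, ham W (μ W (-1 - k) u x) =
      μ W (-1 - k) ((-((-1 - (k : ℤ) : ℤ) : ℂ) - 1) • u + (0, u.2)) x +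
        μ W (-1 - k) u (ham W x) := by
    intro k u x
    rw [μ_creation, ham_ν]
    congr 3
    obtain ⟨a, y⟩ := u
    simp only [genEnergy_mk, Prod.smul_mk, Prod.mk_add_mk]
    refine Prod.ext ?_ ?_ <;> push_cast <;> module
  induction x using induction generalizing n u with
  | zero => simp
  | add x y hx hy => simp only [map_add, hx, hy]; abel
  | smul c x hx => simp only [map_smul, hx, smul_add]
  | vac =>
    rcases le_or_gt 0 n with h | h
    · rw [μ_vac_of_nonneg W h, μ_vac_of_nonneg W h, ham_vac]
      simp
    · obtain ⟨k, rfl⟩ : ∃ k : ℕ, n = -1 - k := ⟨(-1 - n).toNat, by omega⟩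
      exact hν _ _ _
  | creation k v x hx =>
    rw [← μ_creation]
    set j : ℤ := -1 - k with hj
    have e1 := fun u v x => sub_eq_iff_eq_add.1 (μ_comm W n j u v x)
    have hj2 := hν k
    rw [← hj] at hj2
    rw [e1]
    have f0 : W.mode 0 (0, u.2) v + W.mode 0 u (0, v.2) =
        W.mode 0 u v + (0, (W.mode 0 u v).2) := by
      simp [mode_zero]; abel
    have f1 : W.mode 1 (0, u.2) v + W.mode 1 u (0, v.2) =
        (2 : ℂ) • W.mode 1 u v + (0, (W.mode 1 u v).2) := by
      simp [mode_one, two_smul]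
    simp only [map_add, map_smul, LinearMap.add_apply, LinearMap.smul_apply, hx, hj2, smul_add, e1]
    have g0 := congrArg (fun t => μ W (n + j) t x) f0
    have g1 := congrArg (fun t => μ W (n + j - 1) t x) f1
    simp only [map_add, map_smul, LinearMap.add_apply, LinearMap.smul_apply] at g0 g1
    push_cast
    linear_combination (norm := module) -g0 - (n : ℂ) • g1

end Envelope

end OneTruncatedVertexAlgebra

/-! ### Fields, their products and locality -/

namespace Fields

section bsum

variable {V : Type*} [AddCommGroup V] [Module ℂ V]

/-- A sequence which vanishes from some point on. -/
def EvZero (g : ℕ → V) : Prop := ∃ N, ∀ j, N ≤ j → g j = 0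

/-- The binomial sum `∑ ε^j (n choose j) g_j`, with `n ∈ ℤ`. -/
def bsum (ε : ℂ) (n : ℤ) (g : ℕ → V) : V := ∑ᶠ j : ℕ, (ε ^ j * (Ring.choose n j : ℂ)) • g j

lemma bsum_eq_sum (ε : ℂ) (n : ℤ) {g : ℕ → V} {N : ℕ} (h : ∀ j, N ≤ j → g j = 0) :
    bsum ε n g = ∑ j ∈ Finset.range N, (ε ^ j * (Ring.choose n j : ℂ)) • g j := by
  apply finsum_eq_sum_of_support_subset
  intro j hj
  by_contra hj2
  simp only [Finset.coe_range, Set.mem_Iio, not_lt] at hj2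
  exact hj (by simp [h j hj2])

lemma EvZero.add {V : Type*} [AddCommGroup V] {g g' : ℕ → V} (h : EvZero g) (h' : EvZero g') :
    EvZero (fun j => g j + g' j) := by
  obtain ⟨N, hN⟩ := h
  obtain ⟨N', hN'⟩ := h'
  exact ⟨max N N', fun j hj => by
    dsimp only
    rw [hN j (le_trans (le_max_left _ _) hj), hN' j (le_trans (le_max_right _ _) hj), add_zero]⟩

lemma EvZero.map {g : ℕ → V} (h : EvZero g) {V' : Type*} [AddCommGroup V'] [Module ℂ V']
    (f : V →ₗ[ℂ] V') : EvZero (fun j => f (g j)) := by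
  obtain ⟨N, hN⟩ := h
  exact ⟨N, fun j hj => by dsimp only; rw [hN j hj, map_zero]⟩

variable (ε : ℂ) (n : ℤ)

lemma bsum_add {g g' : ℕ → V} (h : EvZero g) (h' : EvZero g') :
    bsum ε n (fun j => g j + g' j) = bsum ε n g + bsum ε n g' := by
  obtain ⟨N, hN⟩ := h
  obtain ⟨N', hN'⟩ := h'
  have h1 : ∀ j, max N N' ≤ j → g j = 0 := fun j hj => hN j (le_trans (le_max_left _ _) hj)
  have h2 : ∀ j, max N N' ≤ j → g' j = 0 := fun j hj => hN' j (le_trans (le_max_right _ _) hj)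
  rw [bsum_eq_sum ε n h1, bsum_eq_sum ε n h2,
    bsum_eq_sum ε n (N := max N N') (fun j hj => by rw [h1 j hj, h2 j hj, add_zero]),
    ← Finset.sum_add_distrib]
  simp only [smul_add]

lemma bsum_map {g : ℕ → V} (h : EvZero g) {V' : Type*} [AddCommGroup V'] [Module ℂ V']
    (f : V →ₗ[ℂ] V') : bsum ε n (fun j => f (g j)) = f (bsum ε n g) := by
  obtain ⟨N, hN⟩ := h
  rw [bsum_eq_sum ε n hN, bsum_eq_sum ε n (N := N) (fun j hj => by rw [hN j hj, map_zero])]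
  simp

lemma bsum_smul {g : ℕ → V} (h : EvZero g) (c : ℂ) :
    bsum ε n (fun j => c • g j) = c • bsum ε n g :=
  bsum_map ε n h (c • LinearMap.id)

lemma bsum_sub {g g' : ℕ → V} (h : EvZero g) (h' : EvZero g') :
    bsum ε n (fun j => g j - g' j) = bsum ε n g - bsum ε n g' := by
  have h1 := bsum_add ε n h (h'.map (-LinearMap.id))
  rw [bsum_map ε n h'] at h1
  simpa [sub_eq_add_neg] using h1

@[simp]
lemma bsum_zero_fun : bsum ε n (fun _ => (0 : V)) = 0 := by simp [bsum]

lemma bsum_zero (g : ℕ → V) : bsum ε 0 g = g 0 := by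
  rw [bsum, finsum_eq_single _ 0]
  · simp
  · intro j hj
    simp [Ring.choose_zero_pos ℂ (Nat.pos_of_ne_zero hj)]

lemma bsum_eq_first {g : ℕ → V} (h : ∀ j, 1 ≤ j → g j = 0) : bsum ε n g = g 0 := by
  rw [bsum_eq_sum ε n h]
  simp

/-- Pascal's rule. -/
lemma bsum_succ {g : ℕ → V} (h : EvZero g) :
    bsum ε (n + 1) g = bsum ε n g + ε • bsum ε n (fun j => g (j + 1)) := by
  obtain ⟨N, hN⟩ := h
  have h1 : ∀ j, N + 1 ≤ j → g j = 0 := fun j hj => hN j (by omega)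
  rw [bsum_eq_sum _ _ h1, bsum_eq_sum _ _ h1,
    bsum_eq_sum ε n (g := fun j => g (j + 1)) (N := N) (fun j hj => h1 _ (by omega)),
    Finset.sum_range_succ', Finset.sum_range_succ', Finset.smul_sum]
  rw [add_right_comm, ← Finset.sum_add_distrib]
  congr 1
  · refine Finset.sum_congr rfl fun j _ => ?_
    rw [smul_smul, ← add_smul]
    congr 1
    push_cast
    rw [Ring.choose_succ_succ]
    ring
  · simp

end bsum

variable {V : Type*} [AddCommGroup V] [Module ℂ V]

/-- A sequence of operators `a_(n)` is a field if each vector is killed by `a_(n)` for `n`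
large. -/
def IsField (a : ℤ → Module.End ℂ V) : Prop := ∀ v, ∃ N : ℤ, ∀ n, N ≤ n → a n v = 0

/-- The solutions of the recursion satisfied by binomial sums are determined by their values at
`n = 0`, if they vanish for `k` large. -/
lemma eq_zero_of_rec {V : Type*} [AddCommGroup V] {E : ℤ → ℤ → ℤ → V} (h0 : ∀ m k, E m 0 k = 0)
    (hrec : ∀ m n k, E m (n + 1) k = E (m + 1) n k - E m n (k + 1))
    (hK : ∀ n, ∃ K : ℤ, ∀ m k, K ≤ k → E m n k = 0) (m n k : ℤ) : E m n k = 0 := by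
  induction n using Int.induction_on generalizing m k with
  | zero => exact h0 m k
  | succ n ih => rw [hrec, ih, ih, sub_zero]
  | pred n ih =>
    have h1 : ∀ m k, E m (-(n : ℤ) - 1) k = E (m - 1) (-(n : ℤ) - 1) (k + 1) := by
      intro m k
      have h := hrec (m - 1) (-(n : ℤ) - 1) k
      rw [sub_add_cancel, sub_add_cancel, ih] at h
      exact sub_eq_zero.1 h.symm
    have h2 : ∀ (p : ℕ) m k, E m (-(n : ℤ) - 1) k = E (m - p) (-(n : ℤ) - 1) (k + p) := by
      intro p
      induction p with
      | zero => simp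
      | succ p ihp =>
        intro m k
        rw [ihp, h1]
        push_cast
        congr 1 <;> ring
    obtain ⟨K, hK⟩ := hK (-(n : ℤ) - 1)
    rw [h2 (K - k).toNat]
    exact hK _ _ (by omega)

section halfProd

variable {a b : ℤ → Module.End ℂ V}

lemma IsField.evZero_right (hb : IsField b) (k : ℤ) (f : ℕ → Module.End ℂ V) (v : V) :
    EvZero (fun j : ℕ => f j (b (k + j) v)) := by
  obtain ⟨N, hN⟩ := hb v
  exact ⟨(N - k).toNat, fun j hj => by dsimp only; rw [hN _ (by omega), map_zero]⟩

/-- The expansion of `(z - w)^n a(z) b(w)` in the domain `|z| > |w|`. -/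
def halfProd (a b : ℤ → Module.End ℂ V) (m n k : ℤ) (v : V) : V :=
  bsum (-1) n (fun j => a (n + m - j) (b (k + j) v))

lemma halfProd_zero (m k : ℤ) (v : V) : halfProd a b m 0 k v = a m (b k v) := by
  rw [halfProd, bsum_zero]; simp

lemma halfProd_rec (hb : IsField b) (m n k : ℤ) (v : V) :
    halfProd a b m (n + 1) k v = halfProd a b (m + 1) n k v - halfProd a b m n (k + 1) v := by
  rw [halfProd, bsum_succ _ _ (hb.evZero_right k (fun j => a (n + 1 + m - j)) v), neg_one_smul,
    ← sub_eq_add_neg]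
  congr 1
  · rw [halfProd]; congr 1; ext j; congr 2; ring
  · rw [halfProd]; congr 1; ext j
    rw [show n + 1 + m - ((j + 1 : ℕ) : ℤ) = n + m - j by push_cast; ring,
      show k + ((j + 1 : ℕ) : ℤ) = k + 1 + j by push_cast; ring]

lemma halfProd_eq_zero {v : V} {K : ℤ} (hK : ∀ n, K ≤ n → b n v = 0) {m n k : ℤ} (h : K ≤ k) :
    halfProd a b m n k v = 0 := by
  rw [halfProd]
  simp [fun j : ℕ => hK (k + j) (by omega)]

lemma halfProd_eq_first {v : V} {m n k : ℤ} (hK : ∀ n, k < n → b n v = 0)  :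
    halfProd a b m n k v = a (n + m) (b k v) := by
  rw [halfProd, bsum_eq_first _ _ (fun j hj => by rw [hK _ (by omega), map_zero])]
  simp

lemma halfProd_add (hb : IsField b) (m n k : ℤ) (v w : V) :
    halfProd a b m n k (v + w) = halfProd a b m n k v + halfProd a b m n k w := by
  simp only [halfProd, map_add]
  exact bsum_add _ _ (hb.evZero_right k (fun j => a (n + m - j)) v)
    (hb.evZero_right k (fun j => a (n + m - j)) w)

lemma halfProd_smul (hb : IsField b) (m n k : ℤ) (c : ℂ) (v : V) :
    halfProd a b m n k (c • v) = c • halfProd a b m n k v := by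
  simp only [halfProd, map_smul]
  exact bsum_smul _ _ (hb.evZero_right k (fun j => a (n + m - j)) v) c

end halfProd

variable {a b c : ℤ → Module.End ℂ V}

/-- The coefficients of `(z - w)^n a(z) b(w) - (z - w)^n b(w) a(z)`, where the first term is
expanded in the domain `|z| > |w|` and the second one in `|w| > |z|`. -/
def comm (a b : ℤ → Module.End ℂ V) (m n k : ℤ) (v : V) : V :=
  halfProd a b m n k v - (-1 : ℂ) ^ n • halfProd b a k n m v

lemma comm_zero (m k : ℤ) (v : V) : comm a b m 0 k v = a m (b k v) - b k (a m v) := by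
  simp [comm, halfProd_zero]

lemma neg_one_zpow_succ (n : ℤ) : (-1 : ℂ) ^ (n + 1) = -(-1 : ℂ) ^ n := by
  rw [zpow_add₀ (by norm_num)]; simp

lemma neg_one_zpow_sq (n : ℤ) : (-1 : ℂ) ^ n * (-1 : ℂ) ^ n = 1 := by
  rw [← mul_zpow]; simp

lemma comm_rec (ha : IsField a) (hb : IsField b) (m n k : ℤ) (v : V) :
    comm a b m (n + 1) k v = comm a b (m + 1) n k v - comm a b m n (k + 1) v := by
  simp only [comm, halfProd_rec ha, halfProd_rec hb, neg_one_zpow_succ]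
  module

lemma comm_swap (m n k : ℤ) (v : V) : comm b a k n m v = -(-1 : ℂ) ^ n • comm a b m n k v := by
  simp only [comm, smul_sub, smul_smul, neg_mul, neg_one_zpow_sq]
  module

lemma comm_add (ha : IsField a) (hb : IsField b) (m n k : ℤ) (v w : V) :
    comm a b m n k (v + w) = comm a b m n k v + comm a b m n k w := by
  simp only [comm, halfProd_add ha, halfProd_add hb]
  module

lemma comm_smul (ha : IsField a) (hb : IsField b) (m n k : ℤ) (c : ℂ) (v : V) :
    comm a b m n k (c • v) = c • comm a b m n k v := by
  simp only [comm, halfProd_smul ha, halfProd_smul hb]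
  module

/-- Two fields are local if `(z - w)^N [a(z), b(w)] = 0` for some `N`. -/
def Local (a b : ℤ → Module.End ℂ V) : Prop := ∃ N : ℕ, ∀ m k v, comm a b m N k v = 0

lemma Local.symm (h : Local a b) : Local b a := by
  obtain ⟨N, hN⟩ := h
  exact ⟨N, fun m k v => by rw [comm_swap, hN, smul_zero]⟩

lemma comm_eq_zero_of_le (ha : IsField a) (hb : IsField b) {N : ℕ}
    (h : ∀ m k v, comm a b m N k v = 0) {n : ℤ} (hn : (N : ℤ) ≤ n) (m k : ℤ) (v : V) :
    comm a b m n k v = 0 := by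
  obtain ⟨p, rfl⟩ : ∃ p : ℕ, n = N + p := ⟨(n - N).toNat, by omega⟩
  induction p generalizing m k with
  | zero => simpa using h m k v
  | succ p ih =>
    push_cast
    rw [← add_assoc, comm_rec ha hb, ih _ _ (by omega), ih _ _ (by omega), sub_zero]

/-- The `n`-th product `a_(n) b` of two fields. -/
def nprod (ha : IsField a) (hb : IsField b) (n k : ℤ) : Module.End ℂ V where
  toFun v := comm a b 0 n k v
  map_add' := comm_add ha hb 0 n k
  map_smul' := comm_smul ha hb 0 n k

lemma nprod_apply (ha : IsField a) (hb : IsField b) (n k : ℤ) (v : V) :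
    nprod ha hb n k v = comm a b 0 n k v := rfl

lemma isField_nprod (ha : IsField a) (hb : IsField b) (n : ℤ) : IsField (nprod ha hb n) := by
  intro v
  obtain ⟨K, hK⟩ := hb v
  obtain ⟨J, hJ⟩ := ha v
  choose f hf using fun j : ℕ => hb (a j v)
  have h1 : ∃ L : ℤ, ∀ j : ℕ, j < J.toNat → f j ≤ L := by
    refine ⟨∑ i ∈ Finset.range J.toNat, |f i|, fun j hj => ?_⟩
    exact (le_abs_self _).trans (Finset.single_le_sum (f := fun i => |f i|)
      (fun i _ => abs_nonneg _) (Finset.mem_range.2 hj))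
  obtain ⟨L, hL⟩ := h1
  refine ⟨max K (L - n + J.toNat), fun k hk => ?_⟩
  rw [nprod_apply, comm, halfProd_eq_zero hK (le_trans (le_max_left _ _) hk), halfProd]
  have h2 : ∀ j : ℕ, b (n + k - j) (a (0 + j) v) = 0 := by
    intro j
    rw [zero_add]
    rcases lt_or_ge j J.toNat with h | h
    · refine hf j _ ?_
      have := hL j h
      have := le_trans (le_max_right _ _) hk
      omega
    · rw [hJ _ (by omega), map_zero]
  simp only [h2, bsum_zero_fun, smul_zero, sub_zero]

/-- The Borcherds identity for a pair of local fields. -/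
lemma bsum_nprod (ha : IsField a) (hb : IsField b) (h : Local a b) (m n k : ℤ) (v : V) :
    bsum 1 m (fun j => nprod ha hb (n + j) (m + k - j) v) = comm a b m n k v := by
  obtain ⟨N, hN⟩ := h
  have hN' := fun n hn => comm_eq_zero_of_le ha hb hN (n := n) hn
  have hev : ∀ m n k, EvZero (fun j : ℕ => nprod ha hb (n + j) (m + k - j) v) := fun m n k =>
    ⟨(N - n).toNat, fun j hj => hN' _ (by omega) _ _ _⟩
  have hrec : ∀ m n k, bsum 1 (m + 1) (fun j => nprod ha hb (n + j) (m + 1 + k - j) v) =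
      bsum 1 m (fun j => nprod ha hb (n + j) (m + (k + 1) - j) v) +
        bsum 1 m (fun j => nprod ha hb (n + 1 + j) (m + k - j) v) := by
    intro m n k
    rw [bsum_succ _ _ (hev (m + 1) n k), one_smul]
    congr 1
    · congr 1; ext j; congr 2; ring
    · congr 1; ext j
      rw [show n + ((j + 1 : ℕ) : ℤ) = n + 1 + j by push_cast; ring,
        show m + 1 + k - ((j + 1 : ℕ) : ℤ) = m + k - j by push_cast; ring]
  induction m using Int.induction_on generalizing n k with
  | zero =>
    rw [bsum_zero]
    simp [nprod_apply]
  | succ m ih =>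
    rw [hrec, ih, ih, comm_rec ha hb]
    abel
  | pred m ih =>
    have h1 := fun n k => hrec (-(m : ℤ) - 1) n k
    have h2 := fun n k => comm_rec ha hb (-(m : ℤ) - 1) n k v
    simp only [sub_add_cancel, ih] at h1 h2
    -- descending induction on `n`: both sides vanish for `n ≥ N`
    have h3 : ∀ p : ℕ, ∀ n k, (N : ℤ) ≤ n + p →
        bsum 1 (-(m : ℤ) - 1) (fun j => nprod ha hb (n + j) (-(m : ℤ) - 1 + k - j) v) =
          comm a b (-(m : ℤ) - 1) n k v := by
      intro p
      induction p with
      | zero =>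
        intro n k hn
        rw [hN' _ (by omega)]
        simp only [nprod_apply]
        rw [show (fun j : ℕ => comm a b 0 (n + j) (-(m : ℤ) - 1 + k - j) v) = fun _ => 0 from
          funext fun j => hN' _ (by omega) _ _ _, bsum_zero_fun]
      | succ p ihp =>
        intro n k hn
        have h4 := h1 n (k - 1)
        have h5 := h2 n (k - 1)
        rw [sub_add_cancel] at h4 h5
        rw [ihp (n + 1) (k - 1) (by push_cast at hn; omega), h5] at h4
        rw [← sub_eq_iff_eq_add] at h4
        rw [← h4]
        abel
    exact h3 (N - n).toNat n k (by omega)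

section Dong

/-- On formal distributions in `x, y, z`, given by their coefficients: multiplication by `x - y`. -/
def diffXY : Module.End ℂ (ℤ → ℤ → ℤ → V) where
  toFun F := fun l m k => F (l + 1) m k - F l (m + 1) k
  map_add' F G := by ext; simp; abel
  map_smul' c F := by ext; simp [smul_sub]

/-- Multiplication of formal distributions by `x - z`. -/
def diffXZ : Module.End ℂ (ℤ → ℤ → ℤ → V) where
  toFun F := fun l m k => F (l + 1) m k - F l m (k + 1)
  map_add' F G := by ext; simp; abel
  map_smul' c F := by ext; simp [smul_sub]

/-- Multiplication of formal distributions by `y - z`. -/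
def diffYZ : Module.End ℂ (ℤ → ℤ → ℤ → V) where
  toFun F := fun l m k => F l (m + 1) k - F l m (k + 1)
  map_add' F G := by ext; simp; abel
  map_smul' c F := by ext; simp [smul_sub]

lemma diffXY_commute : Commute (diffXY (V := V)) diffYZ := by
  ext F l m k
  simp only [Module.End.mul_apply, diffXY, diffYZ, LinearMap.coe_mk, AddHom.coe_mk]
  abel

lemma diff_add : diffXY (V := V) + diffYZ = diffXZ := by
  ext F l m k
  simp [diffXY, diffYZ, diffXZ]

lemma diffXY_comm {c a : ℤ → Module.End ℂ V} (hc : IsField c) (ha : IsField a) (p : ℤ)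
    (w : ℤ → ℤ → V) (hw : ∀ m k, w m k = w 0 k) (r : ℕ) :
    (diffXY ^ r) (fun l m k => comm c a l 0 (p + m) (w m k)) =
      fun l m k => comm c a l r (p + m) (w m k) := by
  induction r with
  | zero => simp
  | succ r ih =>
    rw [pow_succ', Module.End.mul_apply, ih]
    ext l m k
    push_cast
    simp only [diffXY, LinearMap.coe_mk, AddHom.coe_mk, comm_rec hc ha, hw (m + 1), hw m, add_assoc]

lemma diffXZ_comm {c a : ℤ → Module.End ℂ V} (hc : IsField c) (ha : IsField a) (p : ℤ)
    (w : ℤ → V) (r : ℕ) :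
    (diffXZ ^ r) (fun l m k => comm c a l 0 (p + k) (w m)) =
      fun l m k => comm c a l r (p + k) (w m) := by
  induction r with
  | zero => simp
  | succ r ih =>
    rw [pow_succ', Module.End.mul_apply, ih]
    ext l m k
    push_cast
    simp only [diffXZ, LinearMap.coe_mk, AddHom.coe_mk, comm_rec hc ha, add_assoc]

lemma pow_map_fun (D : Module.End ℂ (ℤ → ℤ → ℤ → V)) (f : ℤ → ℤ → Module.End ℂ V)
    (hD : ∀ F, D (fun l m k => f m k (F l m k)) = fun l m k => f m k (D F l m k)) (r : ℕ)
    (F : ℤ → ℤ → ℤ → V) :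
    (D ^ r) (fun l m k => f m k (F l m k)) = fun l m k => f m k ((D ^ r) F l m k) := by
  induction r with
  | zero => simp
  | succ r ih => simp only [pow_succ', Module.End.mul_apply, ih, hD]

lemma pow_bsum (D : Module.End ℂ (ℤ → ℤ → ℤ → V)) (n : ℤ)
    (hD : ∀ T : ℕ → ℤ → ℤ → ℤ → V, (∀ l m k, EvZero (fun j => T j l m k)) →
      (∀ l m k, EvZero (fun j => D (T j) l m k)) ∧
      D (fun l m k => bsum (-1) n (fun j => T j l m k)) =
        fun l m k => bsum (-1) n (fun j => D (T j) l m k)) (r : ℕ)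
    (T : ℕ → ℤ → ℤ → ℤ → V) (hT : ∀ l m k, EvZero (fun j => T j l m k)) :
    (∀ l m k, EvZero (fun j => (D ^ r) (T j) l m k)) ∧
    (D ^ r) (fun l m k => bsum (-1) n (fun j => T j l m k)) =
      fun l m k => bsum (-1) n (fun j => (D ^ r) (T j) l m k) := by
  induction r with
  | zero => exact ⟨hT, rfl⟩
  | succ r ih =>
    obtain ⟨h1, h2⟩ := hD _ ih.1
    refine ⟨by simpa only [pow_succ', Module.End.mul_apply] using h1, ?_⟩
    simp only [pow_succ', Module.End.mul_apply, ih.2, h2]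

lemma EvZero.sub {V : Type*} [AddCommGroup V] [Module ℂ V] {g g' : ℕ → V} (h : EvZero g)
    (h' : EvZero g') : EvZero (fun j => g j - g' j) := by
  simpa [sub_eq_add_neg] using h.add (h'.map (-LinearMap.id))

lemma diffXY_bsum (n : ℤ) (T : ℕ → ℤ → ℤ → ℤ → V) (hT : ∀ l m k, EvZero (fun j => T j l m k)) :
    (∀ l m k, EvZero (fun j => diffXY (T j) l m k)) ∧
      diffXY (fun l m k => bsum (-1) n (fun j => T j l m k)) =
        fun l m k => bsum (-1) n (fun j => diffXY (T j) l m k) :=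
  ⟨fun l m k => (hT _ _ _).sub (hT _ _ _), by
    ext l m k; exact (bsum_sub _ _ (hT _ _ _) (hT _ _ _)).symm⟩

lemma diffXZ_bsum (n : ℤ) (T : ℕ → ℤ → ℤ → ℤ → V) (hT : ∀ l m k, EvZero (fun j => T j l m k)) :
    (∀ l m k, EvZero (fun j => diffXZ (T j) l m k)) ∧
      diffXZ (fun l m k => bsum (-1) n (fun j => T j l m k)) =
        fun l m k => bsum (-1) n (fun j => diffXZ (T j) l m k) :=
  ⟨fun l m k => (hT _ _ _).sub (hT _ _ _), by
    ext l m k; exact (bsum_sub _ _ (hT _ _ _) (hT _ _ _)).symm⟩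

end Dong

end Fields

namespace Fields

variable {V : Type*} [AddCommGroup V] [Module ℂ V]
variable {a b c : ℤ → Module.End ℂ V}

lemma pow_two_stage (n : ℤ) (N : ℕ) (T : ℕ → ℤ → ℤ → ℤ → V)
    (hT : ∀ l m k, EvZero (fun j => T j l m k))
    (h : ∀ j, (diffXY ^ N * diffXZ ^ N : Module.End ℂ (ℤ → ℤ → ℤ → V)) (T j) = 0) :
    (diffXY ^ N * diffXZ ^ N : Module.End ℂ (ℤ → ℤ → ℤ → V))
      (fun l m k => bsum (-1) n (fun j => T j l m k)) = 0 := by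
  obtain ⟨h1, h2⟩ := pow_bsum diffXZ n (diffXZ_bsum n) N T hT
  obtain ⟨_, h3⟩ := pow_bsum diffXY n (diffXY_bsum n) N (fun j => (diffXZ ^ N) (T j)) h1
  rw [Module.End.mul_apply, h2, h3]
  ext l m k
  simp only [← Module.End.mul_apply, h]
  simp

/-- Dong's lemma: a field that is local with respect to two mutually local fields is local with
respect to their products. -/
lemma Local.nprod (ha : IsField a) (hb : IsField b) (hc : IsField c) (hab : Local a b)
    (hca : Local c a) (hcb : Local c b) (n : ℤ) : Local c (nprod ha hb n) := by
  obtain ⟨N₁, hN₁⟩ := hca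
  obtain ⟨N₂, hN₂⟩ := hcb
  obtain ⟨M, hM⟩ := hab
  set N := max N₁ N₂ with hN
  have hca : ∀ l k v, comm c a l N k v = 0 := fun l k v =>
    comm_eq_zero_of_le hc ha hN₁ (by simp [hN]) l k v
  have hcb : ∀ l k v, comm c b l N k v = 0 := fun l k v =>
    comm_eq_zero_of_le hc hb hN₂ (by simp [hN]) l k v
  set r := (M - n).toNat with hr
  refine ⟨N + r + N, fun l k v => ?_⟩
  have hXYXZ : Commute (diffXY (V := V)) diffXZ := by
    rw [← diff_add]
    exact (Commute.refl _).add_right diffXY_commute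
  have hYZXZ : Commute (diffYZ (V := V)) diffXZ := by
    rw [← diff_add]
    exact diffXY_commute.symm.add_right (Commute.refl _)
  let Q : ℤ → ℤ → ℤ → ℤ → V := fun n l m k =>
    c l (comm a b m n k v) - comm a b m n k (c l v)
  have hQ1 : ∀ n, diffYZ (Q n) = Q (n + 1) := by
    intro n
    ext l m k
    simp only [Q, diffYZ, LinearMap.coe_mk, AddHom.coe_mk, comm_rec ha hb, map_sub]
    abel
  have hQ2 : (diffYZ ^ r) (Q n) = 0 := by
    have h : ∀ r : ℕ, (diffYZ ^ r) (Q n) = Q (n + r) := by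
      intro r
      induction r with
      | zero => simp
      | succ r ih => rw [pow_succ', Module.End.mul_apply, ih, hQ1]; push_cast; rw [add_assoc]
    rw [h]
    ext l m k
    simp only [Q]
    rw [comm_eq_zero_of_le ha hb hM (by omega), comm_eq_zero_of_le ha hb hM (by omega)]
    simp
  -- the commutators with `a` are killed by a power of `diffXY`, those with `b` by one of `diffXZ`
  have hQ3 : (diffXY ^ N * diffXZ ^ N : Module.End ℂ (ℤ → ℤ → ℤ → V)) (Q n) = 0 := by
    let T : ℕ → ℤ → ℤ → ℤ → V := fun j l m k =>
      comm c a l 0 (n - j + m) (b (k + j) v) + a (n - j + m) (comm c b l 0 (j + k) v)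
    let T' : ℕ → ℤ → ℤ → ℤ → V := fun j l m k =>
      comm c b l 0 (n - j + k) (a (m + j) v) + b (n - j + k) (comm c a l 0 (j + m) v)
    have eT : ∀ j l m k, T j l m k = c l (a (n + m - j) (b (k + j) v)) -
        a (n + m - j) (b (k + j) (c l v)) := by
      intro j l m k
      simp only [T, comm_zero, map_sub, add_comm (j : ℤ) k, show n - j + m = n + m - j by ring]
      abel
    have eT' : ∀ j l m k, T' j l m k = c l (b (n + k - j) (a (m + j) v)) -
        b (n + k - j) (a (m + j) (c l v)) := by
      intro j l m k
      simp only [T', comm_zero, map_sub, add_comm (j : ℤ) m, show n - j + k = n + k - j by ring]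
      abel
    have evT : ∀ l m k, EvZero (fun j => T j l m k) := by
      intro l m k
      simp only [eT]
      exact ((hb.evZero_right k (fun j => a (n + m - j)) v).map (c l)).sub
        (hb.evZero_right k (fun j => a (n + m - j)) (c l v))
    have evT' : ∀ l m k, EvZero (fun j => T' j l m k) := by
      intro l m k
      simp only [eT']
      exact ((ha.evZero_right m (fun j => b (n + k - j)) v).map (c l)).sub
        (ha.evZero_right m (fun j => b (n + k - j)) (c l v))
    have hQ : Q n = (fun l m k => bsum (-1) n (fun j => T j l m k)) -
        (-1 : ℂ) ^ n • (fun l m k => bsum (-1) n (fun j => T' j l m k)) := by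
      ext l m k
      simp only [Q, Pi.sub_apply, Pi.smul_apply, eT, eT', comm, map_sub, map_smul, halfProd]
      rw [bsum_sub _ _ ((hb.evZero_right k (fun j => a (n + m - j)) v).map (c l))
        (hb.evZero_right k (fun j => a (n + m - j)) (c l v)),
        bsum_sub _ _ ((ha.evZero_right m (fun j => b (n + k - j)) v).map (c l))
        (ha.evZero_right m (fun j => b (n + k - j)) (c l v)),
        bsum_map _ _ (hb.evZero_right k (fun j => a (n + m - j)) v),
        bsum_map _ _ (ha.evZero_right m (fun j => b (n + k - j)) v)]
      simp only [smul_sub]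
      abel
    rw [hQ, map_sub, map_smul, pow_two_stage n N T evT, pow_two_stage n N T' evT', smul_zero,
      sub_zero]
    · intro j
      have e : T' j = (fun l m k => comm c b l 0 (n - j + k) (a (m + j) v)) +
        (fun l m k => b (n - j + k) (comm c a l 0 (j + m) v)) := rfl
      rw [e, map_add, Module.End.mul_apply, diffXZ_comm hc hb (n - j) (fun m => a (m + j) v),
        (hXYXZ.pow_pow N N).eq, Module.End.mul_apply,
        pow_map_fun diffXY (fun m k => b (n - j + k)) (fun F => by
          ext l m k; simp [diffXY]) N (fun l m k => comm c a l 0 (j + m) v),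
        diffXY_comm hc ha j (fun _ _ => v) (fun _ _ => rfl)]
      simp only [hca, hcb, map_zero]
      have e0 : (fun _ _ _ => 0 : ℤ → ℤ → ℤ → V) = 0 := rfl
      simp only [e0, map_zero, add_zero]
    · intro j
      have e : T j = (fun l m k => comm c a l 0 (n - j + m) (b (k + j) v)) +
        (fun l m k => a (n - j + m) (comm c b l 0 (j + k) v)) := rfl
      rw [e, map_add, Module.End.mul_apply, Module.End.mul_apply,
        pow_map_fun diffXZ (fun m k => a (n - j + m)) (fun F => by
          ext l m k; simp [diffXZ]) N (fun l m k => comm c b l 0 (j + k) v),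
        diffXZ_comm hc hb j (fun _ => v), ← Module.End.mul_apply, (hXYXZ.pow_pow N N).eq,
        Module.End.mul_apply,
        diffXY_comm hc ha (n - j) (fun _ k => b (k + j) v) (fun _ _ => rfl)]
      simp only [hca, hcb, map_zero]
      have e0 : (fun _ _ _ => 0 : ℤ → ℤ → ℤ → V) = 0 := rfl
      simp only [e0, map_zero, add_zero]
  have hQ4 : (diffXZ ^ (N + r + N)) (Q n) = 0 := by
    rw [pow_add, Module.End.mul_apply]
    conv_lhs => rw [← diff_add, diffXY_commute.add_pow, diff_add]
    rw [LinearMap.sum_apply]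
    refine Finset.sum_eq_zero fun i _ => ?_
    rw [← nsmul_eq_mul', LinearMap.smul_apply]
    refine (congrArg _ ?_).trans (smul_zero _)
    rcases le_or_gt N i with h | h
    · rw [(diffXY_commute.pow_pow i _).eq, show i = i - N + N by omega, pow_add]
      simp only [Module.End.mul_apply] at hQ3 ⊢
      rw [hQ3]
      simp
    · rw [show N + r - i = N - i + r by omega, pow_add]
      simp only [Module.End.mul_apply]
      rw [← Module.End.mul_apply (diffYZ ^ r), (hYZXZ.pow_pow r N).eq, Module.End.mul_apply, hQ2]
      simp
  have hcomm : ∀ (R : ℕ) l k, (diffXZ ^ R) (Q n) l 0 k =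
      comm c (Fields.nprod ha hb n) l R k v := by
    intro R
    induction R with
    | zero =>
      intro l k
      rw [pow_zero, Nat.cast_zero, comm_zero]
      rfl
    | succ R ih =>
      intro l k
      rw [pow_succ', Module.End.mul_apply]
      simp only [diffXZ, LinearMap.coe_mk, AddHom.coe_mk] at ih ⊢
      rw [ih, ih]
      push_cast
      rw [comm_rec hc (isField_nprod ha hb n)]
  rw [← hcomm, hQ4]
  rfl

lemma isField_add (ha : IsField a) (hb : IsField b) : IsField (a + b) := by
  intro v
  obtain ⟨N, hN⟩ := ha v
  obtain ⟨N', hN'⟩ := hb v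
  exact ⟨max N N', fun n hn => by
    rw [Pi.add_apply, LinearMap.add_apply, hN n (le_trans (le_max_left _ _) hn),
      hN' n (le_trans (le_max_right _ _) hn), add_zero]⟩

lemma isField_smul (ha : IsField a) (t : ℂ) : IsField (t • a) := by
  intro v
  obtain ⟨N, hN⟩ := ha v
  exact ⟨N, fun n hn => by rw [Pi.smul_apply, LinearMap.smul_apply, hN n hn, smul_zero]⟩

lemma halfProd_add_left (hc : IsField c) (m n k : ℤ) (v : V) :
    halfProd (a + b) c m n k v = halfProd a c m n k v + halfProd b c m n k v :=
  bsum_add _ _ (hc.evZero_right k (fun j => a (n + m - j)) v)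
    (hc.evZero_right k (fun j => b (n + m - j)) v)

lemma halfProd_add_right (ha : IsField a) (hb : IsField b) (m n k : ℤ) (v : V) :
    halfProd c (a + b) m n k v = halfProd c a m n k v + halfProd c b m n k v := by
  simp only [halfProd, Pi.add_apply, LinearMap.add_apply, map_add]
  exact bsum_add _ _ (ha.evZero_right k (fun j => c (n + m - j)) v)
    (hb.evZero_right k (fun j => c (n + m - j)) v)

lemma halfProd_smul_left (hc : IsField c) (m n k : ℤ) (t : ℂ) (v : V) :
    halfProd (t • a) c m n k v = t • halfProd a c m n k v :=
  bsum_smul _ _ (hc.evZero_right k (fun j => a (n + m - j)) v) t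

lemma halfProd_smul_right (ha : IsField a) (m n k : ℤ) (t : ℂ) (v : V) :
    halfProd c (t • a) m n k v = t • halfProd c a m n k v := by
  simp only [halfProd, Pi.smul_apply, LinearMap.smul_apply, map_smul]
  exact bsum_smul _ _ (ha.evZero_right k (fun j => c (n + m - j)) v) t

lemma comm_add_right (ha : IsField a) (hb : IsField b) (hc : IsField c) (m n k : ℤ) (v : V) :
    comm c (a + b) m n k v = comm c a m n k v + comm c b m n k v := by
  simp only [comm, halfProd_add_right ha hb, halfProd_add_left hc]
  module

lemma comm_smul_right (ha : IsField a) (hc : IsField c) (t : ℂ) (m n k : ℤ) (v : V) :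
    comm c (t • a) m n k v = t • comm c a m n k v := by
  simp only [comm, halfProd_smul_right ha, halfProd_smul_left hc]
  module

lemma Local.add (ha : IsField a) (hb : IsField b) (hc : IsField c) (hca : Local c a)
    (hcb : Local c b) : Local c (a + b) := by
  obtain ⟨N₁, hN₁⟩ := hca
  obtain ⟨N₂, hN₂⟩ := hcb
  refine ⟨max N₁ N₂, fun m k v => ?_⟩
  rw [comm_add_right ha hb hc, comm_eq_zero_of_le hc ha hN₁ (by simp),
    comm_eq_zero_of_le hc hb hN₂ (by simp), add_zero]

lemma Local.smul (ha : IsField a) (hc : IsField c) (hca : Local c a) (t : ℂ) :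
    Local c (t • a) := by
  obtain ⟨N, hN⟩ := hca
  exact ⟨N, fun m k v => by rw [comm_smul_right ha hc, hN, smul_zero]⟩

/-- Translation of a product of fields. -/
lemma halfProd_trans {D : Module.End ℂ V} (hb : IsField b)
    (hDa : ∀ n v, D (a n v) = -(n : ℂ) • a (n - 1) v + a n (D v))
    (hDb : ∀ n v, D (b n v) = -(n : ℂ) • b (n - 1) v + b n (D v)) (m n k : ℤ) (v : V) :
    D (halfProd a b m n k v) = -(m : ℂ) • halfProd a b (m - 1) n k v -
      (k : ℂ) • halfProd a b m n (k - 1) v + halfProd a b m n k (D v) := by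
  rw [← sub_eq_zero]
  refine eq_zero_of_rec (E := fun m n k => D (halfProd a b m n k v) -
    (-(m : ℂ) • halfProd a b (m - 1) n k v -
      (k : ℂ) • halfProd a b m n (k - 1) v + halfProd a b m n k (D v))) ?_ ?_ ?_ m n k
  · intro m k
    simp only [halfProd_zero, hDa, hDb, map_add, map_smul]
    module
  · intro m n k
    simp only [halfProd_rec hb, map_sub, sub_add_cancel, add_sub_cancel_right]
    push_cast
    module
  · intro n
    obtain ⟨K, hK⟩ := hb v
    obtain ⟨K', hK'⟩ := hb (D v)
    refine ⟨max (K + 1) K', fun m k hk => ?_⟩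
    have h1 := le_trans (le_max_left _ _) hk
    have h2 := le_trans (le_max_right _ _) hk
    rw [halfProd_eq_zero hK (by omega), halfProd_eq_zero hK (by omega),
      halfProd_eq_zero hK (by omega), halfProd_eq_zero hK' h2]
    simp

/-- The Hamiltonian and a product of fields. -/
lemma halfProd_ham {H : Module.End ℂ V} {a' b' : ℤ → Module.End ℂ V} (hb : IsField b)
    (hb' : IsField b')
    (hHa : ∀ n v, H (a n v) = (-(n : ℂ) - 1) • a n v + a' n v + a n (H v))
    (hHb : ∀ n v, H (b n v) = (-(n : ℂ) - 1) • b n v + b' n v + b n (H v)) (m n k : ℤ) (v : V) :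
    H (halfProd a b m n k v) = (-(m : ℂ) - n - k - 2) • halfProd a b m n k v +
      halfProd a' b m n k v + halfProd a b' m n k v + halfProd a b m n k (H v) := by
  rw [← sub_eq_zero]
  refine eq_zero_of_rec (E := fun m n k => H (halfProd a b m n k v) -
    ((-(m : ℂ) - n - k - 2) • halfProd a b m n k v +
      halfProd a' b m n k v + halfProd a b' m n k v + halfProd a b m n k (H v))) ?_ ?_ ?_ m n k
  · intro m k
    simp only [halfProd_zero, hHa, hHb, map_add, map_smul]
    push_cast
    module
  · intro m n k
    simp only [halfProd_rec hb, halfProd_rec hb', map_sub]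
    push_cast
    module
  · intro n
    obtain ⟨K, hK⟩ := hb v
    obtain ⟨K', hK'⟩ := hb (H v)
    obtain ⟨K'', hK''⟩ := hb' v
    refine ⟨max (max K K') K'', fun m k hk => ?_⟩
    have h1 := le_trans (le_max_left _ _) hk
    have h2 := le_trans (le_max_right _ _) hk
    have h3 := le_trans (le_max_left _ _) h1
    have h4 := le_trans (le_max_right _ _) h1
    rw [halfProd_eq_zero hK h3, halfProd_eq_zero hK h3, halfProd_eq_zero hK'' h2,
      halfProd_eq_zero hK' h4]
    simp

/-! ### Reconstruction of a vertex algebra from generating fields -/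

/-- A family of mutually local, translation covariant fields which generates the space `V` from
the vacuum vector. -/
structure IsGenerating {ι : Type*} (gen : ι → ℤ → Module.End ℂ V) (vac : V)
    (D : Module.End ℂ V) : Prop where
  field : ∀ i, IsField (gen i)
  vac_of_nonneg : ∀ i n, 0 ≤ n → gen i n vac = 0
  trans : ∀ i n v, D (gen i n v) = -(n : ℂ) • gen i (n - 1) v + gen i n (D v)
  trans_vac : D vac = 0
  loc : ∀ i j, Local (gen i) (gen j)
  span : ∀ S : Submodule ℂ V, vac ∈ S → (∀ i n x, x ∈ S → gen i n x ∈ S) → S = ⊤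

namespace IsGenerating

variable {ι : Type*} {gen : ι → ℤ → Module.End ℂ V} {vac : V} {D : Module.End ℂ V}
variable (G : IsGenerating gen vac D)

/-- The fields which are translation covariant, well defined on the vacuum and local with respect
to the generating ones: these are the fields of the vertex algebra. -/
def vertexFields : Submodule ℂ (ℤ → Module.End ℂ V) where
  carrier := {φ | IsField φ ∧ (∀ n, 0 ≤ n → φ n vac = 0) ∧
    (∀ n v, D (φ n v) = -(n : ℂ) • φ (n - 1) v + φ n (D v)) ∧ ∀ i, Local (gen i) φ}
  add_mem' := fun {φ ψ} ⟨h1, h2, h3, h4⟩ ⟨h1', h2', h3', h4'⟩ =>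
    ⟨isField_add h1 h1', fun n hn => by simp [h2 n hn, h2' n hn], fun n v => by
      simp only [Pi.add_apply, LinearMap.add_apply, map_add, h3, h3']; module,
      fun i => (h4 i).add h1 h1' (G.field i) (h4' i)⟩
  zero_mem' := ⟨fun v => ⟨0, fun n _ => rfl⟩, fun n _ => rfl, fun n v => by simp, fun i =>
    ⟨0, fun m k v => by simp [comm_zero]⟩⟩
  smul_mem' := fun t φ ⟨h1, h2, h3, h4⟩ =>
    ⟨isField_smul h1 t, fun n hn => by simp [h2 n hn], fun n v => by
      simp only [Pi.smul_apply, LinearMap.smul_apply, map_smul, h3]; module,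
      fun i => (h4 i).smul h1 (G.field i) t⟩

end IsGenerating

end Fields

namespace Fields

/-- The field of the vacuum vector. -/
def idField (V : Type*) [AddCommGroup V] [Module ℂ V] (n : ℤ) : Module.End ℂ V :=
  if n = -1 then LinearMap.id else 0

namespace IsGenerating

variable {V : Type*} [AddCommGroup V] [Module ℂ V]
variable {ι : Type*} {gen : ι → ℤ → Module.End ℂ V} {vac : V} {D : Module.End ℂ V}
variable (G : IsGenerating gen vac D)

lemma idField_mem : idField V ∈ G.vertexFields := by
  refine ⟨fun v => ⟨0, fun n hn => ?_⟩, fun n hn => ?_, fun n v => ?_,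
    fun i => ⟨0, fun m k v => ?_⟩⟩
  · rw [idField, if_neg (by omega)]; rfl
  · rw [idField, if_neg (by omega)]; rfl
  · simp only [idField]
    by_cases h : n = -1
    · subst h; simp
    · by_cases h0 : n = 0
      · subst h0; simp
      · rw [if_neg h, if_neg (by omega)]; simp
  · rw [Nat.cast_zero, comm_zero, idField]
    split_ifs <;> simp

lemma gen_mem (i : ι) : gen i ∈ G.vertexFields :=
  ⟨G.field i, G.vac_of_nonneg i, G.trans i, fun j => G.loc j i⟩

variable {G}
variable {a b : ℤ → Module.End ℂ V}

lemma nprod_mem (ha : a ∈ G.vertexFields) (hb : b ∈ G.vertexFields) (h : Local a b) (n : ℤ) :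
    nprod ha.1 hb.1 n ∈ G.vertexFields := by
  refine ⟨isField_nprod _ _ _, fun k hk => ?_, fun k v => ?_, fun i =>
    Local.nprod ha.1 hb.1 (G.field i) h (ha.2.2.2 i) (hb.2.2.2 i) n⟩
  · rw [nprod_apply, comm, halfProd_eq_zero hb.2.1 hk, halfProd_eq_zero ha.2.1 le_rfl]
    simp
  · simp only [nprod_apply, comm, map_sub, map_smul, halfProd_trans hb.1 ha.2.2.1 hb.2.2.1,
      halfProd_trans ha.1 hb.2.2.1 ha.2.2.1]
    push_cast
    module

lemma nprod_vac (ha : a ∈ G.vertexFields) (hb : b ∈ G.vertexFields) (n : ℤ) :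
    nprod ha.1 hb.1 n (-1) vac = a n (b (-1) vac) := by
  rw [nprod_apply, comm, halfProd_eq_zero ha.2.1 le_rfl,
    halfProd_eq_first (fun k hk => hb.2.1 k (by omega))]
  simp

/-- A vertex field that vanishes on the vacuum in the lowest degree vanishes. -/
lemma eq_zero_of_vac (hb : b ∈ G.vertexFields) (h : b (-1) vac = 0) : b = 0 := by
  have h1 : ∀ k : ℕ, b (-1 - k) vac = 0 := by
    intro k
    induction k with
    | zero => simpa using h
    | succ k ih =>
      have h2 := hb.2.2.1 (-1 - k) vac
      rw [G.trans_vac, map_zero, ih, map_zero, add_zero] at h2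
      have h3 : -((-1 - (k : ℤ) : ℤ) : ℂ) ≠ 0 := by
        rw [neg_ne_zero]; norm_cast; omega
      rw [show -1 - ((k + 1 : ℕ) : ℤ) = -1 - (k : ℤ) - 1 by push_cast; ring]
      exact (smul_eq_zero.1 h2.symm).resolve_left h3
  have h2 : ∀ n, b n vac = 0 := by
    intro n
    rcases le_or_gt 0 n with hn | hn
    · exact hb.2.1 n hn
    · obtain ⟨k, rfl⟩ : ∃ k : ℕ, n = -1 - k := ⟨(-1 - n).toNat, by omega⟩
      exact h1 k
  let S : Submodule ℂ V := ⨅ n, LinearMap.ker (b n)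
  have hS : S = ⊤ := by
    refine G.span S (by simpa [S] using h2) fun i m w hw => ?_
    have hw : ∀ n, b n w = 0 := by simpa [S] using hw
    obtain ⟨N, hN⟩ := hb.2.2.2 i
    obtain ⟨K, hK⟩ := G.field i w
    -- descending induction on the mode of the generator
    have key : ∀ p : ℕ, ∀ m, K ≤ m + p → ∀ n, b n (gen i m w) = 0 := by
      intro p
      induction p with
      | zero => intro m hm n; rw [hK m (by omega), map_zero]
      | succ p ih =>
        intro m hm n
        have h3 := hN m (n - N) w
        rw [comm, halfProd_eq_zero (K := n - N) (fun n _ => hw n) le_rfl, zero_sub, neg_eq_zero,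
          smul_eq_zero_iff_right (zpow_ne_zero _ (by norm_num)), halfProd,
          bsum_eq_first _ _ (fun j hj => ih _ (by push_cast at hm; omega) _)] at h3
        simpa using h3
    have := key (K - m).toNat m (by omega)
    simpa [S] using this
  ext n v
  have : v ∈ S := hS ▸ Submodule.mem_top
  simpa using (by simpa [S] using this : ∀ n, b n v = 0) n

variable (G)

/-- Evaluation of vertex fields on the vacuum. -/
def evVac : G.vertexFields →ₗ[ℂ] V :=
  LinearMap.applyₗ vac ∘ₗ LinearMap.proj (-1) ∘ₗ G.vertexFields.subtype

lemma evVac_bijective : Function.Bijective G.evVac := by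
  refine ⟨?_, ?_⟩
  · rw [← LinearMap.ker_eq_bot, LinearMap.ker_eq_bot']
    intro φ h
    exact Subtype.ext (eq_zero_of_vac φ.2 h)
  · rw [← LinearMap.range_eq_top]
    refine G.span _ ⟨⟨_, G.idField_mem⟩, by simp [evVac, idField]⟩ ?_
    rintro i n _ ⟨φ, rfl⟩
    exact ⟨⟨_, nprod_mem (G.gen_mem i) φ.2 (φ.2.2.2.2 i) n⟩, nprod_vac (G.gen_mem i) φ.2 n⟩

/-- The state-field correspondence. -/
def stateField : V →ₗ[ℂ] G.vertexFields :=
  (LinearEquiv.ofBijective G.evVac G.evVac_bijective).symm.toLinearMap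

/-- The operation `a_(n) b` on states. -/
def op (n : ℤ) : V →ₗ[ℂ] Module.End ℂ V :=
  LinearMap.proj n ∘ₗ G.vertexFields.subtype ∘ₗ G.stateField

lemma op_mem (a : V) : (fun n => G.op n a) ∈ G.vertexFields := (G.stateField a).2

lemma op_neg_one_vac (a : V) : G.op (-1) a vac = a :=
  (LinearEquiv.ofBijective G.evVac G.evVac_bijective).apply_symm_apply a

lemma eq_op {φ : ℤ → Module.End ℂ V} (h : φ ∈ G.vertexFields) {a : V} (ha : φ (-1) vac = a) :
    (fun n => G.op n a) = φ := by
  have h1 : (⟨φ, h⟩ : G.vertexFields) = G.stateField a :=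
    G.evVac_bijective.1 (ha.trans (G.op_neg_one_vac a).symm)
  exact (congrArg Subtype.val h1).symm

lemma op_vac' : (fun n => G.op n vac) = idField V :=
  G.eq_op G.idField_mem (by simp [idField])

lemma op_gen (i : ι) : (fun n => G.op n (gen i (-1) vac)) = gen i := G.eq_op (G.gen_mem i) rfl

lemma op_op {a b : V} (h : Local (fun n => G.op n a) (fun n => G.op n b)) (n : ℤ) :
    (fun k => G.op k (G.op n a b)) = nprod (G.op_mem a).1 (G.op_mem b).1 n :=
  G.eq_op (nprod_mem (G.op_mem a) (G.op_mem b) h n) (by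
    rw [nprod_vac (G.op_mem a) (G.op_mem b), op_neg_one_vac])

lemma op_gen_apply (i : ι) (b : V) (n : ℤ) :
    (fun k => G.op k (gen i n b)) = nprod (G.field i) (G.op_mem b).1 n :=
  G.eq_op (nprod_mem (G.gen_mem i) (G.op_mem b) ((G.op_mem b).2.2.2 i) n) (by
    rw [nprod_vac (G.gen_mem i) (G.op_mem b), op_neg_one_vac])

lemma induction (G : IsGenerating gen vac D) {p : V → Prop} (hvac : p vac)
    (hzero : p 0) (hadd : ∀ x y, p x → p y → p (x + y))
    (hsmul : ∀ (c : ℂ) x, p x → p (c • x)) (hgen : ∀ i n x, p x → p (gen i n x)) (x : V) : p x := by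
  let S : Submodule ℂ V :=
    { carrier := {x | p x}
      add_mem' := fun hx hy => hadd _ _ hx hy
      zero_mem' := hzero
      smul_mem' := fun c x hx => hsmul c x hx }
  have hS : S = ⊤ := G.span S hvac hgen
  have h : x ∈ S := hS ▸ Submodule.mem_top
  exact h

lemma op_local (a b : V) : Local (fun n => G.op n a) (fun n => G.op n b) := by
  apply Local.symm
  induction a using G.induction with
  | hvac =>
    refine ⟨0, fun m k v => ?_⟩
    rw [Nat.cast_zero, comm_zero, congrFun G.op_vac' k, idField]
    split_ifs <;> simp
  | hzero => exact ⟨0, fun m k v => by simp [comm_zero]⟩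
  | hadd x y hx hy =>
    have h := hx.add (G.op_mem x).1 (G.op_mem y).1 (G.op_mem b).1 hy
    convert h using 1
    ext n : 1
    simp
  | hsmul c x hx =>
    have h := hx.smul (G.op_mem x).1 (G.op_mem b).1 c
    convert h using 1
    ext n : 1
    simp
  | hgen i n x hx =>
    rw [op_gen_apply]
    exact Local.nprod _ _ (G.op_mem b).1 ((G.op_mem x).2.2.2 i) ((G.op_mem b).2.2.2 i).symm hx n

/-- The vertex algebra generated by a family of mutually local fields. -/
def vertexAlgebra {V : Type u} [AddCommGroup V] [Module ℂ V]
    {ι : Type*} {gen : ι → ℤ → Module.End ℂ V} {vac : V} {D : Module.End ℂ V}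
    (G : IsGenerating gen vac D) : VertexAlgebra.{u} where
  carrier := V
  vac := vac
  op := G.op
  field a b := by
    obtain ⟨N, hN⟩ := (G.op_mem a).1 b
    exact ⟨N, hN⟩
  vac_op n a := by
    rw [congrFun G.op_vac' n, idField]
    split_ifs <;> rfl
  op_vac n a hn := (G.op_mem a).2.1 n hn
  op_neg_one_vac := G.op_neg_one_vac
  borcherds m n k a b c := by
    have h := bsum_nprod (G.op_mem a).1 (G.op_mem b).1 (G.op_local a b) m n k c
    have h2 : ∀ n k, nprod (G.op_mem a).1 (G.op_mem b).1 n k = G.op k (G.op n a b) :=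
      fun n k => (congrFun (G.op_op (G.op_local a b) n) k).symm
    simp only [h2, bsum, one_pow, one_mul] at h
    rw [h, comm, halfProd, halfProd, bsum, bsum]
    congr 1
    rw [smul_finsum']
    · congr 1
      ext j
      rw [smul_smul, zpow_add₀ (by norm_num), zpow_natCast]
      congr 1
      ring
    · obtain ⟨N, hN⟩ := (G.op_mem a).1.evZero_right m (fun j => G.op (n + k - j) b) c
      refine (Set.finite_lt_nat N).subset fun j hj => ?_
      by_contra hj2
      exact hj (by
        have := hN j (by simpa using hj2)
        simp only at this ⊢
        rw [this, smul_zero])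

lemma ham_op {H : Module.End ℂ V} (σ : ι → ι) (hvac : H vac = 0)
    (hH : ∀ i n x, H (gen i n x) = (-(n : ℂ) - 1) • gen i n x + gen (σ i) n x + gen i n (H x))
    (a : V) (n : ℤ) (b : V) :
    H (G.op n a b) = (-(n : ℂ) - 1) • G.op n a b + G.op n (H a) b + G.op n a (H b) := by
  induction a using G.induction generalizing n b with
  | hvac =>
    rw [hvac, congrFun G.op_vac' n, idField]
    split_ifs with h
    · subst h; simp
    · simp
  | hzero => simp
  | hadd x y hx hy => simp only [map_add, LinearMap.add_apply, hx, hy]; module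
  | hsmul c x hx => simp only [map_smul, LinearMap.smul_apply, hx]; module
  | hgen i p x hx =>
    have e1 : ∀ i x n, G.op n (gen i p x) = nprod (G.field i) (G.op_mem x).1 p n :=
      fun i x n => congrFun (G.op_gen_apply i x p) n
    have hx' := fun n v => hx n v
    simp only [hH, map_add, map_smul, LinearMap.add_apply, LinearMap.smul_apply, e1, nprod_apply,
      comm, map_sub,
      halfProd_ham (G.op_mem x).1 (G.op_mem (H x)).1 (fun n v => hH i n v) hx',
      halfProd_ham (G.field i) (G.field (σ i)) hx' (fun n v => hH i n v)]
    push_cast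
    module

end IsGenerating

end Fields

/-! ### Consequences of the Borcherds identity -/

namespace VertexAlgebra

variable (V : VertexAlgebra.{u})

lemma ringChoose_neg_one (j : ℕ) : Ring.choose (-1 : ℂ) j = (-1) ^ j := by
  induction j with
  | zero => simp
  | succ j ih =>
    have h := Ring.choose_succ_succ (-1 : ℂ) j
    rw [neg_add_cancel, Ring.choose_zero_succ, ih] at h
    rw [pow_succ]
    linear_combination -h

lemma ringChoose_neg_two (j : ℕ) : Ring.choose (-2 : ℂ) j = (-1) ^ j * (j + 1) := by
  induction j with
  | zero => simp
  | succ j ih =>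
    have h := Ring.choose_succ_succ (-2 : ℂ) j
    rw [show (-2 : ℂ) + 1 = -1 by norm_num, ringChoose_neg_one, ih] at h
    push_cast
    linear_combination -h

lemma isField (a : V.carrier) : Fields.IsField (fun n => V.op n a) := V.field a

lemma op_op (n k : ℤ) (a b c : V.carrier) :
    V.op k (V.op n a b) c = Fields.comm (fun n => V.op n a) (fun n => V.op n b) 0 n k c := by
  have h := V.borcherds 0 n k a b c
  rw [finsum_eq_single _ 0 (by
    intro j hj
    simp [Ring.choose_zero_pos ℂ (Nat.pos_of_ne_zero hj)])] at h
  simp only [Int.cast_zero, Ring.choose_zero_right, one_smul, zero_add, Nat.cast_zero, sub_zero,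
    add_zero] at h
  rw [h, Fields.comm, Fields.halfProd, Fields.halfProd, Fields.bsum, Fields.bsum]
  simp only [add_zero, zero_add]
  congr 1
  rw [smul_finsum']
  · congr 1
    ext j
    rw [smul_smul, zpow_add₀ (by norm_num), zpow_natCast]
    congr 1
    ring
  · obtain ⟨N, hN⟩ := (V.isField a).evZero_right 0 (fun j => V.op (n + k - j) b) c
    refine (Set.finite_lt_nat N).subset fun j hj => ?_
    by_contra hj2
    exact hj (by
      have := hN j (by simpa using hj2)
      simp only [zero_add] at this ⊢
      rw [this, smul_zero])

/-- The commutator formula, when all but the first two products vanish. -/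
lemma commutator {a b : V.carrier} (h : ∀ n : ℤ, 2 ≤ n → V.op n a b = 0) (m k : ℤ)
    (c : V.carrier) : V.op m a (V.op k b c) - V.op k b (V.op m a c) =
      V.op (m + k) (V.op 0 a b) c + (m : ℂ) • V.op (m + k - 1) (V.op 1 a b) c := by
  have h1 := V.borcherds m 0 k a b c
  rw [RestrictedVertexAlgebra.finsum_eq_range _ (fun j hj => by
      rw [h _ (by omega)]; simp), finsum_eq_single _ 0 (by
    intro j hj
    simp [Ring.choose_zero_pos ℂ (Nat.pos_of_ne_zero hj)]), finsum_eq_single _ 0 (by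
    intro j hj
    simp [Ring.choose_zero_pos ℂ (Nat.pos_of_ne_zero hj)])] at h1
  simpa [Finset.sum_range_succ] using h1.symm

/-- `(∂ a)_(n) = -n a_(n-1)`. -/
lemma op_der (n : ℤ) (a c : V.carrier) :
    V.op n (V.op (-2) a V.vac) c = -(n : ℂ) • V.op (n - 1) a c := by
  rw [op_op, Fields.comm, Fields.halfProd, Fields.halfProd, Fields.bsum, Fields.bsum]
  simp only [V.vac_op, add_zero, zero_add]
  have e2 : (-1 : ℂ) ^ (-2 : ℤ) = 1 := by norm_num
  rw [e2, one_smul]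
  push_cast
  rcases lt_or_ge n 0 with h | h
  · rw [finsum_eq_single _ (-1 - n).toNat, finsum_eq_zero_of_forall_eq_zero, sub_zero,
      if_pos (by omega), ringChoose_neg_two, ← mul_assoc, ← mul_pow]
    · rw [show -2 - (((-1 - n).toNat : ℕ) : ℤ) = n - 1 by omega]
      congr 1
      have : (((-1 - n).toNat : ℕ) : ℂ) = ((-1 - n : ℤ) : ℂ) := by
        rw [← Int.cast_natCast]; congr 1; omega
      rw [this]
      push_cast
      simp
      ring
    · intro j
      rw [if_neg (by omega), smul_zero]
    · intro j hj
      rw [if_neg (by omega), map_zero, smul_zero]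
  · rw [finsum_eq_zero_of_forall_eq_zero]
    · rcases h.eq_or_lt with rfl | h
      · rw [finsum_eq_zero_of_forall_eq_zero]
        · simp
        · intro j
          rw [if_neg (by omega), smul_zero]
      · rw [finsum_eq_single _ (n - 1).toNat, if_pos (by omega), ringChoose_neg_two, ← mul_assoc,
          ← mul_pow, show (((n - 1).toNat : ℕ) : ℤ) = n - 1 by omega]
        · have : (((n - 1).toNat : ℕ) : ℂ) = ((n - 1 : ℤ) : ℂ) := by
            rw [← Int.cast_natCast]; congr 1; omega
          rw [this]
          push_cast
          simp
        · intro j hj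
          rw [if_neg (by omega), smul_zero]
    · intro j
      rw [if_neg (by omega), map_zero, smul_zero]

/-- `(a_(-1) b)_(-1-n) |0⟩` is a Cauchy product. -/
lemma op_neg_one_vac_eq_sum (n : ℕ) (a b : V.carrier) : V.op (-1 - n) (V.op (-1) a b) V.vac =
    ∑ p ∈ antidiagonal n, V.op (-1 - p.1) a (V.op (-1 - p.2) b V.vac) := by
  rw [op_op, Fields.comm, Fields.halfProd_eq_zero (K := 0) (fun n hn => V.op_vac n a hn) le_rfl,
    smul_zero, sub_zero, Fields.halfProd, Fields.bsum_eq_sum (N := n + 1),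
    Finset.Nat.sum_antidiagonal_eq_sum_range_succ_mk]
  · refine Finset.sum_congr rfl fun j hj => ?_
    rw [Finset.mem_range] at hj
    push_cast
    rw [ringChoose_neg_one, ← mul_pow, show -1 - (n : ℤ) + j = -1 - (n - j : ℕ) by omega]
    simp
  · intro j hj
    rw [V.op_vac _ _ (by omega), map_zero]

end VertexAlgebra

namespace RestrictedVertexAlgebra

variable (V : RestrictedVertexAlgebra.{u})

/-- The inclusion of the one-truncated vertex algebra `V_{≤1}` into `V`. -/
def inj : V.truncObj.Gen →ₗ[ℂ] V.carrier := V.incl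

lemma inj_mode {i j : ℤ} {x y : V.truncObj.Gen} (hx : x ∈ truncWt V.truncObj.V₀ V.truncObj.V₁ i)
    (hy : y ∈ truncWt V.truncObj.V₀ V.truncObj.V₁ j) (n : ℤ) (h : i + j - n - 1 ≤ 1) :
    V.inj (V.truncObj.mode n x y) = V.op n (V.inj x) (V.inj y) :=
  V.incl_truncMode hx hy n h

lemma inj_mode_of_nonneg {n : ℤ} (hn : 0 ≤ n) (x y : V.truncObj.Gen) :
    V.inj (V.truncObj.mode n x y) = V.op n (V.inj x) (V.inj y) := by
  rw [V.truncObj.gen_decomp x, V.truncObj.gen_decomp y]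
  simp only [map_add, LinearMap.add_apply]
  rw [V.inj_mode (V.truncObj.mem₀ _) (V.truncObj.mem₀ _) n (by omega),
    V.inj_mode (V.truncObj.mem₀ _) (V.truncObj.mem₁ _) n (by omega),
    V.inj_mode (V.truncObj.mem₁ _) (V.truncObj.mem₀ _) n (by omega),
    V.inj_mode (V.truncObj.mem₁ _) (V.truncObj.mem₁ _) n (by omega)]

lemma inj_mode_neg_one (a : V.truncObj.V₀) (y : V.truncObj.Gen) :
    V.inj (V.truncObj.mode (-1) (a, 0) y) = V.op (-1) (V.inj (a, 0)) (V.inj y) := by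
  rw [V.truncObj.gen_decomp y]
  simp only [map_add]
  rw [V.inj_mode (V.truncObj.mem₀ _) (V.truncObj.mem₀ _) _ (by omega),
    V.inj_mode (V.truncObj.mem₀ _) (V.truncObj.mem₁ _) _ (by omega)]

lemma inj_vac : V.inj (V.truncObj.vac, 0) = V.vac := V.incl_vac

lemma inj_d (a : V.truncObj.V₀) : V.inj (0, V.truncObj.d a) = V.op (-2) (V.inj (a, 0)) V.vac := by
  have h : (0, V.truncObj.d a) = V.truncObj.mode (-2) (a, 0) (V.truncObj.vac, 0) := by
    rw [OneTruncatedVertexAlgebra.mode₀₀]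
    rfl
  rw [h, ← V.inj_vac]
  exact V.inj_mode (V.truncObj.mem₀ _) (V.truncObj.mem₀ _) _ (by omega)

lemma op_inj_of_two_le {n : ℤ} (hn : 2 ≤ n) (x y : V.truncObj.Gen) :
    V.op n (V.inj x) (V.inj y) = 0 := by
  rw [← V.inj_mode_of_nonneg (by omega), V.truncObj.gen_decomp x, V.truncObj.gen_decomp y]
  simp only [map_add, LinearMap.add_apply, OneTruncatedVertexAlgebra.mode₀₀,
    OneTruncatedVertexAlgebra.mode₀₁, OneTruncatedVertexAlgebra.mode₁₀,
    OneTruncatedVertexAlgebra.mode₁₁, if_neg (show n ≠ -1 by omega), if_neg (show n ≠ -2 by omega),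
    if_neg (show n ≠ 0 by omega), if_neg (show n ≠ 1 by omega), Prod.mk_zero_zero, map_zero,
    add_zero]

lemma inj_mk_zero (a : V.wt 0) : V.inj (a, 0) = (a : V.carrier) := by
  change V.incl (a, 0) = _
  simp [incl]

lemma inj_zero_mk (x : V.wt 1) : V.inj (0, x) = (x : V.carrier) := by
  change V.incl (0, x) = _
  simp [incl]

lemma inj_injective : Function.Injective V.inj :=
  Function.LeftInverse.injective (g := V.pr) V.pr_incl

lemma H_inj (x : V.truncObj.Gen) : V.H (V.inj x) = V.inj (0, x.2) := by
  obtain ⟨a, y⟩ := x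
  have h0 := Module.End.mem_eigenspace_iff.1 a.2
  have h1 := Module.End.mem_eigenspace_iff.1 y.2
  rw [V.truncObj.gen_decomp (a, y), map_add, map_add]
  erw [V.inj_mk_zero a, V.inj_zero_mk y, h0, h1]
  rw [zero_smul, one_smul, zero_add]
  refine (V.inj_zero_mk y).symm.trans (congrArg V.inj ?_)
  simp

end RestrictedVertexAlgebra

namespace OneTruncatedVertexAlgebra

variable (W : OneTruncatedVertexAlgebra.{u})

/-! ### The vertex algebra generated by a one-truncated vertex algebra -/

namespace Envelope

lemma isField_μ (u : W.Gen) : Fields.IsField (fun n => μ W n u) := by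
  intro x
  induction x using induction generalizing u with
  | vac => exact ⟨0, fun n hn => μ_vac_of_nonneg W hn u⟩
  | zero => exact ⟨0, fun n hn => map_zero _⟩
  | add x y hx hy =>
    obtain ⟨N, hN⟩ := hx u
    obtain ⟨N', hN'⟩ := hy u
    exact ⟨max N N', fun n hn => by
      rw [map_add, hN n (le_trans (le_max_left _ _) hn), hN' n (le_trans (le_max_right _ _) hn),
        add_zero]⟩
  | smul c x hx =>
    obtain ⟨N, hN⟩ := hx u
    exact ⟨N, fun n hn => by rw [map_smul, hN n hn, smul_zero]⟩
  | creation k v x hx =>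
    obtain ⟨N, hN⟩ := hx u
    obtain ⟨N₀, hN₀⟩ := hx (W.mode 0 u v)
    obtain ⟨N₁, hN₁⟩ := hx (W.mode 1 u v)
    refine ⟨max N (max N₀ N₁ + k + 2), fun n hn => ?_⟩
    have h1 := le_trans (le_max_left _ _) hn
    have h2 := le_trans (le_max_right _ _) hn
    have h3 := le_max_left N₀ N₁
    have h4 := le_max_right N₀ N₁
    rw [← μ_creation, sub_eq_iff_eq_add.1 (μ_comm W n (-1 - k) u v x), hN n h1,
      hN₀ _ (by omega), hN₁ _ (by omega)]
    simp

lemma isGenerating : Fields.IsGenerating (fun u n => μ W n u) (vac W) (trans W) where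
  field := isField_μ W
  vac_of_nonneg u n hn := μ_vac_of_nonneg W hn u
  trans u n x := trans_μ W n u x
  trans_vac := trans_vac W
  loc u v := by
    refine ⟨2, fun m k x => ?_⟩
    have h := fun m n k x => Fields.comm_rec (isField_μ W u) (isField_μ W v) m n k x
    rw [show ((2 : ℕ) : ℤ) = 0 + 1 + 1 by norm_num]
    simp only [h, Fields.comm_zero, μ_comm]
    rw [show m + 1 + 1 + k = m + (k + 1 + 1) by ring,
      show m + 1 + (k + 1) = m + (k + 1 + 1) by ring]
    push_cast
    module
  span S h0 h1 := eq_top_of_creation h0 fun n u x hx => by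
    rw [← μ_creation]
    exact h1 u _ x hx

lemma ν_mem_eigenspace₀ (n : ℕ) (a : W.V₀) {t : ℂ} {x : W.Envelope}
    (hx : x ∈ Module.End.eigenspace (ham W) t) :
    ν W n (a, 0) x ∈ Module.End.eigenspace (ham W) (t + n) := by
  rw [Module.End.mem_eigenspace_iff] at hx ⊢
  have e : genEnergy n (a, (0 : W.V₁)) = (n : ℂ) • (a, 0) := by simp [genEnergy_mk]
  rw [ham_ν, hx, e]
  simp only [map_smul, LinearMap.smul_apply]
  module

lemma ν_mem_eigenspace₁ (n : ℕ) (y : W.V₁) {t : ℂ} {x : W.Envelope}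
    (hx : x ∈ Module.End.eigenspace (ham W) t) :
    ν W n (0, y) x ∈ Module.End.eigenspace (ham W) (t + (n + 1)) := by
  rw [Module.End.mem_eigenspace_iff] at hx ⊢
  have e : genEnergy n ((0 : W.V₀), y) = ((n : ℂ) + 1) • (0, y) := by simp [genEnergy_mk]
  rw [ham_ν, hx, e]
  simp only [map_smul, LinearMap.smul_apply]
  module

lemma ν_split (n : ℕ) (u : W.Gen) (x : W.Envelope) :
    ν W n u x = ν W n (u.1, 0) x + ν W n (0, u.2) x := by
  rw [← LinearMap.add_apply, ← map_add, ← gen_decomp]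

lemma iSup_eigenspace : ⨆ k : ℕ, Module.End.eigenspace (ham W) (k : ℂ) = ⊤ := by
  refine eq_top_of_creation ?_ fun n u x hx => ?_
  · refine Submodule.mem_iSup_of_mem 0 ?_
    simp
  · induction hx using Submodule.iSup_induction' with
    | mem k x hx =>
      rw [ν_split]
      refine Submodule.add_mem _ (Submodule.mem_iSup_of_mem (k + n) ?_)
        (Submodule.mem_iSup_of_mem (k + (n + 1)) ?_)
      · simpa using ν_mem_eigenspace₀ W n u.1 hx
      · simpa using ν_mem_eigenspace₁ W n u.2 hx
    | zero => simp
    | add x y _ _ hx hy => rw [map_add]; exact Submodule.add_mem _ hx hy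

end Envelope

namespace Envelope

lemma iSup_eigenspace' : ⨆ t : ℂ, Module.End.eigenspace (ham W) t = ⊤ := by
  rw [eq_top_iff, ← iSup_eigenspace W]
  exact iSup_le fun k => le_iSup (fun t : ℂ => Module.End.eigenspace (ham W) t) k

lemma eigenspace_neg (n : ℕ) : Module.End.eigenspace (ham W) (-((n : ℂ) + 1)) = ⊥ := by
  have h1 := Module.End.eigenspaces_iSupIndep (ham W) (-((n : ℂ) + 1))
  have h2 : ⨆ (j : ℂ) (_ : j ≠ -((n : ℂ) + 1)), Module.End.eigenspace (ham W) j = ⊤ := by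
    rw [eq_top_iff, ← iSup_eigenspace W]
    refine iSup_le fun k => le_iSup₂_of_le (k : ℂ) ?_ le_rfl
    intro h
    have h3 : ((k + n + 1 : ℕ) : ℂ) = 0 := by push_cast; linear_combination h
    exact absurd (Nat.cast_eq_zero.1 h3) (by omega)
  rw [h2, disjoint_top] at h1
  exact h1

lemma ham_op (n : ℤ) (a b : W.Envelope) :
    ham W ((isGenerating W).op n a b) - (isGenerating W).op n a (ham W b) =
      (-(n : ℂ) - 1) • (isGenerating W).op n a b + (isGenerating W).op n (ham W a) b :=
  sub_eq_iff_eq_add.2 ((isGenerating W).ham_op (H := ham W) (fun u => ((0 : W.V₀), u.2))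
    (ham_vac W) (fun u n x => by
      rw [ham_μ, map_add, map_smul, LinearMap.add_apply, LinearMap.smul_apply]) a n b)

end Envelope

/-- The restricted vertex algebra freely generated by a one-truncated vertex algebra. -/
def envelope : RestrictedVertexAlgebra.{u} where
  toVertexAlgebra := (Envelope.isGenerating W).vertexAlgebra
  H := Envelope.ham W
  diagonalizable := Envelope.iSup_eigenspace' W
  H_op := Envelope.ham_op W
  no_negative_weight := Envelope.eigenspace_neg W

namespace Envelope

/-- The vector `u_(-1) |0⟩` defined by a generator `u`. -/
def state : W.Gen →ₗ[ℂ] W.Envelope := (ν W 0).flip (vac W)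

lemma state_apply (u : W.Gen) : state W u = ν W 0 u (vac W) := rfl

lemma op_state (n : ℤ) (u : W.Gen) : W.envelope.op n (state W u) = μ W n u := by
  have h := congrFun ((isGenerating W).op_gen u) n
  rw [show state W u = μ W (-1) u (vac W) from
    congrArg (fun f => f u (vac W)) (μ_creation W 0).symm]
  exact h

lemma op_μ (n k : ℤ) (u : W.Gen) (x y : W.Envelope) : W.envelope.op k (μ W n u x) y =
    Fields.comm (fun n => μ W n u) (fun n => W.envelope.op n x) 0 n k y :=
  congrArg (fun f => f y) (congrFun ((isGenerating W).op_gen_apply u x n) k)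

end Envelope

end OneTruncatedVertexAlgebra

/-! ### The adjunction -/

namespace Fields

lemma map_comm {V V' : Type*} [AddCommGroup V] [Module ℂ V] [AddCommGroup V'] [Module ℂ V']
    {a b : ℤ → Module.End ℂ V} {a' b' : ℤ → Module.End ℂ V'} (ha : IsField a) (hb : IsField b)
    (g : V →ₗ[ℂ] V') (hga : ∀ n v, g (a n v) = a' n (g v)) (hgb : ∀ n v, g (b n v) = b' n (g v))
    (m n k : ℤ) (v : V) : g (comm a b m n k v) = comm a' b' m n k (g v) := by
  rw [comm, comm, map_sub, map_smul, halfProd, halfProd, halfProd, halfProd,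
    ← bsum_map (-1) n (hb.evZero_right k (fun j => a (n + m - j)) v) g,
    ← bsum_map (-1) n (ha.evZero_right m (fun j => b (n + k - j)) v) g]
  simp only [hga, hgb]

end Fields

namespace OneTruncatedVertexAlgebra

variable {W : OneTruncatedVertexAlgebra.{u}}

lemma mode_eq (n : ℤ) (u v : W.Gen) : W.mode n u v =
    if n = 0 then W.mode 0 u v else if n = 1 then W.mode 1 u v
    else if n = -1 then W.mode (-1) (u.1, 0) v + W.mode (-1) (v.1, 0) (0, u.2) +
      W.tr (W.mode 0 (0, u.2) (v.1, 0))
    else if n = -2 then W.mode (-1) (v.1, 0) (W.tr u) else 0 := by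
  obtain ⟨a, x⟩ := u
  obtain ⟨b, y⟩ := v
  rcases eq_or_ne n 0 with rfl | h0
  · simp
  rcases eq_or_ne n 1 with rfl | h1
  · simp
  rw [if_neg h0, if_neg h1]
  simp only [mode_neg_one, mode_zero, tr_apply, map_zero]
  conv_lhs => rw [W.gen_decomp (a, x), W.gen_decomp (b, y)]
  simp only [map_add, LinearMap.add_apply, mode₀₀, mode₀₁, mode₁₀, mode₁₁, ract_eq, mulTwo_eq]
  rcases eq_or_ne n (-1) with rfl | h2
  · simp; abel
  rcases eq_or_ne n (-2) with rfl | h3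
  · simp
  simp [h0, h1, h2, h3]

/-- A pair of linear maps which preserves the basic operations is a morphism. -/
def Hom.ofOps {W W' : OneTruncatedVertexAlgebra.{u}} (f₀ : W.V₀ →ₗ[ℂ] W'.V₀)
    (f₁ : W.V₁ →ₗ[ℂ] W'.V₁) (hvac : f₀ W.vac = W'.vac)
    (h0 : ∀ u v, f₀.prodMap f₁ (W.mode 0 u v) =
      W'.mode 0 (f₀.prodMap f₁ u) (f₀.prodMap f₁ v))
    (h1 : ∀ u v, f₀.prodMap f₁ (W.mode 1 u v) =
      W'.mode 1 (f₀.prodMap f₁ u) (f₀.prodMap f₁ v))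
    (h2 : ∀ a v, f₀.prodMap f₁ (W.mode (-1) (a, 0) v) =
      W'.mode (-1) (f₀ a, 0) (f₀.prodMap f₁ v))
    (h3 : ∀ a, f₁ (W.d a) = W'.d (f₀ a)) : Hom W W' where
  f₀ := f₀
  f₁ := f₁
  map_vac := hvac
  map_mode n x y := by
    have h4 : ∀ u, f₀.prodMap f₁ (W.tr u) = W'.tr (f₀.prodMap f₁ u) := fun u => by
      simp [tr_apply, h3]
    have e0 : ∀ u : W.Gen, f₀.prodMap f₁ (u.1, 0) = (f₀ u.1, 0) := fun u => by simp
    have e1 : ∀ u : W.Gen, f₀.prodMap f₁ (0, u.2) = (0, f₁ u.2) := fun u => by simp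
    rw [mode_eq n x y, mode_eq n (f₀.prodMap f₁ x)]
    split_ifs
    · exact h0 _ _
    · exact h1 _ _
    · simp only [map_add, h2, h4, h0, e0, e1]
      simp
    · simp only [h2, h4]
      simp
    · simp

namespace Envelope

variable {V : RestrictedVertexAlgebra.{u}} (f : Hom W V.truncObj)

/-- The generators of `W` as elements of a restricted vertex algebra `V`. -/
def target : W.Gen →ₗ[ℂ] V.carrier := V.inj ∘ₗ f.f₀.prodMap f.f₁

lemma target_mode {n : ℤ} (hn : 0 ≤ n) (u v : W.Gen) :
    target f (W.mode n u v) = V.op n (target f u) (target f v) := by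
  rw [target, LinearMap.comp_apply, f.map_mode]
  exact V.inj_mode_of_nonneg hn _ _

lemma target_mode_neg_one (a : W.V₀) (v : W.Gen) :
    target f (W.mode (-1) (a, 0) v) = V.op (-1) (target f (a, 0)) (target f v) := by
  have e : f.f₀.prodMap f.f₁ (a, 0) = (f.f₀ a, 0) := by simp
  rw [target, LinearMap.comp_apply, f.map_mode, e]
  refine (V.inj_mode_neg_one _ _).trans ?_
  rw [LinearMap.comp_apply, e]
  rfl

lemma target_d (a : W.V₀) : target f (0, W.d a) = V.op (-2) (target f (a, 0)) V.vac := by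
  have e : f.f₀.prodMap f.f₁ (a, 0) = (f.f₀ a, 0) := by simp
  have e' : f.f₀.prodMap f.f₁ (0, W.d a) = (0, V.truncObj.d (f.f₀ a)) := by simp [f.map_d]
  rw [target, LinearMap.comp_apply, LinearMap.comp_apply, e, e']
  exact V.inj_d _

lemma target_vac : target f (W.vac, 0) = V.vac := by
  have e : f.f₀.prodMap f.f₁ (W.vac, 0) = (V.truncObj.vac, 0) := by simp [f.map_vac]
  rw [target, LinearMap.comp_apply, e]
  exact V.inj_vac

lemma H_target (u : W.Gen) : V.H (target f u) = target f (0, u.2) := by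
  refine (V.H_inj _).trans ?_
  simp [target]

lemma target_commutator (u v : W.Gen) (m k : ℤ) (c : V.carrier) :
    V.op m (target f u) (V.op k (target f v) c) - V.op k (target f v) (V.op m (target f u) c) =
      V.op (m + k) (target f (W.mode 0 u v)) c +
        (m : ℂ) • V.op (m + k - 1) (target f (W.mode 1 u v)) c := by
  rw [target_mode f le_rfl, target_mode f zero_le_one]
  exact V.commutator (fun n hn => V.op_inj_of_two_le hn _ _) m k c

/-- The creation operators acting on a restricted vertex algebra. -/
def targetModule : W.CreationModule V.carrier where
  ν n := V.op (-1 - n) ∘ₗ target f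
  der n a x := by
    rw [LinearMap.comp_apply, target_d, V.op_der, LinearMap.comp_apply,
      show -1 - (n : ℤ) - 1 = -1 - (n + 1 : ℕ) by push_cast; ring]
    push_cast
    congr 1
    ring
  comm n m u v x := by
    have h := target_commutator f u v (-1 - n) (-1 - m) x
    simp only [LinearMap.comp_apply]
    rw [h, show -1 - (n : ℤ) + (-1 - m) = -1 - (n + m + 1 : ℕ) by push_cast; ring,
      show -1 - ((n + m + 1 : ℕ) : ℤ) - 1 = -1 - (n + m + 2 : ℕ) by push_cast; ring]
    push_cast
    module

lemma targetModule_isVacuum : (targetModule f).IsVacuum V.vac where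
  vac n := by
    change V.op _ (target f (W.vac, 0)) V.vac = _
    rw [target_vac, V.vac_op]
    by_cases h : n = 0
    · subst h; simp
    · rw [if_neg (by omega), if_neg h]
  mul n a u := by
    change V.op _ (target f _) V.vac = _
    rw [target_mode_neg_one, V.op_neg_one_vac_eq_sum]
    rfl

/-- The linear map underlying the extension of `f` to the envelope. -/
def extend : W.Envelope →ₗ[ℂ] V.carrier := lift (targetModule f) (targetModule_isVacuum f)

lemma extend_vac : extend f (vac W) = V.vac := lift_vac _

lemma extend_ν (n : ℕ) (u : W.Gen) (x : W.Envelope) :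
    extend f (ν W n u x) = V.op (-1 - n) (target f u) (extend f x) := lift_ν _ _ _ _

lemma extend_μ (n : ℤ) (u : W.Gen) (x : W.Envelope) :
    extend f (μ W n u x) = V.op n (target f u) (extend f x) := by
  induction x using induction generalizing n u with
  | zero => simp
  | add x y hx hy => simp only [map_add, hx, hy]
  | smul c x hx => simp only [map_smul, hx]
  | vac =>
    rcases le_or_gt 0 n with h | h
    · rw [μ_vac_of_nonneg W h, map_zero, extend_vac, V.op_vac _ _ h]
    · obtain ⟨k, rfl⟩ : ∃ k : ℕ, n = -1 - k := ⟨(-1 - n).toNat, by omega⟩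
      rw [μ_creation, extend_ν]
  | creation k v x hx =>
    rw [extend_ν, ← μ_creation, sub_eq_iff_eq_add.1 (μ_comm W n (-1 - k) u v x), map_add, map_add,
      map_smul, hx, hx, μ_creation, extend_ν, hx,
      sub_eq_iff_eq_add.1 (target_commutator f u v n (-1 - k) (extend f x))]

lemma extend_op (n : ℤ) (x y : W.Envelope) :
    extend f ((isGenerating W).op n x y) = V.op n (extend f x) (extend f y) := by
  have hvac : ∀ (n : ℤ) (y : W.Envelope),
      (isGenerating W).op n (vac W) y = if n = -1 then y else 0 := W.envelope.vac_op
  induction x using induction generalizing n y with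
  | zero => simp only [map_zero, LinearMap.zero_apply]
  | add x x' hx hx' => simp only [map_add, LinearMap.add_apply, hx, hx']
  | smul c x hx => simp only [map_smul, LinearMap.smul_apply, hx]
  | vac =>
    rw [hvac, extend_vac, V.vac_op]
    split_ifs <;> simp
  | creation k u x hx =>
    have e : (isGenerating W).op n (ν W k u x) y =
        Fields.comm (fun n => μ W n u) (fun n => (isGenerating W).op n x) 0 (-1 - k) n y := by
      rw [← μ_creation]
      exact op_μ W (-1 - k) n u x y
    rw [extend_ν, V.op_op, e]
    exact Fields.map_comm (isField_μ W u) (W.envelope.isField x) (extend f)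
      (fun n v => extend_μ f n u v) (fun n v => hx n v) _ _ _ _

lemma extend_ham (x : W.Envelope) : extend f (ham W x) = V.H (extend f x) := by
  induction x using induction with
  | zero => simp only [map_zero]
  | add x x' hx hx' => simp only [map_add, hx, hx']
  | smul c x hx => simp only [map_smul, hx]
  | vac =>
    rw [ham_vac, map_zero, extend_vac]
    exact (Module.End.mem_eigenspace_iff.1 V.vac_mem).trans (zero_smul _ _) |>.symm
  | creation k u x hx =>
    have h := sub_eq_iff_eq_add.1 (V.H_op (-1 - k) (target f u) (extend f x))
    rw [ham_ν, map_add, extend_ν, extend_ν, extend_ν, hx, h, H_target]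
    congr 1
    rw [← LinearMap.smul_apply, ← LinearMap.add_apply, ← map_smul, ← map_add, ← map_smul,
      ← map_add]
    congr 3
    obtain ⟨a, y⟩ := u
    rw [genEnergy_mk, Prod.smul_mk, Prod.mk_add_mk]
    refine Prod.ext ?_ ?_ <;> push_cast <;> module

/-- The extension of a morphism `W → V_{≤1}` to the envelope. -/
def extendHom : RestrictedVertexAlgebra.Hom W.envelope V where
  toLin := extend f
  map_vac := extend_vac f
  map_op := extend_op f
  map_H := extend_ham f

variable (W)

lemma state_mem₀ (a : W.V₀) : state W (a, 0) ∈ W.envelope.wt 0 := by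
  have h := ν_mem_eigenspace₀ W 0 a (t := 0) (x := vac W) (by simp)
  rw [Nat.cast_zero, add_zero] at h
  exact h

lemma state_mem₁ (x : W.V₁) : state W (0, x) ∈ W.envelope.wt 1 := by
  have h := ν_mem_eigenspace₁ W 0 x (t := 0) (x := vac W) (by simp)
  rw [Nat.cast_zero, zero_add, zero_add] at h
  exact h

/-- The weight zero component of the unit. -/
def unit₀ : W.V₀ →ₗ[ℂ] W.envelope.truncObj.V₀ :=
  LinearMap.codRestrict (W.envelope.wt 0) (state W ∘ₗ LinearMap.inl ℂ W.V₀ W.V₁) (state_mem₀ W)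

/-- The weight one component of the unit. -/
def unit₁ : W.V₁ →ₗ[ℂ] W.envelope.truncObj.V₁ :=
  LinearMap.codRestrict (W.envelope.wt 1) (state W ∘ₗ LinearMap.inr ℂ W.V₀ W.V₁) (state_mem₁ W)

lemma inj_unit (u : W.Gen) :
    W.envelope.inj ((unit₀ W).prodMap (unit₁ W) u) = state W u := by
  have h1 : W.envelope.inj (unit₀ W u.1, 0) = state W (u.1, 0) := W.envelope.inj_mk_zero _
  have h2 : W.envelope.inj (0, unit₁ W u.2) = state W (0, u.2) := W.envelope.inj_zero_mk _
  have h3 : (unit₀ W).prodMap (unit₁ W) u = (unit₀ W u.1, 0) + (0, unit₁ W u.2) := by simp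
  rw [h3, map_add, h1, h2]
  exact (map_add (state W) _ _).symm.trans (by rw [← gen_decomp])

lemma state_vac : state W (W.vac, 0) = vac W := ((isVacuum W).vac 0).trans (if_pos rfl)

lemma op_state_state (n : ℤ) (u v : W.Gen) :
    W.envelope.op n (state W u) (state W v) = μ W n u (ν W 0 v (vac W)) := by
  rw [op_state]; rfl

lemma state_mode_zero (u v : W.Gen) :
    W.envelope.op 0 (state W u) (state W v) = state W (W.mode 0 u v) := by
  have h := μ_comm W 0 (-1 - (0 : ℕ)) u v (vac W)
  rw [op_state_state, ← μ_creation, sub_eq_iff_eq_add.1 h, μ_vac_of_nonneg W le_rfl]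
  simp only [Int.cast_zero, zero_smul, map_zero, add_zero, zero_add]
  rw [μ_creation]
  rfl

lemma state_mode_one (u v : W.Gen) :
    W.envelope.op 1 (state W u) (state W v) = state W (W.mode 1 u v) := by
  have h := μ_comm W 1 (-1 - (0 : ℕ)) u v (vac W)
  have e : (1 : ℤ) + (-1 - (0 : ℕ)) = 0 := by norm_num
  rw [op_state_state, ← μ_creation, sub_eq_iff_eq_add.1 h, μ_vac_of_nonneg W zero_le_one, e,
    μ_vac_of_nonneg W le_rfl]
  simp only [Int.cast_one, one_smul, map_zero, add_zero, zero_add]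
  rw [show (0 : ℤ) - 1 = -1 - (0 : ℕ) by norm_num, μ_creation]
  rfl

lemma state_mode_neg_one (a : W.V₀) (v : W.Gen) :
    W.envelope.op (-1) (state W (a, 0)) (state W v) = state W (W.mode (-1) (a, 0) v) := by
  rw [op_state_state, show (-1 : ℤ) = -1 - (0 : ℕ) by norm_num, μ_creation]
  exact (ν_zero_mul W a v).symm

lemma state_d (a : W.V₀) :
    W.envelope.op (-2) (state W (a, 0)) (vac W) = state W (0, W.d a) := by
  rw [op_state, show (-2 : ℤ) = -1 - (1 : ℕ) by norm_num, μ_creation]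
  have h := (creationModule W).der 0 a (vac W)
  rw [Nat.cast_zero, zero_add, one_smul, zero_add] at h
  exact h.symm

/-- The unit of the adjunction. -/
def unitHom : Hom W W.envelope.truncObj :=
  Hom.ofOps (unit₀ W) (unit₁ W) (Subtype.ext (state_vac W))
    (fun u v => W.envelope.inj_injective (by
      rw [W.envelope.inj_mode_of_nonneg le_rfl, inj_unit, inj_unit, inj_unit, state_mode_zero]))
    (fun u v => W.envelope.inj_injective (by
      rw [W.envelope.inj_mode_of_nonneg zero_le_one, inj_unit, inj_unit, inj_unit,
        state_mode_one]))
    (fun a v => W.envelope.inj_injective (by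
      have h := inj_unit W (a, 0)
      have e : (unit₀ W).prodMap (unit₁ W) (a, 0) = (unit₀ W a, 0) := by simp
      rw [e] at h
      rw [W.envelope.inj_mode_neg_one, inj_unit, inj_unit, h, state_mode_neg_one]))
    (fun a => by
      have h := inj_unit W (a, 0)
      have h' := inj_unit W (0, W.d a)
      have e : (unit₀ W).prodMap (unit₁ W) (a, 0) = (unit₀ W a, 0) := by simp
      have e' : (unit₀ W).prodMap (unit₁ W) (0, W.d a) = (0, unit₁ W (W.d a)) := by simp
      rw [e] at h
      rw [e'] at h'
      have h2 := W.envelope.inj_d (unit₀ W a)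
      rw [h] at h2
      exact (Prod.mk.inj (W.envelope.inj_injective
        (h'.trans ((state_d W a).symm.trans h2.symm)))).2)

variable {W}

lemma extend_state (u : W.Gen) : extend f (state W u) = target f u := by
  rw [state_apply, extend_ν, extend_vac]
  exact V.op_neg_one_vac _

lemma extend_state₀ (a : W.V₀) : extend f (state W (a, 0)) = (f.f₀ a).1 := by
  have e : f.f₀.prodMap f.f₁ (a, 0) = (f.f₀ a, 0) := by simp
  rw [extend_state, target, LinearMap.comp_apply, e]
  exact V.inj_mk_zero _

lemma extend_state₁ (x : W.V₁) : extend f (state W (0, x)) = (f.f₁ x).1 := by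
  have e : f.f₀.prodMap f.f₁ (0, x) = (0, f.f₁ x) := by simp
  rw [extend_state, target, LinearMap.comp_apply, e]
  exact V.inj_zero_mk _

lemma hom_eq_of_state {g g' : RestrictedVertexAlgebra.Hom W.envelope V}
    (h : ∀ u, g.toLin (state W u) = g'.toLin (state W u)) : g = g' := by
  refine RestrictedVertexAlgebra.Hom.ext (hom_ext (g.map_vac.trans g'.map_vac.symm) ?_)
  intro n u x hx
  have e : W.envelope.op (-1 - n) (state W u) x = ν W n u x :=
    congrArg (fun t : Module.End ℂ W.Envelope => t x)
      ((op_state W (-1 - n) u).trans (congrArg (fun t => t u) (μ_creation W n)))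
  rw [← e]
  refine (g.map_op _ _ _).trans (Eq.trans ?_ (g'.map_op _ _ _).symm)
  rw [h u]
  exact congrArg _ hx

variable (W)

/-- The hom-set bijection of the adjunction. -/
def homEquiv (V : RestrictedVertexAlgebra.{u}) :
    (W.envelope ⟶ V) ≃ (W ⟶ truncation.obj V) where
  toFun g := (unitHom W : W ⟶ truncation.obj W.envelope) ≫ truncation.map g
  invFun f := extendHom f
  left_inv g := hom_eq_of_state fun u => by
    refine (extend_state (W := W) (V := V) _ u).trans ?_
    rw [← inj_unit]
    obtain ⟨a, x⟩ := u
    change (g.toLin (state W (a, 0)) : V.carrier) + g.toLin (state W (0, x)) = _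
    exact (map_add g.toLin _ _).symm
  right_inv f := by
    refine Hom.ext (LinearMap.ext fun a => Subtype.ext ?_) (LinearMap.ext fun x => Subtype.ext ?_)
    · exact extend_state₀ f a
    · exact extend_state₁ f x

end Envelope

/-- The functor `U₁`, left adjoint to the truncation. -/
def envelopeFunctor : OneTruncatedVertexAlgebra.{u} ⥤ RestrictedVertexAlgebra.{u} :=
  Adjunction.leftAdjointOfEquiv Envelope.homEquiv (fun W V V' g h => by
    exact (congrArg (fun t => (Envelope.unitHom W : W ⟶ truncation.obj W.envelope) ≫ t)
      (truncation.map_comp h g)).trans (Category.assoc _ _ _).symm)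

/-- The adjunction between the envelope and the truncation. -/
def envelopeAdjunction : envelopeFunctor.{u} ⊣ truncation :=
  Adjunction.adjunctionOfEquivLeft Envelope.homEquiv _

lemma envelopeAdjunction_unit (W : OneTruncatedVertexAlgebra.{u}) :
    envelopeAdjunction.unit.app W = Envelope.unitHom W := by
  have h : envelopeAdjunction.homEquiv W _ (𝟙 _) = Envelope.homEquiv W W.envelope (𝟙 _) := by
    rfl
  rw [Adjunction.homEquiv_id] at h
  rw [h]
  change (Envelope.unitHom W : W ⟶ truncation.obj W.envelope) ≫ truncation.map (𝟙 _) = _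
  rw [truncation.map_id]
  exact Category.comp_id _

end OneTruncatedVertexAlgebra

/-! ### The unit of the adjunction is an isomorphism -/

namespace OneTruncatedVertexAlgebra

variable (W : OneTruncatedVertexAlgebra.{u})

lemma mode_creation (n : ℕ) (u v : W.Gen) : W.mode (-1 - n) u v =
    if n = 0 then (W.mul u.1 v.1, W.act u.1 v.2 + W.act v.1 u.2 + W.d (W.anchor u.2 v.1))
    else if n = 1 then (0, W.act v.1 (W.d u.1)) else 0 := by
  rw [mode_eq, if_neg (by omega), if_neg (by omega)]
  by_cases h0 : n = 0
  · subst h0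
    simp [mode_neg_one, mode_zero, tr_apply]
  by_cases h1 : n = 1
  · subst h1
    simp [mode_neg_one, tr_apply]
  rw [if_neg (by omega), if_neg (by omega), if_neg h0, if_neg h1]

/-- The operations of `W` as creation operators, with the components of weight at least two set
to zero. -/
def truncatedModule : W.CreationModule W.Gen where
  ν n := W.mode (-1 - n)
  der n a x := by
    rcases n with _ | _ | n
    · have h := W.mode_creation 0 (0, W.d a) x
      have h' := W.mode_creation 1 (a, 0) x
      rw [h, h']
      simp [anchor_d]
    · have h := W.mode_creation 1 (0, W.d a) x
      have h' := W.mode_creation 2 (a, 0) x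
      rw [h, h']
      simp
    · rw [mode_creation, mode_creation]
      simp
  comm n m u v x := by
    obtain ⟨a, x⟩ := u
    obtain ⟨b, y⟩ := v
    rename_i w
    obtain ⟨c, z⟩ := w
    simp only [mode_creation, mode_zero, mode_one]
    rcases n with _ | _ | n <;> rcases m with _ | _ | m
    · have h1 := W.act_act b c x
      have h2 := W.act_act a c y
      have h3 := W.act_act a b z
      have h4 := W.act_act b a z
      have h6 := W.d_mul (W.anchor x b) c
      have h7 := W.d_mul b (W.anchor x c)
      have h8 := W.d_mul (W.anchor y a) c
      have h9 := W.d_mul a (W.anchor y c)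
      rw [W.mul_comm' b a] at h4
      refine Prod.ext ?_ ?_
      · simp [← W.mul_assoc', W.mul_comm' b a]
      · simp [W.anchor_mul]
        linear_combination (norm := module) h1 - h2 + h4 - h3 + h6 + h7 - h8 - h9
    all_goals simp
    all_goals rw [W.act_act, W.anchor_d, W.anchor_d]; simp

lemma truncatedModule_isVacuum : W.truncatedModule.IsVacuum (W.vac, 0) := by
  refine W.truncatedModule.isVacuum_of_translation W.tr (fun n u x => ?_) ?_ (fun n => ?_)
    (fun a u => ?_)
  · change W.tr (W.mode _ _ _) = _ • W.mode _ _ _ + W.mode _ _ _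
    rw [mode_creation, mode_creation, mode_creation]
    rcases n with _ | _ | n
    · simp [tr_apply, W.d_mul]; abel
    · simp [tr_apply]
    · simp [tr_apply]
  · simp [tr_apply, W.d_vac]
  · refine (W.vac_mode _ _).trans ?_
    split_ifs <;> first | rfl | omega
  · change W.mode _ _ _ = W.mode _ _ (W.mode _ _ _)
    rw [show -1 - ((0 : ℕ) : ℤ) = -1 by norm_num, W.mode_neg_one_vac, W.mode_neg_one_vac]

namespace Envelope

/-- The projection of the envelope to the components of weight at most one. -/
def retraction : W.Envelope →ₗ[ℂ] W.Gen := lift _ W.truncatedModule_isVacuum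

lemma retraction_state (u : W.Gen) : retraction W (state W u) = u := by
  rw [state_apply, retraction, lift_ν, lift_vac]
  change W.mode _ _ _ = _
  rw [show -1 - ((0 : ℕ) : ℤ) = -1 by norm_num, W.mode_neg_one_vac]

/-- The components of weight at least two. -/
def highWeight : Submodule ℂ W.Envelope :=
  ⨆ k : ℕ, Module.End.eigenspace (ham W) ((k : ℂ) + 2)

lemma mem_highWeight {k : ℕ} (hk : 2 ≤ k) {x : W.Envelope} {t : ℂ} (ht : t = k)
    (hx : x ∈ Module.End.eigenspace (ham W) t) : x ∈ highWeight W := by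
  obtain ⟨j, rfl⟩ := Nat.exists_eq_add_of_le' hk
  refine Submodule.mem_iSup_of_mem j ?_
  rw [ht] at hx
  push_cast at hx
  exact hx

lemma ν_mem_highWeight (n : ℕ) (u : W.Gen) {x : W.Envelope} (hx : x ∈ highWeight W) :
    ν W n u x ∈ highWeight W := by
  induction hx using Submodule.iSup_induction' with
  | mem k x hx =>
    rw [ν_split]
    refine Submodule.add_mem _ ?_ ?_
    · exact mem_highWeight W (k := k + 2 + n) (by omega) (by push_cast; ring)
        (ν_mem_eigenspace₀ W n u.1 hx)
    · exact mem_highWeight W (k := k + 2 + (n + 1)) (by omega) (by push_cast; ring)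
        (ν_mem_eigenspace₁ W n u.2 hx)
  | zero => simp
  | add x y _ _ hx hy => rw [map_add]; exact Submodule.add_mem _ hx hy

lemma ν_one_vac (a : W.V₀) : ν W 1 (a, 0) (vac W) = state W (0, W.d a) := by
  have h := (creationModule W).der 0 a (vac W)
  rw [Nat.cast_zero, zero_add, one_smul] at h
  exact h.symm

/-- The creation operators map `V₀ ⊕ V₁` into its sum with the vectors of weight at least two. -/
lemma ν_state_mem (n : ℕ) (u v : W.Gen) :
    ν W n u (state W v) ∈ LinearMap.range (state W) ⊔ highWeight W := by
  have hs : ∀ v, state W v ∈ LinearMap.range (state W) ⊔ highWeight W := fun v =>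
    Submodule.mem_sup_left ⟨v, rfl⟩
  have hh : ∀ x, x ∈ highWeight W → x ∈ LinearMap.range (state W) ⊔ highWeight W := fun x hx =>
    Submodule.mem_sup_right hx
  have hc := fun n u v => sub_eq_iff_eq_add.1 ((creationModule W).comm n 0 u v (vac W))
  have hb : ∀ b : W.V₀, state W (b, 0) ∈ Module.End.eigenspace (ham W) 0 := state_mem₀ W
  have hy : ∀ y : W.V₁, state W (0, y) ∈ Module.End.eigenspace (ham W) 1 := state_mem₁ W
  rw [ν_split, W.gen_decomp v, map_add, map_add, map_add]
  obtain ⟨a, x⟩ := u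
  obtain ⟨b, y⟩ := v
  refine Submodule.add_mem _ (Submodule.add_mem _ ?_ ?_) (Submodule.add_mem _ ?_ ?_)
  · rcases n with _ | _ | n
    · rw [state_apply, ← ν_zero_mul]
      exact hs _
    · have h := hc 1 (a, 0) (b, 0)
      simp only [mode_zero, mode_one, map_zero, sub_zero, Prod.mk_zero_zero, LinearMap.zero_apply,
        smul_zero, zero_add] at h
      change ν W 1 (a, 0) (ν W 0 (b, 0) (vac W)) ∈ _
      erw [h, ν_one_vac, state_apply, ← ν_zero_mul]
      exact hs _
    · exact hh _ (mem_highWeight W (k := n + 2) (by omega) (by push_cast; ring)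
        (ν_mem_eigenspace₀ W _ a (hb b)))
  · rcases n with _ | n
    · rw [state_apply, ← ν_zero_mul]
      exact hs _
    · exact hh _ (mem_highWeight W (k := n + 2) (by omega) (by push_cast; ring)
        (ν_mem_eigenspace₀ W _ a (hy y)))
  · rcases n with _ | n
    · have h := hc 0 (0, x) (b, 0)
      simp only [mode_zero, mode_one, map_zero, sub_zero, Prod.mk_zero_zero, LinearMap.zero_apply,
        smul_zero, zero_add] at h
      change ν W 0 (0, x) (ν W 0 (b, 0) (vac W)) ∈ _
      erw [h, ν_one_vac, ← ν_zero_mul]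
      exact Submodule.add_mem _ (hs _) (hs _)
    · exact hh _ (mem_highWeight W (k := n + 2) (by omega) (by push_cast; ring)
        (ν_mem_eigenspace₁ W _ x (hb b)))
  · exact hh _ (mem_highWeight W (k := n + 2) (by omega) (by push_cast; ring)
        (ν_mem_eigenspace₁ W _ x (hy y)))

/-- The envelope has no vectors of weight zero and one besides those of `V₀ ⊕ V₁`. -/
lemma range_state_sup : LinearMap.range (state W) ⊔ highWeight W = ⊤ := by
  refine eq_top_of_creation (Submodule.mem_sup_left ⟨_, state_vac W⟩) fun n u x hx => ?_
  obtain ⟨_, ⟨v, rfl⟩, y, hy, rfl⟩ := Submodule.mem_sup.1 hx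
  rw [map_add]
  exact Submodule.add_mem _ (ν_state_mem W n u v)
    (Submodule.mem_sup_right (ν_mem_highWeight W n u hy))

lemma proj_highWeight {k : ℕ} (hk : k < 2) {x : W.Envelope} (hx : x ∈ highWeight W) :
    W.envelope.proj k x = 0 := by
  induction hx using Submodule.iSup_induction' with
  | mem j x hx =>
    refine W.envelope.proj_of_mem_ne (fun h => ?_) hx
    have h' : j + 2 = k := by exact_mod_cast h
    omega
  | zero => exact map_zero _
  | add x y _ _ hx hy => exact (map_add _ _ _).trans (by rw [hx, hy, add_zero])

lemma proj_eq_proj_state {k : ℕ} (hk : k < 2) (x : W.Envelope) :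
    ∃ v, W.envelope.proj k x = W.envelope.proj k (state W v) := by
  have hx : x ∈ LinearMap.range (state W) ⊔ highWeight W := by
    rw [range_state_sup]; trivial
  obtain ⟨_, ⟨v, rfl⟩, y, hy, rfl⟩ := Submodule.mem_sup.1 hx
  exact ⟨v, (map_add _ _ _).trans (by rw [proj_highWeight W hk hy, add_zero])⟩

lemma state_eq (v : W.Gen) : state W v = state W (v.1, 0) + state W (0, v.2) := by
  rw [← map_add, ← gen_decomp]

lemma unit₀_bijective : Function.Bijective (unit₀ W) := by
  refine ⟨fun a b h => ?_, fun x => ?_⟩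
  · have h' : state W (a, 0) = state W (b, 0) := congrArg Subtype.val h
    have := congrArg (retraction W) h'
    rw [retraction_state, retraction_state] at this
    exact congrArg Prod.fst this
  · obtain ⟨v, hv⟩ := proj_eq_proj_state W (k := 0) (by norm_num) x.1
    have h1 := W.envelope.proj_of_mem x.2
    have h2 : W.envelope.proj 0 (state W (0, v.2)) = 0 :=
      W.envelope.proj_of_mem_ne (by norm_num) (state_mem₁ W v.2)
    have h3 := W.envelope.proj_of_mem (state_mem₀ W v.1)
    rw [Nat.cast_zero, state_eq] at hv
    refine ⟨v.1, ?_⟩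
    exact h3.symm.trans ((add_zero _).symm.trans (((congrArg _ h2.symm).trans
      (map_add (W.envelope.proj 0) _ _).symm).trans (hv.symm.trans h1)))

lemma unit₁_bijective : Function.Bijective (unit₁ W) := by
  refine ⟨fun a b h => ?_, fun x => ?_⟩
  · have h' : state W (0, a) = state W (0, b) := congrArg Subtype.val h
    have := congrArg (retraction W) h'
    rw [retraction_state, retraction_state] at this
    exact congrArg Prod.snd this
  · obtain ⟨v, hv⟩ := proj_eq_proj_state W (k := 1) (by norm_num) x.1
    have h1 := W.envelope.proj_of_mem x.2
    have h2 : W.envelope.proj 1 (state W (v.1, 0)) = 0 :=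
      W.envelope.proj_of_mem_ne (by norm_num) (state_mem₀ W v.1)
    have h3 := W.envelope.proj_of_mem (state_mem₁ W v.2)
    rw [Nat.cast_one, state_eq] at hv
    refine ⟨v.2, ?_⟩
    exact h3.symm.trans ((zero_add _).symm.trans (((congrArg (· + _) h2.symm).trans
      (map_add (W.envelope.proj 1) _ _).symm).trans (hv.symm.trans h1)))

end Envelope

lemma isIso_of_bijective {W W' : OneTruncatedVertexAlgebra.{u}} (f : Hom W W')
    (h₀ : Function.Bijective f.f₀) (h₁ : Function.Bijective f.f₁) :
    IsIso (show W ⟶ W' from f) := by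
  let e₀ := LinearEquiv.ofBijective f.f₀ h₀
  let e₁ := LinearEquiv.ofBijective f.f₁ h₁
  have he : ∀ x, f.f₀.prodMap f.f₁ ((e₀.symm : W'.V₀ →ₗ[ℂ] W.V₀).prodMap e₁.symm x) = x :=
    fun x => Prod.ext (e₀.apply_symm_apply x.1) (e₁.apply_symm_apply x.2)
  have hinj : Function.Injective (f.f₀.prodMap f.f₁) := fun x y h =>
    Prod.ext (h₀.1 (congrArg Prod.fst h)) (h₁.1 (congrArg Prod.snd h))
  let g : Hom W' W :=
    { f₀ := e₀.symm
      f₁ := e₁.symm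
      map_vac := h₀.1 ((e₀.apply_symm_apply _).trans f.map_vac.symm)
      map_mode := fun n x y => hinj (by rw [he, f.map_mode, he, he]) }
  exact ⟨g, Hom.ext (LinearMap.ext e₀.symm_apply_apply) (LinearMap.ext e₁.symm_apply_apply),
    Hom.ext (LinearMap.ext e₀.apply_symm_apply) (LinearMap.ext e₁.apply_symm_apply)⟩

lemma isIso_unit : IsIso (envelopeAdjunction.unit.app W) := by
  rw [envelopeAdjunction_unit]
  exact isIso_of_bijective _ (Envelope.unit₀_bijective W) (Envelope.unit₁_bijective W)

end OneTruncatedVertexAlgebra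

/-! ### The degree filtration of the envelope -/

namespace OneTruncatedVertexAlgebra

variable {W : OneTruncatedVertexAlgebra.{u}}

namespace Splitting

variable (S : W.Splitting)

/-- The generator of `W` which corresponds to a symbol. -/
def gen : W.Symbol → W.Gen
  | .ofA _ a => (a, 0)
  | .ofΩ _ w => (0, w)
  | .ofT _ t => (0, S.s t)

/-- The order of differentiation in a symbol. -/
def _root_.OneTruncatedVertexAlgebra.Symbol.order : W.Symbol → ℕ
  | .ofA n _ => n
  | .ofΩ n _ => n
  | .ofT n _ => n

/-- The creation operator of a symbol. -/
def op (x : W.Symbol) : Module.End ℂ W.Envelope := Envelope.ν W x.order (S.gen x)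

/-- The vector `x₁ (x₂ ⋯ (xₖ |0⟩))`. -/
def word (l : List W.Symbol) : W.Envelope := l.foldr (fun x v => S.op x v) (Envelope.vac W)

@[simp] lemma word_nil : S.word [] = Envelope.vac W := rfl

@[simp] lemma word_cons (x : W.Symbol) (l : List W.Symbol) :
    S.word (x :: l) = S.op x (S.word l) := rfl

lemma vertexProd_unit (l : List W.Symbol) :
    W.vertexProd (V := W.envelope) S (Envelope.unitHom W) l = S.word l := by
  have h : ∀ (n : ℕ) (u : W.Gen) (v : W.Envelope),
      W.envelope.op (-1 - n) (Envelope.state W u) v = Envelope.ν W n u v := fun n u v =>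
    congrArg (fun t : Module.End ℂ W.Envelope => t v)
      ((Envelope.op_state W (-1 - n) u).trans (congrArg (fun t => t u) (Envelope.μ_creation W n)))
  induction l with
  | nil => rfl
  | cons x l ih =>
    refine (congrArg (W.symbolOp (V := W.envelope) S (Envelope.unitHom W) x) ih).trans ?_
    cases x with
    | ofA n a => exact h n (a, 0) _
    | ofΩ n w => exact h n (0, w.1) _
    | ofT n t => exact h n (0, S.s t) _

/-- The span of the words of degree less than `d`. -/
def fil (d : ℕ) : Submodule ℂ W.Envelope :=
  Submodule.span ℂ {v | ∃ l, W.totalDegree l < d ∧ v = S.word l}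

variable {S}

lemma word_mem_fil {d : ℕ} {l : List W.Symbol} (h : W.totalDegree l < d) : S.word l ∈ S.fil d :=
  Submodule.subset_span ⟨l, h, rfl⟩

lemma fil_mono {d e : ℕ} (h : d ≤ e) : S.fil d ≤ S.fil e :=
  Submodule.span_mono fun _ ⟨l, hl, hv⟩ => ⟨l, hl.trans_le h, hv⟩

lemma totalDegree_cons (x : W.Symbol) (l : List W.Symbol) :
    W.totalDegree (x :: l) = x.degree + W.totalDegree l := rfl

lemma totalDegree_append (l l' : List W.Symbol) :
    W.totalDegree (l ++ l') = W.totalDegree l + W.totalDegree l' := by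
  simp [totalDegree]

lemma totalWeight_append (l l' : List W.Symbol) :
    W.totalWeight (l ++ l') = W.totalWeight l + W.totalWeight l' := by
  simp [totalWeight]

lemma op_mem_fil (x : W.Symbol) {d e : ℕ} (h : x.degree + d ≤ e) {v : W.Envelope}
    (hv : v ∈ S.fil d) : S.op x v ∈ S.fil e := by
  induction hv using Submodule.span_induction with
  | mem v hv =>
    obtain ⟨l, hl, rfl⟩ := hv
    rw [← word_cons]
    refine word_mem_fil ?_
    rw [totalDegree_cons]
    omega
  | zero => simp
  | add x y _ _ hx hy => rw [map_add]; exact Submodule.add_mem _ hx hy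
  | smul c x _ hx => rw [map_smul]; exact Submodule.smul_mem _ _ hx

lemma ν_A_mem_fil (n : ℕ) (a : W.V₀) {d : ℕ} {v : W.Envelope} (hv : v ∈ S.fil d) :
    Envelope.ν W n (a, 0) v ∈ S.fil d :=
  op_mem_fil (S := S) (.ofA n a) (by simp [Symbol.degree]) hv

lemma ν_Om_mem_fil (n : ℕ) {w : W.V₁} (hw : w ∈ W.Om) {d : ℕ} {v : W.Envelope}
    (hv : v ∈ S.fil d) : Envelope.ν W n (0, w) v ∈ S.fil d :=
  op_mem_fil (S := S) (.ofΩ n ⟨w, hw⟩) (by simp [Symbol.degree]) hv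

lemma ν_V₁_mem_fil (n : ℕ) (x : W.V₁) {d e : ℕ} (h : d + 1 ≤ e) {v : W.Envelope}
    (hv : v ∈ S.fil d) : Envelope.ν W n (0, x) v ∈ S.fil e := by
  have hx : x - S.s (W.Om.mkQ x) ∈ W.Om := sub_mem (S.mkQ_s _).symm
  have e1 : ((0, x) : W.Gen) = (0, S.s (W.Om.mkQ x)) + (0, x - S.s (W.Om.mkQ x)) := by simp
  rw [e1, map_add, LinearMap.add_apply]
  exact Submodule.add_mem _ (op_mem_fil (S := S) (.ofT n _) (by simp [Symbol.degree]; omega) hv)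
    (fil_mono (by omega) (ν_Om_mem_fil n hx hv))

/-- The operators of two symbols commute up to terms of lower degree. -/
lemma op_comm_mem (x y : W.Symbol) {d e : ℕ} (h : x.degree + y.degree + d ≤ e + 1)
    {v : W.Envelope} (hv : v ∈ S.fil d) : S.op x (S.op y v) - S.op y (S.op x v) ∈ S.fil e := by
  have hc := (Envelope.creationModule W).comm x.order y.order (S.gen x) (S.gen y) v
  change S.op x (S.op y v) - S.op y (S.op x v) = Envelope.ν W _ _ _ - _ • Envelope.ν W _ _ _ at hc
  rw [hc, mode_zero, mode_one]
  have hA : ∀ (n m : ℕ) (a b : W.V₀) (c : ℂ), d ≤ e →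
      Envelope.ν W n (a, 0) v - c • Envelope.ν W m (b, 0) v ∈ S.fil e := fun n m a b c hd =>
    Submodule.sub_mem _ (fil_mono hd (ν_A_mem_fil _ _ hv))
      (Submodule.smul_mem _ _ (fil_mono hd (ν_A_mem_fil _ _ hv)))
  have h0 : ∀ (n m : ℕ) (c : ℂ),
      Envelope.ν W n (0, 0) v - c • Envelope.ν W m (0, 0) v ∈ S.fil e := fun n m c => by
    rw [Prod.mk_zero_zero, map_zero, map_zero]; simp
  have hΩ : ∀ (n m : ℕ) (w : W.V₁) (b : W.V₀) (c : ℂ), w ∈ W.Om → d ≤ e →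
      Envelope.ν W n (0, w) v - c • Envelope.ν W m (b, 0) v ∈ S.fil e := fun n m a b c hw hd =>
    Submodule.sub_mem _ (fil_mono hd (ν_Om_mem_fil _ hw hv))
      (Submodule.smul_mem _ _ (fil_mono hd (ν_A_mem_fil _ _ hv)))
  cases x with
  | ofA n a =>
    cases y with
    | ofA m b => simpa [gen] using h0 _ _ _
    | ofΩ m w => simpa [gen, anchor_Om w.2] using h0 _ _ _
    | ofT m t =>
      simp only [Symbol.degree] at h
      simpa [gen] using hA _ _ _ _ _ (by omega)
  | ofΩ n w =>
    cases y with
    | ofA m b => simpa [gen, anchor_Om w.2] using h0 _ _ _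
    | ofΩ m w' => simpa [gen, br_Om_Om w.2 w'.2, pair_Om_Om w.2 w'.2] using h0 _ _ _
    | ofT m t =>
      simp only [Symbol.degree] at h
      simp only [gen, map_zero, sub_zero]
      exact hΩ _ _ _ _ _ (br_mem' w.2 _) (by omega)
  | ofT n t =>
    cases y with
    | ofA m b =>
      simp only [Symbol.degree] at h
      simpa [gen] using hA _ _ _ _ _ (by omega)
    | ofΩ m w =>
      simp only [Symbol.degree] at h
      simp only [gen, map_zero, sub_zero]
      exact hΩ _ _ _ _ _ (br_mem _ w.2) (by omega)
    | ofT m t' =>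
      simp only [Symbol.degree] at h
      simp only [gen, map_zero, sub_zero]
      exact Submodule.sub_mem _ (ν_V₁_mem_fil _ _ (by omega) hv)
        (Submodule.smul_mem _ _ (fil_mono (by omega) (ν_A_mem_fil _ _ hv)))

lemma totalDegree_perm {l l' : List W.Symbol} (h : l.Perm l') :
    W.totalDegree l = W.totalDegree l' := (h.map _).sum_eq

lemma totalWeight_perm {l l' : List W.Symbol} (h : l.Perm l') :
    W.totalWeight l = W.totalWeight l' := (h.map _).sum_eq

/-- Reordering the factors changes a word by terms of lower degree. -/
lemma word_perm {l l' : List W.Symbol} (h : l.Perm l') :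
    S.word l - S.word l' ∈ S.fil (W.totalDegree l) := by
  induction h with
  | nil => simp
  | cons x h ih =>
    rw [word_cons, word_cons, ← map_sub]
    exact op_mem_fil x le_rfl ih
  | swap x y l =>
    rw [word_cons, word_cons, word_cons, word_cons]
    refine op_comm_mem _ _ (d := W.totalDegree l + 1) ?_ (word_mem_fil (Nat.lt_succ_self _))
    rw [totalDegree_cons, totalDegree_cons]
    omega
  | trans h h' ih ih' =>
    rw [← totalDegree_perm h] at ih'
    rw [← sub_add_sub_cancel]
    exact Submodule.add_mem _ ih ih'

lemma foldr_mem_fil (l : List W.Symbol) {d e : ℕ} (h : W.totalDegree l + d ≤ e) {v : W.Envelope}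
    (hv : v ∈ S.fil d) : l.foldr (fun x v => S.op x v) v ∈ S.fil e := by
  induction l generalizing e with
  | nil => exact fil_mono (by simpa [totalDegree] using h) hv
  | cons x l ih =>
    rw [totalDegree_cons] at h
    exact op_mem_fil x (d := W.totalDegree l + d) (by omega) (ih le_rfl)

lemma op_mem_wt (x : W.Symbol) {k : ℕ} {v : W.Envelope}
    (hv : v ∈ Module.End.eigenspace (Envelope.ham W) (k : ℂ)) :
    S.op x v ∈ Module.End.eigenspace (Envelope.ham W) ((x.weight + k : ℕ) : ℂ) := by
  cases x with
  | ofA n a =>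
    convert Envelope.ν_mem_eigenspace₀ W n a hv using 2
    · push_cast [Symbol.weight]; ring
    · rfl
  | ofΩ n w =>
    convert Envelope.ν_mem_eigenspace₁ W n w.1 hv using 2
    · push_cast [Symbol.weight]; ring
    · rfl
  | ofT n t =>
    convert Envelope.ν_mem_eigenspace₁ W n (S.s t) hv using 2
    · push_cast [Symbol.weight]; ring
    · rfl

lemma word_mem_wt (l : List W.Symbol) : S.word l ∈
    Module.End.eigenspace (Envelope.ham W) (W.totalWeight l : ℂ) := by
  induction l with
  | nil => simp [totalWeight]
  | cons x l ih => exact op_mem_wt x ih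

variable (S)

/-- The projection of the envelope to the component of weight `k`. -/
def projWt (k : ℕ) : Module.End ℂ W.Envelope := (W.envelope.wt k).subtype ∘ₗ W.envelope.proj k

lemma projWt_of_mem {k : ℕ} {v : W.Envelope}
    (hv : v ∈ Module.End.eigenspace (Envelope.ham W) (k : ℂ)) : projWt k v = v :=
  congrArg Subtype.val (W.envelope.proj_of_mem hv)

lemma projWt_of_mem_ne {k j : ℕ} (h : j ≠ k) {v : W.Envelope}
    (hv : v ∈ Module.End.eigenspace (Envelope.ham W) (j : ℂ)) : projWt k v = 0 :=
  congrArg Subtype.val (W.envelope.proj_of_mem_ne (by exact_mod_cast h) hv)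

lemma projWt_mem (k : ℕ) (v : W.Envelope) :
    projWt k v ∈ Module.End.eigenspace (Envelope.ham W) (k : ℂ) := (W.envelope.proj k v).2

lemma projWt_mem_fil (k : ℕ) {d : ℕ} {v : W.Envelope} (hv : v ∈ S.fil d) :
    projWt k v ∈ S.fil d := by
  induction hv using Submodule.span_induction with
  | mem v hv =>
    obtain ⟨l, hl, rfl⟩ := hv
    by_cases h : W.totalWeight l = k
    · rw [projWt_of_mem (h ▸ word_mem_wt l)]
      exact word_mem_fil hl
    · rw [projWt_of_mem_ne h (word_mem_wt l)]
      exact zero_mem _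
  | zero => simp
  | add x y _ _ hx hy => rw [map_add]; exact Submodule.add_mem _ hx hy
  | smul c x _ hx => rw [map_smul]; exact Submodule.smul_mem _ _ hx

/-- A projection with kernel the given step of the filtration: it chooses representatives modulo
lower degree. -/
lemma exists_complement (d : ℕ) : ∃ p : Module.End ℂ W.Envelope,
    (∀ v ∈ S.fil d, p v = 0) ∧ ∀ v, p v - v ∈ S.fil d := by
  obtain ⟨q, hq⟩ := (S.fil d).exists_isCompl
  obtain ⟨g, hg⟩ := (S.fil d).subtype.exists_leftInverse_of_injective (by simp)
  refine ⟨LinearMap.id - (S.fil d).subtype ∘ₗ g, fun v hv => ?_, fun v => ?_⟩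
  · have h : g v = ⟨v, hv⟩ := congrArg (fun t => t ⟨v, hv⟩) hg
    simp [h]
  · simp

/-- A projection of the envelope whose kernel is spanned by the words of degree less than `d`. -/
def complement (d : ℕ) : Module.End ℂ W.Envelope := (S.exists_complement d).choose

lemma complement_eq_zero {d : ℕ} {v : W.Envelope} (hv : v ∈ S.fil d) : S.complement d v = 0 :=
  (S.exists_complement d).choose_spec.1 v hv

lemma complement_sub_mem (d : ℕ) (v : W.Envelope) : S.complement d v - v ∈ S.fil d :=
  (S.exists_complement d).choose_spec.2 v

/-- The linear map from polynomials in the symbols which lifts the surjection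
`S(W) → U₁ W`. A monomial is sent to a homogeneous representative of the class of
any of the corresponding words, modulo words of lower degree. -/
def polyMap : MvPolynomial W.Symbol ℂ →ₗ[ℂ] W.Envelope :=
  (MvPolynomial.basisMonomials W.Symbol ℂ).constr ℂ fun m =>
    projWt (W.totalWeight m.toMultiset.toList)
      (S.complement (W.totalDegree m.toMultiset.toList) (S.word m.toMultiset.toList))

open Classical in
lemma monomial_toMultiset (l : List W.Symbol) :
    (l.map (MvPolynomial.X (R := ℂ))).prod =
      MvPolynomial.monomial (Multiset.toFinsupp (l : Multiset W.Symbol)) 1 := by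
  induction l with
  | nil => simp
  | cons x l ih =>
    rw [List.map_cons, List.prod_cons, ih, MvPolynomial.X, MvPolynomial.monomial_mul,
      ← Multiset.cons_coe, ← Multiset.singleton_add, map_add, Multiset.toFinsupp_singleton,
      one_mul]

lemma polyMap_prod (l : List W.Symbol) : S.polyMap (l.map MvPolynomial.X).prod =
    projWt (W.totalWeight l) (S.complement (W.totalDegree l) (S.word l)) := by
  classical
  have hp : ((Multiset.toFinsupp (l : Multiset W.Symbol)).toMultiset.toList).Perm l := by
    rw [Multiset.toFinsupp_toMultiset, ← Multiset.coe_eq_coe, Multiset.coe_toList]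
  have hb := (MvPolynomial.basisMonomials W.Symbol ℂ).constr_basis ℂ (fun m =>
    projWt (W.totalWeight m.toMultiset.toList)
      (S.complement (W.totalDegree m.toMultiset.toList) (S.word m.toMultiset.toList)))
    (Multiset.toFinsupp (l : Multiset W.Symbol))
  rw [MvPolynomial.coe_basisMonomials] at hb
  rw [monomial_toMultiset]
  refine hb.trans ?_
  rw [totalWeight_perm hp, totalDegree_perm hp]
  congr 1
  rw [← sub_eq_zero, ← map_sub]
  refine S.complement_eq_zero ?_
  rw [← totalDegree_perm hp]
  exact word_perm hp

/-- The vectors `Φ(x₁ ⋯ xₖ y)` as functions of the vector that corresponds to `y`, where `y` has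
degree `d` and weight `w`. -/
def leftMul (l : List W.Symbol) (d w : ℕ) : Module.End ℂ W.Envelope :=
  projWt (W.totalWeight l + w) ∘ₗ S.complement (W.totalDegree l + d) ∘ₗ (l.map S.op).prod

lemma foldr_op (l : List W.Symbol) (v : W.Envelope) :
    l.foldr (fun x v => S.op x v) v = (l.map S.op).prod v := by
  induction l with
  | nil => rfl
  | cons x l ih => rw [List.foldr_cons, ih]; rfl

lemma leftMul_eq_zero (l : List W.Symbol) {d : ℕ} (w : ℕ) {v : W.Envelope} (hv : v ∈ S.fil d) :
    S.leftMul l d w v = 0 := by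
  rw [leftMul, LinearMap.comp_apply, LinearMap.comp_apply, ← foldr_op,
    S.complement_eq_zero (foldr_mem_fil l le_rfl hv), map_zero]

lemma polyMap_append (l l' : List W.Symbol) {d w : ℕ} (hd : W.totalDegree l' = d)
    (hw : W.totalWeight l' = w) :
    S.polyMap ((l.map MvPolynomial.X).prod * (l'.map MvPolynomial.X).prod) =
      S.leftMul l d w (S.word l') := by
  rw [← List.prod_append, ← List.map_append, polyMap_prod, totalWeight_append,
    totalDegree_append, hd, hw, leftMul, LinearMap.comp_apply, LinearMap.comp_apply, ← foldr_op,
    word, List.foldr_append]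
  rfl

open MvPolynomial OneTruncatedVertexAlgebra.Symbol in
/-- The ideal of relations is killed: as the last factors of a word, the symbols of a relation act
on the vacuum, where the relation holds up to lower degree. -/
lemma polyMap_mul_relator (l : List W.Symbol) {r : MvPolynomial W.Symbol ℂ} (hr : W.Relator r) :
    S.polyMap ((l.map X).prod * r) = 0 := by
  have h1 : ∀ x, S.polyMap ((l.map X).prod * X x) =
      S.leftMul l x.degree x.weight (S.op x (Envelope.vac W)) := fun x => by
    have := S.polyMap_append l [x] (d := x.degree) (w := x.weight) (by simp [totalDegree])
      (by simp [totalWeight])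
    simpa using this
  have h2 : ∀ x y d w, x.degree + y.degree = d → x.weight + y.weight = w →
      S.polyMap ((l.map X).prod * (X x * X y)) =
      S.leftMul l d w (S.op x (S.op y (Envelope.vac W))) := fun x y d w hd hw => by
    have := S.polyMap_append l [x, y] (d := d) (w := w) (by simpa [totalDegree] using hd)
      (by simpa [totalWeight] using hw)
    simpa using this
  have h0 : S.polyMap ((l.map X).prod * 1) = S.leftMul l 0 0 (Envelope.vac W) := by
    have := S.polyMap_append l [] (d := 0) (w := 0) rfl rfl
    simpa using this
  have hv := Envelope.isVacuum W
  have hp : ∀ (a b : W.V₀), ((a + b, 0) : W.Gen) = (a, 0) + (b, 0) := fun a b => by simp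
  have hp' : ∀ (x y : W.V₁), ((0, x + y) : W.Gen) = (0, x) + (0, y) := fun a b => by simp
  have hs : ∀ (c : ℂ) (a : W.V₀), ((c • a, 0) : W.Gen) = c • (a, 0) := fun c a => by simp
  have hs' : ∀ (c : ℂ) (x : W.V₁), ((0, c • x) : W.Gen) = c • (0, x) := fun c a => by simp
  cases hr with
  | add_A n a b =>
    simp only [mul_sub, mul_add, map_sub, map_add, h1, degree, weight, op, order, gen, hp,
      LinearMap.add_apply, sub_self]
  | add_Ω n v w =>
    simp only [mul_sub, mul_add, map_sub, map_add, h1, degree, weight, op, order, gen, hp',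
      Submodule.coe_add, LinearMap.add_apply, sub_self]
  | add_T n s t =>
    simp only [mul_sub, mul_add, map_sub, map_add, h1, degree, weight, op, order, gen, hp',
      LinearMap.add_apply, sub_self]
  | smul_A n c a =>
    simp only [mul_sub, mul_smul_comm, map_sub, map_smul, h1, degree, weight, op, order, gen, hs,
      LinearMap.smul_apply, sub_self]
  | smul_Ω n c w =>
    simp only [mul_sub, mul_smul_comm, map_sub, map_smul, h1, degree, weight, op, order, gen, hs',
      SetLike.val_smul, LinearMap.smul_apply, sub_self]
  | smul_T n c t =>
    simp only [mul_sub, mul_smul_comm, map_sub, map_smul, h1, degree, weight, op, order, gen, hs',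
      LinearMap.smul_apply, sub_self]
  | one =>
    rw [mul_sub, map_sub, h1, h0, sub_eq_zero]
    exact congrArg _ ((hv.vac 0).trans (if_pos rfl))
  | leibniz_A n a b =>
    rw [mul_sub, Finset.mul_sum, map_sub, map_sum, h1, sub_eq_zero,
      Finset.sum_congr rfl fun p hp => h2 _ _ 0 n rfl
        (Finset.HasAntidiagonal.mem_antidiagonal.1 hp),
      ← map_sum]
    refine congrArg _ (Eq.trans ?_ (hv.mul n a (b, 0)))
    rw [mode_neg_one, map_zero]
    rfl
  | leibniz_Ω n a w =>
    rw [mul_sub, Finset.mul_sum, map_sub, map_sum, h1, sub_eq_zero,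
      Finset.sum_congr rfl fun p hp => h2 _ _ 0 (n + 1) rfl (by
        have := Finset.HasAntidiagonal.mem_antidiagonal.1 hp
        simp only [weight]; omega), ← map_sum]
    refine congrArg _ (Eq.trans ?_ (hv.mul n a (0, w)))
    rw [mode_neg_one, map_zero]
    rfl
  | leibniz_T n a t =>
    rw [mul_sub, Finset.mul_sum, map_sub, map_sum, h1,
      Finset.sum_congr rfl fun p hp => h2 _ _ 1 (n + 1) rfl (by
        have := Finset.HasAntidiagonal.mem_antidiagonal.1 hp
        simp only [weight]; omega), ← map_sum]
    change S.leftMul l 1 (n + 1) _ - _ = 0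
    rw [← map_sub]
    refine S.leftMul_eq_zero l _ ?_
    have h := hv.mul n a (0, S.s t)
    rw [mode_neg_one, map_zero] at h
    change Envelope.ν W n (0, W.act a (S.s t)) (Envelope.vac W) = _ at h
    change Envelope.ν W n (0, S.s (a • t)) (Envelope.vac W) -
      ∑ p ∈ antidiagonal n,
        Envelope.ν W p.1 (a, 0) (Envelope.ν W p.2 (0, S.s t) (Envelope.vac W)) ∈ _
    have e : ((0, S.s (a • t) - W.act a (S.s t)) : W.Gen) =
      (0, S.s (a • t)) - (0, W.act a (S.s t)) := by simp
    have h' := ν_Om_mem_fil (S := S) n (S.γ_mem a t) (d := 1) (v := Envelope.vac W)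
      (word_mem_fil (l := []) (by simp [totalDegree]))
    rw [e, map_sub, LinearMap.sub_apply, h] at h'
    exact h'
  | d n a =>
    rw [mul_sub, mul_smul_comm, map_sub, map_smul, h1, h1, sub_eq_zero]
    refine Eq.trans (congrArg _ ((Envelope.creationModule W).der n a (Envelope.vac W))) ?_
    rw [map_smul]
    rfl

lemma polyMap_eq_zero {f : MvPolynomial W.Symbol ℂ}
    (hf : f ∈ Ideal.span {p | W.Relator p}) : S.polyMap f = 0 := by
  have key : ∀ (g r : MvPolynomial W.Symbol ℂ), W.Relator r → S.polyMap (g * r) = 0 := by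
    classical
    intro g r hr
    induction g using MvPolynomial.induction_on' with
    | monomial m c =>
      have hc : MvPolynomial.monomial m c = c • MvPolynomial.monomial m (1 : ℂ) := by
        rw [MvPolynomial.smul_monomial, smul_eq_mul, mul_one]
      rw [hc, smul_mul_assoc, map_smul]
      have h := monomial_toMultiset m.toMultiset.toList
      rw [Multiset.coe_toList, Finsupp.toMultiset_toFinsupp] at h
      rw [← h, S.polyMap_mul_relator _ hr, smul_zero]
    | add p q hp hq => rw [add_mul, map_add, hp, hq, add_zero]
  induction hf using Submodule.span_induction with
  | mem r hr => simpa using key 1 r hr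
  | zero => simp
  | add x y _ _ hx hy => rw [map_add, hx, hy, add_zero]
  | smul g x hx ih =>
    clear ih
    induction hx using Submodule.span_induction generalizing g with
    | mem r hr => exact key g r hr
    | zero => simp
    | add x y _ _ hx hy => rw [smul_add, map_add, hx, hy, add_zero]
    | smul g' x _ ih => rw [smul_smul]; exact ih _

/-- The surjection `Φ : S(W) → U₁ W`. -/
def symbolMap : W.SymbolAlgebra →ₗ[ℂ] W.Envelope :=
  ((Ideal.span {p | W.Relator p}).restrictScalars ℂ).liftQ S.polyMap fun _ hf =>
    S.polyMap_eq_zero hf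

lemma symbolMap_symbolProd (l : List W.Symbol) : S.symbolMap (W.symbolProd l) =
    projWt (W.totalWeight l) (S.complement (W.totalDegree l) (S.word l)) := S.polyMap_prod l

lemma symbolMap_mem_wt (l : List W.Symbol) : S.symbolMap (W.symbolProd l) ∈
    Module.End.eigenspace (Envelope.ham W) (W.totalWeight l : ℂ) := by
  rw [symbolMap_symbolProd]
  exact projWt_mem _ _

lemma symbolMap_sub_mem (l : List W.Symbol) :
    S.symbolMap (W.symbolProd l) - S.word l ∈ S.fil (W.totalDegree l) := by
  have h : S.symbolMap (W.symbolProd l) - S.word l = projWt (W.totalWeight l)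
      (S.complement (W.totalDegree l) (S.word l) - S.word l) := by
    rw [symbolMap_symbolProd, map_sub, projWt_of_mem (word_mem_wt l)]
  rw [h]
  exact S.projWt_mem_fil _ (S.complement_sub_mem _ _)

lemma fil_le_range (d : ℕ) : S.fil d ≤ LinearMap.range S.symbolMap := by
  induction d with
  | zero =>
    refine Submodule.span_le.2 ?_
    rintro _ ⟨l, hl, -⟩
    exact absurd hl (Nat.not_lt_zero _)
  | succ d ih =>
    refine Submodule.span_le.2 ?_
    rintro _ ⟨l, hl, rfl⟩
    have h := ih (fil_mono (Nat.lt_succ_iff.1 hl) (S.symbolMap_sub_mem l))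
    have := Submodule.sub_mem _ (LinearMap.mem_range_self S.symbolMap (W.symbolProd l)) h
    simpa using this

/-- Every vector lies in some step of the filtration, and each step is in the range of `Φ` by
induction on the degree. -/
lemma symbolMap_surjective : Function.Surjective S.symbolMap := by
  rw [← LinearMap.range_eq_top]
  refine eq_top_iff.2 fun v hv => ?_
  clear hv
  have h : ∃ d, v ∈ S.fil d := by
    induction v using Envelope.induction with
    | vac => exact ⟨1, word_mem_fil (l := []) (by simp [totalDegree])⟩
    | zero => exact ⟨0, zero_mem _⟩
    | add x y hx hy =>
      obtain ⟨d, hd⟩ := hx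
      obtain ⟨e, he⟩ := hy
      exact ⟨max d e, Submodule.add_mem _ (fil_mono (le_max_left _ _) hd)
        (fil_mono (le_max_right _ _) he)⟩
    | smul c x hx => exact ⟨hx.choose, Submodule.smul_mem _ _ hx.choose_spec⟩
    | creation n u x hx =>
      obtain ⟨d, hd⟩ := hx
      refine ⟨d + 1, ?_⟩
      rw [Envelope.ν_split]
      exact Submodule.add_mem _ (fil_mono (Nat.le_succ d) (ν_A_mem_fil n u.1 hd))
        (ν_V₁_mem_fil n u.2 le_rfl hd)
  obtain ⟨d, hd⟩ := h
  exact S.fil_le_range d hd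

/-- If there is a linear map `θ` from the envelope whose leading symbols recover the elements of
the symbol algebra, then `Φ` is injective. -/
lemma symbolMap_injective {C C' : Type*} [AddCommGroup C] [Module ℂ C] [AddCommGroup C']
    [Module ℂ C'] (θ : W.Envelope →ₗ[ℂ] C) (h : ℕ → C →ₗ[ℂ] C') (sym : W.SymbolAlgebra →ₗ[ℂ] C')
    (hsym : Function.Injective sym)
    (h1 : ∀ l, h (W.totalDegree l) (θ (S.word l)) = sym (W.symbolProd l))
    (h2 : ∀ l e, W.totalDegree l < e → h e (θ (S.word l)) = 0) :
    Function.Injective S.symbolMap := by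
  have hfil : ∀ d, ∀ v ∈ S.fil d, h d (θ v) = 0 := by
    intro d v hv
    induction hv using Submodule.span_induction with
    | mem v hv =>
      obtain ⟨l, hl, rfl⟩ := hv
      exact h2 l d hl
    | zero => simp
    | add x y _ _ hx hy => simp [hx, hy]
    | smul c x _ hx => simp [hx]
  have hΦ : ∀ l, h (W.totalDegree l) (θ (S.symbolMap (W.symbolProd l))) =
      sym (W.symbolProd l) := fun l => by
    have := hfil _ _ (S.symbolMap_sub_mem l)
    rwa [map_sub, map_sub, h1, sub_eq_zero] at this
  have hΦ' : ∀ l e, W.totalDegree l < e → h e (θ (S.symbolMap (W.symbolProd l))) = 0 :=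
    fun l e he => by
      have := hfil _ _ (fil_mono he.le (S.symbolMap_sub_mem l))
      rwa [map_sub, map_sub, h2 l e he, sub_zero] at this
  let P : ℕ → Submodule ℂ W.SymbolAlgebra := fun d =>
    Submodule.span ℂ {v | ∃ l, W.totalDegree l < d ∧ v = W.symbolProd l}
  have hP : ∀ d, ∀ f ∈ P d, S.symbolMap f = 0 → f = 0 := by
    intro d
    induction d with
    | zero =>
      intro f hf _
      have : P 0 = ⊥ := by
        refine Submodule.span_eq_bot.2 ?_
        rintro _ ⟨l, hl, -⟩
        exact absurd hl (Nat.not_lt_zero _)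
      rw [this] at hf
      simpa using hf
    | succ d ih =>
      intro f hf h0
      have hsplit : ∃ g ∈ Submodule.span ℂ {v | ∃ l, W.totalDegree l = d ∧ v = W.symbolProd l},
          f - g ∈ P d := by
        clear h0
        induction hf using Submodule.span_induction with
        | mem v hv =>
          obtain ⟨l, hl, rfl⟩ := hv
          rcases Nat.lt_succ_iff_lt_or_eq.1 hl with hl | hl
          · exact ⟨0, zero_mem _, by rw [sub_zero]; exact Submodule.subset_span ⟨l, hl, rfl⟩⟩
          · exact ⟨_, Submodule.subset_span ⟨l, hl, rfl⟩, by rw [sub_self]; exact zero_mem _⟩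
        | zero => exact ⟨0, zero_mem _, by simp⟩
        | add x y _ _ hx hy =>
          obtain ⟨g, hg, hxg⟩ := hx
          obtain ⟨g', hg', hyg⟩ := hy
          exact ⟨g + g', add_mem hg hg', by rw [add_sub_add_comm]; exact add_mem hxg hyg⟩
        | smul c x _ hx =>
          obtain ⟨g, hg, hxg⟩ := hx
          exact ⟨c • g, Submodule.smul_mem _ _ hg, by
            rw [← smul_sub]; exact Submodule.smul_mem _ _ hxg⟩
      obtain ⟨g, hg, hfg⟩ := hsplit
      have e1 : h d (θ (S.symbolMap g)) = sym g := by
        clear hfg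
        induction hg using Submodule.span_induction with
        | mem v hv =>
          obtain ⟨l, rfl, rfl⟩ := hv
          exact hΦ l
        | zero => simp
        | add x y _ _ hx hy => simp [hx, hy]
        | smul c x _ hx => simp [hx]
      have e2 : ∀ v ∈ P d, h d (θ (S.symbolMap v)) = 0 := fun v hv => by
        induction hv using Submodule.span_induction with
        | mem v hv =>
          obtain ⟨l, hl, rfl⟩ := hv
          exact hΦ' l d hl
        | zero => simp
        | add x y _ _ hx hy => simp [hx, hy]
        | smul c x _ hx => simp [hx]
      have e3 := e2 _ hfg
      rw [map_sub, h0, map_sub, map_zero, map_sub, map_zero, e1, zero_sub, neg_eq_zero] at e3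
      obtain rfl : g = 0 := hsym (e3.trans (map_zero sym).symm)
      rw [sub_zero] at hfg
      exact ih f hfg h0
  refine (injective_iff_map_eq_zero _).2 fun f hf => ?_
  have : ∃ d, f ∈ P d := by
    obtain ⟨p, rfl⟩ := Ideal.Quotient.mk_surjective f
    clear hf
    induction p using MvPolynomial.induction_on' with
    | monomial m c =>
      classical
      have hc : MvPolynomial.monomial m c = c • MvPolynomial.monomial m (1 : ℂ) := by
        rw [MvPolynomial.smul_monomial, smul_eq_mul, mul_one]
      have h := monomial_toMultiset m.toMultiset.toList
      rw [Multiset.coe_toList, Finsupp.toMultiset_toFinsupp] at h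
      rw [hc, ← h]
      have hm : W.symbolProd m.toMultiset.toList ∈ P (W.totalDegree m.toMultiset.toList + 1) :=
        Submodule.subset_span ⟨_, Nat.lt_succ_self _, rfl⟩
      exact ⟨_, Submodule.smul_mem _ c hm⟩
    | add p q hp hq =>
      obtain ⟨d, hd⟩ := hp
      obtain ⟨e, he⟩ := hq
      have hm : ∀ {a b}, a ≤ b → P a ≤ P b := fun hab =>
        Submodule.span_mono fun _ ⟨l, hl, hv⟩ => ⟨l, hl.trans_le hab, hv⟩
      exact ⟨max d e, Submodule.add_mem _ (hm (le_max_left _ _) hd) (hm (le_max_right _ _) he)⟩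
  obtain ⟨d, hd⟩ := this
  exact hP d f hd hf

end Splitting
end OneTruncatedVertexAlgebra

/-! ### Prevertex algebras and split one-truncated vertex algebras -/

namespace TruncOps

variable {A M : Type u} [CommRing A] [Algebra ℂ A] [AddCommGroup M] [Module ℂ M]
  (D : TruncOps A M)

lemma toOneTruncated_mul (a b : A) : D.toOneTruncated.mul a b = a * b := by
  change (D.mode (-1) (a, 0) (b, 0)).1 = _
  simp [mode_mk]

lemma toOneTruncated_act (a : A) (x : M) : D.toOneTruncated.act a x = D.act a x := by
  change (D.mode (-1) (a, 0) (0, x)).2 = _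
  simp [mode_mk]

lemma toOneTruncated_anchor (x : M) (a : A) : D.toOneTruncated.anchor x a = D.anchor x a := by
  change (D.mode 0 (0, x) (a, 0)).1 = _
  simp [mode_mk]

lemma toOneTruncated_br (x y : M) : D.toOneTruncated.br x y = D.br x y := by
  change (D.mode 0 (0, x) (0, y)).2 = _
  simp [mode_mk]

lemma toOneTruncated_pair (x y : M) : D.toOneTruncated.pair x y = D.pair x y := by
  change (D.mode 1 (0, x) (0, y)).1 = _
  simp [mode_mk]

lemma toOneTruncated_d (a : A) : D.toOneTruncated.d a = D.d a := by
  change (D.mode (-2) (a, 0) (1, 0)).2 = _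
  simp [mode_mk, D.one_act]

end TruncOps

namespace PrevertexAlgebra

variable (P : PrevertexAlgebra.{u})

/-- The one-truncated vertex algebra of a prevertex algebra. -/
abbrev trunc : OneTruncatedVertexAlgebra.{u} := P.truncOps.toOneTruncated

lemma mem_Om_iff (x : P.T × P.Ω) : x ∈ P.trunc.Om ↔ x.1 = 0 := by
  have hd : ∀ a b : P.A, P.trunc.act a (P.trunc.d b) = ((0, a • P.d b) : P.T × P.Ω) := by
    intro a b
    refine (congrArg (P.trunc.act a) (P.truncOps.toOneTruncated_d b)).trans
      ((P.truncOps.toOneTruncated_act _ _).trans ?_)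
    change P.act a (0, P.d b) = _
    simp [act_mk]
  constructor
  · have hle : P.trunc.Om ≤ LinearMap.ker (LinearMap.fst ℂ P.T P.Ω) := by
      refine Submodule.span_le.2 ?_
      rintro _ ⟨a, b, rfl⟩
      exact congrArg Prod.fst (hd a b)
    exact fun hx => hle hx
  · obtain ⟨t, w⟩ := x
    rintro rfl
    induction w using P.Ω_induction with
    | h a b =>
      rw [← hd]
      exact OneTruncatedVertexAlgebra.act_d_mem _ _
    | h0 => exact zero_mem _
    | hadd v w hv hw =>
      have e : ((0, v + w) : P.T × P.Ω) = (0, v) + (0, w) := by simp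
      exact e ▸ Submodule.add_mem _ hv hw
    | hsmul c w hw =>
      have e : ((0, c • w) : P.T × P.Ω) = c • (0, w) := by simp
      exact e ▸ Submodule.smul_mem _ c hw

/-- The splitting `τ ↦ (τ, 0)` of `A ⊕ (𝒯 ⊕ Ω)`. -/
def split : P.trunc.Splitting where
  s := P.trunc.Om.liftQ (LinearMap.inl ℂ P.T P.Ω ∘ₗ LinearMap.fst ℂ P.T P.Ω) fun x hx => by
    have := (P.mem_Om_iff x).1 hx
    change ((x.1, 0) : P.T × P.Ω) = 0
    rw [this]
    rfl
  mkQ_s t := by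
    obtain ⟨x, rfl⟩ := Submodule.mkQ_surjective _ t
    refine (Submodule.Quotient.eq _).2 ((P.mem_Om_iff _).2 ?_)
    exact sub_self _

/-- The projection `𝒯 ⊕ Ω → 𝒯`, as a map to the quotient of `𝒯 ⊕ Ω` by `Ω`. -/
def toT : P.T →ₗ[ℂ] P.trunc.T := P.trunc.Om.mkQ ∘ₗ LinearMap.inl ℂ P.T P.Ω

lemma mkQ_eq_toT (x : P.T × P.Ω) : P.trunc.Om.mkQ x = P.toT x.1 :=
  (Submodule.Quotient.eq _).2 ((P.mem_Om_iff _).2 (sub_self _))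

lemma split_s_toT (t : P.T) : P.split.s (P.toT t) = ((t, 0) : P.T × P.Ω) := rfl

/-- The inclusion `Ω → 𝒯 ⊕ Ω`. -/
def toOm : P.Ω →ₗ[ℂ] P.trunc.Om :=
  LinearMap.codRestrict _ (LinearMap.inr ℂ P.T P.Ω) fun _ => (P.mem_Om_iff _).2 rfl

/-- A prevertex algebra is isomorphic to that of the corresponding split one-truncated vertex
algebra. -/
def unitHom : Hom P P.split.prevertex where
  fA := AlgHom.ofLinearMap (LinearMap.id : P.A →ₗ[ℂ] P.A) (rfl : (1 : P.A) = 1)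
    (fun a b => (P.truncOps.toOneTruncated_mul a b).symm)
  fΩ := P.toOm
  fT := P.toT
  map_smulΩ a w := Subtype.ext (by
    refine Eq.trans ?_ (P.truncOps.toOneTruncated_act a (0, w)).symm
    change ((0, a • w) : P.T × P.Ω) = P.act a (0, w)
    simp [act_mk])
  map_d a := Subtype.ext (P.truncOps.toOneTruncated_d a).symm
  map_smulT a t := by
    refine Eq.trans ?_ (congrArg P.trunc.Om.mkQ (P.truncOps.toOneTruncated_act a (t, 0)).symm)
    exact (P.mkQ_eq_toT (P.act a (t, 0))).symm
  map_lie s t := by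
    refine Eq.trans ?_ (congrArg P.trunc.Om.mkQ
      (P.truncOps.toOneTruncated_br (s, 0) (t, 0)).symm)
    exact (P.mkQ_eq_toT (P.br (s, 0) (t, 0))).symm
  map_lieA t a := (P.truncOps.toOneTruncated_anchor (t, 0) a).symm
  map_γ a t := Subtype.ext (by
    have h1 : (show P.trunc.V₀ from a) • P.toT t = P.toT (a • t) :=
      (congrArg P.trunc.Om.mkQ (P.truncOps.toOneTruncated_act a (t, 0))).trans
        (P.mkQ_eq_toT (P.act a (t, 0)))
    have h2 : P.trunc.act a (P.split.s (P.toT t)) = P.act a (t, 0) :=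
      P.truncOps.toOneTruncated_act a (t, 0)
    change ((0, P.γ a t) : P.T × P.Ω) =
      P.split.s ((show P.trunc.V₀ from a) • P.toT t) - P.trunc.act a (P.split.s (P.toT t))
    rw [h1, h2, split_s_toT, act_mk]
    refine Prod.ext (sub_self (a • t)).symm ?_
    change P.γ a t = 0 - (a • 0 - P.γ a t)
    rw [smul_zero, zero_sub, zero_sub, neg_neg])
  map_form s t := by
    refine Eq.trans ?_ (P.truncOps.toOneTruncated_pair (s, 0) (t, 0)).symm
    change P.form s t = P.pair (s, 0) (t, 0)
    simp [pair_mk]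
  map_c2 s t := Subtype.ext (by
    have h1 : ⁅P.toT s, P.toT t⁆ = P.toT ⁅s, t⁆ :=
      (congrArg P.trunc.Om.mkQ (P.truncOps.toOneTruncated_br (s, 0) (t, 0))).trans
        (P.mkQ_eq_toT (P.br (s, 0) (t, 0)))
    have h2 : P.trunc.sbr (P.split.s (P.toT s)) (P.split.s (P.toT t)) =
        ((⁅s, t⁆, - P.c2 s t) : P.T × P.Ω) := by
      rw [OneTruncatedVertexAlgebra.sbr_eq]
      refine (congrArg₂ (· - ·) (P.truncOps.toOneTruncated_br (s, 0) (t, 0))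
        (congrArg (fun x => (1 / 2 : ℂ) • x) ((P.truncOps.toOneTruncated_d _).trans
          (congrArg P.truncOps.d (P.truncOps.toOneTruncated_pair (s, 0) (t, 0)))))).trans ?_
      change P.br (s, 0) (t, 0) - (1 / 2 : ℂ) • ((0, P.d (P.pair (s, 0) (t, 0))) : P.T × P.Ω) = _
      simp [br_mk, pair_mk]
    change ((0, P.c2 s t) : P.T × P.Ω) = P.split.s ⁅P.toT s, P.toT t⁆ -
      P.trunc.sbr (P.split.s (P.toT s)) (P.split.s (P.toT t))
    rw [h1, h2, split_s_toT]
    refine Prod.ext (sub_self ⁅s, t⁆).symm ?_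
    exact (neg_neg (P.c2 s t)).symm.trans (zero_sub (-P.c2 s t)).symm)

variable {P} {W : OneTruncatedVertexAlgebra.{u}}

open OneTruncatedVertexAlgebra

/-- The morphism `A ⊕ (𝒯 ⊕ Ω) → W`, `(a, τ, ω) ↦ (a, s(τ) + ω)`, defined by maps to the
components of the prevertex algebra of a split one-truncated vertex algebra `W`. -/
def truncHomOfMaps (S : W.Splitting) (fA : P.A →ₗ[ℂ] W.V₀) (fΩ : P.Ω →ₗ[ℂ] W.Om)
    (fT : P.T →ₗ[ℂ] W.T) (map_one : fA 1 = W.vac) (map_mul : ∀ a b, fA (a * b) = fA a * fA b)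
    (map_smulΩ : ∀ (a : P.A) (w : P.Ω), fΩ (a • w) = fA a • fΩ w)
    (map_d : ∀ a, fΩ (P.d a) = dOm (fA a))
    (map_smulT : ∀ (a : P.A) (t : P.T), fT (a • t) = fA a • fT t)
    (map_lie : ∀ s t : P.T, fT ⁅s, t⁆ = ⁅fT s, fT t⁆)
    (map_lieA : ∀ (t : P.T) (a : P.A), fA ⁅t, a⁆ = ⁅fT t, fA a⁆)
    (map_γ : ∀ a t, fΩ (P.γ a t) = S.γ (fA a) (fT t))
    (map_form : ∀ s t, fA (P.form s t) = S.form (fT s) (fT t))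
    (map_c2 : ∀ s t, fΩ (P.c2 s t) = S.c2 (fT s) (fT t))
    (map_pairing : ∀ t w, fA (P.pairing t w) = S.pairing (fT t) (fΩ w))
    (map_lieΩ : ∀ t w, fΩ (P.lieΩ t w) = S.lieOm (fT t) (fΩ w)) :
    OneTruncatedVertexAlgebra.Hom P.trunc W := by
  let f₁ : P.T × P.Ω →ₗ[ℂ] W.V₁ := (S.s ∘ₗ fT).coprod (W.Om.subtype ∘ₗ fΩ)
  have hf₁ : ∀ (t : P.T) (w : P.Ω), f₁ ((t, w) : P.T × P.Ω) = S.s (fT t) + (fΩ w).1 :=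
    fun t w => rfl
  have h_anchor : ∀ (x : P.T × P.Ω) (a : P.A),
      fA (P.anchor x a) = W.anchor (f₁ x) (fA a) := by
    rintro ⟨t, w⟩ a
    rw [hf₁, map_add, LinearMap.add_apply, anchor_Om (fΩ w).2, add_zero, S.anchor_s, anchor_mk,
      map_lieA]
  have h_d : ∀ a : P.A, f₁ (0, P.d a) = W.d (fA a) := fun a => by
    rw [hf₁, map_zero, map_zero, zero_add, map_d, coe_dOm]
  have h_act : ∀ (a : P.A) (x : P.T × P.Ω), f₁ (P.act a x) = W.act (fA a) (f₁ x) := by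
    rintro a ⟨t, w⟩
    rw [act_mk, hf₁, hf₁, map_sub, Submodule.coe_sub, map_γ, S.coe_γ, map_smulΩ, coe_smul,
      map_smulT, map_add]
    abel
  have h_pair : ∀ x y : P.T × P.Ω, fA (P.pair x y) = W.pair (f₁ x) (f₁ y) := by
    rintro ⟨s, v⟩ ⟨t, w⟩
    rw [pair_mk, map_add, map_add, map_form, map_pairing, map_pairing, hf₁, hf₁, map_add, map_add,
      LinearMap.add_apply, LinearMap.add_apply, pair_Om_Om (fΩ v).2 (fΩ w).2,
      W.pair_comm (fΩ v).1, add_zero, S.form_eq, S.pairing_eq, S.pairing_eq]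
    abel
  have h_br : ∀ x y : P.T × P.Ω, f₁ (P.br x y) = W.br (f₁ x) (f₁ y) := by
    rintro ⟨s, v⟩ ⟨t, w⟩
    have e1 := W.br_comm (fΩ v).1 (S.s (fT t))
    have e2 := W.pair_comm (fΩ v).1 (S.s (fT t))
    simp only [br_mk, hf₁, map_add, map_sub, map_neg, map_smul, LinearMap.add_apply, map_c2, map_d,
      map_form, map_pairing, map_lieΩ, map_lie, Submodule.coe_add, Submodule.coe_sub,
      Submodule.coe_neg, SetLike.val_smul, S.coe_c2, coe_dOm, S.coe_lieOm, S.form_eq, S.pairing_eq,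
      sbr_eq, e1, e2, br_Om_Om (fΩ v).2 (fΩ w).2]
    module
  refine OneTruncatedVertexAlgebra.Hom.ofOps fA f₁ map_one ?_ ?_ ?_ fun a =>
    (congrArg f₁ (P.truncOps.toOneTruncated_d a)).trans (h_d a)
  · intro u v
    rw [mode_zero, mode_zero]
    refine Prod.ext ?_ ((congrArg f₁ (P.truncOps.toOneTruncated_br u.2 v.2)).trans (h_br _ _))
    refine Eq.trans (congrArg fA (congrArg₂ (· - ·) (P.truncOps.toOneTruncated_anchor u.2 v.1)
      (P.truncOps.toOneTruncated_anchor v.2 u.1))) ?_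
    exact (map_sub fA _ _).trans (congrArg₂ (· - ·) (h_anchor _ _) (h_anchor _ _))
  · intro u v
    rw [mode_one, mode_one]
    exact Prod.ext ((congrArg fA (P.truncOps.toOneTruncated_pair u.2 v.2)).trans (h_pair _ _))
      (map_zero f₁)
  · intro a v
    rw [mode_neg_one, mode_neg_one]
    exact Prod.ext ((congrArg fA (P.truncOps.toOneTruncated_mul a v.1)).trans (map_mul _ _))
      ((congrArg f₁ (P.truncOps.toOneTruncated_act a v.2)).trans (h_act _ _))

/-- The morphism `A ⊕ (𝒯 ⊕ Ω) → W` defined by a morphism to the prevertex algebra of a split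
one-truncated vertex algebra `W`. -/
def ofPrevertexHom (S : W.Splitting) (h : Hom P S.prevertex) :
    OneTruncatedVertexAlgebra.Hom P.trunc W :=
  truncHomOfMaps S h.fA.toLinearMap h.fΩ h.fT (map_one h.fA) (map_mul h.fA) h.map_smulΩ h.map_d
    h.map_smulT h.map_lie h.map_lieA h.map_γ h.map_form h.map_c2 h.map_pairing h.map_lieΩ

lemma ofPrevertexHom_onT (S : W.Splitting) (h : Hom P S.prevertex) (t : P.T) :
    (ofPrevertexHom S h).onT (P.toT t) = h.fT t := by
  have e : (ofPrevertexHom S h).f₁ ((t, 0) : P.T × P.Ω) = S.s (h.fT t) :=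
    (congrArg (fun z => S.s (h.fT t) + W.Om.subtype z) (map_zero h.fΩ)).trans (add_zero _)
  exact (congrArg W.Om.mkQ e).trans (S.mkQ_s _)

lemma ofPrevertexHom_s (S : W.Splitting) (h : Hom P S.prevertex) (t : P.trunc.T) :
    (ofPrevertexHom S h).f₁ (P.split.s t) = S.s ((ofPrevertexHom S h).onT t) := by
  obtain ⟨x, hx⟩ := Submodule.mkQ_surjective _ t
  obtain rfl : t = P.toT x.1 := hx.symm.trans (P.mkQ_eq_toT x)
  rw [ofPrevertexHom_onT]
  exact (congrArg (fun z => S.s (h.fT x.1) + W.Om.subtype z) (map_zero h.fΩ)).trans (add_zero _)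

/-- The morphism to the prevertex algebra of a split one-truncated vertex algebra `W` defined by
a morphism `A ⊕ (𝒯 ⊕ Ω) → W` which commutes with the splittings. -/
def toPrevertexHom (S : W.Splitting) (f : OneTruncatedVertexAlgebra.Hom P.trunc W)
    (hf : ∀ t, f.f₁ (P.split.s t) = S.s (f.onT t)) : Hom P S.prevertex :=
  CategoryStruct.comp (obj := PrevertexAlgebra.{u}) (X := P) (Y := P.split.prevertex)
    (Z := S.prevertex) P.unitHom (f.onPrevertex P.split S hf)

/-- Morphisms from a prevertex algebra to that of a split one-truncated vertex algebra `W` are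
morphisms `A ⊕ (𝒯 ⊕ Ω) → W` which commute with the splittings. -/
def splitEquiv (S : W.Splitting) :
    {f : OneTruncatedVertexAlgebra.Hom P.trunc W // ∀ t, f.f₁ (P.split.s t) = S.s (f.onT t)} ≃
      Hom P S.prevertex where
  toFun f := toPrevertexHom S f.1 f.2
  invFun h := ⟨ofPrevertexHom S h, ofPrevertexHom_s S h⟩
  left_inv f := by
    refine Subtype.ext (OneTruncatedVertexAlgebra.Hom.ext rfl (LinearMap.ext fun x => ?_))
    obtain ⟨t, w⟩ := x
    have h1 : S.s (f.1.onT (P.toT t)) = f.1.f₁ ((t, 0) : P.T × P.Ω) := (f.2 (P.toT t)).symm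
    refine (congrArg (· + f.1.f₁ ((0, w) : P.T × P.Ω)) h1).trans
      ((map_add f.1.f₁ _ _).symm.trans (congrArg f.1.f₁ ?_))
    exact Prod.ext (add_zero t) (zero_add w)
  right_inv h := by
    refine Hom.ext (AlgHom.ext fun a => rfl) (LinearMap.ext fun w => Subtype.ext ?_)
      (LinearMap.ext fun t => ofPrevertexHom_onT S h t)
    exact (congrArg (· + W.Om.subtype (h.fΩ w)) ((congrArg S.s (map_zero h.fT)).trans
      (map_zero S.s))).trans (zero_add _)

end PrevertexAlgebra

/-! ### The vertex envelope of a prevertex algebra -/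

namespace OneTruncatedVertexAlgebra

variable {W W' W'' : OneTruncatedVertexAlgebra.{u}}

lemma Hom.onT_comp (f : Hom W W') (g : Hom W' W'') (h : Hom W W'')
    (e : ∀ x, h.f₁ x = g.f₁ (f.f₁ x)) (t : W.T) : h.onT t = g.onT (f.onT t) := by
  obtain ⟨x, rfl⟩ := Submodule.mkQ_surjective _ t
  exact congrArg W''.Om.mkQ (e x)

/-- The transport of a splitting along an isomorphism `i`, with inverse `j`. -/
def Splitting.transport (S : W.Splitting) (i : Hom W W') (j : Hom W' W)
    (hij : ∀ x, i.f₁ (j.f₁ x) = x) : W'.Splitting where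
  s := i.f₁ ∘ₗ S.s ∘ₗ j.onT
  mkQ_s t := by
    obtain ⟨x, rfl⟩ := Submodule.mkQ_surjective _ t
    have h := S.mkQ_s (W.Om.mkQ (j.f₁ x))
    have h' : i.onT (W.Om.mkQ (S.s (W.Om.mkQ (j.f₁ x)))) = i.onT (W.Om.mkQ (j.f₁ x)) :=
      congrArg _ h
    exact h'.trans (congrArg W'.Om.mkQ (hij x))

/-- The inverse of the unit. -/
def Envelope.unitInv (W : OneTruncatedVertexAlgebra.{u}) : Hom W.envelope.truncObj W :=
  haveI : IsIso (show W ⟶ W.envelope.truncObj from unitHom W) :=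
    isIso_of_bijective _ (unit₀_bijective W) (unit₁_bijective W)
  inv (show W ⟶ W.envelope.truncObj from unitHom W)

lemma Envelope.unitHom_unitInv (x : W.envelope.truncObj.V₁) :
    (unitHom W).f₁ ((unitInv W).f₁ x) = x :=
  haveI : IsIso (show W ⟶ W.envelope.truncObj from unitHom W) :=
    isIso_of_bijective _ (unit₀_bijective W) (unit₁_bijective W)
  LinearMap.congr_fun (congrArg Hom.f₁
    (IsIso.inv_hom_id (show W ⟶ W.envelope.truncObj from unitHom W))) x

lemma Envelope.unitInv_unitHom (x : W.V₁) :
    (unitInv W).f₁ ((unitHom W).f₁ x) = x :=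
  haveI : IsIso (show W ⟶ W.envelope.truncObj from unitHom W) :=
    isIso_of_bijective _ (unit₀_bijective W) (unit₁_bijective W)
  LinearMap.congr_fun (congrArg Hom.f₁
    (IsIso.hom_inv_id (show W ⟶ W.envelope.truncObj from unitHom W))) x

end OneTruncatedVertexAlgebra

namespace PrevertexAlgebra

open OneTruncatedVertexAlgebra

variable (P : PrevertexAlgebra.{u})

/-- The vertex envelope of a prevertex algebra: the envelope of `A ⊕ (𝒯 ⊕ Ω)` with the splitting
transported from `A ⊕ (𝒯 ⊕ Ω)`. -/
def vertexEnvelope : SplitRestrictedVertexAlgebra.{u} where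
  toRestrictedVertexAlgebra := P.trunc.envelope
  splitting := P.split.transport (Envelope.unitHom P.trunc) (Envelope.unitInv P.trunc)
    Envelope.unitHom_unitInv

variable {P} {V : SplitRestrictedVertexAlgebra.{u}}

lemma compatible_iff (g : RestrictedVertexAlgebra.Hom P.trunc.envelope
      V.toRestrictedVertexAlgebra)
    (f : OneTruncatedVertexAlgebra.Hom P.trunc V.toRestrictedVertexAlgebra.truncObj)
    (hf : ∀ x, f.f₁ x = (RestrictedVertexAlgebra.truncMap g).f₁ ((Envelope.unitHom P.trunc).f₁ x)) :
    (∀ t, g.onWt 1 (P.vertexEnvelope.splitting.s t) =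
      V.splitting.s ((RestrictedVertexAlgebra.truncMap g).onT t)) ↔
    ∀ t, f.f₁ (P.split.s t) = V.splitting.s (f.onT t) := by
  have hT := Hom.onT_comp (Envelope.unitHom P.trunc) (RestrictedVertexAlgebra.truncMap g) f hf
  have hs : ∀ t, g.onWt 1 (P.vertexEnvelope.splitting.s t) =
      f.f₁ (P.split.s ((Envelope.unitInv P.trunc).onT t)) := fun t => (hf _).symm
  constructor
  · intro h t
    have h1 : (Envelope.unitInv P.trunc).onT ((Envelope.unitHom P.trunc).onT t) = t := by
      obtain ⟨x, rfl⟩ := Submodule.mkQ_surjective _ t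
      exact congrArg P.trunc.Om.mkQ (Envelope.unitInv_unitHom x)
    have h2 := (hs _).symm.trans (h ((Envelope.unitHom P.trunc).onT t))
    rw [h1] at h2
    exact h2.trans (congrArg V.splitting.s (hT t).symm)
  · intro h t
    have h1 : (Envelope.unitHom P.trunc).onT ((Envelope.unitInv P.trunc).onT t) = t := by
      obtain ⟨x, rfl⟩ := Submodule.mkQ_surjective _ t
      exact congrArg P.trunc.envelope.truncObj.Om.mkQ (Envelope.unitHom_unitInv x)
    refine (hs t).trans ((h _).trans (congrArg V.splitting.s ?_))
    rw [hT, h1]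

variable (P V)

/-- Morphisms from the vertex envelope are the morphisms from `A ⊕ (𝒯 ⊕ Ω)` that commute with the
splittings. -/
def splitHomEquiv : (P.vertexEnvelope ⟶ V) ≃
    {f : OneTruncatedVertexAlgebra.Hom P.trunc V.toRestrictedVertexAlgebra.truncObj //
      ∀ t, f.f₁ (P.split.s t) = V.splitting.s (f.onT t)} where
  toFun g := ⟨Envelope.homEquiv P.trunc V.toRestrictedVertexAlgebra g.toHom,
    (compatible_iff g.toHom _ fun _ => rfl).1 g.map_s⟩
  invFun f := ⟨(Envelope.homEquiv P.trunc V.toRestrictedVertexAlgebra).symm f.1,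
    (compatible_iff _ f.1 fun x => (LinearMap.congr_fun (congrArg Hom.f₁
      ((Envelope.homEquiv P.trunc V.toRestrictedVertexAlgebra).apply_symm_apply f.1)) x).symm).2
      f.2⟩
  left_inv g := SplitRestrictedVertexAlgebra.Hom.ext
    ((Envelope.homEquiv P.trunc V.toRestrictedVertexAlgebra).symm_apply_apply g.toHom)
  right_inv f := Subtype.ext
    ((Envelope.homEquiv P.trunc V.toRestrictedVertexAlgebra).apply_symm_apply f.1)

/-- The hom-set bijection between the vertex envelope and the functor `𝒫`. -/
def vertexEnvelopeEquiv : (P.vertexEnvelope ⟶ V) ≃ (P ⟶ prevertexFunctor.obj V) :=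
  (P.splitHomEquiv V).trans (splitEquiv V.splitting)

lemma vertexEnvelopeEquiv_comp {V V' : SplitRestrictedVertexAlgebra.{u}}
    (h : P.vertexEnvelope ⟶ V) (g : V ⟶ V') :
    P.vertexEnvelopeEquiv V' (h ≫ g) = P.vertexEnvelopeEquiv V h ≫ prevertexFunctor.map g := by
  refine PrevertexAlgebra.Hom.ext (AlgHom.ext fun a => rfl) (LinearMap.ext fun w => rfl)
    (LinearMap.ext fun t => rfl)

end PrevertexAlgebra

open PrevertexAlgebra in
/-- The functor `𝒱`, left adjoint to `𝒫`. -/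
def vertexEnvelopeFunctor : PrevertexAlgebra.{u} ⥤ SplitRestrictedVertexAlgebra.{u} :=
  Adjunction.leftAdjointOfEquiv vertexEnvelopeEquiv
    (fun P _ _ g h => P.vertexEnvelopeEquiv_comp h g)

open PrevertexAlgebra in
/-- The adjunction between the vertex envelope and the functor `𝒫`. -/
def vertexEnvelopeAdjunction : vertexEnvelopeFunctor.{u} ⊣ prevertexFunctor :=
  Adjunction.adjunctionOfEquivLeft vertexEnvelopeEquiv _

namespace PrevertexAlgebra
open OneTruncatedVertexAlgebra

lemma envelope_map_eq {P P' : PrevertexAlgebra.{u}} (f : P ⟶ P') :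
    (vertexEnvelopeFunctor.map f).toHom = envelopeFunctor.map (prevertexToOneTruncated.map f) := by
  let i := Envelope.unitHom P'.trunc
  have key : ofPrevertexHom P'.vertexEnvelope.splitting
      (show Hom P P'.vertexEnvelope.splitting.prevertex from
        f ≫ P'.vertexEnvelopeEquiv P'.vertexEnvelope (𝟙 _)) =
      (show P.trunc ⟶ P'.trunc from Hom.onTrunc f) ≫
        (show P'.trunc ⟶ P'.trunc.envelope.truncObj from i) := by
    refine OneTruncatedVertexAlgebra.Hom.ext rfl (LinearMap.ext fun x => ?_)
    obtain ⟨t, w⟩ := x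
    have h1 := ((compatible_iff (V := P'.vertexEnvelope) (RestrictedVertexAlgebra.Hom.mk
      LinearMap.id rfl (fun _ _ _ => rfl) (fun _ => rfl)) i (fun _ => rfl)).1
        (fun t => by
          obtain ⟨x, rfl⟩ := Submodule.mkQ_surjective _ t
          rfl) (P'.toT (f.fT t))).symm
    refine (congrArg (· + i.f₁ ((0, f.fΩ w) : P'.T × P'.Ω)) h1).trans
      ((map_add i.f₁ _ _).symm.trans (congrArg i.f₁ ?_))
    exact Prod.ext (add_zero (f.fT t)) (zero_add (f.fΩ w))
  exact congrArg (fun g => (Envelope.extendHom g : P.trunc.envelope ⟶ P'.trunc.envelope)) key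

end PrevertexAlgebra

/-- Forgetting the splitting of the vertex envelope yields the envelope of `A ⊕ (𝒯 ⊕ Ω)`. -/
def vertexEnvelopeIso : vertexEnvelopeFunctor.{u} ⋙ forgetSplitting ≅
    prevertexToOneTruncated ⋙ OneTruncatedVertexAlgebra.envelopeFunctor :=
  NatIso.ofComponents (fun P => Iso.refl P.trunc.envelope) (fun f =>
    (Category.comp_id _).trans
      ((PrevertexAlgebra.envelope_map_eq f).trans (Category.id_comp _).symm))

/-! ### A Poincaré–Birkhoff–Witt construction -/

namespace Pbw

open MvPolynomial

variable {X J N : Type*} [LinearOrder X] [CommRing J] [Algebra ℂ J] [AddCommGroup N] [Module ℂ N]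

/-- The monomials with coefficients in `J`. -/
def mono (m : Multiset X) : J →ₗ[ℂ] MvPolynomial X J :=
  (monomial (R := J) (Multiset.toFinsupp m)).restrictScalars ℂ

lemma mono_apply (m : Multiset X) (j : J) : mono m j = monomial (Multiset.toFinsupp m) j := rfl

lemma mono_zero (j : J) : mono (0 : Multiset X) j = C j := by simp [mono_apply]

lemma X_mul_mono (k : X) (m : Multiset X) (j : J) :
    MvPolynomial.X k * mono m j = mono (k ::ₘ m) j := by
  rw [mono_apply, mono_apply, MvPolynomial.X, monomial_mul, one_mul, ← Multiset.singleton_add,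
    map_add,
    Multiset.toFinsupp_singleton]

/-- The linear map with prescribed values on the monomials `x_{i₁} ⋯ x_{iₖ} j`, `i₁ ≤ ⋯ ≤ iₖ`. -/
def lin (f : List X → J →ₗ[ℂ] N) : MvPolynomial X J →ₗ[ℂ] N :=
  Finsupp.lsum ℂ (fun d : X →₀ ℕ => f ((Finsupp.toMultiset d).sort (· ≤ ·))) ∘ₗ
    (AddMonoidAlgebra.coeffLinearEquiv ℂ).toLinearMap

lemma lin_mono (f : List X → J →ₗ[ℂ] N) (m : Multiset X) (j : J) :
    lin f (mono m j) = f (m.sort (· ≤ ·)) j := by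
  have h : AddMonoidAlgebra.coeffLinearEquiv ℂ (mono m j) =
      Finsupp.single (Multiset.toFinsupp m) j := rfl
  rw [lin, LinearMap.comp_apply, LinearEquiv.coe_coe, h, Finsupp.lsum_single,
    Multiset.toFinsupp_toMultiset]

lemma lin_mono_zero (f : List X → J →ₗ[ℂ] N) (j : J) : lin f (mono 0 j) = f [] j := by
  rw [lin_mono, Multiset.sort_zero]

lemma lin_mono_cons (f : List X → J →ₗ[ℂ] N) {i : X} {m : Multiset X} (h : ∀ b ∈ m, i ≤ b)
    (j : J) : lin f (mono (i ::ₘ m) j) = f (i :: m.sort (· ≤ ·)) j := by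
  rw [lin_mono, Multiset.sort_cons _ _ (r := (· ≤ ·)) h]

lemma exists_cons (m : Multiset X) : m = 0 ∨ ∃ i m', m = i ::ₘ m' ∧ ∀ b ∈ m', i ≤ b := by
  have h1 := Multiset.sort_eq m (· ≤ ·)
  have h2 := Multiset.pairwise_sort m (· ≤ ·)
  rcases h : m.sort (· ≤ ·) with _ | ⟨i, s⟩
  · left
    rw [← h1, h]
    rfl
  · right
    rw [h] at h1 h2
    refine ⟨i, s, by rw [← h1]; rfl, fun b hb => ?_⟩
    exact (List.pairwise_cons.1 h2).1 b hb

/-- The polynomials of degree less than `n`. -/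
def Lt (n : ℕ) : Submodule ℂ (MvPolynomial X J) :=
  Submodule.span ℂ {p | ∃ (m : Multiset X) (j : J), m.card < n ∧ p = mono m j}

lemma mono_mem {m : Multiset X} {n : ℕ} (h : m.card < n) (j : J) : mono m j ∈ Lt (J := J) n :=
  Submodule.subset_span ⟨m, j, h, rfl⟩

lemma Lt_mono {n k : ℕ} (h : n ≤ k) : (Lt n : Submodule ℂ (MvPolynomial X J)) ≤ Lt k :=
  Submodule.span_mono fun _ ⟨m, j, hm, e⟩ => ⟨m, j, hm.trans_le h, e⟩

lemma Lt_zero {p : MvPolynomial X J} (hp : p ∈ Lt 0) : p = 0 := by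
  have : (Lt 0 : Submodule ℂ (MvPolynomial X J)) ≤ ⊥ :=
    Submodule.span_le.2 fun _ ⟨m, j, hm, e⟩ => absurd hm (Nat.not_lt_zero _)
  exact this hp

lemma exists_mem_Lt (p : MvPolynomial X J) : ∃ n, p ∈ Lt n := by
  induction p using MvPolynomial.induction_on' with
  | monomial d j =>
    refine ⟨(Finsupp.toMultiset d).card + 1, ?_⟩
    have h := mono_mem (Nat.lt_succ_self (Finsupp.toMultiset d).card) j
    rwa [mono_apply, Finsupp.toMultiset_toFinsupp] at h
  | add p q hp hq =>
    obtain ⟨n, hp⟩ := hp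
    obtain ⟨k, hq⟩ := hq
    exact ⟨max n k, add_mem (Lt_mono (le_max_left _ _) hp) (Lt_mono (le_max_right _ _) hq)⟩

/-- A linear condition holds on the polynomials of degree less than `n` if it does on monomials. -/
lemma apply_mem_of_mono {n : ℕ} (f : MvPolynomial X J →ₗ[ℂ] N) (K : Submodule ℂ N)
    (h : ∀ (m : Multiset X) (j : J), m.card < n → f (mono m j) ∈ K) {p : MvPolynomial X J}
    (hp : p ∈ Lt n) : f p ∈ K := by
  have : (Lt n : Submodule ℂ (MvPolynomial X J)) ≤ K.comap f :=
    Submodule.span_le.2 fun _ ⟨m, j, hm, e⟩ => e ▸ h m j hm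
  exact this hp

lemma eq_of_mono {n : ℕ} {f g : MvPolynomial X J →ₗ[ℂ] N}
    (h : ∀ (m : Multiset X) (j : J), m.card < n → f (mono m j) = g (mono m j))
    {p : MvPolynomial X J} (hp : p ∈ Lt n) : f p = g p := by
  have := apply_mem_of_mono (f - g) ⊥ (fun m j hm => by simp [h m j hm]) hp
  simpa [sub_eq_zero] using this

/-- Multiplication by a variable. -/
def mulX (k : X) : MvPolynomial X J →ₗ[ℂ] MvPolynomial X J := LinearMap.mulLeft ℂ (MvPolynomial.X k)

lemma mulX_mono (k : X) (m : Multiset X) (j : J) : mulX k (mono m j) = mono (k ::ₘ m) j :=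
  X_mul_mono k m j

variable {𝔩 : Type*} [LieRing 𝔩] [LieAlgebra ℂ 𝔩] (x : X → 𝔩)
  (β : 𝔩 →ₗ[ℂ] J →ₗ[ℂ] MvPolynomial X J)

/-- The action of the element `x k`, given an approximation `G` of the action of the Lie algebra.
On a monomial that begins with `x i`, `i < k`, it is obtained by moving `x k` past `x i`, with the
product of the variables split off. -/
def varStep (G : 𝔩 →ₗ[ℂ] MvPolynomial X J →ₗ[ℂ] MvPolynomial X J) (k : X) :
    MvPolynomial X J →ₗ[ℂ] MvPolynomial X J :=
  mulX k + lin fun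
    | [] => 0
    | i :: s => if i < k then (G (x i) ∘ₗ (G (x k) - mulX k) + G ⁅x k, x i⁆) ∘ₗ mono s else 0

/-- The recursion that improves an approximation `G` of the action of the Lie algebra by
one degree: on `J` the action is `β`, and `l` acts on `x i s` by `x i l s + [l, x i] s`. -/
def step (G : 𝔩 →ₗ[ℂ] MvPolynomial X J →ₗ[ℂ] MvPolynomial X J) :
    𝔩 →ₗ[ℂ] MvPolynomial X J →ₗ[ℂ] MvPolynomial X J :=
  LinearMap.flip <| lin fun
    | [] => β.flip
    | i :: s => ((G.compl₂ (mono s)).compr₂ (varStep x G i) -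
        (G ∘ₗ (LieAlgebra.ad ℂ 𝔩 (x i) : 𝔩 →ₗ[ℂ] 𝔩)).compl₂ (mono s)).flip

variable {x β} {G G' : 𝔩 →ₗ[ℂ] MvPolynomial X J →ₗ[ℂ] MvPolynomial X J}

lemma varStep_mono_zero (k : X) (j : J) : varStep x G k (mono 0 j) = mono {k} j := by
  rw [varStep, LinearMap.add_apply, lin_mono_zero, mulX_mono]
  simp

lemma varStep_mono_of_le {k : X} {m : Multiset X} (h : ∀ b ∈ m, k ≤ b) (j : J) :
    varStep x G k (mono m j) = mono (k ::ₘ m) j := by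
  rcases exists_cons m with rfl | ⟨i, m, rfl, hi⟩
  · exact varStep_mono_zero k j
  · rw [varStep, LinearMap.add_apply, lin_mono_cons _ hi, mulX_mono]
    simp only
    rw [if_neg (not_lt.2 (h i (Multiset.mem_cons_self _ _)))]
    simp

lemma varStep_mono_cons {i k : X} {m : Multiset X} (hi : ∀ b ∈ m, i ≤ b) (hk : i < k) (j : J) :
    varStep x G k (mono (i ::ₘ m) j) = mono (k ::ₘ i ::ₘ m) j +
      (G (x i) (G (x k) (mono m j) - mono (k ::ₘ m) j) + G ⁅x k, x i⁆ (mono m j)) := by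
  rw [varStep, LinearMap.add_apply, lin_mono_cons _ hi, mulX_mono]
  simp only
  rw [if_pos hk]
  simp [mulX_mono]

lemma step_mono_zero (l : 𝔩) (j : J) : step x β G l (mono 0 j) = β l j := by
  rw [step, LinearMap.flip_apply, lin_mono_zero]
  rfl

lemma step_mono_cons {i : X} {m : Multiset X} (hi : ∀ b ∈ m, i ≤ b) (l : 𝔩) (j : J) :
    step x β G l (mono (i ::ₘ m) j) =
      varStep x G i (G l (mono m j)) + G ⁅l, x i⁆ (mono m j) := by
  rw [step, LinearMap.flip_apply, lin_mono_cons _ hi]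
  simp only [LinearMap.flip_apply, LinearMap.sub_apply, LinearMap.compr₂_apply,
    LinearMap.compl₂_apply, LinearMap.comp_apply, Multiset.sort_eq, ← lie_skew l (x i),
    map_neg, LinearMap.neg_apply]
  rw [sub_eq_add_neg]
  rfl

/-- `G` raises degrees by at most one. -/
def Bounded (G : 𝔩 →ₗ[ℂ] MvPolynomial X J →ₗ[ℂ] MvPolynomial X J) : Prop :=
  ∀ d, ∀ p ∈ Lt d, ∀ l, G l p ∈ Lt (d + 1)

/-- `G (x k)` is multiplication by the variable `k` up to terms of lower degree. -/
def Leading (x : X → 𝔩) (G : 𝔩 →ₗ[ℂ] MvPolynomial X J →ₗ[ℂ] MvPolynomial X J) (n : ℕ) : Prop :=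
  ∀ d ≤ n, ∀ p ∈ Lt d, ∀ k, G (x k) p - mulX k p ∈ Lt d

lemma varStep_mem (hG : Bounded G) (k : X) {d : ℕ} {p : MvPolynomial X J} (hp : p ∈ Lt d) :
    varStep x G k p ∈ Lt (d + 1) := by
  refine apply_mem_of_mono _ _ (fun m j hm => ?_) hp
  rcases exists_cons m with rfl | ⟨i, m, rfl, hi⟩
  · rw [varStep_mono_zero]
    exact mono_mem (by simpa using hm) j
  rw [Multiset.card_cons] at hm
  by_cases hk : i < k
  · rw [varStep_mono_cons hi hk]
    obtain ⟨d, rfl⟩ : ∃ e, d = e + 1 := ⟨d - 1, by omega⟩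
    have h1 : mono m j ∈ Lt (J := J) d := mono_mem (by omega) j
    refine add_mem (mono_mem (by simpa using hm) j) (add_mem ?_ ?_)
    · exact hG _ _ (sub_mem (hG _ _ h1 _) (mono_mem (by simpa using hm) j)) _
    · exact Lt_mono (by omega) (hG _ _ h1 _)
  · rw [varStep_mono_of_le (by
      intro b hb
      rcases Multiset.mem_cons.1 hb with rfl | hb
      · exact not_lt.1 hk
      · exact (not_lt.1 hk).trans (hi b hb))]
    exact mono_mem (by simpa using hm) j

lemma varStep_sub_mem (hG : Bounded G) {n : ℕ} (hL : Leading x G n) (k : X) {d : ℕ}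
    (hd : d ≤ n + 1) {p : MvPolynomial X J} (hp : p ∈ Lt d) :
    varStep x G k p - mulX k p ∈ Lt d := by
  refine apply_mem_of_mono (varStep x G k - mulX k) _ (fun m j hm => ?_) hp
  rw [LinearMap.sub_apply, mulX_mono]
  by_cases h : ∀ b ∈ m, k ≤ b
  · rw [varStep_mono_of_le h, sub_self]
    exact zero_mem _
  rcases exists_cons m with rfl | ⟨i, m, rfl, hi⟩
  · simp at h
  have hk : i < k := by
    by_contra hk
    refine h fun b hb => ?_
    rcases Multiset.mem_cons.1 hb with rfl | hb
    · exact not_lt.1 hk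
    · exact (not_lt.1 hk).trans (hi b hb)
  rw [Multiset.card_cons] at hm
  obtain ⟨d, rfl⟩ : ∃ e, d = e + 1 := ⟨d - 1, by omega⟩
  have h1 : mono m j ∈ Lt (J := J) d := mono_mem (by omega) j
  rw [varStep_mono_cons hi hk, add_sub_cancel_left]
  refine add_mem (hG _ _ ?_ _) (hG _ _ h1 _)
  rw [← mulX_mono]
  exact hL d (by omega) _ h1 k

lemma step_bounded (hβ : ∀ l j, β l j ∈ Lt 2) (hG : Bounded G) : Bounded (step x β G) := by
  intro d p hp l
  refine apply_mem_of_mono _ _ (fun m j hm => ?_) hp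
  rcases exists_cons m with rfl | ⟨i, m, rfl, hi⟩
  · rw [step_mono_zero]
    exact Lt_mono (by simp at hm; omega) (hβ l j)
  rw [Multiset.card_cons] at hm
  obtain ⟨d, rfl⟩ : ∃ e, d = e + 1 := ⟨d - 1, by omega⟩
  have h1 : mono m j ∈ Lt (J := J) d := mono_mem (by omega) j
  rw [step_mono_cons hi]
  exact add_mem (varStep_mem hG i (hG _ _ h1 _)) (Lt_mono (by omega) (hG _ _ h1 _))

lemma varStep_congr {n : ℕ} (hL : Leading x G n) (h : ∀ p ∈ Lt n, ∀ l, G l p = G' l p) (k : X)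
    {p : MvPolynomial X J} (hp : p ∈ Lt (n + 1)) : varStep x G k p = varStep x G' k p := by
  refine eq_of_mono (fun m j hm => ?_) hp
  by_cases hm' : ∀ b ∈ m, k ≤ b
  · rw [varStep_mono_of_le hm', varStep_mono_of_le hm']
  rcases exists_cons m with rfl | ⟨i, m, rfl, hi⟩
  · simp at hm'
  have hk : i < k := by
    by_contra hk
    refine hm' fun b hb => ?_
    rcases Multiset.mem_cons.1 hb with rfl | hb
    · exact not_lt.1 hk
    · exact (not_lt.1 hk).trans (hi b hb)
  rw [Multiset.card_cons] at hm
  have h1 : mono m j ∈ Lt (J := J) n := mono_mem (by omega) j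
  have h2 := hL n le_rfl _ h1 k
  rw [mulX_mono] at h2
  rw [varStep_mono_cons hi hk, varStep_mono_cons hi hk, h _ h2, h _ h1, h _ h1]

/-- The `n`-th approximation of the action. It is exact on polynomials of degree less than `n`. -/
def approx (x : X → 𝔩) (β : 𝔩 →ₗ[ℂ] J →ₗ[ℂ] MvPolynomial X J) :
    ℕ → 𝔩 →ₗ[ℂ] MvPolynomial X J →ₗ[ℂ] MvPolynomial X J
  | 0 => 0
  | n + 1 => step x β (approx x β n)

lemma approx_succ (n : ℕ) : approx x β (n + 1) = step x β (approx x β n) := rfl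

lemma approx_bounded (hβ : ∀ l j, β l j ∈ Lt 2) (n : ℕ) : Bounded (approx x β n) := by
  induction n with
  | zero => exact fun d p hp l => zero_mem _
  | succ n ih => exact step_bounded hβ ih

/-- The approximations are consistent: the `n`-th one has the leading terms of multiplication by
the variables, agrees with the next one in degree less than `n`, and one more step makes the
elements `x k` act as prescribed by `varStep`. -/
lemma approx_spec (hβ : ∀ l j, β l j ∈ Lt 2) (hx : ∀ k j, β (x k) j = mono {k} j) (n : ℕ) :
    Leading x (approx x β n) n ∧
    (∀ p ∈ Lt n, ∀ l, approx x β (n + 1) l p = approx x β n l p) ∧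
    (∀ p ∈ Lt (n + 1), ∀ k, approx x β (n + 1) (x k) p = varStep x (approx x β n) k p) := by
  induction n with
  | zero =>
    refine ⟨fun d hd p hp k => ?_, fun p hp l => ?_, fun p hp k => ?_⟩
    · obtain rfl : d = 0 := by omega
      rw [Lt_zero hp]
      simp
    · rw [Lt_zero hp]
      simp
    · refine eq_of_mono (fun m j hm => ?_) hp
      obtain rfl : m = 0 := by simpa using hm
      rw [approx_succ, step_mono_zero, hx, varStep_mono_zero]
  | succ n ih =>
    obtain ⟨hL, hS, hC⟩ := ih
    have hB := approx_bounded (x := x) hβ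
    have hL' : Leading x (approx x β (n + 1)) (n + 1) := by
      intro d hd p hp k
      rw [hC p (Lt_mono hd hp)]
      exact varStep_sub_mem (hB n) hL k hd hp
    have hV : ∀ p ∈ Lt (n + 1), ∀ k,
        varStep x (approx x β (n + 1)) k p = varStep x (approx x β n) k p := fun p hp k =>
      (varStep_congr hL (fun p hp l => (hS p hp l).symm) k hp).symm
    have hS' : ∀ p ∈ Lt (n + 1), ∀ l, approx x β (n + 1 + 1) l p = approx x β (n + 1) l p := by
      intro p hp l
      refine eq_of_mono (fun m j hm => ?_) hp
      rcases exists_cons m with rfl | ⟨i, m, rfl, hi⟩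
      · rw [approx_succ, step_mono_zero, approx_succ, step_mono_zero]
      rw [Multiset.card_cons] at hm
      have h1 : mono m j ∈ Lt (J := J) n := mono_mem (by omega) j
      rw [approx_succ, step_mono_cons hi, approx_succ n, step_mono_cons hi, ← approx_succ,
        hS _ h1, hS _ h1,
        hV _ (hB n _ _ h1 _)]
    refine ⟨hL', hS', fun p hp k => ?_⟩
    refine eq_of_mono (fun m j hm => ?_) hp
    rcases exists_cons m with rfl | ⟨i, m, rfl, hi⟩
    · rw [approx_succ, step_mono_zero, hx, varStep_mono_zero]
    rw [Multiset.card_cons] at hm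
    have h1 : mono m j ∈ Lt (J := J) (n + 1) := mono_mem (by omega) j
    -- `x k` acts by multiplication on a monomial all of whose variables are at least `k`
    have hmul : ∀ a, (∀ b ∈ m, a ≤ b) → approx x β (n + 1) (x a) (mono m j) = mono (a ::ₘ m) j :=
      fun a ha => by rw [hC _ h1, varStep_mono_of_le ha]
    rw [approx_succ, step_mono_cons hi]
    rcases lt_trichotomy k i with hk | rfl | hk
    · have hk' : ∀ b ∈ m, k ≤ b := fun b hb => hk.le.trans (hi b hb)
      have hk2 : ∀ b ∈ i ::ₘ m, k ≤ b := fun b hb => by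
        rcases Multiset.mem_cons.1 hb with rfl | hb
        · exact hk.le
        · exact hk' b hb
      rw [hmul k hk', varStep_mono_cons hk' hk, hmul i hi, sub_self, map_zero, zero_add,
        varStep_mono_of_le hk2, ← lie_skew (x k), map_neg, LinearMap.neg_apply, add_assoc,
        add_neg_cancel, add_zero, Multiset.cons_swap]
    · have hk : ∀ b ∈ k ::ₘ m, k ≤ b := fun b hb => by
        rcases Multiset.mem_cons.1 hb with rfl | hb
        · exact le_rfl
        · exact hi b hb
      rw [hmul k hi, varStep_mono_of_le hk, lie_self, map_zero,
        LinearMap.zero_apply, add_zero]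
    · have hki : ∀ b ∈ k ::ₘ m, i ≤ b := fun b hb => by
        rcases Multiset.mem_cons.1 hb with rfl | hb
        · exact hk.le
        · exact hi b hb
      have h2 := hL' _ le_rfl _ h1 k
      rw [mulX_mono] at h2
      rw [varStep_mono_cons hi hk, ← add_assoc]
      congr 1
      conv_lhs => rw [← sub_add_cancel (approx x β (n + 1) (x k) (mono m j)) (mono (k ::ₘ m) j)]
      rw [map_add, varStep_mono_of_le hki, hV _ h2, ← hC _ h2, Multiset.cons_swap, add_comm]

lemma approx_eq (hβ : ∀ l j, β l j ∈ Lt 2) (hx : ∀ k j, β (x k) j = mono {k} j) {n k : ℕ}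
    (h : n ≤ k) {p : MvPolynomial X J} (hp : p ∈ Lt n) (l : 𝔩) :
    approx x β k l p = approx x β n l p := by
  induction k, h using Nat.le_induction with
  | base => rfl
  | succ k hk ih => rw [(approx_spec hβ hx k).2.1 p (Lt_mono hk hp), ih]

/-- The action of the Lie algebra on polynomials that extends `β`. -/
def action (x : X → 𝔩) (β : 𝔩 →ₗ[ℂ] J →ₗ[ℂ] MvPolynomial X J) :
    𝔩 →ₗ[ℂ] MvPolynomial X J →ₗ[ℂ] MvPolynomial X J :=
  LinearMap.flip <| lin fun s => ((approx x β (s.length + 1)).compl₂ (mono s)).flip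

lemma action_mono (l : 𝔩) (m : Multiset X) (j : J) :
    action x β l (mono m j) = approx x β (m.card + 1) l (mono m j) := by
  rw [action, LinearMap.flip_apply, lin_mono, Multiset.length_sort]
  simp

lemma action_eq (hβ : ∀ l j, β l j ∈ Lt 2) (hx : ∀ k j, β (x k) j = mono {k} j) {n : ℕ}
    {p : MvPolynomial X J} (hp : p ∈ Lt n) (l : 𝔩) : action x β l p = approx x β n l p :=
  eq_of_mono (fun m j hm => by
    rw [action_mono, approx_eq hβ hx hm (mono_mem (Nat.lt_succ_self _) j)]) hp

/-- `β` is the restriction to `J` of an action of a Lie algebra by operators of degree at most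
one, with `x k` acting on `J` as multiplication by the variable `k`. -/
structure IsBase (x : X → 𝔩) (β : 𝔩 →ₗ[ℂ] J →ₗ[ℂ] MvPolynomial X J) : Prop where
  mem : ∀ l j, β l j ∈ Lt 2
  var : ∀ k j, β (x k) j = mono {k} j

lemma action_mem (h : IsBase x β) {n : ℕ} {p : MvPolynomial X J} (hp : p ∈ Lt n) (l : 𝔩) :
    action x β l p ∈ Lt (n + 1) := by
  rw [action_eq h.mem h.var hp]
  exact approx_bounded h.mem n n p hp l

lemma action_sub_mem (h : IsBase x β) {n : ℕ} {p : MvPolynomial X J} (hp : p ∈ Lt n) (k : X) :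
    action x β (x k) p - mulX k p ∈ Lt n := by
  rw [action_eq h.mem h.var hp]
  exact (approx_spec h.mem h.var n).1 n le_rfl p hp k

lemma action_mono_zero (l : 𝔩) (j : J) : action x β l (mono 0 j) = β l j := by
  rw [action_mono]
  exact step_mono_zero l j

lemma action_var_of_le (h : IsBase x β) {k : X} {m : Multiset X} (hk : ∀ b ∈ m, k ≤ b) (j : J) :
    action x β (x k) (mono m j) = mono (k ::ₘ m) j := by
  have h1 : mono m j ∈ Lt (J := J) (m.card + 1) := mono_mem (Nat.lt_succ_self _) j
  rw [action_mono, (approx_spec h.mem h.var _).2.2 _ h1, varStep_mono_of_le hk]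

lemma action_mono_cons (h : IsBase x β) {i : X} {m : Multiset X} (hi : ∀ b ∈ m, i ≤ b) (l : 𝔩)
    (j : J) : action x β l (mono (i ::ₘ m) j) =
      action x β (x i) (action x β l (mono m j)) + action x β ⁅l, x i⁆ (mono m j) := by
  have h1 : mono m j ∈ Lt (J := J) (m.card + 1) := mono_mem (Nat.lt_succ_self _) j
  have h2 := approx_bounded (x := x) h.mem (m.card + 1) _ _ h1 l
  rw [action_mono, Multiset.card_cons, approx_succ, step_mono_cons hi, action_mono, action_mono,
    action_eq h.mem h.var h2, (approx_spec h.mem h.var _).2.2 _ h2]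

/-- The commutation relation of `l` and `l'` at a polynomial. -/
def Rel (x : X → 𝔩) (β : 𝔩 →ₗ[ℂ] J →ₗ[ℂ] MvPolynomial X J) (l l' : 𝔩)
    (p : MvPolynomial X J) : Prop :=
  action x β l (action x β l' p) - action x β l' (action x β l p) = action x β ⁅l, l'⁆ p

lemma Rel.symm {l l' : 𝔩} {p : MvPolynomial X J} (h : Rel x β l l' p) : Rel x β l' l p := by
  rw [Rel, ← lie_skew, map_neg, LinearMap.neg_apply, ← h, neg_sub]

lemma Rel.add {l l' : 𝔩} {p q : MvPolynomial X J} (h : Rel x β l l' p) (h' : Rel x β l l' q) :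
    Rel x β l l' (p + q) := by
  simp only [Rel, map_add] at *
  rw [← h, ← h']
  abel

lemma rel_of_mono {l l' : 𝔩} {n : ℕ} (h : ∀ m j, m.card < n → Rel x β l l' (mono m j))
    {p : MvPolynomial X J} (hp : p ∈ Lt n) : Rel x β l l' p := by
  have := eq_of_mono (f := action x β l ∘ₗ action x β l' - action x β l' ∘ₗ action x β l)
    (g := action x β ⁅l, l'⁆) (fun m j hm => h m j hm) hp
  exact this

/-- The commutation relations with `x i` hold by construction on monomials all of whose variables
are at least `i`. -/
lemma rel_of_le (h : IsBase x β) {i : X} {m : Multiset X} (hi : ∀ b ∈ m, i ≤ b) (l : 𝔩) (j : J) :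
    Rel x β l (x i) (mono m j) := by
  rw [Rel, action_var_of_le h hi, action_mono_cons h hi, add_sub_cancel_left]

/-- The Jacobi identity propagates commutation relations from `p` to `x i` applied to `p`. -/
lemma rel_step {l l' a : 𝔩} {p : MvPolynomial X J} (h1 : Rel x β l a (action x β l' p))
    (h2 : Rel x β l' a (action x β l p)) (h3 : Rel x β l a p) (h4 : Rel x β l' a p)
    (h5 : Rel x β l l' p) (h6 : Rel x β l ⁅l', a⁆ p) (h7 : Rel x β l' ⁅l, a⁆ p)
    (h8 : Rel x β ⁅l, l'⁆ a p) : Rel x β l l' (action x β a p) := by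
  have e : ⁅⁅l, l'⁆, a⁆ = ⁅l, ⁅l', a⁆⁆ - ⁅l', ⁅l, a⁆⁆ := by
    rw [leibniz_lie l l' a]; abel
  simp only [Rel, e, map_sub, LinearMap.sub_apply] at *
  rw [sub_eq_iff_eq_add] at h1 h2 h3 h4 h8
  rw [h4, h3, h8, map_add, map_add, h1, h2, ← h6, ← h7, ← h5, map_sub]
  abel

/-- The relations on `J` imply the relations on all polynomials. By induction on the degree, the
relations are proved at the top degree for two elements `x a`, `x b`, then for any element and an
`x b`, and then for any two elements; each step rests on the Jacobi identity. -/
theorem rel_of_base (h : IsBase x β) (hrel : ∀ l l' j, Rel x β l l' (mono 0 j)) (l l' : 𝔩)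
    (p : MvPolynomial X J) : Rel x β l l' p := by
  suffices H : ∀ n, ∀ p ∈ Lt n, ∀ l l', Rel x β l l' p by
    obtain ⟨n, hp⟩ := exists_mem_Lt p
    exact H n p hp l l'
  intro n
  induction n with
  | zero =>
    intro p hp l l'
    rw [Lt_zero hp]
    simp [Rel]
  | succ n ih =>
    -- the inductive step, given the relations with `x i` at the top degree
    have key : ∀ l l', (∀ (i : X) (m : Multiset X) (j : J), m.card < n → (∀ b ∈ m, i ≤ b) →
        Rel x β l l' (mono (i ::ₘ m) j) ∨ (Rel x β l (x i) (action x β l' (mono m j)) ∧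
          Rel x β l' (x i) (action x β l (mono m j)))) →
        ∀ p ∈ Lt (n + 1), Rel x β l l' p := by
      intro l l' hll p hp
      refine rel_of_mono (fun m j hm => ?_) hp
      rcases exists_cons m with rfl | ⟨i, m, rfl, hi⟩
      · exact hrel l l' j
      rw [Multiset.card_cons] at hm
      have h1 : mono m j ∈ Lt (J := J) n := mono_mem (by omega) j
      rcases hll i m j (by omega) hi with h2 | ⟨h2, h3⟩
      · exact h2
      rw [← action_var_of_le h hi]
      exact rel_step h2 h3 (ih _ h1 _ _) (ih _ h1 _ _) (ih _ h1 _ _) (ih _ h1 _ _) (ih _ h1 _ _)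
        (ih _ h1 _ _)
    -- a relation with `x i` on the image of a monomial under `x b`
    have aux : ∀ (l : 𝔩) (i b : X) (m : Multiset X) (j : J), m.card < n → (∀ c ∈ m, i ≤ c) →
        i ≤ b → Rel x β l (x i) (action x β (x b) (mono m j)) := by
      intro l i b m j hm hi hb
      have h1 : mono m j ∈ Lt (J := J) n := mono_mem hm j
      rw [← sub_add_cancel (action x β (x b) (mono m j)) (mulX b (mono m j))]
      refine (ih _ (action_sub_mem h h1 b) _ _).add ?_
      rw [mulX_mono]
      refine rel_of_le h (fun c hc => ?_) l j
      rcases Multiset.mem_cons.1 hc with rfl | hc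
      · exact hb
      · exact hi c hc
    have low : ∀ (l : 𝔩) (i b : X) (m : Multiset X) (j : J), (∀ c ∈ m, i ≤ c) → b ≤ i →
        Rel x β l (x b) (mono (i ::ₘ m) j) := by
      intro l i b m j hi hb
      refine rel_of_le h (fun c hc => ?_) l j
      rcases Multiset.mem_cons.1 hc with rfl | hc
      · exact hb
      · exact hb.trans (hi c hc)
    have rel_var_var : ∀ a b : X, ∀ p ∈ Lt (n + 1), Rel x β (x a) (x b) p := by
      intro a b
      refine key _ _ fun i m j hm hi => ?_
      rcases le_total b i with hb | hb
      · exact Or.inl (low _ i b m j hi hb)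
      rcases le_total a i with ha | ha
      · exact Or.inl (low _ i a m j hi ha).symm
      · exact Or.inr ⟨aux _ i b m j hm hi hb, aux _ i a m j hm hi ha⟩
    have rel_var : ∀ (l : 𝔩) (b : X), ∀ p ∈ Lt (n + 1), Rel x β l (x b) p := by
      intro l b
      refine key _ _ fun i m j hm hi => ?_
      rcases le_total b i with hb | hb
      · exact Or.inl (low _ i b m j hi hb)
      · exact Or.inr ⟨aux _ i b m j hm hi hb,
          rel_var_var b i _ (action_mem h (mono_mem hm j) l)⟩
    intro p hp l l'
    exact key l l' (fun i m j hm hi => Or.inr ⟨rel_var l i _ (action_mem h (mono_mem hm j) l'),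
      rel_var l' i _ (action_mem h (mono_mem hm j) l)⟩) p hp

end Pbw

/-! ### The symbol algebra and the algebra of arcs -/

namespace OneTruncatedVertexAlgebra

variable (W : OneTruncatedVertexAlgebra.{u})

/-- Families of linear maps to a commutative algebra `R` that satisfy the relations between the
symbols. -/
structure SymbolRep (R : Type*) [CommRing R] [Algebra ℂ R] where
  fA : ℕ → W.V₀ →ₗ[ℂ] R
  fΩ : ℕ → W.Om →ₗ[ℂ] R
  fT : ℕ → W.T →ₗ[ℂ] R
  one : fA 0 1 = 1
  mul_A : ∀ n a b, fA n (a * b) = ∑ p ∈ antidiagonal n, fA p.1 a * fA p.2 b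
  mul_Ω : ∀ n a (w : W.Om), fΩ n (a • w) = ∑ p ∈ antidiagonal n, fA p.1 a * fΩ p.2 w
  mul_T : ∀ n a (t : W.T), fT n (a • t) = ∑ p ∈ antidiagonal n, fA p.1 a * fT p.2 t
  d : ∀ n a, fΩ n (dOm a) = ((n : ℂ) + 1) • fA (n + 1) a

variable {W} {R : Type*} [CommRing R] [Algebra ℂ R]

namespace SymbolRep

/-- The values on symbols. -/
def val (F : W.SymbolRep R) : W.Symbol → R
  | .ofA n a => F.fA n a
  | .ofΩ n w => F.fΩ n w
  | .ofT n t => F.fT n t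

lemma aeval_relator (F : W.SymbolRep R) {p : MvPolynomial W.Symbol ℂ} (hp : W.Relator p) :
    MvPolynomial.aeval F.val p = 0 := by
  cases hp with
  | add_A n a b => simp [val]
  | add_Ω n v w => simp [val]
  | add_T n s t => simp [val]
  | smul_A n c a => simp [val]
  | smul_Ω n c w => simp [val]
  | smul_T n c t => simp [val]
  | one => simp [val, F.one]
  | leibniz_A n a b => simp [val, F.mul_A]
  | leibniz_Ω n a w => simp [val, F.mul_Ω]
  | leibniz_T n a t => simp [val, F.mul_T]
  | d n a => simp [val, F.d]

/-- The algebra morphism from the symbol algebra. -/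
def lift (F : W.SymbolRep R) : W.SymbolAlgebra →ₐ[ℂ] R :=
  Ideal.Quotient.liftₐ _ (MvPolynomial.aeval F.val) fun p hp => by
    have : Ideal.span {p | W.Relator p} ≤ RingHom.ker (MvPolynomial.aeval (R := ℂ) F.val) :=
      Ideal.span_le.2 fun p hp => F.aeval_relator hp
    exact this hp

end SymbolRep

/-- The class of a symbol. -/
def sym (x : W.Symbol) : W.SymbolAlgebra := Ideal.Quotient.mk _ (MvPolynomial.X x)

lemma SymbolRep.lift_sym (F : W.SymbolRep R) (x : W.Symbol) : F.lift (sym x) = F.val x :=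
  (Ideal.Quotient.liftₐ_apply _ _ _ _).trans (MvPolynomial.aeval_X _ _)

lemma symbolProd_nil : W.symbolProd [] = 1 := by simp [symbolProd]

lemma symbolProd_cons (x : W.Symbol) (l : List W.Symbol) :
    W.symbolProd (x :: l) = sym x * W.symbolProd l := by simp [symbolProd, sym]

lemma symbolAlgebra_hom_ext {f g : W.SymbolAlgebra →ₐ[ℂ] R}
    (h : ∀ x : W.Symbol, f (sym x) = g (sym x)) : f = g := by
  refine Ideal.Quotient.algHom_ext _ (MvPolynomial.algHom_ext fun x => ?_)
  exact h x

lemma mk_eq_zero_of_relator {p : MvPolynomial W.Symbol ℂ} (hp : W.Relator p) :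
    (Ideal.Quotient.mk (Ideal.span {p | W.Relator p}) p) = 0 :=
  Ideal.Quotient.eq_zero_iff_mem.2 (Ideal.subset_span hp)

variable (W) in
/-- The symbols as linear maps to the symbol algebra. -/
def symRep : W.SymbolRep W.SymbolAlgebra where
  fA n :=
    { toFun := fun a => sym (.ofA n a)
      map_add' := fun a b => sub_eq_zero.1 (by
        simpa [sym, sub_eq_zero] using mk_eq_zero_of_relator (Relator.add_A n a b))
      map_smul' := fun c a => sub_eq_zero.1 (mk_eq_zero_of_relator (Relator.smul_A n c a)) }
  fΩ n :=
    { toFun := fun a => sym (.ofΩ n a)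
      map_add' := fun a b => sub_eq_zero.1 (by
        simpa [sym, sub_eq_zero] using mk_eq_zero_of_relator (Relator.add_Ω n a b))
      map_smul' := fun c a => sub_eq_zero.1 (mk_eq_zero_of_relator (Relator.smul_Ω n c a)) }
  fT n :=
    { toFun := fun a => sym (.ofT n a)
      map_add' := fun a b => sub_eq_zero.1 (by
        simpa [sym, sub_eq_zero] using mk_eq_zero_of_relator (Relator.add_T n a b))
      map_smul' := fun c a => sub_eq_zero.1 (mk_eq_zero_of_relator (Relator.smul_T n c a)) }
  one := sub_eq_zero.1 (mk_eq_zero_of_relator Relator.one)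
  mul_A n a b := sub_eq_zero.1 (by
    have h := mk_eq_zero_of_relator (Relator.leibniz_A n a b)
    rw [map_sub, map_sum] at h
    simp only [map_mul] at h
    exact h)
  mul_Ω n a b := sub_eq_zero.1 (by
    have h := mk_eq_zero_of_relator (Relator.leibniz_Ω n a b)
    rw [map_sub, map_sum] at h
    simp only [map_mul] at h
    exact h)
  mul_T n a b := sub_eq_zero.1 (by
    have h := mk_eq_zero_of_relator (Relator.leibniz_T n a b)
    rw [map_sub, map_sum] at h
    simp only [map_mul] at h
    exact h)
  d n a := sub_eq_zero.1 (mk_eq_zero_of_relator (Relator.d n a))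

variable (W) in
/-- The algebra of functions on arcs: the quotient of the symbol algebra by the `∂^(n) τ`. -/
def Arc : Type u := W.SymbolAlgebra ⧸ Ideal.span (Set.range fun p : ℕ × W.T => sym (.ofT p.1 p.2))

instance : CommRing W.Arc := inferInstanceAs (CommRing (_ ⧸ Ideal.span _))

instance : Algebra ℂ W.Arc :=
  inferInstanceAs (Algebra ℂ (W.SymbolAlgebra ⧸
    Ideal.span (Set.range fun p : ℕ × W.T => sym (.ofT p.1 p.2))))

variable (W) in
/-- The projection from the symbol algebra. -/
def toArc : W.SymbolAlgebra →ₐ[ℂ] W.Arc := Ideal.Quotient.mkₐ ℂ _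

lemma toArc_surjective : Function.Surjective W.toArc := Ideal.Quotient.mkₐ_surjective _ _

lemma toArc_sym_ofT (n : ℕ) (t : W.T) : W.toArc (sym (.ofT n t)) = 0 :=
  Ideal.Quotient.eq_zero_iff_mem.2 (Ideal.subset_span ⟨(n, t), rfl⟩)

/-- The algebra morphism from the algebra of arcs. -/
def arcLift (F : W.SymbolRep R) (h : F.fT = 0) : W.Arc →ₐ[ℂ] R :=
  Ideal.Quotient.liftₐ _ F.lift fun p hp => by
    have : Ideal.span (Set.range fun p : ℕ × W.T => sym (.ofT p.1 p.2)) ≤ RingHom.ker F.lift := by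
      refine Ideal.span_le.2 ?_
      rintro _ ⟨⟨n, t⟩, rfl⟩
      refine (F.lift_sym _).trans ?_
      change F.fT n t = 0
      rw [h]; rfl
    exact this hp

lemma arcLift_toArc (F : W.SymbolRep R) (h : F.fT = 0) (p : W.SymbolAlgebra) :
    arcLift F h (W.toArc p) = F.lift p := rfl

variable (W) in
/-- The coefficients `a^(k)` of the arc of a function `a`, zero for `k < 0`. -/
def arc (k : ℤ) : W.V₀ →ₗ[ℂ] W.Arc :=
  if 0 ≤ k then W.toArc.toLinearMap ∘ₗ W.symRep.fA k.toNat else 0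

variable (W) in
/-- The coefficients `ω^(k)` of the arc of a differential `ω`, zero for `k < 0`. -/
def arcΩ (k : ℤ) : W.Om →ₗ[ℂ] W.Arc :=
  if 0 ≤ k then W.toArc.toLinearMap ∘ₗ W.symRep.fΩ k.toNat else 0

lemma arc_natCast (n : ℕ) (a : W.V₀) : W.arc n a = W.toArc (sym (.ofA n a)) := by
  rw [arc, if_pos (by omega)]; rfl

lemma arcΩ_natCast (n : ℕ) (a : W.Om) : W.arcΩ n a = W.toArc (sym (.ofΩ n a)) := by
  rw [arcΩ, if_pos (by omega)]; rfl

lemma arc_of_neg {k : ℤ} (h : k < 0) : W.arc k = 0 := by rw [arc, if_neg (by omega)]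

lemma arcΩ_of_neg {k : ℤ} (h : k < 0) : W.arcΩ k = 0 := by rw [arcΩ, if_neg (by omega)]

lemma arc_one : W.arc 0 1 = 1 := by
  have h := congrArg W.toArc W.symRep.one
  exact (arc_natCast 0 1).trans (h.trans (map_one W.toArc))

lemma arc_mul_nat (n : ℕ) (a b : W.V₀) :
    W.arc n (a * b) = ∑ p ∈ antidiagonal n, W.arc p.1 a * W.arc p.2 b := by
  have h := congrArg W.toArc (W.symRep.mul_A n a b)
  rw [map_sum] at h
  simp only [map_mul] at h
  simp only [arc_natCast]
  exact h

lemma arcΩ_smul_nat (n : ℕ) (a : W.V₀) (b : W.Om) :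
    W.arcΩ n (a • b) = ∑ p ∈ antidiagonal n, W.arc p.1 a * W.arcΩ p.2 b := by
  have h := congrArg W.toArc (W.symRep.mul_Ω n a b)
  rw [map_sum] at h
  simp only [map_mul] at h
  simp only [arc_natCast, arcΩ_natCast]
  exact h

lemma sum_antidiagonal_int {R : Type*} [CommRing R] (n : ℕ) (f g : ℤ → R)
    (hg : ∀ k < 0, g k = 0) {N : ℕ} (hN : n < N) :
    ∑ p ∈ antidiagonal n, f p.1 * g p.2 = ∑ p ∈ Finset.range N, f p * g (n - p) := by
  rw [Finset.Nat.sum_antidiagonal_eq_sum_range_succ_mk]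
  rw [← Finset.sum_subset (s₁ := Finset.range (n + 1)) (Finset.range_mono hN)]
  · refine Finset.sum_congr rfl fun p hp => ?_
    rw [Finset.mem_range] at hp
    rw [Nat.cast_sub (by omega)]
  · intro p _ hp
    rw [Finset.mem_range] at hp
    rw [hg _ (by omega), mul_zero]

lemma arc_mul {k : ℤ} {N : ℕ} (hN : k < N) (a b : W.V₀) :
    W.arc k (a * b) = ∑ p ∈ Finset.range N, W.arc p a * W.arc (k - p) b := by
  rcases lt_or_ge k 0 with h | h
  · rw [arc_of_neg h, LinearMap.zero_apply]
    exact (Finset.sum_eq_zero fun p _ => by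
      rw [arc_of_neg (k := k - p) (by omega), LinearMap.zero_apply, mul_zero]).symm
  · lift k to ℕ using h
    rw [arc_mul_nat]
    exact sum_antidiagonal_int k (fun p => W.arc p a) (fun p => W.arc p b)
      (fun p hp => by simp only [arc_of_neg hp, LinearMap.zero_apply]) (by omega)

lemma arcΩ_smul {k : ℤ} {N : ℕ} (hN : k < N) (a : W.V₀) (b : W.Om) :
    W.arcΩ k (a • b) = ∑ p ∈ Finset.range N, W.arc p a * W.arcΩ (k - p) b := by
  rcases lt_or_ge k 0 with h | h
  · rw [arcΩ_of_neg h, LinearMap.zero_apply]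
    exact (Finset.sum_eq_zero fun p _ => by
      rw [arcΩ_of_neg (k := k - p) (by omega), LinearMap.zero_apply, mul_zero]).symm
  · lift k to ℕ using h
    rw [arcΩ_smul_nat]
    exact sum_antidiagonal_int k (fun p => W.arc p a) (fun p => W.arcΩ p b)
      (fun p hp => by simp only [arcΩ_of_neg hp, LinearMap.zero_apply]) (by omega)

lemma arcΩ_d (k : ℤ) (a : W.V₀) : W.arcΩ k (dOm a) = ((k : ℂ) + 1) • W.arc (k + 1) a := by
  rcases lt_or_ge k 0 with h | h
  · rw [arcΩ_of_neg h, LinearMap.zero_apply]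
    rcases eq_or_ne k (-1) with rfl | h'
    · simp
    · rw [arc_of_neg (by omega), LinearMap.zero_apply, smul_zero]
  · lift k to ℕ using h
    have h := congrArg W.toArc (W.symRep.d k a)
    rw [map_smul] at h
    rw [show ((k : ℤ) + 1) = ((k + 1 : ℕ) : ℤ) by push_cast; rfl, arcΩ_natCast, arc_natCast]
    exact h

lemma sub_antidiagonal_shift {R : Type*} [CommRing R] (m n : ℕ) (f g : ℤ → R)
    (hg : ∀ k < 0, g k = 0) : ∑ p ∈ antidiagonal m, f p.1 * g (p.2 - n) =
      ∑ p ∈ Finset.range (m + 1), f p * g ((m - n : ℤ) - p) := by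
  rw [sum_antidiagonal_int m f (fun k => g (k - n)) (fun k hk => hg _ (by omega))
    (Nat.lt_succ_self m)]
  exact Finset.sum_congr rfl fun p _ => by rw [show (m : ℤ) - p - n = m - n - p by ring]

lemma sum_arc_mul_arc (m n : ℕ) (a b : W.V₀) :
    ∑ p ∈ antidiagonal m, W.arc p.1 a * W.arc (p.2 - n) b = W.arc (m - n) (a * b) := by
  rw [sub_antidiagonal_shift m n (fun k => W.arc k a) (fun k => W.arc k b)
    (fun p hp => by simp only [arc_of_neg hp, LinearMap.zero_apply])]
  exact (arc_mul (by omega) a b).symm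

lemma sum_arc_mul_arcΩ (m n : ℕ) (a : W.V₀) (b : W.Om) :
    ∑ p ∈ antidiagonal m, W.arc p.1 a * W.arcΩ (p.2 - n) b = W.arcΩ (m - n) (a • b) := by
  rw [sub_antidiagonal_shift m n (fun k => W.arc k a) (fun k => W.arcΩ k b)
    (fun p hp => by simp only [arcΩ_of_neg hp, LinearMap.zero_apply])]
  exact (arcΩ_smul (by omega) a b).symm

lemma sum_arcΩ_mul_arc (m n : ℕ) (a : W.V₀) (b : W.Om) :
    ∑ p ∈ antidiagonal m, W.arcΩ p.2 b * W.arc (p.1 - n) a = W.arcΩ (m - n) (a • b) := by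
  have h := sub_antidiagonal_shift m n (fun k => W.arcΩ k b) (fun k => W.arc k a)
    (fun p hp => by simp only [arc_of_neg hp, LinearMap.zero_apply])
  rw [← Finset.Nat.sum_antidiagonal_swap]
  refine h.trans ?_
  rcases lt_or_ge ((m : ℤ) - n) 0 with hk | hk
  · rw [arcΩ_of_neg hk, LinearMap.zero_apply]
    exact (Finset.sum_eq_zero fun p _ => by
      rw [arc_of_neg (k := (m : ℤ) - n - p) (by omega), LinearMap.zero_apply, mul_zero])
  · obtain ⟨k, hk⟩ : ∃ k : ℕ, (m : ℤ) - n = k := ⟨((m : ℤ) - n).toNat, by omega⟩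
    rw [hk, arcΩ_smul_nat, ← sum_antidiagonal_int k (fun k => W.arcΩ k b) (fun k => W.arc k a)
      (fun p hp => by simp only [arc_of_neg hp, LinearMap.zero_apply]) (by omega),
      ← Finset.Nat.sum_antidiagonal_swap]
    exact Finset.sum_congr rfl fun p _ => mul_comm _ _

/-- The algebra of arcs is generated by the coefficients of functions. -/
@[elab_as_elim]
lemma arc_induction {P : W.Arc → Prop} (hA : ∀ (n : ℕ) a, P (W.arc n a))
    (hC : ∀ c : ℂ, P (algebraMap ℂ W.Arc c)) (hadd : ∀ i j, P i → P j → P (i + j))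
    (hmul : ∀ i j, P i → P j → P (i * j)) (j : W.Arc) : P j := by
  have hsmul : ∀ (c : ℂ) j, P j → P (c • j) := fun c j hj => by
    rw [Algebra.smul_def]
    exact hmul _ _ (hC c) hj
  have hz : P 0 := by simpa using hC 0
  have hsum : ∀ (s : Finset (ℕ × ℕ)) (f : ℕ × ℕ → W.Arc), (∀ p ∈ s, P (f p)) →
      P (∑ p ∈ s, f p) := fun s f hf =>
    Finset.sum_induction f P hadd hz hf
  have hΩ : ∀ (n : ℕ) (w : W.V₁) (hw : w ∈ W.Om), P (W.arcΩ n ⟨w, hw⟩) := by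
    intro n w hw
    induction hw using Om_induction with
    | h a b =>
      have e : (⟨W.act a (W.d b), act_d_mem a b⟩ : W.Om) = a • dOm b := rfl
      rw [e, arcΩ_smul_nat]
      refine hsum _ _ fun p _ => hmul _ _ (hA _ _) ?_
      rw [arcΩ_d]
      exact hsmul _ _ (hA (p.2 + 1) b)
    | h0 =>
      have e : (⟨0, zero_mem _⟩ : W.Om) = 0 := rfl
      rw [e, map_zero]
      exact hz
    | hadd x y hx hy ex ey =>
      have e : (⟨x + y, add_mem hx hy⟩ : W.Om) = ⟨x, hx⟩ + ⟨y, hy⟩ := rfl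
      rw [e, map_add]
      exact hadd _ _ ex ey
    | hsmul c x hx ex =>
      have e : (⟨c • x, Submodule.smul_mem _ c hx⟩ : W.Om) = c • ⟨x, hx⟩ := rfl
      rw [e, map_smul]
      exact hsmul _ _ ex
  obtain ⟨p, rfl⟩ := toArc_surjective j
  obtain ⟨p, rfl⟩ := Ideal.Quotient.mk_surjective p
  induction p using MvPolynomial.induction_on with
  | C c => exact hC c
  | add p q hp hq =>
    rw [map_add, map_add]
    exact hadd _ _ hp hq
  | mul_X p x hp =>
    rw [map_mul, map_mul]
    refine hmul _ _ hp ?_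
    change P (W.toArc (sym x))
    cases x with
    | ofA n a => rw [← arc_natCast]; exact hA n a
    | ofΩ n w => rw [← arcΩ_natCast]; exact hΩ n w.1 w.2
    | ofT n t => rw [toArc_sym_ofT]; exact hz

lemma arc_derivation_ext {D D' : Derivation ℂ W.Arc W.Arc}
    (h : ∀ (n : ℕ) a, D (W.arc n a) = D' (W.arc n a)) : D = D' := by
  ext j
  induction j using arc_induction with
  | hA n a => exact h n a
  | hC c => rw [Derivation.map_algebraMap, Derivation.map_algebraMap]
  | hadd i j hi hj => rw [map_add, map_add, hi, hj]
  | hmul i j hi hj => rw [Derivation.leibniz, Derivation.leibniz, hi, hj]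

section Derivations

variable (W)

/-- The infinitesimal automorphism of the algebra of arcs defined by the mode `x_(n)`, on
generators. A derivation is encoded as an algebra homomorphism to the dual numbers, the sum of the
identity and `ε` times the derivation; the terms are the commutators of `x_(n)` with the modes of
`a` and `ω`. -/
def arcDerRep (n : ℕ) (x : W.V₁) : W.SymbolRep (TrivSqZeroExt W.Arc W.Arc) where
  fA m := LinearMap.prod (W.arc m) (W.arc (m - n) ∘ₗ W.anchor x)
  fΩ m := LinearMap.prod (W.arcΩ m)
    (W.arcΩ (m - n) ∘ₗ (W.br x).restrict (fun _ hw => br_mem x hw) +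
      (n : ℂ) • W.arc (m + 1 - n) ∘ₗ W.pair x ∘ₗ W.Om.subtype)
  fT := 0
  one := by
    refine TrivSqZeroExt.ext arc_one ?_
    change W.arc _ (W.anchor x 1) = 0
    rw [← one_eq, anchor_vac, map_zero]
  mul_A m a b := by
    refine TrivSqZeroExt.ext ?_ ?_
    · rw [TrivSqZeroExt.fst_sum]
      exact arc_mul_nat m a b
    · rw [TrivSqZeroExt.snd_sum]
      change W.arc _ (W.anchor x (W.mul a b)) = ∑ p ∈ antidiagonal m,
        (W.arc p.1 a * W.arc (p.2 - n) (W.anchor x b) +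
          W.arc (p.1 - n) (W.anchor x a) * W.arc p.2 b)
      rw [Finset.sum_add_distrib, anchor_mul, map_add, sum_arc_mul_arc, mul_eq, mul_eq, add_comm]
      congr 1
      rw [mul_comm, ← sum_arc_mul_arc, ← Finset.Nat.sum_antidiagonal_swap]
      exact Finset.sum_congr rfl fun p _ => mul_comm _ _
  mul_Ω m a w := by
    refine TrivSqZeroExt.ext ?_ ?_
    · rw [TrivSqZeroExt.fst_sum]
      exact arcΩ_smul_nat m a w
    · rw [TrivSqZeroExt.snd_sum]
      have e : (W.br x).restrict (fun _ hw => br_mem x hw) (a • w) =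
          W.anchor x a • w + a • (W.br x).restrict (fun _ hw => br_mem x hw) w :=
        Subtype.ext (W.br_act a x w.1)
      have e' : W.pair x (a • w : W.Om).1 = a * W.pair x w := Splitting.pair_act_Om a x w.2
      change W.arcΩ _ ((W.br x).restrict (fun _ hw => br_mem x hw) (a • w)) +
        (n : ℂ) • W.arc _ (W.pair x (a • w : W.Om).1) = ∑ p ∈ antidiagonal m,
        (W.arc p.1 a * (W.arcΩ (p.2 - n) ((W.br x).restrict (fun _ hw => br_mem x hw) w) +
          (n : ℂ) • W.arc (p.2 + 1 - n) (W.pair x w)) +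
          W.arc (p.1 - n) (W.anchor x a) * W.arcΩ p.2 w)
      have h3 : ∑ p ∈ antidiagonal m, (n : ℂ) • (W.arc p.1 a * W.arc (p.2 + 1 - n) (W.pair x w)) =
          (n : ℂ) • W.arc (m + 1 - n) (a * W.pair x w) := by
        rcases n with _ | n
        · simp
        · rw [← Finset.smul_sum, show (m : ℤ) + 1 - (n + 1 : ℕ) = m - n by push_cast; ring,
            ← sum_arc_mul_arc]
          congr 1
          refine Finset.sum_congr rfl fun p _ => ?_
          rw [show (p.2 : ℤ) + 1 - (n + 1 : ℕ) = p.2 - n by push_cast; ring]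
      simp only [mul_add, Finset.sum_add_distrib, mul_smul_comm]
      rw [h3, sum_arc_mul_arcΩ, e, e', map_add]
      have h4 := sum_arcΩ_mul_arc m n (W.anchor x a) w
      simp only [mul_comm (W.arc _ (W.anchor x a))]
      rw [h4]
      abel
  mul_T m a w := by simp
  d m a := by
    refine TrivSqZeroExt.ext (arcΩ_d m a) ?_
    have e : (W.br x).restrict (fun _ hw => br_mem x hw) (dOm a) = dOm (W.anchor x a) :=
      Subtype.ext (W.br_d a x)
    have e' : W.pair x (W.Om.subtype (dOm a)) = W.anchor x a := W.pair_d' x a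
    change W.arcΩ _ ((W.br x).restrict (fun _ hw => br_mem x hw) (dOm a)) +
      (n : ℂ) • W.arc _ (W.pair x (W.Om.subtype (dOm a))) =
        ((m : ℂ) + 1) • W.arc _ (W.anchor x a)
    rw [e, e', arcΩ_d, show (m : ℤ) - n + 1 = m + 1 - n by ring,
      show ((m + 1 : ℕ) : ℤ) - n = m + 1 - n by push_cast; ring, ← add_smul]
    push_cast
    congr 1
    ring

/-- The derivation of the algebra of arcs defined by the mode `x_(n)`, `n ≥ 0`. -/
def arcDer (n : ℕ) (x : W.V₁) : Derivation ℂ W.Arc W.Arc :=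
  have hfst : ∀ j, (arcLift (W.arcDerRep n x) rfl j).fst = j := by
    have : (TrivSqZeroExt.fstHom ℂ W.Arc W.Arc).comp (arcLift (W.arcDerRep n x) rfl) =
        AlgHom.id ℂ W.Arc := by
      refine AlgHom.cancel_right toArc_surjective |>.1 ?_
      refine symbolAlgebra_hom_ext fun y => ?_
      change TrivSqZeroExt.fst ((W.arcDerRep n x).lift (sym y)) = _
      rw [SymbolRep.lift_sym]
      cases y with
      | ofA m a => exact arc_natCast m a
      | ofΩ m w => exact arcΩ_natCast m w
      | ofT m t => exact (toArc_sym_ofT m t).symm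
    exact fun j => congr($this j)
  Derivation.mk' ((TrivSqZeroExt.sndHom W.Arc W.Arc).restrictScalars ℂ ∘ₗ
    (arcLift (W.arcDerRep n x) rfl).toLinearMap) fun i j => by
      change (arcLift (W.arcDerRep n x) rfl (i * j)).snd = _
      rw [map_mul, TrivSqZeroExt.snd_mul, hfst, hfst, op_smul_eq_smul]
      rfl

variable {W}

lemma arcDer_arc (n : ℕ) (x : W.V₁) (k : ℤ) (a : W.V₀) :
    W.arcDer n x (W.arc k a) = W.arc (k - n) (W.anchor x a) := by
  rcases lt_or_ge k 0 with h | h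
  · rw [arc_of_neg h, arc_of_neg (by omega), LinearMap.zero_apply, LinearMap.zero_apply, map_zero]
  · lift k to ℕ using h
    rw [arc_natCast]
    change ((W.arcDerRep n x).lift (sym (.ofA k a))).snd = _
    rw [SymbolRep.lift_sym]
    rfl

lemma arcDer_arcΩ (n : ℕ) (x : W.V₁) (k : ℤ) (w : W.Om) :
    W.arcDer n x (W.arcΩ k w) = W.arcΩ (k - n) ⟨W.br x w, br_mem x w.2⟩ +
      (n : ℂ) • W.arc (k + 1 - n) (W.pair x w) := by
  rcases lt_or_ge k 0 with h | h
  · rw [arcΩ_of_neg h, arcΩ_of_neg (by omega), LinearMap.zero_apply, LinearMap.zero_apply, map_zero,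
      zero_add]
    rcases n with _ | n
    · simp
    · rw [arc_of_neg (by push_cast; omega), LinearMap.zero_apply, smul_zero]
  · lift k to ℕ using h
    rw [arcΩ_natCast]
    change ((W.arcDerRep n x).lift (sym (.ofΩ k w))).snd = _
    rw [SymbolRep.lift_sym]
    rfl

lemma arcDer_add (n : ℕ) (x y : W.V₁) : W.arcDer n (x + y) = W.arcDer n x + W.arcDer n y :=
  arc_derivation_ext fun m a => by simp [arcDer_arc]

lemma arcDer_Om (n : ℕ) {x : W.V₁} (hx : x ∈ W.Om) : W.arcDer n x = 0 :=
  arc_derivation_ext fun m a => by simp [arcDer_arc, anchor_Om hx]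

lemma arcDer_comm (m n : ℕ) (x y : W.V₁) (j : W.Arc) :
    W.arcDer m x (W.arcDer n y j) - W.arcDer n y (W.arcDer m x j) =
      W.arcDer (m + n) (W.br x y) j := by
  have h : ⁅W.arcDer m x, W.arcDer n y⁆ = W.arcDer (m + n) (W.br x y) :=
    arc_derivation_ext fun k a => by
      rw [Derivation.commutator_apply]
      simp only [arcDer_arc, anchor_br, map_sub]
      push_cast
      congr 2 <;> congr 1 <;> ring
  rw [← h, Derivation.commutator_apply]

/-- Each element of the algebra of arcs is killed by the derivations `x_(n)` with `n` large. -/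
lemma exists_arcDer_eq_zero (x : W.V₁) (j : W.Arc) : ∃ N : ℕ, ∀ n, N ≤ n → W.arcDer n x j = 0 := by
  induction j using arc_induction with
  | hA m a =>
    exact ⟨m + 1, fun n hn => by
      rw [arcDer_arc, arc_of_neg (by omega), LinearMap.zero_apply]⟩
  | hC c => exact ⟨0, fun n _ => Derivation.map_algebraMap _ c⟩
  | hadd i j hi hj =>
    obtain ⟨N, hN⟩ := hi
    obtain ⟨N', hN'⟩ := hj
    exact ⟨max N N', fun n hn => by
      rw [map_add, hN n (le_trans (le_max_left _ _) hn),
        hN' n (le_trans (le_max_right _ _) hn), add_zero]⟩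
  | hmul i j hi hj =>
    obtain ⟨N, hN⟩ := hi
    obtain ⟨N', hN'⟩ := hj
    exact ⟨max N N', fun n hn => by
      rw [Derivation.leibniz, hN n (le_trans (le_max_left _ _) hn),
        hN' n (le_trans (le_max_right _ _) hn), smul_zero, smul_zero, add_zero]⟩

lemma arc_one_of_ne {k : ℤ} (h : k ≠ 0) : W.arc k 1 = 0 := by
  have h1 := arcΩ_d (W := W) (k - 1) 1
  rw [Derivation.map_one_eq_zero, map_zero, sub_add_cancel] at h1
  refine (smul_eq_zero.1 h1.symm).resolve_left ?_
  push_cast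
  rw [sub_add_cancel]
  exact_mod_cast h

/-- The derivation `(x_(-1) f)_(n)` in terms of the derivations `x_(p)`. -/
lemma exists_sum_arc_mul_arcDer (n : ℕ) (x : W.V₁) (f : W.V₀) (j : W.Arc) : ∃ N : ℕ, ∀ M, N ≤ M →
    ∑ p ∈ Finset.range M, W.arc (p - n) f * W.arcDer p x j = W.arcDer n (W.ract x f) j := by
  induction j using arc_induction with
  | hA m a =>
    refine ⟨m + n + 1, fun M hM => ?_⟩
    obtain ⟨M, rfl⟩ : ∃ M', M = n + M' := ⟨M - n, by omega⟩
    rw [Finset.sum_range_add, Finset.sum_eq_zero fun p hp => ?_, zero_add, arcDer_arc, ract_eq,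
      map_add, LinearMap.add_apply, anchor_d, add_zero, anchor_act, mul_eq,
      arc_mul (N := M) (by omega)]
    · refine Finset.sum_congr rfl fun p _ => ?_
      rw [arcDer_arc]
      push_cast
      congr 3 <;> ring
    · rw [Finset.mem_range] at hp
      rw [arc_of_neg (k := (p : ℤ) - n) (by omega), LinearMap.zero_apply, zero_mul]
  | hC c => exact ⟨0, fun M _ => by simp [Derivation.map_algebraMap]⟩
  | hadd i j hi hj =>
    obtain ⟨N, hN⟩ := hi
    obtain ⟨N', hN'⟩ := hj
    exact ⟨max N N', fun M hM => by
      rw [map_add, ← hN M (le_trans (le_max_left _ _) hM),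
        ← hN' M (le_trans (le_max_right _ _) hM), ← Finset.sum_add_distrib]
      exact Finset.sum_congr rfl fun p _ => by rw [map_add, mul_add]⟩
  | hmul i j hi hj =>
    obtain ⟨N, hN⟩ := hi
    obtain ⟨N', hN'⟩ := hj
    exact ⟨max N N', fun M hM => by
      rw [Derivation.leibniz, ← hN M (le_trans (le_max_left _ _) hM),
        ← hN' M (le_trans (le_max_right _ _) hM), smul_eq_mul, smul_eq_mul, Finset.mul_sum,
        Finset.mul_sum, ← Finset.sum_add_distrib]
      refine Finset.sum_congr rfl fun p _ => ?_
      rw [Derivation.leibniz, smul_eq_mul, smul_eq_mul]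
      ring⟩

end Derivations

end OneTruncatedVertexAlgebra

/-! ### Normally ordered products -/

namespace Fields

variable {V : Type*} [AddCommGroup V] [Module ℂ V] {a b : ℤ → Module.End ℂ V}

lemma bsum_neg_one {g : ℕ → V} {N : ℕ} (h : ∀ j, N ≤ j → g j = 0) :
    bsum (-1) (-1) g = ∑ j ∈ Finset.range N, g j := by
  induction N generalizing g with
  | zero =>
    have : g = fun _ => 0 := funext fun j => h j (Nat.zero_le _)
    rw [this, bsum_zero_fun, Finset.sum_range_zero]
  | succ N ih =>
    have h1 := bsum_succ (-1) (-1) (g := g) ⟨N + 1, h⟩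
    rw [ih (g := fun j => g (j + 1)) (fun j hj => h _ (by omega)), neg_add_cancel, bsum_zero] at h1
    rw [Finset.sum_range_succ', h1]
    module

/-- The coefficients of the normally ordered product. -/
lemma comm_neg_one {m k : ℤ} {v : V} {N : ℕ} (hb : ∀ p : ℕ, N ≤ p → b (k + p) v = 0)
    (ha : ∀ p : ℕ, N ≤ p → a (m + p) v = 0) : comm a b m (-1) k v =
      ∑ p ∈ Finset.range N, (a (m - 1 - p) (b (k + p) v) + b (k - 1 - p) (a (m + p) v)) := by
  rw [comm, halfProd, halfProd, bsum_neg_one (fun p hp => by rw [hb p hp, map_zero]),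
    bsum_neg_one (fun p hp => by rw [ha p hp, map_zero]), Finset.sum_add_distrib]
  simp only [zpow_neg_one, show (-1 : ℂ)⁻¹ = -1 by norm_num, neg_one_smul, sub_neg_eq_add,
    show ∀ x y : ℤ, -1 + x - y = x - 1 - y by intros; ring]

/-- Changing the point where the product is split changes the normally ordered product by
commutators. -/
lemma comm_neg_one_shift (ha : IsField a) (hb : IsField b) {c : ℤ → V} {v : V}
    (h : ∀ m k, a m (b k v) - b k (a m v) = c (m + k)) (m k : ℤ) :
    comm a b m (-1) k v = comm a b 0 (-1) (m + k) v + (m : ℂ) • c (m + k - 1) := by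
  have hrec : ∀ m k, comm a b (m + 1) (-1) k v = comm a b m (-1) (k + 1) v + c (m + k) := by
    intro m k
    have := comm_rec ha hb m (-1) k v
    rw [neg_add_cancel, comm_zero, h, eq_sub_iff_add_eq] at this
    rw [← this, add_comm]
  induction m using Int.induction_on generalizing k with
  | zero => simp
  | succ m ih =>
    rw [hrec, ih, show (m : ℤ) + (k + 1) = m + 1 + k by ring,
      show (m : ℤ) + 1 + k - 1 = m + k by ring]
    push_cast
    module
  | pred m ih =>
    have h1 := hrec (-m - 1) (k - 1)
    rw [sub_add_cancel, sub_add_cancel, ih, ← sub_eq_iff_eq_add] at h1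
    rw [← h1, show -(m : ℤ) + (k - 1) = -m - 1 + k by ring,
      show -(m : ℤ) - 1 + (k - 1) = -m - 1 + k - 1 by ring]
    push_cast
    module

end Fields

/-! ### The base of the action of the modes -/

namespace OneTruncatedVertexAlgebra

open Pbw

namespace Splitting

variable {W : OneTruncatedVertexAlgebra.{u}} {I : Type u}
  (t : Module.Basis I W.V₀ W.T) (S : W.Splitting)

lemma mkQ_ract (x : W.V₁) (f : W.V₀) : W.Om.mkQ (W.ract x f) = f • W.Om.mkQ x := by
  rw [ract_eq, map_add, smul_mk]
  have h : W.Om.mkQ (W.d (W.anchor x f)) = 0 := (Submodule.Quotient.mk_eq_zero _).2 (d_mem _)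
  rw [h, add_zero]

/-- The coordinates of the class in `𝒯` of an element of `V₁`. -/
def coords : W.V₁ →ₗ[ℂ] I →₀ W.V₀ := (t.repr.toLinearMap.restrictScalars ℂ) ∘ₗ W.Om.mkQ

/-- The combinations `∑ x_i f_i` of the lifts `x_i` of the elements of a basis. -/
def combine : (I →₀ W.V₀) →ₗ[ℂ] W.V₁ := Finsupp.lsum ℂ fun i => W.ract (S.s (t i))

lemma combine_single (i : I) (f : W.V₀) :
    S.combine t (Finsupp.single i f) = W.ract (S.s (t i)) f := by
  rw [combine, Finsupp.lsum_single]

lemma coords_of_mem {x : W.V₁} (hx : x ∈ W.Om) : coords t x = 0 := by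
  have h : W.Om.mkQ x = 0 := (Submodule.Quotient.mk_eq_zero _).2 hx
  rw [coords, LinearMap.comp_apply, h, map_zero]

lemma coords_ract (i : I) (f : W.V₀) :
    coords t (W.ract (S.s (t i)) f) = Finsupp.single i f := by
  rw [coords, LinearMap.comp_apply, mkQ_ract, S.mkQ_s]
  change t.repr (f • t i) = _
  rw [map_smul, t.repr_self, Finsupp.smul_single, smul_eq_mul, mul_one]

lemma coords_combine (c : I →₀ W.V₀) : coords t (S.combine t c) = c := by
  induction c using Finsupp.induction_linear with
  | zero => simp
  | add c c' h h' => rw [map_add, map_add, h, h']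
  | single i f => rw [combine_single, coords_ract]

lemma sub_combine_mem (x : W.V₁) : x - S.combine t (coords t x) ∈ W.Om := by
  have h : coords t (x - S.combine t (coords t x)) = 0 := by
    rw [map_sub, coords_combine, sub_self]
  have h' : W.Om.mkQ (x - S.combine t (coords t x)) = 0 := t.repr.map_eq_zero_iff.1 h
  exact (Submodule.Quotient.mk_eq_zero _).1 h'

/-- The component in `Ω` of an element of `V₁`. -/
def omPart : W.V₁ →ₗ[ℂ] W.Om :=
  LinearMap.codRestrict W.Om (LinearMap.id - S.combine t ∘ₗ coords t) (S.sub_combine_mem t)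

lemma omPart_of_mem (w : W.Om) : S.omPart t w = w := Subtype.ext (by
  change (w : W.V₁) - S.combine t (coords t w) = w
  rw [coords_of_mem t w.2, map_zero, sub_zero])

lemma omPart_ract (i : I) (f : W.V₀) : S.omPart t (W.ract (S.s (t i)) f) = 0 := Subtype.ext (by
  change W.ract (S.s (t i)) f - S.combine t (coords t (W.ract (S.s (t i)) f)) = 0
  rw [coords_ract, combine_single, sub_self])

/-- `V₁` is spanned by `Ω` and the elements `x_i f`. -/
lemma induction_on {P : W.V₁ → Prop} (hΩ : ∀ w : W.Om, P w)
    (hx : ∀ i f, P (W.ract (S.s (t i)) f)) (hadd : ∀ x y, P x → P y → P (x + y)) (x : W.V₁) :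
    P x := by
  have h0 : P 0 := hΩ 0
  have hc : ∀ c, P (S.combine t c) := fun c => by
    induction c using Finsupp.induction_linear with
    | zero => rw [map_zero]; exact h0
    | add c c' h h' => rw [map_add]; exact hadd _ _ h h'
    | single i f => rw [combine_single]; exact hx i f
  rw [← sub_add_cancel x (S.combine t (coords t x))]
  exact hadd _ _ (hΩ ⟨_, S.sub_combine_mem t x⟩) (hc _)

variable [LinearOrder I]

variable (W I) in
/-- Polynomials in the variables `x_{i,p}`, with coefficients in the algebra of arcs. -/
abbrev Poly : Type u := MvPolynomial (I ×ₗ ℕ) W.Arc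

/-- Multiplication by the coefficient `a^(-1-n)`. -/
def arcOp (n : ℤ) : W.V₀ →ₗ[ℂ] Module.End ℂ (Poly W I) :=
  LinearMap.mul ℂ (Poly W I) ∘ₗ mono 0 ∘ₗ W.arc (-1 - n)

lemma mono_zero_mul_mono (m : Multiset (I ×ₗ ℕ)) (i j : W.Arc) :
    mono 0 i * mono m j = mono m (i * j) := by
  rw [mono_apply, mono_apply, MvPolynomial.monomial_mul, map_zero, zero_add]
  rfl

lemma arcOp_mono (n : ℤ) (a : W.V₀) (m : Multiset (I ×ₗ ℕ)) (j : W.Arc) :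
    arcOp n a (mono m j) = mono m (W.arc (-1 - n) a * j) := mono_zero_mul_mono m _ j

lemma arcOp_of_nonneg {n : ℤ} (hn : 0 ≤ n) (a : W.V₀) : arcOp (I := I) n a = 0 := by
  rw [arcOp, arc_of_neg (by omega)]
  simp

/-- The modes of the lift `x_i`: multiplication by a variable, or a derivation of the algebra of
arcs. For `n ≥ 0` only the restriction to the algebra of arcs is the action of the mode; the
extension to polynomials, coefficient by coefficient, merely makes this an endomorphism. -/
def varOp (i : I) (n : ℤ) : Module.End ℂ (Poly W I) :=
  if n < 0 then mulX (toLex (i, (-1 - n).toNat))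
  else lin fun s => mono s ∘ₗ (W.arcDer n.toNat (S.s (t i))).toLinearMap

lemma varOp_neg (i : I) (p : ℕ) : S.varOp t i (-1 - p) = mulX (toLex (i, p)) := by
  rw [varOp, if_pos (by omega)]
  congr
  omega

lemma varOp_natCast (i : I) (n : ℕ) (j : W.Arc) :
    S.varOp t i n (mono 0 j) = mono 0 (W.arcDer n (S.s (t i)) j) := by
  rw [varOp, if_neg (by omega), lin_mono, Int.toNat_natCast, LinearMap.comp_apply,
    Multiset.sort_zero]
  rfl

lemma arcOp_eq_zero {n : ℤ} {N : ℕ} (hN : -n ≤ N) (f : W.V₀) (v : Poly W I) (p : ℕ)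
    (hp : N ≤ p) : arcOp (n + p) f v = 0 := by
  rw [arcOp_of_nonneg (by omega), LinearMap.zero_apply]

/-- On the algebra of arcs, the normally ordered product of the fields of `x_i` and `f` is a finite
sum. -/
lemma normal_eq (i : I) {n : ℤ} {N : ℕ} (hN : -n ≤ N) (f : W.V₀) (j : W.Arc)
    (hj : ∀ p : ℕ, N ≤ p → W.arcDer p (S.s (t i)) j = 0) :
    Fields.comm (S.varOp t i) (fun n => arcOp n f) 0 (-1) n (mono 0 j) =
      ∑ p ∈ Finset.range N, (mono {toLex (i, p)} (W.arc (-1 - n - p) f * j) +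
        mono 0 (W.arc (p - n) f * W.arcDer p (S.s (t i)) j)) := by
  rw [Fields.comm_neg_one (N := N) (fun p hp => arcOp_eq_zero hN f _ p hp) (fun p hp => by
    rw [zero_add, varOp_natCast, hj p hp, map_zero])]
  refine Finset.sum_congr rfl fun p _ => ?_
  rw [zero_sub, varOp_neg, zero_add, varOp_natCast, arcOp_mono, arcOp_mono, mulX_mono,
    show -1 - (n + p) = -1 - n - p by ring, show -1 - (n - 1 - p) = p - n by ring]
  rfl

/-- The mode `(x_{i (-1)} f)_(n)`, on the algebra of arcs. -/
def normalOp (i : I) (n : ℤ) : W.V₀ →ₗ[ℂ] W.Arc →ₗ[ℂ] Poly W I :=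
  have hb : ∀ j, ∃ N : ℕ, -n ≤ N ∧ ∀ p : ℕ, N ≤ p → W.arcDer p (S.s (t i)) j = 0 := fun j => by
    obtain ⟨N, hN⟩ := exists_arcDer_eq_zero (S.s (t i)) j
    exact ⟨max N (-n).toNat, by omega, fun p hp => hN p (le_trans (le_max_left _ _) hp)⟩
  LinearMap.mk₂ ℂ (fun f j => Fields.comm (S.varOp t i) (fun n => arcOp n f) 0 (-1) n (mono 0 j))
    (fun f g j => by
      obtain ⟨N, h1, h2⟩ := hb j
      rw [S.normal_eq t i h1 _ j h2, S.normal_eq t i h1 _ j h2, S.normal_eq t i h1 _ j h2,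
        ← Finset.sum_add_distrib]
      refine Finset.sum_congr rfl fun p _ => ?_
      simp only [map_add, add_mul]
      abel)
    (fun c f j => by
      obtain ⟨N, h1, h2⟩ := hb j
      rw [S.normal_eq t i h1 _ j h2, S.normal_eq t i h1 _ j h2, Finset.smul_sum]
      refine Finset.sum_congr rfl fun p _ => ?_
      simp only [map_smul, smul_mul_assoc, smul_add])
    (fun f j j' => by
      obtain ⟨N, h1, h2⟩ := hb j
      obtain ⟨N', h1', h2'⟩ := hb j'
      have e : ∀ p : ℕ, max N N' ≤ p → W.arcDer p (S.s (t i)) j = 0 := fun p hp =>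
        h2 p (le_trans (le_max_left _ _) hp)
      have e' : ∀ p : ℕ, max N N' ≤ p → W.arcDer p (S.s (t i)) j' = 0 := fun p hp =>
        h2' p (le_trans (le_max_right _ _) hp)
      have h : -n ≤ (max N N' : ℕ) := by omega
      rw [S.normal_eq t i h _ j e, S.normal_eq t i h _ j' e', S.normal_eq t i h _ (j + j')
        (fun p hp => by rw [map_add, e p hp, e' p hp, add_zero]), ← Finset.sum_add_distrib]
      refine Finset.sum_congr rfl fun p _ => ?_
      simp only [map_add, mul_add]
      abel)
    (fun c f j => by
      obtain ⟨N, h1, h2⟩ := hb j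
      rw [S.normal_eq t i h1 _ j h2, S.normal_eq t i h1 _ (c • j)
        (fun p hp => by rw [Derivation.map_smul, h2 p hp, smul_zero]), Finset.smul_sum]
      refine Finset.sum_congr rfl fun p _ => ?_
      simp only [Derivation.map_smul, map_smul, mul_smul_comm, smul_add])

lemma normalOp_apply (i : I) (n : ℤ) (f : W.V₀) (j : W.Arc) : S.normalOp t i n f j =
    Fields.comm (S.varOp t i) (fun n => arcOp n f) 0 (-1) n (mono 0 j) := rfl

/-- The action of the modes on the algebra of arcs, with values in polynomials. -/
def baseFun (n : ℤ) : W.Gen →ₗ[ℂ] W.Arc →ₗ[ℂ] Poly W I :=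
  (((LinearMap.mul ℂ W.Arc).compr₂ (mono 0)) ∘ₗ W.arc (-1 - n)).coprod
    (((LinearMap.mul ℂ W.Arc).compr₂ (mono 0)) ∘ₗ W.arcΩ (-1 - n) ∘ₗ S.omPart t +
      Finsupp.lsum ℂ (fun i => S.normalOp t i n) ∘ₗ coords t)

lemma baseFun_mk (n : ℤ) (a : W.V₀) (x : W.V₁) (j : W.Arc) : S.baseFun t n (a, x) j =
    mono 0 (W.arc (-1 - n) a * j) + (mono 0 (W.arcΩ (-1 - n) (S.omPart t x) * j) +
      Finsupp.lsum ℂ (fun i => S.normalOp t i n) (coords t x) j) := rfl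

/-- The action of the modes on the algebra of arcs, with values in polynomials. -/
def base : W.Mode →ₗ[ℂ] W.Arc →ₗ[ℂ] Poly W I :=
  modeLift (S.baseFun t) fun n a => by
    have hda : S.omPart t (W.d a) = dOm a := S.omPart_of_mem t (dOm a)
    ext1 j
    rw [LinearMap.smul_apply, baseFun_mk, baseFun_mk, hda, coords_of_mem t (d_mem a), map_zero,
      map_zero, map_zero, map_zero, map_zero, LinearMap.zero_apply, zero_mul,
      arcΩ_d, show -1 - n + 1 = -1 - (n - 1) by ring, smul_mul_assoc, map_smul]
    simp only [map_zero, LinearMap.zero_apply, zero_add, add_zero]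
    congr 1
    push_cast
    ring

lemma base_fst (n : ℤ) (a : W.V₀) (j : W.Arc) :
    S.base t (W.md n (a, 0)) j = mono 0 (W.arc (-1 - n) a * j) := by
  rw [base, modeLift_md, baseFun_mk]
  simp

lemma base_Om (n : ℤ) (w : W.Om) (j : W.Arc) :
    S.base t (W.md n (0, w)) j = mono 0 (W.arcΩ (-1 - n) w * j) := by
  rw [base, modeLift_md, baseFun_mk, omPart_of_mem, coords_of_mem t w.2]
  simp

lemma base_ract (n : ℤ) (i : I) (f : W.V₀) (j : W.Arc) :
    S.base t (W.md n (0, W.ract (S.s (t i)) f)) j = S.normalOp t i n f j := by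
  rw [base, modeLift_md, baseFun_mk, omPart_ract, coords_ract, Finsupp.lsum_single]
  simp

lemma base_natCast (n : ℕ) (x : W.V₁) (j : W.Arc) :
    S.base t (W.md n (0, x)) j = mono 0 (W.arcDer n x j) := by
  induction x using S.induction_on t with
  | hΩ w =>
    rw [base_Om, arcDer_Om n w.2, arcΩ_of_neg (by omega)]
    simp
  | hx i f =>
    obtain ⟨N, hN⟩ := exists_arcDer_eq_zero (S.s (t i)) j
    obtain ⟨N', hN'⟩ := exists_sum_arc_mul_arcDer n (S.s (t i)) f j
    have e : ∀ p : ℕ, max N N' ≤ p → W.arcDer p (S.s (t i)) j = 0 := fun p hp =>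
      hN p (le_trans (le_max_left _ _) hp)
    rw [base_ract, normalOp_apply, S.normal_eq t i (by omega) f j e, ← hN' _ (le_max_right _ _),
      map_sum]
    refine Finset.sum_congr rfl fun p _ => ?_
    rw [arc_of_neg (k := -1 - n - p) (by omega), LinearMap.zero_apply, zero_mul, map_zero, zero_add]
  | hadd x y hx hy =>
    have h : ((0, x + y) : W.Gen) = (0, x) + (0, y) := by simp
    rw [h, map_add, map_add, LinearMap.add_apply, hx, hy, arcDer_add, Derivation.add_apply,
      map_add]

/-- The modes that correspond to the variables. -/
def varMode (k : I ×ₗ ℕ) : W.Mode := W.md (-1 - (ofLex k).2) (0, S.s (t (ofLex k).1))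

lemma isBase : IsBase (S.varMode t) (S.base t) where
  mem l j := by
    have h1 : ∀ j, mono 0 j ∈ Lt (X := I ×ₗ ℕ) (J := W.Arc) 2 := fun j => mono_mem (by simp) j
    induction l using mode_induction with
    | h n u =>
      obtain ⟨a, x⟩ := u
      rw [gen_decomp W (a, x), map_add, map_add, LinearMap.add_apply]
      refine add_mem ?_ ?_
      · rw [base_fst]
        exact h1 _
      · induction x using S.induction_on t with
        | hΩ w =>
          rw [base_Om]
          exact h1 _
        | hx i f =>
          obtain ⟨N, hN⟩ := exists_arcDer_eq_zero (S.s (t i)) j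
          have e : ∀ p : ℕ, max N (-n).toNat ≤ p → W.arcDer p (S.s (t i)) j = 0 := fun p hp =>
            hN p (le_trans (le_max_left _ _) hp)
          rw [base_ract, normalOp_apply, S.normal_eq t i (by omega) f j e]
          exact sum_mem fun p _ => add_mem (mono_mem (by simp) _) (h1 _)
        | hadd x y hx hy =>
          have h : ((0, x + y) : W.Gen) = (0, x) + (0, y) := by simp
          rw [h, map_add, map_add, LinearMap.add_apply]
          exact add_mem hx hy
    | h0 => simp
    | hadd x y hx hy => rw [map_add, LinearMap.add_apply]; exact add_mem hx hy
  var k j := by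
    obtain ⟨i, n⟩ := k
    have h : W.ract (S.s (t i)) 1 = S.s (t i) := W.ract_vac _
    obtain ⟨N, hN⟩ := exists_arcDer_eq_zero (S.s (t i)) j
    have e : ∀ p : ℕ, max N (n + 1) ≤ p → W.arcDer p (S.s (t i)) j = 0 := fun p hp =>
      hN p (le_trans (le_max_left _ _) hp)
    change S.base t (W.md (-1 - n) (0, S.s (t i))) j = mono {toLex (i, n)} j
    rw [← h, base_ract, normalOp_apply, S.normal_eq t i (N := max N (n + 1)) (by omega) 1 j e,
      Finset.sum_eq_single n]
    · rw [show -1 - (-1 - (n : ℤ)) - n = 0 by ring, arc_one, one_mul,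
        arc_one_of_ne (k := n - (-1 - n)) (by omega), zero_mul, map_zero, add_zero]
    · intro p _ hp
      rw [arc_one_of_ne (k := -1 - (-1 - n) - p) (by omega),
        arc_one_of_ne (k := p - (-1 - n)) (by omega)]
      simp
    · intro hn
      exact absurd (Finset.mem_range.2 (by omega)) hn

/-- The action of the modes on polynomials. -/
def polyAct : W.Mode →ₗ[ℂ] Poly W I →ₗ[ℂ] Poly W I := action (S.varMode t) (S.base t)

lemma isField_polyAct (u : W.Gen) : Fields.IsField fun n => S.polyAct t (W.md n u) := by
  have key : ∀ k, ∀ (m : Multiset (I ×ₗ ℕ)), m.card = k → ∀ (j : W.Arc) (u : W.Gen),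
      ∃ N : ℤ, ∀ n, N ≤ n → S.polyAct t (W.md n u) (mono m j) = 0 := by
    intro k
    induction k with
    | zero =>
      intro m hm j u
      obtain rfl : m = 0 := by simpa using hm
      obtain ⟨a, x⟩ := u
      obtain ⟨N, hN⟩ := exists_arcDer_eq_zero x j
      refine ⟨N, fun n hn => ?_⟩
      lift n to ℕ using by omega
      rw [gen_decomp W (a, x), map_add, map_add, LinearMap.add_apply, polyAct, action_mono_zero,
        action_mono_zero, base_fst, base_natCast, hN n (by omega), arc_of_neg (by omega)]
      simp
    | succ k ih =>
      intro m hm j u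
      rcases exists_cons m with rfl | ⟨i, m, rfl, hi⟩
      · simp at hm
      have hm' : m.card = k := by simpa using hm
      obtain ⟨N, hN⟩ := ih m hm' j u
      obtain ⟨N', hN'⟩ := ih m hm' j (W.mode 0 u (0, S.s (t (ofLex i).1)))
      obtain ⟨N'', hN''⟩ := ih m hm' j (W.mode 1 u (0, S.s (t (ofLex i).1)))
      refine ⟨max N (max N' N'' + 2 + (ofLex i).2), fun n hn => ?_⟩
      rw [polyAct, action_mono_cons (S.isBase t) hi, ← polyAct, hN n (by omega), varMode, lie_md,
        map_add, map_smul, LinearMap.add_apply, LinearMap.smul_apply, hN' _ (by omega),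
        hN'' _ (by omega)]
      simp
  intro v
  obtain ⟨d, hv⟩ := exists_mem_Lt v
  induction hv using Submodule.span_induction with
  | mem v hv =>
    obtain ⟨m, j, -, rfl⟩ := hv
    exact key _ m rfl j u
  | zero => exact ⟨0, fun n _ => map_zero _⟩
  | add v w _ _ hv hw =>
    obtain ⟨N, hN⟩ := hv
    obtain ⟨N', hN'⟩ := hw
    exact ⟨max N N', fun n hn => by
      dsimp only
      rw [map_add]
      exact (congrArg₂ (· + ·) (hN n (by omega)) (hN' n (by omega))).trans (add_zero _)⟩
  | smul c v _ hv =>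
    obtain ⟨N, hN⟩ := hv
    exact ⟨N, fun n hn => by
      dsimp only
      rw [map_smul]
      exact (congrArg _ (hN n hn)).trans (smul_zero _)⟩

end Splitting

end OneTruncatedVertexAlgebra

/-! ### The normally ordered product of two modes on the algebra of arcs -/

namespace OneTruncatedVertexAlgebra

open Pbw

variable {W : OneTruncatedVertexAlgebra.{u}}

lemma arcΩ_smul' {k : ℤ} {N : ℕ} (hN : k < N) (a : W.V₀) (w : W.Om) :
    W.arcΩ k (a • w) = ∑ p ∈ Finset.range N, W.arcΩ p w * W.arc (k - p) a := by
  rcases lt_or_ge k 0 with h | h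
  · rw [arcΩ_of_neg h, LinearMap.zero_apply]
    exact (Finset.sum_eq_zero fun p _ => by
      rw [arc_of_neg (k := k - p) (by omega), LinearMap.zero_apply, mul_zero]).symm
  · lift k to ℕ using h
    rw [← sum_antidiagonal_int k (fun p => W.arcΩ p w) (fun p => W.arc p a)
      (fun p hp => by simp only [arc_of_neg hp, LinearMap.zero_apply]) (by omega), arcΩ_smul_nat]
    simp only [mul_comm (W.arcΩ _ w)]
    exact Finset.Nat.sum_antidiagonal_swap (f := fun p => W.arc p.1 a * W.arcΩ p.2 w) |>.symm

lemma sum_arc_sub_mul_arc {n : ℤ} {M : ℕ} (hM : -n ≤ M) {q : ℕ} (hq : q < M) (g f : W.V₀) :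
    ∑ p ∈ Finset.range M, W.arc (p - q) g * W.arc (-1 - n - p) f = W.arc (-1 - n - q) (g * f) := by
  obtain ⟨M, rfl⟩ : ∃ M', M = q + M' := ⟨M - q, by omega⟩
  rw [Finset.sum_range_add, Finset.sum_eq_zero fun p hp => ?_, zero_add,
    arc_mul (N := M) (by omega)]
  · refine Finset.sum_congr rfl fun p _ => ?_
    push_cast
    congr 3 <;> ring
  · rw [Finset.mem_range] at hp
    rw [arc_of_neg (k := (p : ℤ) - q) (by omega), LinearMap.zero_apply, zero_mul]

lemma sum_arc_mul_arc_int {n : ℤ} {M : ℕ} (hM : -n ≤ M) {q : ℕ} (hq : q < M) (g f : W.V₀) :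
    ∑ p ∈ Finset.range M, (W.arc (q + 1 + p) g * W.arc (-1 - n - p) f +
      W.arc (q - p) g * W.arc (p - n) f) = W.arc (q - n) (g * f) := by
  rw [arc_mul (N := q + 1 + M) (by omega), Finset.sum_range_add, Finset.sum_add_distrib, add_comm]
  congr 1
  · obtain ⟨M, rfl⟩ : ∃ M', M = q + 1 + M' := ⟨M - (q + 1), by omega⟩
    rw [Finset.sum_range_add, ← Finset.sum_range_reflect (n := q + 1), add_eq_left.2]
    · refine Finset.sum_congr rfl fun p hp => ?_
      rw [Finset.mem_range] at hp
      rw [show ((q + 1 - 1 - p : ℕ) : ℤ) = q - p by omega, show (q : ℤ) - (q - p) = p by ring,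
        show (q : ℤ) - p - n = q - n - p by ring]
    · refine Finset.sum_eq_zero fun p _ => ?_
      rw [arc_of_neg (k := (q : ℤ) - _) (by omega), LinearMap.zero_apply, zero_mul]
  · refine Finset.sum_congr rfl fun p _ => ?_
    push_cast
    congr 3; ring

lemma sum_sum_range_add {R : Type*} [AddCommMonoid R] (F : ℕ → R) {M : ℕ}
    (hF : ∀ s, M ≤ s → F s = 0) :
    ∑ p ∈ Finset.range M, ∑ q ∈ Finset.range M, F (p + q) =
      ∑ s ∈ Finset.range M, (s + 1) • F s := by
  have h1 : ∀ p ∈ Finset.range M, ∑ q ∈ Finset.range M, F (p + q) = ∑ s ∈ Finset.Ico p M, F s := by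
    intro p hp
    rw [Finset.mem_range] at hp
    rw [Finset.sum_Ico_eq_sum_range]
    refine (Finset.sum_subset (Finset.range_mono (Nat.sub_le _ _)) fun q _ hq => hF _ ?_).symm
    rw [Finset.mem_range] at hq
    omega
  rw [Finset.sum_congr rfl h1, Finset.sum_comm' (t' := Finset.range M)
    (s' := fun s => Finset.range (s + 1)) (fun p s => by
      simp only [Finset.mem_range, Finset.mem_Ico]; omega)]
  exact Finset.sum_congr rfl fun s _ => by rw [Finset.sum_const, Finset.card_range]

lemma sum_sum_arc_mul_arc {n : ℤ} {M : ℕ} (hM : -n ≤ M) (g f : W.V₀) :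
    ∑ p ∈ Finset.range M, ∑ q ∈ Finset.range M, W.arc (q + 1 + p) g * W.arc (-1 - n - p - q) f =
      W.arcΩ (-1 - n) (f • dOm g) := by
  have h := sum_sum_range_add (M := M)
    (fun s : ℕ => W.arc (s + 1) g * W.arc (-1 - n - s) f) (fun s hs => by
      rw [arc_of_neg (k := -1 - n - s) (by omega), LinearMap.zero_apply, mul_zero])
  rw [arcΩ_smul' (N := M) (by omega)]
  refine Eq.trans ?_ (h.trans (Finset.sum_congr rfl fun s _ => ?_))
  · refine Finset.sum_congr rfl fun p _ => Finset.sum_congr rfl fun q _ => ?_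
    push_cast
    congr 3 <;> ring
  · rw [arcΩ_d, ← Nat.cast_smul_eq_nsmul ℂ, ← smul_mul_assoc]
    push_cast
    rfl

lemma arcDer_ract (n : ℕ) (x : W.V₁) (f : W.V₀) (j : W.Arc) {N : ℕ}
    (hN : ∀ p : ℕ, N ≤ p → W.arcDer p x j = 0) :
    W.arcDer n (W.ract x f) j = ∑ p ∈ Finset.range N, W.arc (p - n) f * W.arcDer p x j := by
  obtain ⟨N', hN'⟩ := exists_sum_arc_mul_arcDer n x f j
  rw [← hN' (max N N') (le_max_right _ _)]
  refine (Finset.sum_subset (Finset.range_mono (le_max_left _ _)) fun p _ hp => ?_).symm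
  rw [hN p (by simpa using hp), mul_zero]

lemma anchor_ract (x : W.V₁) (f a : W.V₀) : W.anchor (W.ract x f) a = W.mul f (W.anchor x a) := by
  rw [ract_eq, map_add, LinearMap.add_apply, anchor_act, anchor_d, add_zero]

lemma ract_ract (x : W.V₁) (g f : W.V₀) : W.ract (W.ract x g) f =
    W.ract x (g * f) + W.act (W.anchor x f) (W.d g) := by
  rw [W.ract_eq f (W.ract x g), anchor_ract, W.ract_eq g x, W.ract_eq (g * f) x, map_add, ← mul_eq,
    mul_comm' W g f, act_act, anchor_mul, map_add, d_mul, d_mul, d_mul]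
  abel

lemma br_ract (y x : W.V₁) (f : W.V₀) : W.br y (W.ract x f) =
    W.ract (W.br y x) f + W.ract x (W.anchor y f) := by
  simp only [ract_eq, map_add, br_act, br_d, anchor_br, map_sub]
  abel

lemma pair_ract (y x : W.V₁) (f : W.V₀) : W.pair y (W.ract x f) =
    W.mul (W.pair y x) f + W.anchor (W.br y x) f := by
  rw [ract_eq, map_add, pair_d', W.pair_comm y, pair_act, W.pair_comm x, anchor_br,
    mul_comm' W f]
  abel

lemma ract_Om {w : W.V₁} (hw : w ∈ W.Om) (f : W.V₀) : W.ract w f = W.act f w := by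
  rw [ract_eq, anchor_Om hw, map_zero, add_zero]

namespace Splitting

variable {I : Type u} [LinearOrder I] (t : Module.Basis I W.V₀ W.T) (S : W.Splitting)

lemma polyAct_mono_zero (l : W.Mode) (j : W.Arc) : S.polyAct t l (mono 0 j) = S.base t l j :=
  action_mono_zero l j

/-- The field of an element of `V₀ ⊕ V₁`. -/
def fld (u : W.Gen) (n : ℤ) : Module.End ℂ (Poly W I) := S.polyAct t (W.md n u)

lemma isField_fld (u : W.Gen) : Fields.IsField (S.fld t u) := S.isField_polyAct t u

/-- The normally ordered product of the fields of `u` and of `f`. -/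
def nop (u : W.Gen) (f : W.V₀) (n : ℤ) (v : Poly W I) : Poly W I :=
  Fields.comm (S.fld t u) (S.fld t (f, 0)) 0 (-1) n v

/-- On a given vector, the infinite sums in a normally ordered product can be cut off at any
sufficiently large index. -/
lemma exists_comm_eq_sum {V : Type*} [AddCommGroup V] [Module ℂ V] {a b : ℤ → Module.End ℂ V}
    (ha : Fields.IsField a) (hb : Fields.IsField b) (m n : ℤ) (v : V) :
    ∃ N : ℕ, ∀ M, N ≤ M → Fields.comm a b m (-1) n v =
      ∑ p ∈ Finset.range M, (a (m - 1 - p) (b (n + p) v) + b (n - 1 - p) (a (m + p) v)) := by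
  obtain ⟨N, hN⟩ := hb v
  obtain ⟨N', hN'⟩ := ha v
  refine ⟨max (N - n).toNat (N' - m).toNat, fun M hM => Fields.comm_neg_one (fun p hp => ?_)
    (fun p hp => ?_)⟩
  · exact hN _ (by omega)
  · exact hN' _ (by omega)

lemma exists_nop_eq_sum (u : W.Gen) (f : W.V₀) (n : ℤ) (v : Poly W I) :
    ∃ N : ℕ, ∀ M, N ≤ M → S.nop t u f n v = ∑ p ∈ Finset.range M,
      (S.fld t u (-1 - p) (S.fld t (f, 0) (n + p) v) +
        S.fld t (f, 0) (n - 1 - p) (S.fld t u p v)) := by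
  obtain ⟨N, hN⟩ := exists_comm_eq_sum (S.isField_fld t u) (S.isField_fld t (f, 0)) 0 n v
  exact ⟨N, fun M hM => by rw [nop]; simpa using hN M hM⟩

lemma nop_add (u u' : W.Gen) (f : W.V₀) (n : ℤ) (v : Poly W I) :
    S.nop t (u + u') f n v = S.nop t u f n v + S.nop t u' f n v := by
  obtain ⟨N, hN⟩ := S.exists_nop_eq_sum t u f n v
  obtain ⟨N', hN'⟩ := S.exists_nop_eq_sum t u' f n v
  obtain ⟨N'', hN''⟩ := S.exists_nop_eq_sum t (u + u') f n v
  rw [hN (max N (max N' N'')) (by omega), hN' (max N (max N' N'')) (by omega),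
    hN'' (max N (max N' N'')) (by omega), ← Finset.sum_add_distrib]
  refine Finset.sum_congr rfl fun p _ => ?_
  simp only [fld, map_add, LinearMap.add_apply]
  abel

lemma fld_fst (a : W.V₀) (n : ℤ) (j : W.Arc) :
    S.fld t (a, 0) n (mono 0 j) = mono 0 (W.arc (-1 - n) a * j) := by
  rw [fld, polyAct_mono_zero, base_fst]

lemma fld_Om (w : W.Om) (n : ℤ) (j : W.Arc) :
    S.fld t (0, w) n (mono 0 j) = mono 0 (W.arcΩ (-1 - n) w * j) := by
  rw [fld, polyAct_mono_zero, base_Om]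

lemma fld_natCast (x : W.V₁) (n : ℕ) (j : W.Arc) :
    S.fld t (0, x) n (mono 0 j) = mono 0 (W.arcDer n x j) := by
  rw [fld, polyAct_mono_zero, base_natCast]

lemma fld_ract (i : I) (f : W.V₀) {n : ℤ} {N : ℕ} (hN : -n ≤ N) (j : W.Arc)
    (hj : ∀ p : ℕ, N ≤ p → W.arcDer p (S.s (t i)) j = 0) :
    S.fld t (0, W.ract (S.s (t i)) f) n (mono 0 j) =
      ∑ p ∈ Finset.range N, (mono {toLex (i, p)} (W.arc (-1 - n - p) f * j) +
        mono 0 (W.arc (p - n) f * W.arcDer p (S.s (t i)) j)) := by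
  rw [fld, polyAct_mono_zero, base_ract, normalOp_apply, S.normal_eq t i hN f j hj]

lemma nop_fst (a f : W.V₀) (n : ℤ) (j : W.Arc) : S.nop t (a, 0) f n (mono 0 j) =
    S.fld t (W.mul a f, 0) n (mono 0 j) := by
  obtain ⟨N, hN⟩ := S.exists_nop_eq_sum t (a, 0) f n (mono 0 j)
  rw [hN (max N (-n).toNat) (le_max_left _ _), fld_fst, mul_eq,
    arc_mul (N := max N (-n).toNat) (by omega), Finset.sum_mul, map_sum]
  refine Finset.sum_congr rfl fun p _ => ?_
  rw [fld_fst, fld_fst, fld_fst, fld_fst, arc_of_neg (k := -1 - (p : ℤ)) (by omega)]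
  rw [show -1 - (-1 - (p : ℤ)) = p by ring, show -1 - (n + (p : ℤ)) = -1 - n - p by ring]
  simp only [LinearMap.zero_apply, zero_mul, mul_zero, map_zero, add_zero, mul_assoc]

lemma nop_Om (w : W.Om) (f : W.V₀) (n : ℤ) (j : W.Arc) : S.nop t (0, w) f n (mono 0 j) =
    S.fld t (0, W.ract w f) n (mono 0 j) := by
  obtain ⟨N, hN⟩ := S.exists_nop_eq_sum t (0, w) f n (mono 0 j)
  have h : W.ract w f = ((f • w : W.Om) : W.V₁) := ract_Om w.2 f
  rw [hN (max N (-n).toNat) (le_max_left _ _), h, fld_Om,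
    arcΩ_smul' (N := max N (-n).toNat) (by omega), Finset.sum_mul, map_sum]
  refine Finset.sum_congr rfl fun p _ => ?_
  rw [fld_fst, fld_Om, fld_Om, fld_fst, arcΩ_of_neg (k := -1 - (p : ℤ)) (by omega)]
  rw [show -1 - (-1 - (p : ℤ)) = p by ring, show -1 - (n + (p : ℤ)) = -1 - n - p by ring]
  simp only [LinearMap.zero_apply, zero_mul, mul_zero, map_zero, add_zero, mul_assoc]

/-- The normally ordered product is associative up to the term that corresponds to
`(x_(-1) g)_(-1) f = x_(-1) (g f) + x(f) ∂g`. Both sides are double sums of coefficients of arcs,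
which are compared for each index of the variable or derivation. -/
lemma nop_ract (i : I) (g f : W.V₀) (n : ℤ) (j : W.Arc) :
    S.nop t (0, W.ract (S.s (t i)) g) f n (mono 0 j) =
      S.fld t (0, W.ract (W.ract (S.s (t i)) g) f) n (mono 0 j) := by
  obtain ⟨N, hN⟩ := S.exists_nop_eq_sum t (0, W.ract (S.s (t i)) g) f n (mono 0 j)
  obtain ⟨N', hN'⟩ := exists_arcDer_eq_zero (S.s (t i)) j
  obtain ⟨M, hM⟩ : ∃ M, max (max N N') (-n).toNat ≤ M := ⟨_, le_rfl⟩
  set x := S.s (t i) with hx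
  have hj : ∀ p : ℕ, M ≤ p → W.arcDer p x j = 0 := fun p hp => hN' p (by omega)
  have hw : W.act (W.anchor x f) (W.d g) = ((W.anchor x f • dOm g : W.Om) : W.V₁) := rfl
  have e : ((0, W.ract x (g * f) + W.act (W.anchor x f) (W.d g)) : W.Gen) =
    (0, W.ract x (g * f)) + (0, W.act (W.anchor x f) (W.d g)) := by simp
  have e2 : S.fld t (0, W.ract (W.ract x g) f) n (mono 0 j) =
      S.fld t (0, W.ract x (g * f)) n (mono 0 j) +
        S.fld t (0, ((W.anchor x f • dOm g : W.Om) : W.V₁)) n (mono 0 j) := by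
    rw [ract_ract, e, ← hw, fld, map_add, map_add]
    rfl
  have e1 : ∀ p ∈ Finset.range M,
      S.fld t (0, W.ract x g) (-1 - p) (S.fld t (f, 0) (n + p) (mono 0 j)) +
        S.fld t (f, 0) (n - 1 - p) (S.fld t (0, W.ract x g) p (mono 0 j)) =
      ∑ q ∈ Finset.range M, (mono {toLex (i, q)} (W.arc (p - q) g * W.arc (-1 - n - p) f * j) +
        mono 0 ((W.arc (q + 1 + p) g * W.arc (-1 - n - p) f +
          W.arc (q - p) g * W.arc (p - n) f) * W.arcDer q x j) +
        mono 0 (W.arc (q + 1 + p) g * W.arc (-1 - n - p - q) (W.anchor x f) * j)) := by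
    intro p hp
    rw [Finset.mem_range] at hp
    have hj' : ∀ q : ℕ, M ≤ q → W.arcDer q x (W.arc (-1 - (n + p)) f * j) = 0 := fun q hq => by
      rw [Derivation.leibniz, hj q hq, arcDer_arc,
        arc_of_neg (k := -1 - (n + (p : ℤ)) - q) (by omega)]
      simp
    rw [fld_natCast, fld_fst, fld_fst, S.fld_ract t i g (N := M) (by omega) _ hj',
      arcDer_ract p x g j hj, Finset.mul_sum, map_sum, ← Finset.sum_add_distrib]
    refine Finset.sum_congr rfl fun q _ => ?_
    rw [Derivation.leibniz, arcDer_arc, smul_eq_mul, smul_eq_mul, add_assoc, add_assoc, ← map_add,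
      ← map_add]
    rw [show -1 - (-1 - (p : ℤ)) - q = p - q by ring, show -1 - (n + p) = -1 - n - p by ring,
      show (q : ℤ) - (-1 - p) = q + 1 + p by ring, show -1 - (n - 1 - (p : ℤ)) = p - n by ring,
      mul_assoc]
    congr 2
    ring
  rw [hN M (by omega), Finset.sum_congr rfl e1, e2, fld_Om,
    S.fld_ract t i (g * f) (N := M) (by omega) j hj, ← sum_sum_arc_mul_arc (M := M) (by omega),
    Finset.sum_comm, Finset.sum_comm (f := fun p q : ℕ =>
      W.arc (q + 1 + p) g * W.arc (-1 - n - p - q) (W.anchor x f)), Finset.sum_mul, map_sum,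
    ← Finset.sum_add_distrib]
  refine Finset.sum_congr rfl fun q hq => ?_
  rw [Finset.mem_range] at hq
  rw [← sum_arc_sub_mul_arc (by omega) hq, ← sum_arc_mul_arc_int (by omega) hq,
    Finset.sum_add_distrib, Finset.sum_add_distrib]
  simp only [Finset.sum_mul, map_sum]
  rfl

/-- On the algebra of arcs, the normally ordered product of the fields of `u` and `f` is the field
of `u_(-1) f`. -/
lemma nop_eq (u : W.Gen) (f : W.V₀) (n : ℤ) (j : W.Arc) : S.nop t u f n (mono 0 j) =
    S.fld t (W.mul u.1 f, W.ract u.2 f) n (mono 0 j) := by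
  have hs : ∀ u v : W.Gen, S.fld t (u + v) n (mono 0 j) =
      S.fld t u n (mono 0 j) + S.fld t v n (mono 0 j) := fun u v => by
    rw [fld, map_add, map_add]
    rfl
  obtain ⟨a, x⟩ := u
  rw [gen_decomp W (a, x), nop_add, gen_decomp W (W.mul _ f, _), hs, nop_fst]
  have h : S.nop t (0, x) f n (mono 0 j) = S.fld t (0, W.ract x f) n (mono 0 j) := by
    induction x using S.induction_on t with
    | hΩ w => exact S.nop_Om t w f n j
    | hx i g => exact S.nop_ract t i g f n j
    | hadd x y hx hy =>
      have h : ∀ x y : W.V₁, ((0, x + y) : W.Gen) = (0, x) + (0, y) := by simp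
      rw [h, nop_add, hx, hy, map_add, LinearMap.add_apply, h, hs]
  simp [h]

end Splitting

end OneTruncatedVertexAlgebra

/-! ### The commutation relations on polynomials -/

namespace OneTruncatedVertexAlgebra

open Pbw

variable {W : OneTruncatedVertexAlgebra.{u}}

/-- The modes that are easily seen to preserve the algebra of arcs. -/
def IsLow (l : W.Mode) : Prop :=
  (∃ n a, l = W.md n (a, 0)) ∨ (∃ n, ∃ w : W.Om, l = W.md n (0, w)) ∨
    ∃ (n : ℕ) (x : W.V₁), l = W.md n (0, x)

namespace Splitting

variable {I : Type u} [LinearOrder I] (t : Module.Basis I W.V₀ W.T) (S : W.Splitting)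

/-- The commutation relation of two modes at a polynomial. -/
abbrev Comm (l l' : W.Mode) (p : Poly W I) : Prop := Pbw.Rel (S.varMode t) (S.base t) l l' p

lemma comm_md {m n : ℤ} {u v : W.Gen} {p : Poly W I} : S.Comm t (W.md m u) (W.md n v) p ↔
    S.fld t u m (S.fld t v n p) - S.fld t v n (S.fld t u m p) =
      S.fld t (W.mode 0 u v) (m + n) p + (m : ℂ) • S.fld t (W.mode 1 u v) (m + n - 1) p := by
  rw [Comm, Pbw.Rel, lie_md, map_add, map_smul]
  rfl

variable {t S} in
lemma Comm.add_left {l₁ l₂ l : W.Mode} {p : Poly W I} (h₁ : S.Comm t l₁ l p)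
    (h₂ : S.Comm t l₂ l p) : S.Comm t (l₁ + l₂) l p := by
  simp only [Comm, Pbw.Rel, map_add, LinearMap.add_apply, add_lie] at *
  rw [← h₁, ← h₂]
  abel

lemma fld_add (u v : W.Gen) (n : ℤ) (p : Poly W I) :
    S.fld t (u + v) n p = S.fld t u n p + S.fld t v n p := by
  rw [fld, map_add, map_add]
  rfl

lemma fld_zero (n : ℤ) (p : Poly W I) : S.fld t 0 n p = 0 := by
  rw [fld, map_zero, map_zero, LinearMap.zero_apply]

lemma fld_mk_zero (n : ℤ) (p : Poly W I) : S.fld t (0, 0) n p = 0 := S.fld_zero t n p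

lemma exists_of_isLow {l : W.Mode} (h : IsLow l) (j : W.Arc) :
    ∃ j', S.polyAct t l (mono 0 j) = mono 0 j' := by
  obtain ⟨n, a, rfl⟩ | ⟨n, w, rfl⟩ | ⟨n, x, rfl⟩ := h
  exacts [⟨_, S.fld_fst t a n j⟩, ⟨_, S.fld_Om t w n j⟩, ⟨_, S.fld_natCast t x n j⟩]

lemma comm_isLow {l l' : W.Mode} (h : IsLow l) (h' : IsLow l') (j : W.Arc) :
    S.Comm t l l' (mono 0 j) := by
  have hxa : ∀ (n : ℕ) (x : W.V₁) k a, S.Comm t (W.md n (0, x)) (W.md k (a, 0)) (mono 0 j) := by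
    intro n x k a
    rw [comm_md, mode_zero, mode_one]
    simp only [map_zero, sub_zero, zero_mul, fld_fst, fld_natCast,
      smul_zero, add_zero, Derivation.leibniz, arcDer_arc, smul_eq_mul, map_add]
    rw [add_sub_cancel_left, show -1 - k - (n : ℤ) = -1 - (n + k) by ring, mul_comm j]
  have hxw : ∀ (n : ℕ) (x : W.V₁) k (w : W.Om),
      S.Comm t (W.md n (0, x)) (W.md k (0, w)) (mono 0 j) := by
    intro n x k w
    rw [comm_md, mode_zero, mode_one]
    have h := S.fld_Om t ⟨W.br x w, br_mem x w.2⟩ (n + k) j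
    simp only [map_zero, sub_zero]
    rw [h]
    simp only [fld_fst, fld_natCast, fld_Om, Derivation.leibniz, arcDer_arcΩ, smul_eq_mul, map_add]
    rw [add_sub_cancel_left, show -1 - k - (n : ℤ) = -1 - (n + k) by ring,
      show -1 - k + 1 - (n : ℤ) = -1 - (n + k - 1) by ring, mul_comm j, add_mul, map_add,
      smul_mul_assoc, map_smul]
    rfl
  have haw : ∀ n a k (w : W.Om), S.Comm t (W.md n (a, 0)) (W.md k (0, w)) (mono 0 j) := by
    intro n a k w
    rw [comm_md, mode_zero, mode_one]
    simp only [map_zero, LinearMap.zero_apply, zero_mul, fld_fst, fld_Om,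
      smul_zero, add_zero, anchor_Om w.2, sub_self, mul_left_comm]
  obtain ⟨n, a, rfl⟩ | ⟨n, w, rfl⟩ | ⟨n, x, rfl⟩ := h <;>
    obtain ⟨k, b, rfl⟩ | ⟨k, z, rfl⟩ | ⟨k, y, rfl⟩ := h'
  · rw [comm_md, mode_zero, mode_one]
    simp only [map_zero, LinearMap.zero_apply, zero_mul, fld_fst,
      smul_zero, add_zero, sub_self, mul_left_comm]
  · exact haw n a k z
  · exact (hxa k y n a).symm
  · exact (haw k b n w).symm
  · rw [comm_md, mode_zero, mode_one]
    simp only [map_zero, fld_Om, fld_mk_zero, br_Om_Om w.2 z.2,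
      pair_Om_Om w.2 z.2, smul_zero, add_zero, sub_self, mul_left_comm]
  · exact (hxw k y n w).symm
  · exact hxa n x k b
  · exact hxw n x k z
  · rw [comm_md, mode_zero, mode_one]
    have h := S.fld_natCast t (W.br x y) (n + k) j
    rw [Nat.cast_add] at h
    simp only [map_zero, sub_zero, h, fld_natCast, fld_fst, ← map_sub,
      arcDer_comm]
    rcases eq_or_ne n 0 with rfl | hn
    · simp
    · rw [arc_of_neg (by omega)]
      simp

lemma fld_snd (x : W.V₁) (f : W.V₀) (n : ℤ) (j : W.Arc) :
    S.fld t (0, W.ract x f) n (mono 0 j) = S.nop t (0, x) f n (mono 0 j) := by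
  rw [nop_eq]
  simp

lemma comm_shift {w : W.Gen} {f : W.V₀} {j : W.Arc}
    (h : ∀ p k, S.Comm t (W.md p w) (W.md k (f, 0)) (mono 0 j)) (m n : ℤ) :
    Fields.comm (S.fld t w) (S.fld t (f, 0)) m (-1) n (mono 0 j) =
      S.fld t (W.mul w.1 f, W.ract w.2 f) (m + n) (mono 0 j) +
        (m : ℂ) • S.fld t (W.anchor w.2 f, 0) (m + n - 1) (mono 0 j) := by
  rw [← nop_eq]
  refine Fields.comm_neg_one_shift (S.isField_fld t w) (S.isField_fld t (f, 0))
    (c := fun n => S.fld t (W.anchor w.2 f, 0) n (mono 0 j)) (fun p k => ?_) m n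
  have h := (S.comm_md t).1 (h p k)
  rw [h, mode_zero, mode_one]
  simp [fld_mk_zero]

/-- The commutator of a mode with the normally ordered product of the fields of a basis element
and of `f`, computed from the commutators with each of the two fields. -/
lemma fld_nop (m n : ℤ) (u : W.Gen) (i : I) (f : W.V₀) (j : W.Arc)
    (hl : ∀ l, IsLow l → ∀ j, S.Comm t (W.md m u) l (mono 0 j))
    (hw : ∀ p k, S.Comm t (W.md p (W.mode 0 u (0, S.s (t i)))) (W.md k (f, 0)) (mono 0 j)) :
    S.fld t u m (S.nop t (0, S.s (t i)) f n (mono 0 j)) -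
      S.nop t (0, S.s (t i)) f n (S.fld t u m (mono 0 j)) =
    S.polyAct t ⁅W.md m u, W.md n (0, W.ract (S.s (t i)) f)⁆ (mono 0 j) := by
  set x := S.s (t i) with hx
  set v : Poly W I := mono 0 j with hv
  have hfld : ∀ n, IsLow (W.md n (f, 0)) := fun n => Or.inl ⟨n, f, rfl⟩
  have hc : W.mode 0 u (f, 0) = (W.anchor u.2 f, 0) := by simp [mode_zero]
  have hc' : W.mode 1 u (f, 0) = 0 := by simp [mode_one]
  set w := W.mode 0 u (0, x) with hw'
  set y := W.mode 1 u (0, x) with hy'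
  have h2 : ∀ k j, S.fld t u m (S.fld t (f, 0) k (mono 0 j)) =
      S.fld t (f, 0) k (S.fld t u m (mono 0 j)) +
        S.fld t (W.anchor u.2 f, 0) (m + k) (mono 0 j) := by
    intro k j
    have h := (S.comm_md t).1 (hl _ (hfld k) j)
    rw [hc, hc', fld_zero, smul_zero, add_zero, sub_eq_iff_eq_add'] at h
    exact h
  have h1 : ∀ (p : ℕ) j, S.fld t u m (S.fld t (0, x) (-1 - p) (mono 0 j)) =
      S.fld t (0, x) (-1 - p) (S.fld t u m (mono 0 j)) + S.fld t w (m - 1 - p) (mono 0 j) +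
        (m : ℂ) • S.fld t y (m - 1 - 1 - p) (mono 0 j) := by
    intro p j
    have h : S.Comm t (W.md m u) (W.md (-1 - p) (0, x)) (mono 0 j) :=
      rel_of_le (S.isBase t) (i := toLex (i, p)) (m := 0) (by simp) (W.md m u) j
    rw [comm_md, sub_eq_iff_eq_add', ← hw', ← hy'] at h
    rw [h, add_assoc, show m + (-1 - (p : ℤ)) = m - 1 - p by ring,
      show m - 1 - (p : ℤ) - 1 = m - 1 - 1 - p by ring]
  have h4 : ∀ p : ℕ, S.fld t u m (S.fld t (0, x) p v) =
      S.fld t (0, x) p (S.fld t u m v) + S.fld t w (m + p) v +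
        (m : ℂ) • S.fld t y (m - 1 + p) v := by
    intro p
    have h := (S.comm_md t).1 (hl _ (Or.inr (Or.inr ⟨p, x, rfl⟩)) j)
    rw [sub_eq_iff_eq_add', ← hw', ← hy'] at h
    rw [hv, h, add_assoc, show m + (p : ℤ) - 1 = m - 1 + p by ring]
  obtain ⟨N₁, hN₁⟩ := S.exists_nop_eq_sum t (0, x) f n v
  obtain ⟨N₂, hN₂⟩ := S.exists_nop_eq_sum t (0, x) f n (S.fld t u m v)
  obtain ⟨N₃, hN₃⟩ := S.exists_nop_eq_sum t (0, x) (W.anchor u.2 f) (m + n) v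
  obtain ⟨N₄, hN₄⟩ := exists_comm_eq_sum (S.isField_fld t w) (S.isField_fld t (f, 0)) m n v
  obtain ⟨N₅, hN₅⟩ := exists_comm_eq_sum (S.isField_fld t y) (S.isField_fld t (f, 0)) (m - 1) n v
  obtain ⟨M, hM⟩ : ∃ M, max N₁ (max N₂ (max N₃ (max N₄ N₅))) ≤ M := ⟨_, le_rfl⟩
  have key : S.fld t u m (S.nop t (0, x) f n v) - S.nop t (0, x) f n (S.fld t u m v) =
      S.nop t (0, x) (W.anchor u.2 f) (m + n) v +
        Fields.comm (S.fld t w) (S.fld t (f, 0)) m (-1) n v +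
        (m : ℂ) • Fields.comm (S.fld t y) (S.fld t (f, 0)) (m - 1) (-1) n v := by
    rw [hN₁ M (by omega), hN₂ M (by omega), hN₃ M (by omega), hN₄ M (by omega), hN₅ M (by omega),
      Finset.smul_sum, map_sum, ← Finset.sum_sub_distrib, ← Finset.sum_add_distrib,
      ← Finset.sum_add_distrib]
    refine Finset.sum_congr rfl fun p _ => ?_
    have e1 := h1 p (W.arc (-1 - (n + p)) f * j)
    rw [← S.fld_fst t, ← hv, hv, h2, ← hv, map_add] at e1
    have e2 := h2 (n - 1 - p) (W.arcDer p x j)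
    rw [← S.fld_natCast t, ← hv, h4, map_add, map_add, map_smul] at e2
    rw [map_add, e1, e2, show m + (n + (p : ℤ)) = m + n + p by ring,
      show m + (n - 1 - (p : ℤ)) = m + n - 1 - p by ring]
    module
  have hy : y = (W.pair u.2 x, 0) := mode_one _ _ _
  have h5 := S.comm_shift t hw m n
  have h6 := S.comm_shift t (w := y) (f := f) (j := j) (fun p k => by
    rw [hy]
    exact S.comm_isLow t (Or.inl ⟨_, _, rfl⟩) (hfld k) j) (m - 1) n
  rw [key, h5, h6, nop_eq, lie_md, map_add, map_smul]
  have h7 : W.mode 0 u (0, W.ract x f) = (W.mul w.1 f, W.ract w.2 f) +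
      (W.mul 0 (W.anchor u.2 f), W.ract x (W.anchor u.2 f)) := by
    rw [hw']
    simp only [mode_zero, anchor_ract, br_ract, map_zero, LinearMap.zero_apply, zero_sub,
      Prod.mk_add_mk, add_zero, map_neg, LinearMap.neg_apply]
    rw [W.mul_comm' f]
  have h8 : W.mode 1 u (0, W.ract x f) = (W.mul y.1 f, W.ract y.2 f) + (W.anchor w.2 f, 0) := by
    rw [hw', hy]
    simp only [mode_zero, mode_one, pair_ract, map_zero, LinearMap.zero_apply,
      Prod.mk_add_mk, add_zero]
  have h9 : y.2 = 0 := by rw [hy]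
  rw [h7, h8, map_add, map_add, map_add, map_add, h9, map_zero, LinearMap.zero_apply,
    show m - 1 + n = m + n - 1 by ring]
  change _ = S.fld t _ _ v + S.fld t _ _ v + (m : ℂ) • (S.fld t _ _ v + S.fld t _ _ v)
  simp only [map_zero, LinearMap.zero_apply, fld_mk_zero]
  module

/-- If `u_(m)` preserves the algebra of arcs, it commutes with the modes of `x_(-1) f` as it should,
since it does so with those of the two factors and `u_(0) x` does so with functions. -/
lemma comm_low_ract {m : ℤ} {u : W.Gen} (hu : IsLow (W.md m u)) (n : ℤ) (i : I) (f : W.V₀)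
    (j : W.Arc)
    (hw : ∀ p k, S.Comm t (W.md p (W.mode 0 u (0, S.s (t i)))) (W.md k (f, 0)) (mono 0 j)) :
    S.Comm t (W.md m u) (W.md n (0, W.ract (S.s (t i)) f)) (mono 0 j) := by
  have h := S.fld_nop t m n u i f j (fun l hl j => S.comm_isLow t hu hl j) hw
  obtain ⟨j', hj'⟩ := S.exists_of_isLow t hu j
  change S.fld t u m (mono 0 j) = _ at hj'
  rw [hj', ← fld_snd, ← fld_snd, ← hj'] at h
  exact h

/-- The commutation relations with the modes of functions. -/
lemma comm_fst (m k : ℤ) (u : W.Gen) (a : W.V₀) (j : W.Arc) :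
    S.Comm t (W.md m u) (W.md k (a, 0)) (mono 0 j) := by
  have ha : IsLow (W.md k (a, 0)) := Or.inl ⟨_, _, rfl⟩
  obtain ⟨b, x⟩ := u
  rw [gen_decomp W (b, x), map_add]
  refine Comm.add_left (S.comm_isLow t (Or.inl ⟨_, _, rfl⟩) ha j) ?_
  change S.Comm t (W.md m (0, x)) _ _
  induction x using S.induction_on t with
  | hΩ w => exact S.comm_isLow t (Or.inr (Or.inl ⟨_, _, rfl⟩)) ha j
  | hx i f =>
    refine (S.comm_low_ract t ha m i f j fun p k => S.comm_isLow t
      (Or.inl ⟨p, -W.anchor (S.s (t i)) a, ?_⟩) (Or.inl ⟨_, _, rfl⟩) j).symm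
    simp [mode_zero]
  | hadd x y hx hy =>
    have h : ((0, x + y) : W.Gen) = (0, x) + (0, y) := by simp
    rw [h, map_add]
    exact hx.add_left hy

/-- The commutation relations with a mode that preserves the algebra of arcs; they rest on the
relations between the modes of `u_(0) x` and those of functions. -/
lemma comm_low {l : W.Mode} (hl : IsLow l) (m : ℤ) (u : W.Gen) (j : W.Arc) :
    S.Comm t (W.md m u) l (mono 0 j) := by
  obtain ⟨b, x⟩ := u
  rw [gen_decomp W (b, x), map_add]
  refine Comm.add_left (S.comm_isLow t (Or.inl ⟨_, _, rfl⟩) hl j) ?_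
  change S.Comm t (W.md m (0, x)) _ _
  induction x using S.induction_on t with
  | hΩ w => exact S.comm_isLow t (Or.inr (Or.inl ⟨_, _, rfl⟩)) hl j
  | hx i f =>
    have h : ∃ n u, l = W.md n u := by
      obtain ⟨n, a, rfl⟩ | ⟨n, w, rfl⟩ | ⟨n, x, rfl⟩ := hl
      exacts [⟨_, _, rfl⟩, ⟨_, _, rfl⟩, ⟨_, _, rfl⟩]
    obtain ⟨n, u, rfl⟩ := h
    exact (S.comm_low_ract t hl m i f j fun p k => S.comm_fst t _ _ _ _ _).symm
  | hadd x y hx hy =>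
    have h : ((0, x + y) : W.Gen) = (0, x) + (0, y) := by simp
    rw [h, map_add]
    exact hx.add_left hy

/-- On polynomials of degree at most one, the field of `x_(-1) f` is still the normally ordered
product of the fields of `x` and `f`; it follows from the case of degree zero by commuting with
the variable. -/
lemma fld_ract_eq_nop (i : I) (f : W.V₀) (n : ℤ) {v : Poly W I} (hv : v ∈ Lt 2) :
    S.fld t (0, W.ract (S.s (t i)) f) n v = S.nop t (0, S.s (t i)) f n v := by
  refine eq_of_mono (f := S.fld t (0, W.ract (S.s (t i)) f) n)
    (g := Fields.nprod (S.isField_fld t (0, S.s (t i))) (S.isField_fld t (f, 0)) (-1) n)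
    (fun m j hm => ?_) hv
  rcases exists_cons m with rfl | ⟨k, m, rfl, -⟩
  · exact S.fld_snd t _ f n j
  · obtain rfl : m = 0 := by simpa using hm
    have hk : S.fld t (0, S.s (t (ofLex k).1)) (-1 - (ofLex k).2) (mono 0 j) =
        mono (k ::ₘ 0) j := by
      rw [fld, polyAct_mono_zero]
      exact (S.isBase t).var k j
    have h := S.fld_nop t (-1 - (ofLex k).2) n (0, S.s (t (ofLex k).1)) i f j
      (fun l hl j => S.comm_low t hl _ _ _) (fun p k => S.comm_fst t _ _ _ _ _)
    have h' : S.Comm t (W.md n (0, W.ract (S.s (t i)) f)) (S.varMode t k) (mono 0 j) :=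
      rel_of_le (S.isBase t) (i := k) (m := 0) (by simp) _ j
    have h'' := h'.symm
    rw [← fld_snd, hk] at h
    refine sub_right_injective (Eq.trans ?_ h.symm)
    rw [← hk]
    exact h''

/-- The commutation relations of all modes on the algebra of arcs. A mode takes the algebra of arcs
to polynomials of degree at most one, where the field of `x_(-1) f` is known to be a normally
ordered product. -/
lemma comm_base (l l' : W.Mode) (j : W.Arc) : S.Comm t l l' (mono 0 j) := by
  have h0 : ∀ l, S.Comm t 0 l (mono 0 j) := fun l => by simp [Comm, Pbw.Rel]
  -- the relations of a mode follow from those with the modes of `x f`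
  have key : ∀ l, (∀ n i f, S.Comm t l (W.md n (0, W.ract (S.s (t i)) f)) (mono 0 j)) →
      (∀ l', IsLow l' → S.Comm t l l' (mono 0 j)) → ∀ l', S.Comm t l l' (mono 0 j) := by
    intro l h1 h2 l'
    refine Pbw.Rel.symm ?_
    change S.Comm t l' l _
    induction l' using mode_induction with
    | h n u =>
      obtain ⟨b, x⟩ := u
      rw [gen_decomp W (b, x), map_add]
      refine Comm.add_left (h2 _ (Or.inl ⟨_, _, rfl⟩)).symm ?_
      change S.Comm t (W.md n (0, x)) _ _
      induction x using S.induction_on t with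
      | hΩ w => exact (h2 _ (Or.inr (Or.inl ⟨_, _, rfl⟩))).symm
      | hx i f => exact (h1 n i f).symm
      | hadd x y hx hy =>
        have h : ((0, x + y) : W.Gen) = (0, x) + (0, y) := by simp
        rw [h, map_add]
        exact hx.add_left hy
    | h0 => exact h0 l
    | hadd x y hx hy => exact hx.add_left hy
  induction l using mode_induction with
  | h m u =>
    refine key _ (fun n i f => ?_) (fun l hl => S.comm_low t hl m u j) l'
    have h := S.fld_nop t m n u i f j (fun l hl j => S.comm_low t hl _ _ _)
      (fun p k => S.comm_fst t _ _ _ _ _)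
    have hv : S.fld t u m (mono 0 j) ∈ Lt (X := I ×ₗ ℕ) (J := W.Arc) 2 := by
      rw [fld, polyAct_mono_zero]
      exact (S.isBase t).mem _ j
    rw [← fld_snd, ← S.fld_ract_eq_nop t i f n hv] at h
    exact h
  | h0 => exact h0 l'
  | hadd x y hx hy => exact hx.add_left hy

/-- The modes act on polynomials through a representation of their Lie algebra. -/
theorem polyAct_lie (l l' : W.Mode) (p : Poly W I) :
    S.polyAct t l (S.polyAct t l' p) - S.polyAct t l' (S.polyAct t l p) =
      S.polyAct t ⁅l, l'⁆ p :=
  rel_of_base (S.isBase t) (S.comm_base t) l l' p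

end Splitting

end OneTruncatedVertexAlgebra

/-! ### Leading terms -/

namespace Pbw

variable {X : Type*} [LinearOrder X] {J : Type*} [CommRing J] [Algebra ℂ J]
  {𝔩 : Type*} [LieRing 𝔩] [LieAlgebra ℂ 𝔩]
  {x : X → 𝔩} {β : 𝔩 →ₗ[ℂ] J →ₗ[ℂ] MvPolynomial X J}

lemma mono_mul_mono (m m' : Multiset X) (i j : J) :
    mono m i * mono m' j = mono (m + m') (i * j) := by
  rw [mono_apply, mono_apply, mono_apply, MvPolynomial.monomial_mul, map_add]

lemma isHomogeneous_mono (m : Multiset X) (j : J) : (mono m j).IsHomogeneous m.card :=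
  MvPolynomial.isHomogeneous_monomial _ (by
    change (Multiset.toFinsupp m).sum (fun _ => id) = _
    rw [← Finsupp.card_toMultiset, Multiset.toFinsupp_toMultiset])

lemma mem_Lt_of_isHomogeneous {d : ℕ} {p : MvPolynomial X J} (hp : p.IsHomogeneous d) :
    p ∈ Lt (d + 1) := by
  rw [p.as_sum]
  refine sum_mem fun s hs => ?_
  have h : (Finsupp.toMultiset s).card = d := by
    rw [Finsupp.card_toMultiset, ← hp (MvPolynomial.mem_support_iff.1 hs)]
    change s.degree = _
    rw [Finsupp.degree_eq_weight_one]
    rfl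
  have := mono_mem (n := d + 1) (m := Finsupp.toMultiset s) (by omega) (p.coeff s)
  rwa [mono_apply, Finsupp.toMultiset_toFinsupp] at this

lemma homogeneousComponent_eq_zero_of_mem {d e : ℕ} {p : MvPolynomial X J} (hp : p ∈ Lt d)
    (h : d ≤ e) : MvPolynomial.homogeneousComponent e p = 0 := by
  have := apply_mem_of_mono ((MvPolynomial.homogeneousComponent e).restrictScalars ℂ) ⊥
    (fun (m : Multiset X) (j : J) hm => (Submodule.mem_bot ℂ).2
      ((MvPolynomial.homogeneousComponent_of_mem (isHomogeneous_mono m j)).trans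
        (if_neg (by omega)))) hp
  exact (Submodule.mem_bot ℂ).1 this

/-- A leading term on `J` is a leading term on all polynomials. -/
lemma action_sub_mul_mem (h : IsBase x β) (l : 𝔩) {c : MvPolynomial X J}
    (hc : ∀ n, ∀ p ∈ Lt (X := X) (J := J) n, c * p ∈ Lt (n + 1))
    (hl : ∀ j, β l j - c * mono 0 j ∈ Lt 1) {n : ℕ}
    {p : MvPolynomial X J} (hp : p ∈ Lt n) : action x β l p - c * p ∈ Lt n := by
  suffices H : ∀ k (m : Multiset X), m.card = k → ∀ j, action x β l (mono m j) - c * mono m j ∈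
      Lt (k + 1) from
    apply_mem_of_mono (action x β l - LinearMap.mulLeft ℂ c) (Lt n)
      (fun m j hm => Lt_mono (by omega) (H _ m rfl j)) hp
  intro k
  induction k with
  | zero =>
    intro m hm j
    obtain rfl : m = 0 := by simpa using hm
    rw [action_mono_zero]
    exact hl j
  | succ k ih =>
    intro m hm j
    rcases exists_cons m with rfl | ⟨i, m, rfl, hi⟩
    · simp at hm
    have hm' : m.card = k := by simpa using hm
    have h0 : mono m j ∈ Lt (J := J) (k + 1) := mono_mem (by omega) j
    have h1 := action_mem h (ih m hm' j) (x i)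
    have h2 := action_sub_mem h (hc _ _ h0) i
    have h3 := action_mem h h0 ⁅l, x i⁆
    rw [action_mono_cons h hi]
    have e : c * mono (i ::ₘ m) j = mulX i (c * mono m j) := by
      rw [← mulX_mono]
      exact mul_left_comm _ _ _
    rw [map_sub] at h1
    rw [e]
    convert add_mem (add_mem h1 h2) h3 using 1
    abel

end Pbw

namespace OneTruncatedVertexAlgebra

open Pbw

namespace Splitting

variable {W : OneTruncatedVertexAlgebra.{u}} {I : Type u} [LinearOrder I]
  (t : Module.Basis I W.V₀ W.T) (S : W.Splitting)

variable (W) in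
/-- The symbols of the functions, in polynomials. -/
def leadA (n : ℕ) : W.V₀ →ₗ[ℂ] Poly W I := mono 0 ∘ₗ W.arc n

variable (W) in
/-- The symbols of the differentials, in polynomials. -/
def leadΩ (n : ℕ) : W.Om →ₗ[ℂ] Poly W I := mono 0 ∘ₗ W.arcΩ n

/-- The symbol `∂^(n) τ`, in polynomials. -/
def leadT (n : ℕ) : W.T →ₗ[ℂ] Poly W I :=
  (Finsupp.lsum ℂ fun i => ∑ p ∈ antidiagonal n, mono {toLex (i, p.2)} ∘ₗ W.arc p.1) ∘ₗ
    t.repr.toLinearMap.restrictScalars ℂ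

lemma leadT_smul_basis (n : ℕ) (i : I) (f : W.V₀) : leadT t n (f • t i) =
    ∑ p ∈ antidiagonal n, mono {toLex (i, p.2)} (W.arc p.1 f) := by
  change Finsupp.lsum ℂ _ (t.repr (f • t i)) = _
  rw [map_smul, t.repr_self, Finsupp.smul_single, smul_eq_mul, mul_one, Finsupp.lsum_single,
    LinearMap.sum_apply]
  rfl

lemma basis_induction {I : Type u} (t : Module.Basis I W.V₀ W.T) {P : W.T → Prop}
    (hx : ∀ i (f : W.V₀), P (f • t i)) (h0 : P 0)
    (hadd : ∀ x y, P x → P y → P (x + y)) (x : W.T) : P x := by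
  rw [← t.linearCombination_repr x]
  induction t.repr x using Finsupp.induction_linear with
  | zero => rw [map_zero]; exact h0
  | add c c' h h' => rw [map_add]; exact hadd _ _ h h'
  | single i f => rw [Finsupp.linearCombination_single]; exact hx i f

lemma leadT_smul (n : ℕ) (a : W.V₀) (x : W.T) :
    leadT t n (a • x) = ∑ p ∈ antidiagonal n, leadA W p.1 a * leadT t p.2 x := by
  induction x using basis_induction t with
  | hx i f =>
    -- associativity of the product of three power series
    obtain ⟨F, hFc⟩ : ∃ F : W.V₀ → PowerSeries (Poly W I), ∀ n a,
        PowerSeries.coeff n (F a) = mono 0 (W.arc n a) :=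
      ⟨fun a => PowerSeries.mk fun p => mono 0 (W.arc p a), fun n a => PowerSeries.coeff_mk _ _⟩
    obtain ⟨H, hHc⟩ : ∃ H : PowerSeries (Poly W I), ∀ n,
        PowerSeries.coeff n H = mono {toLex (i, n)} 1 :=
      ⟨PowerSeries.mk fun p => mono {toLex (i, p)} 1, fun n => PowerSeries.coeff_mk _ _⟩
    have hF : F a * F f = F (a * f) := PowerSeries.ext fun n => by
      simp only [PowerSeries.coeff_mul, hFc, arc_mul_nat, map_sum, mono_mul_mono, add_zero]
    have hH : ∀ n f, leadT t n (f • t i) = PowerSeries.coeff n (F f * H) := fun n f => by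
      rw [leadT_smul_basis, PowerSeries.coeff_mul]
      simp only [hFc, hHc, mono_mul_mono, zero_add, mul_one]
    rw [smul_smul, hH, ← hF, mul_assoc, PowerSeries.coeff_mul]
    exact Finset.sum_congr rfl fun p _ => by rw [hH, hFc]; rfl
  | h0 => simp only [smul_zero, map_zero, mul_zero, Finset.sum_const_zero]
  | hadd x y hx hy =>
    rw [smul_add, map_add, hx, hy, ← Finset.sum_add_distrib]
    exact Finset.sum_congr rfl fun p _ => by rw [map_add, mul_add]

/-- The values of the symbols in polynomials. -/
def leadRep : W.SymbolRep (Poly W I) where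
  fA := leadA W
  fΩ := leadΩ W
  fT := leadT t
  one := by
    change mono 0 (W.arc 0 1) = 1
    rw [arc_one, mono_zero, map_one]
  mul_A n a b := by
    change mono 0 (W.arc n (a * b)) = _
    rw [arc_mul_nat, map_sum]
    exact Finset.sum_congr rfl fun p _ => (mono_mul_mono 0 0 _ _).symm
  mul_Ω n a b := by
    change mono 0 (W.arcΩ n (a • b)) = _
    rw [arcΩ_smul_nat, map_sum]
    exact Finset.sum_congr rfl fun p _ => (mono_mul_mono 0 0 _ _).symm
  mul_T := leadT_smul t
  d n a := by
    change mono 0 (W.arcΩ n (dOm a)) = ((n : ℂ) + 1) • mono 0 (W.arc (n + 1 : ℕ) a)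
    rw [arcΩ_d, map_smul]
    push_cast
    rfl

/-- The values of the symbols recover the elements of the symbol algebra, so that they present it
as an algebra of polynomials over the algebra of arcs. -/
lemma leadRep_lift_injective : Function.Injective (leadRep t).lift := by
  let F₀ : W.SymbolRep W.SymbolAlgebra :=
    { W.symRep with
      fT := 0
      mul_T := fun n a x => by simp }
  let g : Poly W I →+* W.SymbolAlgebra := MvPolynomial.eval₂Hom (arcLift F₀ rfl).toRingHom
    fun k => sym (.ofT (ofLex k).2 (t (ofLex k).1))
  have hC : ∀ j, g (mono 0 j) = arcLift F₀ rfl j := fun j => by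
    rw [mono_zero]
    exact MvPolynomial.eval₂Hom_C _ _ _
  have hX : ∀ i p j, g (mono {toLex (i, p)} j) = arcLift F₀ rfl j * sym (.ofT p (t i)) := by
    intro i p j
    have e : mono {toLex (i, p)} j = MvPolynomial.X (toLex (i, p)) * mono 0 j :=
      (X_mul_mono (toLex (i, p)) 0 j).symm
    rw [e, map_mul, hC, mul_comm]
    congr 1
    exact MvPolynomial.eval₂Hom_X' _ _ _
  have hA : ∀ (n : ℕ) a, arcLift F₀ rfl (W.arc n a) = sym (.ofA n a) := fun n a => by
    rw [arc_natCast, arcLift_toArc, SymbolRep.lift_sym]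
    rfl
  have hΩ : ∀ (n : ℕ) a, arcLift F₀ rfl (W.arcΩ n a) = sym (.ofΩ n a) := fun n a => by
    rw [arcΩ_natCast, arcLift_toArc, SymbolRep.lift_sym]
    rfl
  let g' : Poly W I →ₐ[ℂ] W.SymbolAlgebra :=
    { g with
      commutes' := fun c => by
        have h : algebraMap ℂ (Poly W I) c = mono 0 (algebraMap ℂ W.Arc c) := by
          rw [mono_zero]
          rfl
        change g _ = _
        rw [h, hC, AlgHom.commutes] }
  have hg : g'.comp (leadRep t).lift = AlgHom.id ℂ _ := symbolAlgebra_hom_ext fun y => by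
    rw [AlgHom.comp_apply, SymbolRep.lift_sym]
    cases y with
    | ofA n a => exact (hC _).trans (hA n a)
    | ofΩ n a => exact (hC _).trans (hΩ n a)
    | ofT n x =>
      change g (leadT t n x) = W.symRep.fT n x
      induction x using basis_induction t with
      | hx i f =>
        rw [leadT_smul_basis, map_sum, W.symRep.mul_T]
        exact Finset.sum_congr rfl fun p _ => by rw [hX, hA]; rfl
      | h0 => simp
      | hadd x y hx hy => rw [map_add, map_add, map_add, hx, hy]
  exact Function.LeftInverse.injective (g := g') fun p => DFunLike.congr_fun hg p

lemma leadRep_val_isHomogeneous (y : W.Symbol) : ((leadRep t).val y).IsHomogeneous y.degree := by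
  cases y with
  | ofA n a => exact isHomogeneous_mono 0 _
  | ofΩ n a => exact isHomogeneous_mono 0 _
  | ofT n x =>
    change (leadT t n x).IsHomogeneous 1
    induction x using basis_induction t with
    | hx i f =>
      rw [leadT_smul_basis]
      exact MvPolynomial.IsHomogeneous.sum _ _ _ fun p _ => isHomogeneous_mono {toLex (i, p.2)} _
    | h0 => rw [map_zero]; exact MvPolynomial.isHomogeneous_zero _ _ _
    | hadd x y hx hy => rw [map_add]; exact hx.add hy

lemma leadRep_symbolProd_isHomogeneous (l : List W.Symbol) :
    ((leadRep t).lift (W.symbolProd l)).IsHomogeneous (W.totalDegree l) := by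
  induction l with
  | nil =>
    rw [symbolProd_nil, map_one]
    exact MvPolynomial.isHomogeneous_one _ _
  | cons y l ih =>
    rw [symbolProd_cons, map_mul, SymbolRep.lift_sym, totalDegree_cons]
    exact (leadRep_val_isHomogeneous t y).mul ih

/-- The polynomials as a module over the creation operators. -/
def polyModule : W.CreationModule (Poly W I) where
  ν n := (S.polyAct t) ∘ₗ W.md (-1 - n)
  der n a p := by
    simp only [LinearMap.comp_apply]
    rw [md_d, map_smul, show (-1 - (n : ℤ) - 1) = -1 - (n + 1 : ℕ) by push_cast; ring]
    push_cast
    rw [LinearMap.smul_apply]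
    congr 1
    ring
  comm n m u v p := by
    simp only [LinearMap.comp_apply]
    rw [polyAct_lie, lie_md, map_add, map_smul, LinearMap.add_apply, LinearMap.smul_apply,
      show (-1 - (n : ℤ) + (-1 - m)) = -1 - (n + m + 1 : ℕ) by push_cast; ring,
      show (-1 - ((n + m + 1 : ℕ) : ℤ) - 1) = -1 - (n + m + 2 : ℕ) by push_cast; ring]
    push_cast
    module

lemma polyModule_ν (n : ℕ) (u : W.Gen) (p : Poly W I) :
    (S.polyModule t).ν n u p = S.fld t u (-1 - n) p := rfl

lemma polyModule_isVacuum : (S.polyModule t).IsVacuum (mono 0 1) where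
  vac n := by
    rw [polyModule_ν, fld_fst, mul_one, show -1 - (-1 - (n : ℤ)) = n by ring, one_eq]
    split_ifs with h
    · rw [h, Nat.cast_zero, arc_one]
    · rw [arc_one_of_ne (by omega), map_zero]
  mul n a u := by
    have h0 : ∀ p : ℕ, S.fld t u p (mono 0 1) = 0 := fun p => by
      obtain ⟨b, x⟩ := u
      rw [gen_decomp W (b, x), fld_add, fld_fst, fld_natCast, arc_of_neg (by omega),
        Derivation.map_one_eq_zero]
      simp
    have e : W.mode (-1) (a, 0) u = (W.mul u.1 a, W.ract u.2 a) - W.tr (W.anchor u.2 a, 0) := by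
      rw [mode_neg_one, tr_apply, ract_eq, W.mul_comm' a]
      simp
    obtain ⟨N, hN⟩ := S.exists_nop_eq_sum t u a (-1 - n) (mono 0 1)
    have h1 : S.nop t u a (-1 - n) (mono 0 1) =
        ∑ p ∈ antidiagonal n, S.fld t u (-1 - p.2) (S.fld t (a, 0) (-1 - p.1) (mono 0 1)) := by
      rw [hN (max N (n + 1)) (le_max_left _ _), ← Finset.Nat.sum_antidiagonal_swap,
        Finset.Nat.sum_antidiagonal_eq_sum_range_succ_mk]
      symm
      refine (Finset.sum_congr rfl fun p hp => ?_).trans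
        (Finset.sum_subset (Finset.range_mono (le_max_right N (n + 1))) fun p _ hp => ?_)
      · rw [Finset.mem_range] at hp
        dsimp only [Prod.swap]
        rw [h0, map_zero, add_zero, show -1 - ((n - p : ℕ) : ℤ) = -1 - n + p by omega]
      · rw [Finset.mem_range] at hp
        rw [h0, map_zero, add_zero, S.fld_fst t, arc_of_neg (by omega)]
        simp
    have h2 : ∀ p ∈ antidiagonal n, S.fld t u (-1 - p.2) (S.fld t (a, 0) (-1 - p.1) (mono 0 1)) =
        S.fld t (a, 0) (-1 - p.1) (S.fld t u (-1 - p.2) (mono 0 1)) +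
          S.fld t (W.anchor u.2 a, 0) (-2 - n) (mono 0 1) := fun p hp => by
      rw [Finset.HasAntidiagonal.mem_antidiagonal] at hp
      have h := (S.comm_md t).1 (S.comm_fst t (-1 - p.2) (-1 - p.1) u a 1)
      rw [← sub_eq_iff_eq_add', h, mode_zero, mode_one,
        show (-1 - (p.2 : ℤ) + (-1 - p.1)) = -2 - n by omega]
      simp [fld_mk_zero]
    simp only [polyModule_ν]
    rw [e, fld, map_sub, map_sub, LinearMap.sub_apply, md_tr, map_smul, LinearMap.smul_apply]
    change S.fld t _ _ _ - _ • S.fld t _ _ _ = _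
    rw [← nop_eq, h1, Finset.sum_congr rfl h2, Finset.sum_add_distrib, Finset.sum_const,
      Finset.Nat.card_antidiagonal, ← Nat.cast_smul_eq_nsmul ℂ,
      show -1 - (n : ℤ) - 1 = -2 - n by ring]
    push_cast
    module

/-- The map from the envelope to polynomials. -/
def toPoly : W.Envelope →ₗ[ℂ] Poly W I := Envelope.lift (S.polyModule t) (S.polyModule_isVacuum t)

lemma mul_mem_Lt {c : Poly W I} {d : ℕ} (hc : c.IsHomogeneous d) {n : ℕ} {p : Poly W I}
    (hp : p ∈ Lt n) : c * p ∈ Lt (n + d) :=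
  apply_mem_of_mono (LinearMap.mulLeft ℂ c) (Lt (n + d)) (fun m j hm =>
    Lt_mono (by omega) (mem_Lt_of_isHomogeneous (hc.mul (isHomogeneous_mono m j)))) hp

/-- The field of a function or a differential acts by multiplication up to lower degree. -/
lemma fld_low_sub_mem (k : ℤ) (a : W.V₀) (w : W.Om) {n : ℕ} {p : Poly W I} (hp : p ∈ Lt (n + 1)) :
    S.fld t (a, w) k p - mono 0 (W.arc (-1 - k) a + W.arcΩ (-1 - k) w) * p ∈ Lt n := by
  suffices H : ∀ d (m : Multiset (I ×ₗ ℕ)), m.card = d → ∀ j k a (w : W.Om),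
      S.fld t (a, w) k (mono m j) - mono 0 (W.arc (-1 - k) a + W.arcΩ (-1 - k) w) * mono m j ∈
        Lt d from
    apply_mem_of_mono (S.fld t (a, w) k - LinearMap.mulLeft ℂ _) (Lt n)
      (fun m j hm => Lt_mono (by omega) (H _ m rfl j k a w)) hp
  intro d
  induction d with
  | zero =>
    intro m hm j k a w
    obtain rfl : m = 0 := by simpa using hm
    rw [gen_decomp W (a, _), fld_add, fld_fst, fld_Om, map_add, add_mul, mono_zero_mul_mono,
      mono_zero_mul_mono, sub_self]
    exact zero_mem _
  | succ d ih =>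
    intro m hm j k a w
    rcases exists_cons m with rfl | ⟨i, m, rfl, hi⟩
    · simp at hm
    have hm' : m.card = d := by simpa using hm
    have hlow : ∀ k a (w : W.Om), S.fld t (a, w) k (mono m j) ∈ Lt (d + 1) := fun k a w => by
      have h := add_mem (Lt_mono (Nat.le_succ d) (ih m hm' j k a w))
        (mono_mem (n := d + 1) (m := m) (by omega) ((W.arc (-1 - k) a + W.arcΩ (-1 - k) w) * j))
      rwa [mono_zero_mul_mono, sub_add_cancel] at h
    set c := W.arc (-1 - k) a + W.arcΩ (-1 - k) w with hc
    have h1 := action_mem (S.isBase t) (ih m hm' j k a w) (S.varMode t i)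
    have h2 := action_sub_mem (S.isBase t) (mono_mem (n := d + 1) (m := m) (by omega) (c * j)) i
    have h3 : S.polyAct t ⁅W.md k (a, (w : W.V₁)), S.varMode t i⁆ (mono m j) ∈ Lt (d + 1) := by
      rw [varMode, lie_md, map_add, map_smul, mode_zero, mode_one]
      have h := hlow (k + (-1 - (ofLex i).2)) (W.anchor w 0 - W.anchor (S.s (t (ofLex i).1)) a)
        ⟨_, br_mem' w.2 (S.s (t (ofLex i).1))⟩
      have h' := hlow (k + (-1 - (ofLex i).2) - 1) (W.pair w (S.s (t (ofLex i).1))) 0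
      exact add_mem h (Submodule.smul_mem _ _ h')
    have e : S.fld t (a, w) k (mono (i ::ₘ m) j) = S.polyAct t (S.varMode t i)
        (S.fld t (a, w) k (mono m j)) +
          S.polyAct t ⁅W.md k (a, (w : W.V₁)), S.varMode t i⁆ (mono m j) :=
      action_mono_cons (S.isBase t) hi _ _
    rw [map_sub, ← hc, mono_zero_mul_mono] at h1
    rw [e, mono_zero_mul_mono, ← mulX_mono]
    convert add_mem (add_mem h1 h2) h3 using 1
    simp only [polyAct, fld]
    abel

lemma base_sub_leadT_mem (n : ℕ) (x : W.V₁) (j : W.Arc) :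
    S.base t (W.md (-1 - n) (0, x)) j - leadT t n (W.Om.mkQ x) * mono 0 j ∈ Lt 1 := by
  induction x using S.induction_on t with
  | hΩ w =>
    rw [base_Om, mkQ_Om w.2, map_zero, zero_mul, sub_zero]
    exact mono_mem (by simp) _
  | hx i f =>
    obtain ⟨N, hN⟩ := exists_arcDer_eq_zero (S.s (t i)) j
    have e : ∀ p : ℕ, max N (n + 1) ≤ p → W.arcDer p (S.s (t i)) j = 0 := fun p hp =>
      hN p (le_trans (le_max_left _ _) hp)
    rw [base_ract, normalOp_apply, S.normal_eq t i (N := max N (n + 1)) (by omega) f j e,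
      Finset.sum_add_distrib, mkQ_ract, S.mkQ_s, leadT_smul_basis, Finset.sum_mul,
      ← Finset.Nat.sum_antidiagonal_swap, Finset.Nat.sum_antidiagonal_eq_sum_range_succ_mk]
    have h : ∑ p ∈ Finset.range (n + 1), mono {toLex (i, p)} (W.arc (n - p : ℕ) f) * mono 0 j =
        ∑ p ∈ Finset.range (max N (n + 1)),
          mono {toLex (i, p)} (W.arc (-1 - (-1 - n) - p) f * j) := by
      refine (Finset.sum_congr rfl fun p hp => ?_).trans
        (Finset.sum_subset (Finset.range_mono (le_max_right N (n + 1))) fun p _ hp => ?_)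
      · rw [Finset.mem_range] at hp
        rw [mono_mul_mono, add_zero, show ((n - p : ℕ) : ℤ) = -1 - (-1 - n) - p by omega]
      · rw [Finset.mem_range] at hp
        rw [arc_of_neg (by omega)]
        simp
    dsimp only [Prod.swap]
    rw [h, add_sub_cancel_left]
    exact sum_mem fun p _ => mono_mem (by simp) _
  | hadd x y hx hy =>
    have h : ((0, x + y) : W.Gen) = (0, x) + (0, y) := by simp
    rw [h, map_add, map_add, map_add, map_add, LinearMap.add_apply, add_mul]
    convert add_mem hx hy using 1
    abel

/-- The mode `s(τ)_(-1-n)` acts as multiplication by its leading term, up to lower degree. -/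
lemma fld_lift_sub_mem (n : ℕ) (x : W.T) {d : ℕ} {p : Poly W I} (hp : p ∈ Lt d) :
    S.fld t (0, S.s x) (-1 - n) p - leadT t n x * p ∈ Lt d := by
  refine action_sub_mul_mem (S.isBase t) _ (fun n p hp =>
    mul_mem_Lt (leadRep_val_isHomogeneous t (.ofT _ x)) hp) (fun j => ?_) hp
  have h := S.base_sub_leadT_mem t n (S.s x) j
  rwa [S.mkQ_s] at h

/-- The leading term of the image of a word is the product of its symbols. -/
lemma toPoly_word_sub_mem (l : List W.Symbol) :
    S.toPoly t (S.word l) - (leadRep t).lift (W.symbolProd l) ∈ Lt (W.totalDegree l) := by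
  induction l with
  | nil =>
    rw [word_nil, toPoly, Envelope.lift_vac, symbolProd_nil, map_one (leadRep t).lift, mono_zero,
      map_one MvPolynomial.C, sub_self]
    exact zero_mem _
  | cons y l ih =>
    set q := (leadRep t).lift (W.symbolProd l) with hq
    have hmem : S.toPoly t (S.word l) ∈ Lt (W.totalDegree l + 1) := by
      rw [← sub_add_cancel (S.toPoly t (S.word l)) q]
      exact add_mem (Lt_mono (Nat.le_succ _) ih)
        (mem_Lt_of_isHomogeneous (leadRep_symbolProd_isHomogeneous t l))
    have e : S.toPoly t (S.word (y :: l)) =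
        S.fld t (S.gen y) (-1 - y.order) (S.toPoly t (S.word l)) :=
      Envelope.lift_ν _ _ _ _
    have h1 := mul_mem_Lt (leadRep_val_isHomogeneous t y) ih
    have h2 : S.fld t (S.gen y) (-1 - y.order) (S.toPoly t (S.word l)) -
        (leadRep t).val y * S.toPoly t (S.word l) ∈ Lt (W.totalDegree (y :: l)) := by
      cases y with
      | ofA n a =>
        have h := S.fld_low_sub_mem t (-1 - n) a 0 hmem
        rw [map_zero, add_zero, show -1 - (-1 - (n : ℤ)) = n by ring] at h
        rw [totalDegree_cons]
        exact Lt_mono (Nat.le_add_left _ _) h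
      | ofΩ n w =>
        have h := S.fld_low_sub_mem t (-1 - n) 0 w hmem
        rw [map_zero, zero_add, show -1 - (-1 - (n : ℤ)) = n by ring] at h
        rw [totalDegree_cons]
        exact Lt_mono (Nat.le_add_left _ _) h
      | ofT n x =>
        rw [totalDegree_cons, add_comm]
        exact S.fld_lift_sub_mem t n x hmem
    rw [e, symbolProd_cons, map_mul, SymbolRep.lift_sym, ← hq]
    rw [totalDegree_cons] at h2 ⊢
    rw [mul_sub, add_comm] at h1
    convert add_mem h2 h1 using 1
    abel

end Splitting

end OneTruncatedVertexAlgebra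

/-! ### Projective modules are stably free -/

section Swindle

variable {R M L : Type*} [CommRing R] [AddCommGroup M] [Module R M] [AddCommGroup L] [Module R L]

/-- A retract `M` of `L` is absorbed by `L^(ℕ)`: the copy of `M` in each summand `L` is moved to the
next summand, and the new copy takes its place in the first one. -/
def swindleEquiv (s : M →ₗ[R] L) (q : L →ₗ[R] M) (h : ∀ m, q (s m) = m) :
    (M × (ℕ →₀ L)) ≃ₗ[R] (ℕ →₀ L) :=
  let E : (ℕ →₀ L) →ₗ[R] (ℕ →₀ L) := Finsupp.mapRange.linearMap (s ∘ₗ q)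
  let U : (ℕ →₀ L) →ₗ[R] (ℕ →₀ L) := Finsupp.lmapDomain L R Nat.succ
  let D : (ℕ →₀ L) →ₗ[R] (ℕ →₀ L) := Finsupp.lcomapDomain Nat.succ Nat.succ_injective
  have hU0 : ∀ f, U f 0 = 0 := fun f => Finsupp.mapDomain_of_notMem_range _ _ (by simp)
  have hU1 : ∀ f n, U f (n + 1) = f n := fun f n => Finsupp.mapDomain_apply Nat.succ_injective f n
  have hD : ∀ f n, D f n = f (n + 1) := fun f n => rfl
  have hE : ∀ f n, E f n = s (q (f n)) := fun f n => rfl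
  LinearEquiv.ofLinearMap
    ((Finsupp.lsingle 0 ∘ₗ s).coprod (U ∘ₗ E + (LinearMap.id - E)))
    ((q ∘ₗ Finsupp.lapply 0).prod (D ∘ₗ E + (LinearMap.id - E)))
    (by
      refine LinearMap.ext fun g => Finsupp.ext fun n => ?_
      cases n with
      | zero => simp [hU0, hD, hE, h]
      | succ n => simp [hU1, hD, hE, h])
    (by
      refine LinearMap.ext fun p => Prod.ext ?_ (Finsupp.ext fun n => ?_)
      · simp [hU0, hE, h]
      · cases n with
        | zero => simp [hU0, hU1, hD, hE, h]
        | succ n => simp [hU1, hD, hE, h])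

/-- A projective module becomes free when a suitable free module is added to it. -/
lemma free_prod_of_projective [Module.Projective R M] :
    Module.Free R (M × (ℕ × M →₀ R)) := by
  obtain ⟨s, hs⟩ := Module.projective_def'.1 (inferInstance : Module.Projective R M)
  exact Module.Free.of_equiv (((LinearEquiv.refl R M).prodCongr (Finsupp.curryLinearEquiv R)).trans
    (swindleEquiv s (Finsupp.linearCombination R id) fun m => LinearMap.congr_fun hs m)).symm

end Swindle

namespace OneTruncatedVertexAlgebra

/-! ### Functoriality of the symbol algebra -/

section Transport

variable {W W' : OneTruncatedVertexAlgebra.{u}}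

/-- The creation operators of `W` on a module over those of `W'`. -/
def CreationModule.comap {M : Type*} [AddCommGroup M] [Module ℂ M] (N : W'.CreationModule M)
    (f : Hom W W') : W.CreationModule M where
  ν n := N.ν n ∘ₗ f.f₀.prodMap f.f₁
  der n a x := by
    have h := N.der n (f.f₀ a) x
    rw [← f.map_d] at h
    simpa using h
  comm n m u v x := by
    have h := N.comm n m (f.f₀.prodMap f.f₁ u) (f.f₀.prodMap f.f₁ v) x
    rw [← f.map_mode, ← f.map_mode] at h
    exact h

lemma CreationModule.IsVacuum.comap {M : Type*} [AddCommGroup M] [Module ℂ M]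
    {N : W'.CreationModule M} {e : M} (he : N.IsVacuum e) (f : Hom W W') :
    (N.comap f).IsVacuum e where
  vac n := by
    have h := he.vac n
    rw [← f.map_vac] at h
    simpa [CreationModule.comap] using h
  mul n a u := by
    have h := he.mul n (f.f₀ a) (f.f₀.prodMap f.f₁ u)
    have e : (f.f₀ a, (0 : W'.V₁)) = f.f₀.prodMap f.f₁ (a, 0) := by simp
    rw [e, ← f.map_mode] at h
    exact h

/-- The values on the symbols of `W` induced by those on the symbols of `W'`. -/
def SymbolRep.comap {R : Type*} [CommRing R] [Algebra ℂ R] (F : W'.SymbolRep R) (f : Hom W W') :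
    W.SymbolRep R where
  fA n := F.fA n ∘ₗ f.f₀
  fΩ n := F.fΩ n ∘ₗ f.onOm
  fT n := F.fT n ∘ₗ f.onT
  one := (congrArg (F.fA 0) f.map_vac).trans F.one
  mul_A n a b := (congrArg (F.fA n) (f.map_mul a b)).trans (F.mul_A n _ _)
  mul_Ω n a w := (congrArg (F.fΩ n) (Subtype.ext (f.map_act a w))).trans
    (F.mul_Ω n (f.f₀ a) (f.onOm w))
  mul_T n a t := (congrArg (F.fT n) (f.onT_smul a t)).trans (F.mul_T n _ _)
  d n a := (congrArg (F.fΩ n) (Subtype.ext (f.map_d a))).trans (F.d n (f.f₀ a))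

/-- The image of a symbol. -/
def Hom.onSymbol (f : Hom W W') : W.Symbol → W'.Symbol
  | .ofA n a => .ofA n (f.f₀ a)
  | .ofΩ n w => .ofΩ n (f.onOm w)
  | .ofT n t => .ofT n (f.onT t)

lemma totalDegree_map_onSymbol (f : Hom W W') (l : List W.Symbol) :
    W'.totalDegree (l.map f.onSymbol) = W.totalDegree l := by
  rw [totalDegree, totalDegree, List.map_map]
  congr 2
  ext x
  cases x <;> rfl

/-- The morphism of symbol algebras. -/
def Hom.onSymbolAlgebra (f : Hom W W') : W.SymbolAlgebra →ₐ[ℂ] W'.SymbolAlgebra :=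
  (W'.symRep.comap f).lift

lemma Hom.onSymbolAlgebra_sym (f : Hom W W') (x : W.Symbol) :
    f.onSymbolAlgebra (sym x) = sym (f.onSymbol x) := by
  rw [onSymbolAlgebra, SymbolRep.lift_sym]
  cases x <;> rfl

lemma Hom.onSymbolAlgebra_symbolProd (f : Hom W W') (l : List W.Symbol) :
    f.onSymbolAlgebra (W.symbolProd l) = W'.symbolProd (l.map f.onSymbol) := by
  induction l with
  | nil => rw [List.map_nil, symbolProd_nil, symbolProd_nil, map_one f.onSymbolAlgebra]
  | cons x l ih => rw [List.map_cons, symbolProd_cons, symbolProd_cons,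
      _root_.map_mul f.onSymbolAlgebra, ih, onSymbolAlgebra_sym]

lemma Hom.onSymbolAlgebra_injective (i : Hom W W') (p : Hom W' W) (h₀ : ∀ a, p.f₀ (i.f₀ a) = a)
    (h₁ : ∀ x, p.f₁ (i.f₁ x) = x) : Function.Injective i.onSymbolAlgebra := by
  have h : p.onSymbolAlgebra.comp i.onSymbolAlgebra = AlgHom.id ℂ _ :=
    symbolAlgebra_hom_ext fun x => by
      rw [AlgHom.comp_apply, onSymbolAlgebra_sym, onSymbolAlgebra_sym, AlgHom.id_apply]
      congr 1
      cases x with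
      | ofA n a => exact congrArg _ (h₀ a)
      | ofΩ n w => exact congrArg _ (Subtype.ext (h₁ w))
      | ofT n t =>
        obtain ⟨y, rfl⟩ := Submodule.mkQ_surjective _ t
        exact congrArg _ (congrArg W.Om.mkQ (h₁ y))
  exact Function.LeftInverse.injective (g := p.onSymbolAlgebra) fun x =>
    congrArg (fun t : W.SymbolAlgebra →ₐ[ℂ] W.SymbolAlgebra => t x) h

/-- The map `Φ` is injective if `W` is a retract of a one-truncated vertex algebra whose Lie
algebroid is a free module. -/
theorem Splitting.symbolMap_injective_of_retract (S : W.Splitting) (S' : W'.Splitting)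
    (i : Hom W W') (p : Hom W' W) (h₀ : ∀ a, p.f₀ (i.f₀ a) = a) (h₁ : ∀ x, p.f₁ (i.f₁ x) = x)
    (hs : ∀ τ, i.f₁ (S.s τ) = S'.s (i.onT τ)) {I : Type u} [LinearOrder I]
    (t : Module.Basis I W'.V₀ W'.T) : Function.Injective S.symbolMap := by
  let θ : W.Envelope →ₗ[ℂ] Poly W' I := Envelope.lift ((S'.polyModule t).comap i)
    ((S'.polyModule_isVacuum t).comap i)
  have hθ : ∀ l, θ (S.word l) = S'.toPoly t (S'.word (l.map i.onSymbol)) := fun l => by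
    induction l with
    | nil =>
      exact (Envelope.lift_vac _).trans (Envelope.lift_vac _).symm
    | cons x l ih =>
      refine (Envelope.lift_ν _ _ _ _).trans (Eq.trans ?_ (Envelope.lift_ν _ _ _ _).symm)
      change (S'.polyModule t).ν _ (i.f₀.prodMap i.f₁ (S.gen x)) (θ (S.word l)) =
        (S'.polyModule t).ν _ _ (S'.toPoly t (S'.word (l.map i.onSymbol)))
      rw [ih]
      cases x with
      | ofA n a => simp [Splitting.gen, Hom.onSymbol, Symbol.order]
      | ofΩ n w =>
        simp [Splitting.gen, Hom.onSymbol, Symbol.order]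
        rfl
      | ofT n τ => simp [Splitting.gen, Hom.onSymbol, Symbol.order, hs]
  have hlt := fun l : List W.Symbol => S'.toPoly_word_sub_mem t (l.map i.onSymbol)
  have hhom := fun l : List W.Symbol => leadRep_symbolProd_isHomogeneous t (l.map i.onSymbol)
  simp only [totalDegree_map_onSymbol] at hlt hhom
  refine S.symbolMap_injective θ
    (fun e => (MvPolynomial.homogeneousComponent e).restrictScalars ℂ)
    ((leadRep t).lift.toLinearMap ∘ₗ i.onSymbolAlgebra.toLinearMap)
    ((leadRep_lift_injective t).comp (i.onSymbolAlgebra_injective p h₀ h₁)) (fun l => ?_)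
    fun l e he => ?_
  · have h := Pbw.homogeneousComponent_eq_zero_of_mem (hlt l) le_rfl
    rw [map_sub, sub_eq_zero, MvPolynomial.homogeneousComponent_of_mem (hhom l), if_pos rfl,
      ← hθ] at h
    refine h.trans ?_
    rw [LinearMap.comp_apply, AlgHom.toLinearMap_apply, AlgHom.toLinearMap_apply,
      i.onSymbolAlgebra_symbolProd]
  · refine Pbw.homogeneousComponent_eq_zero_of_mem (d := W.totalDegree l + 1) ?_ he
    rw [hθ, ← sub_add_cancel (S'.toPoly t _) ((leadRep t).lift (W'.symbolProd (l.map i.onSymbol)))]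
    exact add_mem (Pbw.Lt_mono (Nat.le_succ _) (hlt l)) (Pbw.mem_Lt_of_isHomogeneous (hhom l))

end Transport
/-! ### Stabilization -/

section Stabilization

variable (W : OneTruncatedVertexAlgebra.{u}) (K : Type u)

/-- The operations of `V₀ ⊕ (V₁ ⊕ V₀^(K))`: to the Lie algebroid a free module is added, on
which it acts through the coordinates, and whose bracket and pairing are zero. -/
def stabOps : TruncOps W.V₀ (W.V₁ × (K →₀ W.V₀)) where
  act := LinearMap.mk₂ ℂ (fun a x => (W.act a x.1, a • x.2))
    (fun a b x => by simp [add_smul]) (fun c a x => by simp)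
    (fun a x y => by simp) (fun c a x => by simp [smul_comm a c])
  anchor := W.anchor ∘ₗ LinearMap.fst ℂ _ _
  d := LinearMap.inl ℂ _ _ ∘ₗ W.d
  br := LinearMap.mk₂ ℂ (fun x y => (W.br x.1 y.1,
      Finsupp.mapRange.linearMap (W.anchor x.1) y.2 -
        Finsupp.mapRange.linearMap (W.anchor y.1) x.2))
    (fun x x' y => Prod.ext (by simp) (Finsupp.ext fun k => by simp; abel))
    (fun c x y => Prod.ext (by simp) (Finsupp.ext fun k => by simp [smul_sub]))
    (fun x y y' => Prod.ext (by simp) (Finsupp.ext fun k => by simp; abel))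
    (fun c x y => Prod.ext (by simp) (Finsupp.ext fun k => by simp [smul_sub]))
  pair := W.pair.compl₁₂ (LinearMap.fst ℂ _ _) (LinearMap.fst ℂ _ _)
  one_act x := Prod.ext (W.vac_act x.1) (one_smul _ _)
  act_act a b x := by
    refine Prod.ext ?_ (Finsupp.ext fun k => ?_)
    · have h := W.act_act a b x.1
      rw [mul_eq] at h
      simp [h]
      abel
    · simp [mul_assoc]
  d_mul a b := by
    have h := W.d_mul a b
    rw [mul_eq] at h
    simp [h]
  anchor_mul x a b := W.anchor_mul a b x.1
  anchor_act a x b := W.anchor_act a b x.1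
  anchor_d a b := W.anchor_d a b
  pair_comm x y := W.pair_comm x.1 y.1
  pair_d x a := W.pair_d' x.1 a
  pair_act a x y := W.pair_act a x.1 y.1
  br_comm x y := Prod.ext (W.br_comm x.1 y.1) (Finsupp.ext fun k => by simp)
  br_d x a := Prod.ext (W.br_d a x.1) (Finsupp.ext fun k => by simp [anchor_d])
  br_act x a y := Prod.ext (W.br_act a x.1 y.1) (Finsupp.ext fun k => by
    simp [← mul_eq, anchor_mul, anchor_act]
    abel)
  anchor_br x y a := W.anchor_br a x.1 y.1
  anchor_pair x y z := W.anchor_pair x.1 y.1 z.1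
  br_br x y z := Prod.ext (W.br_br x.1 y.1 z.1) (Finsupp.ext fun k => by
    simp [anchor_br]
    abel)

/-- The stabilization of `W`: a free module is added to the Lie algebroid. -/
abbrev stab : OneTruncatedVertexAlgebra.{u} := (W.stabOps K).toOneTruncated

/-- The inclusion of `W` in its stabilization. -/
def toStab : Hom W (W.stab K) :=
  Hom.ofOps LinearMap.id (LinearMap.inl ℂ W.V₁ (K →₀ W.V₀)) rfl
    (fun u v => by
      rw [mode_zero, mode_zero]
      refine Prod.ext ?_ ?_
      · exact (congrArg₂ (· - ·) ((W.stabOps K).toOneTruncated_anchor (u.2, 0) v.1)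
          ((W.stabOps K).toOneTruncated_anchor (v.2, 0) u.1)).symm
      · refine Eq.trans (b := (W.stabOps K).br (u.2, 0) (v.2, 0)) (Prod.ext rfl ?_)
          ((W.stabOps K).toOneTruncated_br (u.2, 0) (v.2, 0)).symm
        change (0 : K →₀ W.V₀) = Finsupp.mapRange.linearMap (W.anchor u.2) 0 -
          Finsupp.mapRange.linearMap (W.anchor v.2) 0
        rw [map_zero, map_zero, sub_zero])
    (fun u v => by
      rw [mode_one, mode_one]
      exact Prod.ext ((W.stabOps K).toOneTruncated_pair (u.2, 0) (v.2, 0)).symm rfl)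
    (fun a v => by
      rw [mode_neg_one, mode_neg_one]
      refine Prod.ext ((W.stabOps K).toOneTruncated_mul a v.1).symm ?_
      refine Eq.trans (b := (W.stabOps K).act a (v.2, 0)) (Prod.ext rfl ?_)
        ((W.stabOps K).toOneTruncated_act a (v.2, 0)).symm
      exact (smul_zero (A := K →₀ W.V₀) a).symm)
    (fun a => ((W.stabOps K).toOneTruncated_d a).symm)

/-- The retraction of the stabilization of `W` to `W`. -/
def ofStab : Hom (W.stab K) W :=
  Hom.ofOps LinearMap.id (LinearMap.fst ℂ W.V₁ (K →₀ W.V₀)) rfl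
    (fun u v => by
      rw [mode_zero, mode_zero]
      exact Prod.ext (congrArg₂ (· - ·) ((W.stabOps K).toOneTruncated_anchor u.2 v.1)
          ((W.stabOps K).toOneTruncated_anchor v.2 u.1))
        (congrArg Prod.fst ((W.stabOps K).toOneTruncated_br u.2 v.2)))
    (fun u v => by
      rw [mode_one, mode_one]
      exact Prod.ext ((W.stabOps K).toOneTruncated_pair u.2 v.2) rfl)
    (fun a v => by
      rw [mode_neg_one, mode_neg_one]
      exact Prod.ext ((W.stabOps K).toOneTruncated_mul a v.1)
        (congrArg Prod.fst ((W.stabOps K).toOneTruncated_act a v.2)))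
    (fun a => congrArg Prod.fst ((W.stabOps K).toOneTruncated_d a))

variable {W K}

lemma mem_Om_stab (x : W.V₁ × (K →₀ W.V₀)) :
    x ∈ (W.stab K).Om ↔ x.1 ∈ W.Om ∧ x.2 = 0 := by
  constructor
  · intro hx
    refine ⟨(W.ofStab K).map_mem_Om hx, ?_⟩
    have hle : (W.stab K).Om ≤ LinearMap.ker (LinearMap.snd ℂ W.V₁ (K →₀ W.V₀)) := by
      refine Submodule.span_le.2 ?_
      rintro _ ⟨a, b, rfl⟩
      have h : (W.stab K).act a ((W.stab K).d b) = (W.stabOps K).act a ((W.stabOps K).d b) :=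
        ((W.stabOps K).toOneTruncated_act a _).trans
          (congrArg _ ((W.stabOps K).toOneTruncated_d b))
      rw [h]
      exact smul_zero (M := W.V₀) (A := K →₀ W.V₀) a
    exact hle hx
  · obtain ⟨x, g⟩ := x
    rintro ⟨hx, rfl⟩
    exact (W.toStab K).map_mem_Om hx

variable (W K) in
/-- The Lie algebroid of the stabilization. -/
def stabT : (W.T × (K →₀ W.V₀)) ≃+ (W.stab K).T :=
  AddEquiv.symm <| LinearEquiv.toAddEquiv (R := ℂ) <| LinearEquiv.ofBijective
    ((W.stab K).Om.liftQ (W.Om.mkQ.prodMap LinearMap.id) fun x hx => by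
      have h := (mem_Om_stab x).1 hx
      exact Prod.ext (mkQ_Om h.1) h.2)
    ⟨(injective_iff_map_eq_zero _).2 fun τ hτ => by
      obtain ⟨x, rfl⟩ := Submodule.mkQ_surjective _ τ
      refine (Submodule.Quotient.mk_eq_zero _).2 ((mem_Om_stab x).2 ⟨?_, congrArg Prod.snd hτ⟩)
      exact (Submodule.Quotient.mk_eq_zero _).1 (congrArg Prod.fst hτ), by
      rintro ⟨τ, g⟩
      obtain ⟨x, rfl⟩ := Submodule.mkQ_surjective _ τ
      exact ⟨(W.stab K).Om.mkQ (x, g), rfl⟩⟩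

variable (W) in
lemma stabT_mk (x : W.V₁) (g : K →₀ W.V₀) :
    W.stabT K (W.Om.mkQ x, g) = (W.stab K).Om.mkQ (x, g) :=
  (AddEquiv.symm_apply_eq _).2 rfl

variable (W K) in
/-- The identity map between the two copies of the algebra `V₀`. -/
def stabA : W.V₀ ≃+* (W.stab K).V₀ where
  toFun a := a
  invFun a := a
  left_inv _ := rfl
  right_inv _ := rfl
  map_mul' a b := ((W.stabOps K).toOneTruncated_mul a b).symm
  map_add' _ _ := rfl

lemma stabT_smul (a : W.V₀) (x : W.T × (K →₀ W.V₀)) :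
    W.stabT K (a • x) = W.stabA K a • W.stabT K x := by
  obtain ⟨τ, g⟩ := x
  obtain ⟨x, rfl⟩ := Submodule.mkQ_surjective _ τ
  refine (W.stabT_mk (W.act a x) (a • g)).trans ?_
  rw [stabT_mk]
  exact congrArg (W.stab K).Om.mkQ ((W.stabOps K).toOneTruncated_act a (x, g)).symm

/-- The splitting of the stabilization. -/
def Splitting.stab (S : W.Splitting) (K : Type u) : (W.stab K).Splitting where
  s := (W.stab K).Om.liftQ ((S.s ∘ₗ W.Om.mkQ).prodMap LinearMap.id) fun x hx => by
    have h := (mem_Om_stab x).1 hx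
    refine Prod.ext ?_ h.2
    change S.s (W.Om.mkQ x.1) = 0
    rw [mkQ_Om h.1, map_zero]
  mkQ_s τ := by
    obtain ⟨x, rfl⟩ := Submodule.mkQ_surjective _ τ
    refine (Submodule.Quotient.eq _).2 ((mem_Om_stab _).2 ⟨Splitting.sub_mem (S.mkQ_s _), ?_⟩)
    exact sub_self x.2

variable (W) in
lemma free_stab [Module.Projective W.V₀ W.T] :
    Module.Free (W.stab (ℕ × W.T)).V₀ (W.stab (ℕ × W.T)).T := by
  have := free_prod_of_projective (R := W.V₀) (M := W.T)
  have h1 := RingHomInvPair.of_ringEquiv (W.stabA (ℕ × W.T))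
  have h2 := RingHomInvPair.of_ringEquiv (W.stabA (ℕ × W.T)).symm
  exact Module.Free.of_equiv (R := W.V₀) (M := W.T × (ℕ × W.T →₀ W.V₀))
    (σ := (W.stabA (ℕ × W.T) : W.V₀ →+* (W.stab (ℕ × W.T)).V₀))
    (σ' := ((W.stabA (ℕ × W.T)).symm : (W.stab (ℕ × W.T)).V₀ →+* W.V₀))
    { W.stabT (ℕ × W.T) with map_smul' := stabT_smul }

end Stabilization

/-- The map `Φ` is injective if the Lie algebroid is projective. -/
theorem Splitting.symbolMap_injective_of_projective {W : OneTruncatedVertexAlgebra.{u}}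
    (S : W.Splitting) (h : Module.Projective W.V₀ W.T) : Function.Injective S.symbolMap := by
  have := W.free_stab
  let _ : LinearOrder (Module.Free.ChooseBasisIndex (W.stab (ℕ × W.T)).V₀ (W.stab (ℕ × W.T)).T) :=
    IsWellOrder.linearOrder WellOrderingRel
  refine S.symbolMap_injective_of_retract (S.stab (ℕ × W.T)) (W.toStab _) (W.ofStab _)
    (fun _ => rfl) (fun _ => rfl) (fun τ => ?_) (Module.Free.chooseBasis _ _)
  obtain ⟨x, rfl⟩ := Submodule.mkQ_surjective _ τ
  rfl

end OneTruncatedVertexAlgebra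

end

theorem mainTheorem2 :
    ∃ (U₁ : OneTruncatedVertexAlgebra.{u} ⥤ RestrictedVertexAlgebra.{u}) (adj : U₁ ⊣ truncation),
      (∀ W : OneTruncatedVertexAlgebra.{u}, IsIso (adj.unit.app W)) ∧
      (∀ (W : OneTruncatedVertexAlgebra.{u}) (S : W.Splitting),
        ∃ Φ : W.SymbolAlgebra →ₗ[ℂ] (U₁.obj W).carrier,
          Function.Surjective Φ ∧
          (Module.Projective W.V₀ W.T → Function.Injective Φ) ∧
          ∀ l : List W.Symbol,
            Φ (W.symbolProd l) ∈ (U₁.obj W).wt (W.totalWeight l : ℂ) ∧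
            Φ (W.symbolProd l) - W.vertexProd S (adj.unit.app W) l ∈
              Submodule.span ℂ {v | ∃ l' : List W.Symbol, W.totalDegree l' < W.totalDegree l ∧
                v = W.vertexProd S (adj.unit.app W) l'}) ∧
      ∃ (𝒱 : PrevertexAlgebra.{u} ⥤ SplitRestrictedVertexAlgebra.{u}) (_ : 𝒱 ⊣ prevertexFunctor),
        Nonempty (𝒱 ⋙ forgetSplitting ≅ prevertexToOneTruncated ⋙ U₁) := by
  refine ⟨OneTruncatedVertexAlgebra.envelopeFunctor,
    OneTruncatedVertexAlgebra.envelopeAdjunction, OneTruncatedVertexAlgebra.isIso_unit,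
    fun W S => ?_, vertexEnvelopeFunctor, vertexEnvelopeAdjunction, ⟨vertexEnvelopeIso⟩⟩
  refine ⟨S.symbolMap, S.symbolMap_surjective, S.symbolMap_injective_of_projective, fun l =>
    ⟨S.symbolMap_mem_wt l, ?_⟩⟩
  have h : ∀ l, W.vertexProd S (OneTruncatedVertexAlgebra.envelopeAdjunction.unit.app W) l =
      S.word l := fun l =>
    (congrArg (fun i => W.vertexProd S i l)
      (OneTruncatedVertexAlgebra.envelopeAdjunction_unit W)).trans (S.vertexProd_unit l)
  simp only [h]
  exact S.symbolMap_sub_mem l
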